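/- Let $\mathbb{T}=\mathbb{R}/2\pi\mathbb{Z}$, $\Pi=[0,1]\times\mathbb{T}$ with coordinates $(\psi,\theta)$, and let $\mathbb{F}$ be $\mathbb{R}$ or $\mathbb{C}$. For $m\in\mathbb{N}$ and $\gamma\in\mathbb{R}$, let $H^m(\mathbb{T})$ be the space of $\xi:\mathbb{T}\to\mathbb{F}$ whose weak derivatives up to order $m$ are in $L^2$, with $\|\xi\|_{H^m}^2=\sum_{q=0}^m\|D^q\xi\|_{L^2(\mathbb{T})}^2$. Let $K^m_\gamma(\Pi)$ be the space of functions $w:\Pi\to\mathbb{F}$ whose weak derivatives on $(0,1)\times\mathbb{T}$ up to order $m$ exist and for which $$\|w\|_{K^m_\gamma(\Pi)}^2=\sum_{p+q\le m}\|\psi^{p-\gamma}\partial_\psi^p\partial_\theta^q w\|_{L^2(\Pi)}^2<\infty .$$ Let $$J^m_{0,\gamma}(\Pi)=\{u(\psi,\theta)=\xi(\theta)+w(\psi,\theta):\ \xi\in H^m(\mathbb{T}),\ w\in K^m_\gamma(\Pi)\}$$ with the direct sum norm $\|u\|^2=\|\xi\|_{H^m}^2+\|w\|_{K^m_\gamma}^2$.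 \textbf{Theorem.} Let $m>1$ be an integer and $\gamma>1/2$. Every $u\in J^m_{0,\gamma}(\Pi)$ has a representative that is continuous on $\Pi$, so that its image $u(\Pi)$ is defined. There is a constant $C$, depending only on $\mathbb{F}$, $m$ and $\gamma$, such that the following holds for every open $\Omega\subseteq\mathbb{F}$ and every $f:\Omega\to\mathbb{F}$ of class $C^{m+1}$ (in the real sense). Put $\mathcal{U}_\Omega=\{u\in J^m_{0,\gamma}(\Pi): u(\Pi)\subset\Omega\}$. (i) $\mathcal{U}_\Omega$ is open in $J^m_{0,\gamma}(\Pi)$, and for each $u\in\mathcal{U}_\Omega$ the function $f(u)=f\circ u$ belongs to $J^m_{0,\gamma}(\Pi)$ (as a uniquely determined element). (ii) The map $u\mapsto f(u)$, $\mathcal{U}_\Omega\to J^m_{0,\gamma}(\Pi)$, is continuous. (iii) For every $u\in\mathcal{U}_\Omega$, $$\|f(u)\|_{J^m_{0,\gamma}(\Pi)}\le C\,M\,\bigl(1+\|u\|_{J^m_{0,\gamma}(\Pi)}^{m+1}\bigr)\quad\text{whenever } M\ge \max_{0\le j\le m+1}\ \sup_{z\in u(\Pi)}\|D^jf(z)\|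 .$$ (iv) If moreover $f\in C^{m+2}(\Omega)$, then the map $u\mapsto f(u)$, $\mathcal{U}_\Omega\to J^m_{0,\gamma}(\Pi)$, is $C^1$ (over $\mathbb{R}$); if $\mathbb{F}=\mathbb{C}$ and $f$ is moreover complex differentiable (holomorphic), it is $C^1$ over $\mathbb{C}$. -/

import Mathlib

open MeasureTheory Set Filter Topology
open scoped ContDiff

namespace Kondratev

instance fact_two_pi_pos : Fact (0 < 2 * Real.pi) := ⟨Real.two_pi_pos⟩

/-- The circle of length `2π`. -/
abbrev Circ : Type := AddCircle (2 * Real.pi)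

/-- The open annulus `(0,1) × 𝕋`, as a subset of `ℝ × 𝕋`. -/
def openPi : Set (ℝ × Circ) := Ioo (0 : ℝ) 1 ×ˢ univ

/-- The closed annulus `Π = [0,1] × 𝕋`, as a subset of `ℝ × 𝕋`. -/
def closedPi : Set (ℝ × Circ) := Icc (0 : ℝ) 1 ×ˢ univ

/-- Lebesgue measure on `Π` (the two boundary circles are null sets). -/
noncomputable def muPi : Measure (ℝ × Circ) := volume.restrict openPi

/-! ### Weak derivatives on the circle and on the annulus -/

/-- `D^q φ` for a function on the circle. -/
noncomputable def circDeriv (q : ℕ) (φ : Circ → ℝ) : Circ → ℝ :=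
  fun x => iteratedDeriv q (fun s : ℝ => φ (x + (s : Circ))) 0

/-- Test functions on the circle: smooth functions. -/
def IsCircTest (φ : Circ → ℝ) : Prop := ContDiff ℝ ∞ (fun s : ℝ => φ (s : Circ))

/-- `∂_ψ^p ∂_θ^q φ` for a function on `ℝ × 𝕋`. -/
noncomputable def mixedDeriv (p q : ℕ) (φ : ℝ × Circ → ℝ) : ℝ × Circ → ℝ :=
  fun x => iteratedDeriv q
    (fun s : ℝ => iteratedDeriv p (fun r : ℝ => φ (r, x.2 + (s : Circ))) x.1) 0

/-- Test functions on the annulus: smooth, with compact support in `(0,1) × 𝕋`. -/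
structure IsPiTest (φ : ℝ × Circ → ℝ) : Prop where
  smooth : ContDiff ℝ ∞ (fun y : ℝ × ℝ => φ (y.1, (y.2 : Circ)))
  compact : HasCompactSupport φ
  support_subset : tsupport φ ⊆ openPi

variable {𝕜 : Type*} [RCLike 𝕜]

/-- `v` is the weak derivative `D^q u` on the circle. -/
structure IsCircWeakDeriv (q : ℕ) (u v : Circ → 𝕜) : Prop where
  left_int : Integrable u volume
  right_int : Integrable v volume
  eq : ∀ φ : Circ → ℝ, IsCircTest φ →
    ∫ x, circDeriv q φ x • u x = (-1 : ℝ) ^ q • ∫ x, φ x • v x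

/-- `v` is the weak derivative `∂_ψ^p ∂_θ^q u` on `(0,1) × 𝕋`. -/
structure IsPiWeakDeriv (p q : ℕ) (u v : ℝ × Circ → 𝕜) : Prop where
  left_int : LocallyIntegrableOn u openPi volume
  right_int : LocallyIntegrableOn v openPi volume
  eq : ∀ φ : ℝ × Circ → ℝ, IsPiTest φ →
    ∫ x, mixedDeriv p q φ x • u x ∂muPi = (-1 : ℝ) ^ (p + q) • ∫ x, φ x • v x ∂muPi

/-! ### Auxiliary facts on test functions -/

theorem isOpen_openPi : IsOpen openPi := isOpen_Ioo.prod isOpen_univ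

theorem continuous_circDeriv {φ : Circ → ℝ} (hφ : IsCircTest φ) (q : ℕ) :
    Continuous (circDeriv q φ) := by
  have hq : IsOpenQuotientMap ((↑) : ℝ → Circ) := QuotientAddGroup.isOpenQuotientMap_mk
  rw [hq.isQuotientMap.continuous_iff]
  have h : (circDeriv q φ) ∘ ((↑) : ℝ → Circ) = iteratedDeriv q (fun s : ℝ => φ (s : Circ)) := by
    funext t
    have := iteratedDeriv_comp_const_add (n := q) (fun s : ℝ => φ (s : Circ)) t
    simpa [circDeriv] using congrFun this 0
  rw [h]
  exact ContDiff.continuous_iteratedDeriv q hφ (by exact_mod_cast le_top)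

theorem contDiff_partial_fst {F : ℝ × ℝ → ℝ} (hF : ContDiff ℝ ∞ F) (p : ℕ) :
    ContDiff ℝ ∞ (fun y : ℝ × ℝ => iteratedDeriv p (fun r => F (r, y.2)) y.1) := by
  induction p with
  | zero => simpa using hF
  | succ p ih =>
    have h : (fun y : ℝ × ℝ => iteratedDeriv (p + 1) (fun r => F (r, y.2)) y.1) =
        fun y => fderiv ℝ (fun z : ℝ × ℝ => iteratedDeriv p (fun r => F (r, z.2)) z.1) y (1, 0) := by
      funext y
      rw [iteratedDeriv_succ]
      have h1 : HasFDerivAt (fun z : ℝ × ℝ => iteratedDeriv p (fun r => F (r, z.2)) z.1)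
          (fderiv ℝ (fun z : ℝ × ℝ => iteratedDeriv p (fun r => F (r, z.2)) z.1) y) (y.1, y.2) :=
        (ih.differentiable (by simp) y).hasFDerivAt
      have h2 : HasDerivAt (fun r : ℝ => (r, y.2)) ((1 : ℝ), (0 : ℝ)) y.1 :=
        (hasDerivAt_id _).prodMk (hasDerivAt_const _ _)
      exact (h1.comp_hasDerivAt y.1 h2).deriv
    rw [h]
    exact (ih.fderiv_right (m := ∞) (by simp)).clm_apply contDiff_const

theorem contDiff_partial_snd {F : ℝ × ℝ → ℝ} (hF : ContDiff ℝ ∞ F) (q : ℕ) :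
    ContDiff ℝ ∞ (fun y : ℝ × ℝ => iteratedDeriv q (fun r => F (y.1, r)) y.2) := by
  have h1 : ContDiff ℝ ∞ (fun y : ℝ × ℝ => F (y.2, y.1)) :=
    hF.comp (contDiff_snd.prodMk contDiff_fst)
  exact (contDiff_partial_fst h1 q).comp (contDiff_snd.prodMk contDiff_fst)

theorem continuous_mixedDeriv {φ : ℝ × Circ → ℝ}
    (hφ : ContDiff ℝ ∞ (fun y : ℝ × ℝ => φ (y.1, (y.2 : Circ)))) (p q : ℕ) :
    Continuous (mixedDeriv p q φ) := by
  have hq : IsOpenQuotientMap (Prod.map id ((↑) : ℝ → Circ) : ℝ × ℝ → ℝ × Circ) :=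
    IsOpenQuotientMap.id.prodMap QuotientAddGroup.isOpenQuotientMap_mk
  rw [hq.isQuotientMap.continuous_iff]
  have h : (mixedDeriv p q φ) ∘ (Prod.map id ((↑) : ℝ → Circ)) = fun y : ℝ × ℝ =>
      iteratedDeriv q (fun s : ℝ => iteratedDeriv p (fun r : ℝ => φ (r, (s : Circ))) y.1) y.2 := by
    funext y
    have := iteratedDeriv_comp_const_add (n := q)
      (fun s : ℝ => iteratedDeriv p (fun r => φ (r, (s : Circ))) y.1) y.2
    simpa [mixedDeriv] using congrFun this 0
  rw [h]
  exact (contDiff_partial_snd (contDiff_partial_fst hφ p) q).continuous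

theorem mixedDeriv_eq_zero {φ : ℝ × Circ → ℝ} (p q : ℕ) {x : ℝ × Circ} (hx : x ∉ tsupport φ) :
    mixedDeriv p q φ x = 0 := by
  have h0 : ∀ᶠ y in 𝓝 x, ∀ᶠ z in 𝓝 y, φ z = 0 :=
    ((notMem_tsupport_iff_eventuallyEq.1 hx)).eventually_nhds
  have hc : Tendsto (fun s : ℝ => (x.1, x.2 + (s : Circ))) (𝓝 (0 : ℝ)) (𝓝 x) := by
    have hcont : Continuous (fun s : ℝ => (x.1, x.2 + (s : Circ))) :=
      continuous_const.prodMk (continuous_const.add QuotientAddGroup.continuous_mk)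
    simpa using hcont.tendsto (0 : ℝ)
  have h1 : (fun s : ℝ => iteratedDeriv p (fun r : ℝ => φ (r, x.2 + (s : Circ))) x.1)
      =ᶠ[𝓝 (0 : ℝ)] fun _ => (0 : ℝ) := by
    filter_upwards [hc.eventually h0] with s hs
    have hr : Tendsto (fun r : ℝ => (r, x.2 + (s : Circ))) (𝓝 x.1) (𝓝 (x.1, x.2 + (s : Circ))) :=
      (continuous_id.prodMk continuous_const).tendsto _
    have h2 : (fun r : ℝ => φ (r, x.2 + (s : Circ))) =ᶠ[𝓝 x.1] fun _ => (0 : ℝ) :=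
      hr.eventually hs
    rw [h2.iteratedDeriv_eq]
    simp
  unfold mixedDeriv
  rw [h1.iteratedDeriv_eq]
  simp

theorem integrable_circ_smul {ψ : Circ → ℝ} (hψ : Continuous ψ) {u : Circ → 𝕜}
    (hu : Integrable u volume) : Integrable (fun x => ψ x • u x) volume := by
  obtain ⟨C, hC⟩ := (isCompact_range hψ).isBounded.exists_norm_le
  refine (hu.norm.const_mul C).mono' (hψ.aestronglyMeasurable.smul hu.aestronglyMeasurable) ?_
  refine Eventually.of_forall fun x => ?_
  rw [norm_smul]
  exact mul_le_mul_of_nonneg_right (hC _ (mem_range_self x)) (norm_nonneg _)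

theorem integrable_pi_smul {K : Set (ℝ × Circ)} (hK : IsCompact K) (hKs : K ⊆ openPi)
    {ψ : ℝ × Circ → ℝ} (hψ : Continuous ψ) (h0 : ∀ x, x ∉ K → ψ x = 0) {u : ℝ × Circ → 𝕜}
    (hu : LocallyIntegrableOn u openPi volume) : Integrable (fun x => ψ x • u x) muPi := by
  have h1 : IntegrableOn u K volume := hu.integrableOn_compact_subset hKs hK
  have h2 : IntegrableOn (fun x => ψ x • u x) K volume :=
    h1.continuousOn_smul hψ.continuousOn hK
  have h3 : Integrable (fun x => ψ x • u x) volume := by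
    rw [← integrableOn_iff_integrable_of_support_subset (s := K)]
    · exact h2
    · intro x hx
      by_contra hxK
      exact hx (by simp [h0 x hxK])
  exact h3.restrict

theorem IsPiTest.integrable_mixedDeriv {φ : ℝ × Circ → ℝ} (hφ : IsPiTest φ) (p q : ℕ)
    {u : ℝ × Circ → 𝕜} (hu : LocallyIntegrableOn u openPi volume) :
    Integrable (fun x => mixedDeriv p q φ x • u x) muPi :=
  integrable_pi_smul hφ.compact hφ.support_subset (continuous_mixedDeriv hφ.smooth p q)
    (fun _ hx => mixedDeriv_eq_zero p q hx) hu

theorem mixedDeriv_zero_zero (φ : ℝ × Circ → ℝ) : mixedDeriv 0 0 φ = φ := by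
  funext x; simp [mixedDeriv]

theorem circDeriv_zero (φ : Circ → ℝ) : circDeriv 0 φ = φ := by
  funext x; simp [circDeriv]

theorem IsPiTest.integrable {φ : ℝ × Circ → ℝ} (hφ : IsPiTest φ)
    {u : ℝ × Circ → 𝕜} (hu : LocallyIntegrableOn u openPi volume) :
    Integrable (fun x => φ x • u x) muPi := by
  simpa [mixedDeriv_zero_zero] using hφ.integrable_mixedDeriv 0 0 hu

theorem IsCircTest.integrable {φ : Circ → ℝ} (hφ : IsCircTest φ)
    {u : Circ → 𝕜} (hu : Integrable u volume) : Integrable (fun x => φ x • u x) volume := by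
  have := integrable_circ_smul (continuous_circDeriv hφ 0) hu
  simpa [circDeriv_zero] using this

theorem IsCircWeakDeriv.add {q : ℕ} {u v u' v' : Circ → 𝕜} (h : IsCircWeakDeriv q u v)
    (h' : IsCircWeakDeriv q u' v') : IsCircWeakDeriv q (u + u') (v + v') where
  left_int := h.left_int.add h'.left_int
  right_int := h.right_int.add h'.right_int
  eq φ hφ := by
    simp only [Pi.add_apply, smul_add]
    rw [integral_add (integrable_circ_smul (continuous_circDeriv hφ q) h.left_int)
      (integrable_circ_smul (continuous_circDeriv hφ q) h'.left_int),
      integral_add (hφ.integrable h.right_int) (hφ.integrable h'.right_int), smul_add,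
      h.eq φ hφ, h'.eq φ hφ]

theorem IsCircWeakDeriv.smul {q : ℕ} {u v : Circ → 𝕜} (c : 𝕜) (h : IsCircWeakDeriv q u v) :
    IsCircWeakDeriv q (c • u) (c • v) where
  left_int := h.left_int.smul c
  right_int := h.right_int.smul c
  eq φ hφ := by
    simp only [Pi.smul_apply, smul_comm _ c]
    rw [integral_smul, integral_smul, h.eq φ hφ, smul_comm]



theorem IsCircWeakDeriv.congr {q : ℕ} {u v u' v' : Circ → 𝕜} (h : IsCircWeakDeriv q u v)
    (hu : u =ᵐ[volume] u') (hv : v =ᵐ[volume] v') : IsCircWeakDeriv q u' v' where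
  left_int := h.left_int.congr hu
  right_int := h.right_int.congr hv
  eq φ hφ := by
    have h1 : ∫ x, circDeriv q φ x • u' x = ∫ x, circDeriv q φ x • u x :=
      integral_congr_ae (by filter_upwards [hu] with x hx; rw [hx])
    have h2 : ∫ x, φ x • v' x = ∫ x, φ x • v x :=
      integral_congr_ae (by filter_upwards [hv] with x hx; rw [hx])
    rw [h1, h2, h.eq φ hφ]

theorem IsPiWeakDeriv.add {p q : ℕ} {u v u' v' : ℝ × Circ → 𝕜} (h : IsPiWeakDeriv p q u v)
    (h' : IsPiWeakDeriv p q u' v') : IsPiWeakDeriv p q (u + u') (v + v') where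
  left_int := h.left_int.add h'.left_int
  right_int := h.right_int.add h'.right_int
  eq φ hφ := by
    simp only [Pi.add_apply, smul_add]
    rw [integral_add (hφ.integrable_mixedDeriv p q h.left_int)
      (hφ.integrable_mixedDeriv p q h'.left_int),
      integral_add (hφ.integrable h.right_int) (hφ.integrable h'.right_int), smul_add,
      h.eq φ hφ, h'.eq φ hφ]

theorem IsPiWeakDeriv.smul {p q : ℕ} {u v : ℝ × Circ → 𝕜} (c : 𝕜) (h : IsPiWeakDeriv p q u v) :
    IsPiWeakDeriv p q (c • u) (c • v) where
  left_int := h.left_int.smul c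
  right_int := h.right_int.smul c
  eq φ hφ := by
    simp only [Pi.smul_apply, smul_comm _ c]
    rw [integral_smul, integral_smul, h.eq φ hφ, smul_comm]

theorem IsPiWeakDeriv.congr {p q : ℕ} {u v u' v' : ℝ × Circ → 𝕜} (h : IsPiWeakDeriv p q u v)
    (hu : u =ᵐ[muPi] u') (hv : v =ᵐ[muPi] v') : IsPiWeakDeriv p q u' v' where
  left_int := h.left_int.congr hu
  right_int := h.right_int.congr hv
  eq φ hφ := by
    have h1 : ∫ x, mixedDeriv p q φ x • u' x ∂muPi = ∫ x, mixedDeriv p q φ x • u x ∂muPi :=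
      integral_congr_ae (by filter_upwards [hu] with x hx; rw [hx])
    have h2 : ∫ x, φ x • v' x ∂muPi = ∫ x, φ x • v x ∂muPi :=
      integral_congr_ae (by filter_upwards [hv] with x hx; rw [hx])
    rw [h1, h2, h.eq φ hφ]

theorem IsCircWeakDeriv.zero (q : ℕ) : IsCircWeakDeriv q (0 : Circ → 𝕜) 0 where
  left_int := integrable_zero _ _ _
  right_int := integrable_zero _ _ _
  eq φ hφ := by simp

theorem IsPiWeakDeriv.zero (p q : ℕ) : IsPiWeakDeriv p q (0 : ℝ × Circ → 𝕜) 0 where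
  left_int := locallyIntegrableOn_zero
  right_int := locallyIntegrableOn_zero
  eq φ hφ := by simp

/-! ### The Sobolev space `H^m(𝕋)` -/

variable (𝕜) in
/-- `H^m(𝕋)`. A function `ξ` is stored together with its weak derivatives, as the tuple
`(ξ, Dξ, …, D^m ξ)` in `L²(𝕋)^{m+1}`; the inherited norm is `‖ξ‖² = ∑_{q ≤ m} ‖D^q ξ‖²_{L²}`. -/
noncomputable def SobolevCirc (m : ℕ) :
    Submodule 𝕜 (PiLp 2 (fun _ : Fin (m + 1) => Lp 𝕜 2 (volume : Measure Circ))) where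
  carrier := {g | ∀ q : Fin (m + 1), IsCircWeakDeriv (q : ℕ) (g 0 : Circ → 𝕜) (g q)}
  zero_mem' := fun q =>
    (IsCircWeakDeriv.zero (q : ℕ)).congr (Lp.coeFn_zero 𝕜 2 _).symm (Lp.coeFn_zero 𝕜 2 _).symm
  add_mem' := fun {a b} ha hb q =>
    ((ha q).add (hb q)).congr (Lp.coeFn_add (a 0) (b 0)).symm (Lp.coeFn_add (a q) (b q)).symm
  smul_mem' := fun c a ha q =>
    ((ha q).smul c).congr (Lp.coeFn_smul c (a 0)).symm (Lp.coeFn_smul c (a q)).symm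

/-- The function on the circle given by an element of `H^m(𝕋)`. -/
noncomputable def SobolevCirc.fn {m : ℕ} (ξ : SobolevCirc 𝕜 m) : Circ → 𝕜 :=
  (ξ : PiLp 2 (fun _ : Fin (m + 1) => Lp 𝕜 2 (volume : Measure Circ))) 0

/-! ### The Kondratev space `K_γ^m(Π)` -/

/-- The pairs `(p, q)` with `p + q ≤ m`. -/
abbrev derivIdx (m : ℕ) : Type :=
  ↥((Finset.range (m + 1) ×ˢ Finset.range (m + 1)).filter (fun k => k.1 + k.2 ≤ m))

/-- The pair `(0, 0)`. -/
def derivIdxZero (m : ℕ) : derivIdx m := ⟨(0, 0), by simp⟩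

/-- Multiplication by `ψ^{γ-p}`. It undoes the weight `ψ^{p-γ}` in the norm of `K_γ^m(Π)`. -/
noncomputable def unweight (γ : ℝ) (p : ℕ) (g : ℝ × Circ → 𝕜) : ℝ × Circ → 𝕜 :=
  fun x => (x.1 ^ (γ - (p : ℝ))) • g x

variable (𝕜) in
/-- `K_γ^m(Π)`. A function `w` is stored together with its weighted weak derivatives, as the
family `(ψ^{p-γ} ∂_ψ^p ∂_θ^q w)_{p+q ≤ m}` in `L²(Π)`; the inherited norm is
`‖w‖² = ∑_{p+q ≤ m} ‖ψ^{p-γ} ∂_ψ^p ∂_θ^q w‖²_{L²(Π)}`. -/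
noncomputable def KondratevPi (m : ℕ) (γ : ℝ) :
    Submodule 𝕜 (PiLp 2 (fun _ : derivIdx m => Lp 𝕜 2 muPi)) where
  carrier := {g | ∀ k : derivIdx m, IsPiWeakDeriv k.1.1 k.1.2
    (unweight γ 0 (g (derivIdxZero m) : ℝ × Circ → 𝕜)) (unweight γ k.1.1 (g k))}
  zero_mem' := fun k => by
    refine (IsPiWeakDeriv.zero k.1.1 k.1.2).congr ?_ ?_ <;>
    · filter_upwards [Lp.coeFn_zero 𝕜 2 muPi] with x hx
      simp only [unweight, PiLp.zero_apply]
      rw [hx]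
      simp
  add_mem' := fun {a b} ha hb k => by
    refine ((ha k).add (hb k)).congr ?_ ?_
    · filter_upwards [Lp.coeFn_add (a (derivIdxZero m)) (b (derivIdxZero m))] with x hx
      simp only [unweight, PiLp.add_apply, Pi.add_apply]
      rw [hx]
      simp
    · filter_upwards [Lp.coeFn_add (a k) (b k)] with x hx
      simp only [unweight, PiLp.add_apply, Pi.add_apply]
      rw [hx]
      simp
  smul_mem' := fun c a ha k => by
    refine ((ha k).smul c).congr ?_ ?_
    · filter_upwards [Lp.coeFn_smul c (a (derivIdxZero m))] with x hx
      simp only [unweight, PiLp.smul_apply, Pi.smul_apply]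
      rw [hx]
      simp
    · filter_upwards [Lp.coeFn_smul c (a k)] with x hx
      simp only [unweight, PiLp.smul_apply, Pi.smul_apply]
      rw [hx]
      simp

/-- The function on `Π` given by an element of `K_γ^m(Π)`. -/
noncomputable def KondratevPi.fn {m : ℕ} {γ : ℝ} (w : KondratevPi 𝕜 m γ) : ℝ × Circ → 𝕜 :=
  unweight γ 0
    ((w : PiLp 2 (fun _ : derivIdx m => Lp 𝕜 2 muPi)) (derivIdxZero m) : ℝ × Circ → 𝕜)

/-! ### The space `J_{0,γ}^m(Π)` -/

variable (𝕜) in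
/-- `J_{0,γ}^m(Π)`: the functions `ξ(θ) + w(ψ,θ)` with `ξ ∈ H^m(𝕋)` and `w ∈ K_γ^m(Π)`, with the
norm `‖u‖² = ‖ξ‖² + ‖w‖²` of the direct sum. -/
abbrev JSpace (m : ℕ) (γ : ℝ) : Type _ :=
  WithLp 2 (SobolevCirc 𝕜 m × KondratevPi 𝕜 m γ)

/-- The function `u(ψ,θ) = ξ(θ) + w(ψ,θ)`, defined up to null sets. -/
noncomputable def JSpace.fn {m : ℕ} {γ : ℝ} (u : JSpace 𝕜 m γ) : ℝ × Circ → 𝕜 :=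
  fun x => SobolevCirc.fn u.fst x.2 + KondratevPi.fn u.snd x

/-- `U` is a continuous representative of `u` on the closed annulus `Π`. -/
structure IsContRep {m : ℕ} {γ : ℝ} (u : JSpace 𝕜 m γ) (U : ℝ × Circ → 𝕜) : Prop where
  continuousOn : ContinuousOn U closedPi
  ae_eq : JSpace.fn u =ᵐ[muPi] U

/-- The set of `u ∈ J_{0,γ}^m(Π)` whose image `u(Π)` lies in `Ω`. -/
def imageIn (m : ℕ) (γ : ℝ) (Ω : Set 𝕜) : Set (JSpace 𝕜 m γ) :=
  {u | ∃ U : ℝ × Circ → 𝕜, IsContRep u U ∧ ∀ x ∈ closedPi, U x ∈ Ω}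

end Kondratev

/-! Up to equivalent norms, `w` lies in K^m_γ when all words of length at most `m` in the fields
ψ∂_ψ and ∂_θ map it into ψ^γ L²; for ξ(θ) the same holds without the weight. The Boolean in
`SobBound` distinguishes these two classes, so that one argument serves both. Derivatives are meant
in the sense of absolute continuity on almost every coordinate line, which makes the Leibniz and
chain rules one-variable facts. Fourier modes on the circle and the du Bois-Reymond lemma on the
interval translate weak derivatives into these and back.

An angular derivative in L² bounds |a|² by a function of ψ alone with controlled integral; a radial
one bounds it by ψ^{2γ-1} times a function of θ alone. Together they give boundedness with decay as
ψ → 0 (here γ > 1/2 enters) and the product estimate `SobBound.mul`.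

A composition g(U) need not lie in the weighted class, since it need not decay at ψ = 0, so it is
estimated as a multiplier. In `IsMultiplier.comp` the induction on the order uses X(g(U)) =
Dg(U)(XU) for X = ψ∂_ψ, ∂_θ. The real linear map Dg(U) is encoded by its two Wirtinger coefficients,
which are again scalar functions of U with one derivative fewer, and multiplication by XU costs one
order of regularity.

For u = ξ + w, split f(u) = f(ξ) + [f(ξ + w) − f(ξ)]. The first term multiplies the class of
functions of θ. The bracket has to carry functions of θ into the weighted class
(`SplitData.isMultiplier_sub`): its derivatives reproduce brackets and multipliers of lower order,
and at order zero it vanishes at ψ = 0 and has radial derivative Df(u)(ψ∂_ψ w), so Hardy's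
inequality applies. Hardy costs one further derivative of f, hence C^{m+1}. Applying both
multipliers to the constant 1 yields f(u), with constants linear in M and of degree m + 1 in the
norm of u. The same inductions for differences give continuity.

For f in C^{m+2} the Wirtinger coefficients a, b of Df are in C^{m+1}, so D(u)h = a(u)h + b(u) conj
h depends continuously on u, because the space is an algebra. Point evaluations separate elements,
and along segments they reduce f(u + h) − f(u) = ∫₀¹ D(u + th)h dt to calculus in the scalar field.
This identity and the continuity of D give differentiability. -/

namespace Kondratev

/-! ### Absolutely continuous functions of one variable -/

section OneVariable

variable {E F G : Type*} [NormedAddCommGroup E] [NormedSpace ℝ E]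
  [NormedAddCommGroup F] [NormedSpace ℝ F] [NormedAddCommGroup G] [NormedSpace ℝ G]

/-- `u` is a primitive of the locally integrable function `v` on the interval `I`. -/
structure IsPrimitiveOn (I : Set ℝ) (u v : ℝ → E) : Prop where
  int : ∀ a ∈ I, ∀ b ∈ I, IntervalIntegrable v volume a b
  eq : ∀ a ∈ I, ∀ b ∈ I, u b - u a = ∫ x in a..b, v x

theorem absolutelyContinuousOnInterval_of_dist_le {X Y : Type*} [PseudoMetricSpace X]
    [PseudoMetricSpace Y] {f : ℝ → X} {h : ℝ → Y} {a b K : ℝ}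
    (hf : AbsolutelyContinuousOnInterval f a b)
    (hh : ∀ x ∈ uIcc a b, ∀ y ∈ uIcc a b, dist (h x) (h y) ≤ K * dist (f x) (f y)) :
    AbsolutelyContinuousOnInterval h a b := by
  unfold AbsolutelyContinuousOnInterval at hf ⊢
  have h0 := Filter.Tendsto.const_mul K hf
  rw [mul_zero] at h0
  -- Absolute continuity says that the sums of increments tend to zero with the total length of the
  -- intervals; the hypothesis compares these sums term by term.
  refine squeeze_zero' (Eventually.of_forall fun _ => Finset.sum_nonneg fun _ _ => dist_nonneg)
    ?_ h0
  have : ∀ᶠ E in AbsolutelyContinuousOnInterval.totalLengthFilter ⊓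
      𝓟 (AbsolutelyContinuousOnInterval.disjWithin a b),
      E ∈ AbsolutelyContinuousOnInterval.disjWithin a b :=
    eventually_inf_principal.mpr (by simp)
  filter_upwards [this] with E hE
  rw [Finset.mul_sum]
  exact Finset.sum_le_sum fun i hi => hh _ (hE.1 i hi).1 _ (hE.1 i hi).2

theorem absolutelyContinuousOnInterval_primitive {v : ℝ → E} {a b : ℝ}
    (h : IntervalIntegrable v volume a b) :
    AbsolutelyContinuousOnInterval (fun x => ∫ t in a..x, v t) a b := by
  have h1 := (h.norm).absolutelyContinuousOnInterval_intervalIntegral (c := a) left_mem_uIcc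
  refine absolutelyContinuousOnInterval_of_dist_le (K := 1) h1 fun x hx y hy => ?_
  have hax : IntervalIntegrable v volume a x := h.mono_set (uIcc_subset_uIcc left_mem_uIcc hx)
  have hay : IntervalIntegrable v volume a y := h.mono_set (uIcc_subset_uIcc left_mem_uIcc hy)
  rw [one_mul, dist_eq_norm, dist_eq_norm, intervalIntegral.integral_interval_sub_left hax hay,
    intervalIntegral.integral_interval_sub_left hax.norm hay.norm]
  exact intervalIntegral.norm_integral_le_abs_integral_norm

namespace IsPrimitiveOn

variable {I : Set ℝ} {u v u' v' : ℝ → E}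

theorem absolutelyContinuousOnInterval (h : IsPrimitiveOn I u v) [I.OrdConnected] {a b : ℝ}
    (ha : a ∈ I) (hb : b ∈ I) : AbsolutelyContinuousOnInterval u a b := by
  refine absolutelyContinuousOnInterval_of_dist_le (K := 1)
    (absolutelyContinuousOnInterval_primitive (h.int a ha b hb)) fun x hx y hy => ?_
  have hsub : uIcc a b ⊆ I := Set.OrdConnected.uIcc_subset ‹_› ha hb
  rw [one_mul, dist_eq_norm, dist_eq_norm,
    intervalIntegral.integral_interval_sub_left (h.int a ha x (hsub hx)) (h.int a ha y (hsub hy)),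
    ← h.eq y (hsub hy) x (hsub hx)]

theorem continuousOn_uIcc (h : IsPrimitiveOn I u v) [I.OrdConnected] {a b : ℝ}
    (ha : a ∈ I) (hb : b ∈ I) : ContinuousOn u (uIcc a b) :=
  (h.absolutelyContinuousOnInterval ha hb).continuousOn

theorem continuousOn (h : IsPrimitiveOn I u v) [I.OrdConnected] (hI : IsOpen I) :
    ContinuousOn u I := by
  intro x hx
  obtain ⟨ε, hε, hb⟩ := Metric.isOpen_iff.1 hI x hx
  have h1 : x - ε / 2 ∈ I := hb (by simp [abs_of_pos hε, hε])
  have h2 : x + ε / 2 ∈ I := hb (by simp [abs_of_pos hε, hε])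
  refine ((h.continuousOn_uIcc h1 h2).continuousAt ?_).continuousWithinAt
  rw [uIcc_of_le (by linarith)]
  exact Icc_mem_nhds (by linarith) (by linarith)

theorem congr (h : IsPrimitiveOn I u v) [I.OrdConnected]
    (hv : v =ᵐ[volume.restrict I] v') : IsPrimitiveOn I u v' := by
  have key : ∀ a ∈ I, ∀ b ∈ I, v =ᵐ[volume.restrict (uIoc a b)] v' := fun a ha b hb =>
    ae_mono (Measure.restrict_mono
      (uIoc_subset_uIcc.trans (Set.OrdConnected.uIcc_subset ‹_› ha hb)) le_rfl) hv
  refine ⟨fun a ha b hb => (h.int a ha b hb).congr_ae (key a ha b hb), fun a ha b hb => ?_⟩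
  rw [h.eq a ha b hb]
  exact intervalIntegral.integral_congr_ae_restrict (key a ha b hb)

theorem add (h : IsPrimitiveOn I u v) (h' : IsPrimitiveOn I u' v') :
    IsPrimitiveOn I (fun x => u x + u' x) (fun x => v x + v' x) := by
  refine ⟨fun a ha b hb => (h.int a ha b hb).add (h'.int a ha b hb), fun a ha b hb => ?_⟩
  rw [intervalIntegral.integral_add (h.int a ha b hb) (h'.int a ha b hb), ← h.eq a ha b hb,
    ← h'.eq a ha b hb]
  abel

theorem clm_comp [CompleteSpace E] [CompleteSpace F] (L : E →L[ℝ] F) (h : IsPrimitiveOn I u v) :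
    IsPrimitiveOn I (fun x => L (u x)) (fun x => L (v x)) := by
  refine ⟨fun a ha b hb => ?_, fun a ha b hb => ?_⟩
  · have := h.int a ha b hb
    exact ⟨L.integrable_comp this.1, L.integrable_comp this.2⟩
  · rw [L.intervalIntegral_comp_comm (h.int a ha b hb), ← h.eq a ha b hb, map_sub]

theorem prodMk [CompleteSpace E] [CompleteSpace F] {w z : ℝ → F} (h : IsPrimitiveOn I u v)
    (h' : IsPrimitiveOn I w z) :
    IsPrimitiveOn I (fun x => (u x, w x)) (fun x => (v x, z x)) := by
  have h1 := h.clm_comp (ContinuousLinearMap.inl ℝ E F)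
  have h2 := h'.clm_comp (ContinuousLinearMap.inr ℝ E F)
  simpa using h1.add h2

theorem of_hasDerivAt [CompleteSpace E] [I.OrdConnected] (h : ∀ x ∈ I, HasDerivAt u (v x) x)
    (hv : ContinuousOn v I) : IsPrimitiveOn I u v := by
  have hint : ∀ a ∈ I, ∀ b ∈ I, IntervalIntegrable v volume a b := fun a ha b hb =>
    (hv.mono (Set.OrdConnected.uIcc_subset ‹_› ha hb)).intervalIntegrable
  refine ⟨hint, fun a ha b hb => ?_⟩
  exact (intervalIntegral.integral_eq_sub_of_hasDerivAt
    (fun x hx => h x (Set.OrdConnected.uIcc_subset ‹_› ha hb hx)) (hint a ha b hb)).symm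

theorem ae_hasDerivAt [CompleteSpace E] [I.OrdConnected] (h : IsPrimitiveOn I u v) {a b : ℝ}
    (ha : a ∈ I) (hb : b ∈ I) : ∀ᵐ x, x ∈ uIcc a b → HasDerivAt u (v x) x := by
  have hsub : uIcc a b ⊆ I := Set.OrdConnected.uIcc_subset ‹_› ha hb
  have h₁ : ∀ᵐ x : ℝ, x ≠ a := by simp [ae_iff, measure_singleton]
  have h₂ : ∀ᵐ x : ℝ, x ≠ b := by simp [ae_iff, measure_singleton]
  filter_upwards [(h.int a ha b hb).ae_hasDerivAt_integral, h₁, h₂] with x hx hxa hxb hxm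
  have h3 := (hx hxm a left_mem_uIcc).const_add (u a)
  refine h3.congr_of_eventuallyEq ?_
  have hn : uIcc a b ∈ 𝓝 x := by
    rcases le_total a b with hab | hab
    · rw [uIcc_of_le hab] at hxm ⊢
      exact Icc_mem_nhds (lt_of_le_of_ne hxm.1 hxa.symm) (lt_of_le_of_ne hxm.2 hxb)
    · rw [uIcc_of_ge hab] at hxm ⊢
      exact Icc_mem_nhds (lt_of_le_of_ne hxm.1 hxb.symm) (lt_of_le_of_ne hxm.2 hxa)
  filter_upwards [hn] with y hy
  rw [← h.eq a ha y (hsub hy)]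
  abel

/-- The chain rule for absolutely continuous functions. -/
theorem comp [CompleteSpace E] [CompleteSpace F] [I.OrdConnected] (h : IsPrimitiveOn I u v)
    {g : E → F} {Ω : Set E} (hΩ : IsOpen Ω) (hg : ContDiffOn ℝ 1 g Ω)
    (hm : MapsTo u I Ω) :
    IsPrimitiveOn I (fun x => g (u x)) (fun x => fderiv ℝ g (u x) (v x)) := by
  have hgd : ContinuousOn (fderiv ℝ g) Ω := hg.continuousOn_fderiv_of_isOpen hΩ le_rfl
  have hint : ∀ a ∈ I, ∀ b ∈ I,
      IntervalIntegrable (fun x => fderiv ℝ g (u x) (v x)) volume a b := by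
    intro a ha b hb
    have hsub : uIcc a b ⊆ I := Set.OrdConnected.uIcc_subset ‹_› ha hb
    have hc : ContinuousOn (fun x => fderiv ℝ g (u x)) (uIcc a b) :=
      hgd.comp (h.continuousOn_uIcc ha hb) (hm.mono_left hsub)
    obtain ⟨C, hC⟩ := (isCompact_uIcc.image_of_continuousOn hc).isBounded.exists_norm_le
    rw [intervalIntegrable_iff]
    have hv := intervalIntegrable_iff.1 (h.int a ha b hb)
    refine (hv.norm.const_mul C).mono' ?_ ?_
    · have h1 : AEStronglyMeasurable (fun x => fderiv ℝ g (u x)) (volume.restrict (uIoc a b)) :=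
        (hc.aestronglyMeasurable_of_isCompact isCompact_uIcc measurableSet_uIcc).mono_set
          uIoc_subset_uIcc
      exact (ContinuousLinearMap.apply ℝ F).flip.aestronglyMeasurable_comp₂ h1 hv.aestronglyMeasurable
    · filter_upwards [ae_restrict_mem measurableSet_uIoc] with x hx
      exact (ContinuousLinearMap.le_opNorm _ _).trans (mul_le_mul_of_nonneg_right
        (hC _ (mem_image_of_mem _ (uIoc_subset_uIcc hx))) (norm_nonneg _))
  refine ⟨hint, fun a ha b hb => ?_⟩
  have hsub : uIcc a b ⊆ I := Set.OrdConnected.uIcc_subset ‹_› ha hb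
  have huc := h.continuousOn_uIcc ha hb
  have hK : IsCompact (u '' uIcc a b) := isCompact_uIcc.image_of_continuousOn huc
  have hKΩ : u '' uIcc a b ⊆ Ω := by
    rintro _ ⟨x, hx, rfl⟩
    exact hm (hsub hx)
  -- A C¹ map is Lipschitz on the compact image of the segment, so g ∘ u is absolutely continuous.
  -- It then differs by a constant from the primitive of the candidate derivative, as both have the
  -- same derivative almost everywhere.
  have hLip : LocallyLipschitzOn (u '' uIcc a b) g := by
    intro y hy
    obtain ⟨K, t, ht, hL⟩ := (hg.contDiffAt (hΩ.mem_nhds (hKΩ hy))).exists_lipschitzOnWith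
    exact ⟨K, t, mem_nhdsWithin_of_mem_nhds ht, hL⟩
  obtain ⟨K, hL⟩ := hLip.exists_lipschitzOnWith_of_compact hK
  have hAC1 : AbsolutelyContinuousOnInterval (fun x => g (u x)) a b :=
    absolutelyContinuousOnInterval_of_dist_le (h.absolutelyContinuousOnInterval ha hb)
      fun x hx y hy => hL.dist_le_mul _ (mem_image_of_mem _ hx) _ (mem_image_of_mem _ hy)
  have hAC2 := absolutelyContinuousOnInterval_primitive (hint a ha b hb)
  obtain ⟨C, hC⟩ := (hAC1.sub hAC2).const_of_ae_hasDerivAt_zero (by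
    filter_upwards [h.ae_hasDerivAt ha hb, (hint a ha b hb).ae_hasDerivAt_integral]
      with x h1 h2 hx
    have h3 : HasFDerivAt g (fderiv ℝ g (u x)) (u x) :=
      ((hg.contDiffAt (hΩ.mem_nhds (hm (hsub hx)))).differentiableAt (by simp)).hasFDerivAt
    simpa using! (h3.comp_hasDerivAt x (h1 hx)).sub (h2 hx a left_mem_uIcc))
  have ea := hC a left_mem_uIcc
  have eb := hC b right_mem_uIcc
  simp only [Pi.sub_apply, intervalIntegral.integral_same, sub_zero] at ea eb
  rw [ea, ← eb]
  abel

/-- Leibniz's rule is the chain rule for the multiplication map on pairs. -/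
theorem mul {𝔸 : Type*} [NormedRing 𝔸] [NormedAlgebra ℝ 𝔸] [CompleteSpace 𝔸] [I.OrdConnected]
    {u v u' v' : ℝ → 𝔸} (h : IsPrimitiveOn I u v) (h' : IsPrimitiveOn I u' v') :
    IsPrimitiveOn I (fun x => u x * u' x) (fun x => v x * u' x + u x * v' x) := by
  have h1 := (h.prodMk h').comp (g := fun p : 𝔸 × 𝔸 => p.1 * p.2) isOpen_univ
    (contDiff_fst.mul contDiff_snd).contDiffOn (mapsTo_univ _ _)
  convert! h1 using 2 with x
  have h2 : HasFDerivAt (Prod.fst : 𝔸 × 𝔸 → 𝔸) (.fst ℝ 𝔸 𝔸) (u x, u' x) := hasFDerivAt_fst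
  have h3 : HasFDerivAt (Prod.snd : 𝔸 × 𝔸 → 𝔸) (.snd ℝ 𝔸 𝔸) (u x, u' x) := hasFDerivAt_snd
  have h4 : HasFDerivAt (fun p : 𝔸 × 𝔸 => p.1 * p.2) _ (u x, u' x) := h2.mul' h3
  rw [h4.fderiv]
  simp [add_comm]

/-- The inequality ‖u x‖ ≤ ‖u y‖ + ∫‖v‖ is averaged over y in the interval. This is the
one-dimensional Sobolev embedding with explicit dependence on the length. -/
theorem norm_le (h : IsPrimitiveOn I u v) [I.OrdConnected] {a b x : ℝ} (hab : a < b)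
    (ha : a ∈ I) (hb : b ∈ I) (hx : x ∈ Icc a b) :
    ‖u x‖ ≤ (b - a)⁻¹ * (∫ y in a..b, ‖u y‖) + ∫ y in a..b, ‖v y‖ := by
  have hsub : uIcc a b ⊆ I := Set.OrdConnected.uIcc_subset ‹_› ha hb
  rw [uIcc_of_le hab.le] at hsub
  have h1 : ∀ y ∈ Icc a b, ‖u x‖ ≤ ‖u y‖ + ∫ y in a..b, ‖v y‖ := by
    intro y hy
    have h2 : ‖u x - u y‖ ≤ ∫ y in a..b, ‖v y‖ := by
      rw [h.eq y (hsub hy) x (hsub hx)]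
      refine intervalIntegral.norm_integral_le_integral_norm_uIoc.trans ?_
      rw [intervalIntegral.integral_of_le hab.le]
      refine setIntegral_mono_set (h.int a ha b hb).norm.1
        (Eventually.of_forall fun _ => norm_nonneg _) (Eventually.of_forall ?_)
      intro z hz
      rcases le_total x y with hxy | hxy
      · rw [uIoc_of_ge hxy] at hz
        exact ⟨hx.1.trans_lt hz.1, hz.2.trans hy.2⟩
      · rw [uIoc_of_le hxy] at hz
        exact ⟨hy.1.trans_lt hz.1, hz.2.trans hx.2⟩
    calc ‖u x‖ = ‖u y + (u x - u y)‖ := by congr 1; abel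
      _ ≤ _ := (norm_add_le _ _).trans (by gcongr)
  have hcu : IntervalIntegrable (fun y => ‖u y‖) volume a b :=
    (h.continuousOn_uIcc ha hb).norm.intervalIntegrable
  have h3 : ∫ _ in a..b, ‖u x‖ ≤ ∫ y in a..b, (‖u y‖ + ∫ y in a..b, ‖v y‖) :=
    intervalIntegral.integral_mono_on hab.le intervalIntegrable_const
      (hcu.add intervalIntegrable_const) h1
  rw [intervalIntegral.integral_add hcu intervalIntegrable_const, intervalIntegral.integral_const,
    intervalIntegral.integral_const, smul_eq_mul, smul_eq_mul] at h3
  have hpos : 0 < b - a := sub_pos.2 hab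
  have h4 := mul_le_mul_of_nonneg_left h3 (inv_nonneg.2 hpos.le)
  rwa [inv_mul_cancel_left₀ hpos.ne', mul_add, inv_mul_cancel_left₀ hpos.ne'] at h4

end IsPrimitiveOn

/-- `u` agrees almost everywhere on `I` with a primitive of `v`. -/
def HasACDeriv (I : Set ℝ) (u v : ℝ → E) : Prop :=
  ∃ U : ℝ → E, U =ᵐ[volume.restrict I] u ∧ IsPrimitiveOn I U v

namespace HasACDeriv

variable {I : Set ℝ} {u v u' v' : ℝ → E}

theorem congr [I.OrdConnected] (h : HasACDeriv I u v) (hu : u =ᵐ[volume.restrict I] u')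
    (hv : v =ᵐ[volume.restrict I] v') : HasACDeriv I u' v' := by
  obtain ⟨U, hU, hp⟩ := h
  exact ⟨U, hU.trans hu, hp.congr hv⟩

theorem add (h : HasACDeriv I u v) (h' : HasACDeriv I u' v') :
    HasACDeriv I (fun x => u x + u' x) (fun x => v x + v' x) := by
  obtain ⟨U, hU, hp⟩ := h
  obtain ⟨U', hU', hp'⟩ := h'
  refine ⟨fun x => U x + U' x, ?_, hp.add hp'⟩
  filter_upwards [hU, hU'] with x h1 h2
  rw [h1, h2]

theorem clm_comp [CompleteSpace E] [CompleteSpace F] (L : E →L[ℝ] F) (h : HasACDeriv I u v) :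
    HasACDeriv I (fun x => L (u x)) (fun x => L (v x)) := by
  obtain ⟨U, hU, hp⟩ := h
  refine ⟨fun x => L (U x), ?_, hp.clm_comp L⟩
  filter_upwards [hU] with x h1
  rw [h1]

theorem mul {𝔸 : Type*} [NormedRing 𝔸] [NormedAlgebra ℝ 𝔸] [CompleteSpace 𝔸] [I.OrdConnected]
    {u v u' v' : ℝ → 𝔸} (h : HasACDeriv I u v) (h' : HasACDeriv I u' v') :
    HasACDeriv I (fun x => u x * u' x) (fun x => v x * u' x + u x * v' x) := by
  obtain ⟨U, hU, hp⟩ := h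
  obtain ⟨U', hU', hp'⟩ := h'
  refine ⟨fun x => U x * U' x, ?_, (hp.mul hp').congr ?_⟩
  · filter_upwards [hU, hU'] with x h1 h2
    rw [h1, h2]
  · filter_upwards [hU, hU'] with x h1 h2
    rw [h1, h2]

/-- A continuous function that agrees almost everywhere with a primitive is a primitive. -/
theorem isPrimitiveOn [I.OrdConnected] (h : HasACDeriv I u v) (hI : IsOpen I)
    (hu : ContinuousOn u I) : IsPrimitiveOn I u v := by
  obtain ⟨U, hU, hp⟩ := h
  have he : EqOn U u I :=
    Measure.eqOn_of_ae_eq hU (hp.continuousOn hI) hu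
      (subset_closure.trans (closure_mono hI.interior_eq.symm.subset))
  refine ⟨hp.int, fun a ha b hb => ?_⟩
  rw [← he ha, ← he hb, hp.eq a ha b hb]

end HasACDeriv

end OneVariable

end Kondratev

namespace Kondratev

variable {𝕜 : Type*} [RCLike 𝕜]

/-! ### Derivatives along the coordinate lines of the annulus -/

theorem muPi_eq : muPi = (volume.restrict (Ioo (0 : ℝ) 1)).prod (volume : Measure Circ) := by
  unfold muPi openPi
  rw [← Measure.restrict_univ (μ := (volume : Measure Circ)), Measure.prod_restrict,
    Measure.volume_eq_prod]

instance : IsFiniteMeasure muPi := by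
  rw [muPi_eq]
  infer_instance

/-- The line is a countable union of periods, and the projection of each period to the circle
preserves measure. -/
theorem ae_coe_circ {P : Circ → Prop} (h : ∀ᵐ θ : Circ, P θ) :
    ∀ᵐ s : ℝ, P (s : Circ) := by
  have h1 : ∀ n : ℤ, ∀ᵐ s : ℝ ∂((volume : Measure ℝ).restrict
      (Ioc (0 + n • (2 * Real.pi)) (0 + (n + 1) • (2 * Real.pi)))), P (s : Circ) := by
    intro n
    have h2 := (AddCircle.measurePreserving_mk (2 * Real.pi)
      (0 + n • (2 * Real.pi))).quasiMeasurePreserving.ae h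
    have e : (0 + n • (2 * Real.pi)) + 2 * Real.pi = 0 + (n + 1) • (2 * Real.pi) := by
      rw [add_smul, one_smul, add_assoc]
    rwa [e] at h2
  have h3 := (ae_restrict_iUnion_iff _ _).2 h1
  rwa [iUnion_Ioc_add_zsmul Real.two_pi_pos, Measure.restrict_univ] at h3

theorem ae_radial_of_ae_muPi {P : ℝ × Circ → Prop} (h : ∀ᵐ x ∂muPi, P x) :
    ∀ᵐ ψ ∂(volume.restrict (Ioo (0 : ℝ) 1)), ∀ᵐ θ : Circ, P (ψ, θ) := by
  rw [muPi_eq] at h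
  exact Measure.ae_ae_of_ae_prod h

theorem ae_angular_of_ae_muPi {P : ℝ × Circ → Prop} (h : ∀ᵐ x ∂muPi, P x) :
    ∀ᵐ θ : Circ, ∀ᵐ ψ ∂(volume.restrict (Ioo (0 : ℝ) 1)), P (ψ, θ) := by
  rw [muPi_eq] at h
  have h1 := (Measure.measurePreserving_swap (μ := (volume : Measure Circ))
    (ν := volume.restrict (Ioo (0 : ℝ) 1))).quasiMeasurePreserving.ae h
  exact Measure.ae_ae_of_ae_prod h1

theorem ae_muPi_snd {P : Circ → Prop} (h : ∀ᵐ θ : Circ, P θ) : ∀ᵐ x ∂muPi, P x.2 := by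
  rw [muPi_eq]
  exact Measure.quasiMeasurePreserving_snd.ae h

theorem ae_muPi_fst {P : ℝ → Prop} (h : ∀ᵐ ψ ∂(volume.restrict (Ioo (0 : ℝ) 1)), P ψ) :
    ∀ᵐ x ∂muPi, P x.1 := by
  rw [muPi_eq]
  exact Measure.quasiMeasurePreserving_fst.ae h

theorem ae_muPi_mem : ∀ᵐ x ∂muPi, x ∈ openPi := ae_restrict_mem isOpen_openPi.measurableSet

/-- `v = ψ ∂_ψ u` on almost every radial line of the annulus. -/
def HasRadialDeriv (u v : ℝ × Circ → 𝕜) : Prop :=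
  ∀ᵐ θ : Circ, HasACDeriv (Ioo (0 : ℝ) 1) (fun ψ => u (ψ, θ)) (fun ψ => ψ⁻¹ • v (ψ, θ))

/-- `v = ∂_θ u` on almost every circle of the annulus. -/
def HasAngularDeriv (u v : ℝ × Circ → 𝕜) : Prop :=
  ∀ᵐ ψ ∂(volume.restrict (Ioo (0 : ℝ) 1)),
    HasACDeriv univ (fun s : ℝ => u (ψ, (s : Circ))) (fun s => v (ψ, (s : Circ)))

namespace HasRadialDeriv

variable {u v u' v' : ℝ × Circ → 𝕜}

theorem congr (h : HasRadialDeriv u v) (hu : u =ᵐ[muPi] u') (hv : v =ᵐ[muPi] v') :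
    HasRadialDeriv u' v' := by
  filter_upwards [h, ae_angular_of_ae_muPi hu, ae_angular_of_ae_muPi hv] with θ h1 h2 h3
  refine h1.congr h2 ?_
  filter_upwards [h3] with ψ h4
  rw [h4]

theorem add (h : HasRadialDeriv u v) (h' : HasRadialDeriv u' v') :
    HasRadialDeriv (fun x => u x + u' x) (fun x => v x + v' x) := by
  filter_upwards [h, h'] with θ h1 h2
  simpa only [smul_add] using h1.add h2

theorem clm_comp (L : 𝕜 →L[ℝ] 𝕜) (h : HasRadialDeriv u v) :
    HasRadialDeriv (fun x => L (u x)) (fun x => L (v x)) := by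
  filter_upwards [h] with θ h1
  simpa only [map_smul] using h1.clm_comp L

theorem mul (h : HasRadialDeriv u v) (h' : HasRadialDeriv u' v') :
    HasRadialDeriv (fun x => u x * u' x) (fun x => v x * u' x + u x * v' x) := by
  filter_upwards [h, h'] with θ h1 h2
  simpa only [smul_add, smul_mul_assoc, mul_smul_comm] using h1.mul h2

theorem of_radial {α : Circ → 𝕜} (h : u =ᵐ[muPi] fun x => α x.2) : HasRadialDeriv u 0 := by
  filter_upwards [ae_angular_of_ae_muPi h] with θ h1
  refine ⟨fun _ => α θ, EventuallyEq.symm h1, ?_⟩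
  simp only [Pi.zero_apply, smul_zero]
  exact ⟨fun _ _ _ _ => intervalIntegrable_const, fun _ _ _ _ => by simp⟩

theorem isPrimitiveOn (h : HasRadialDeriv u v) (hu : ContinuousOn u openPi) :
    ∀ᵐ θ : Circ, IsPrimitiveOn (Ioo (0 : ℝ) 1) (fun ψ => u (ψ, θ))
      (fun ψ => ψ⁻¹ • v (ψ, θ)) := by
  filter_upwards [h] with θ h1
  refine h1.isPrimitiveOn isOpen_Ioo ?_
  exact hu.comp (by fun_prop) fun ψ hψ => ⟨hψ, mem_univ _⟩

/-- Continuity of `u` is needed so that `u` itself, not merely a representative, is the primitive on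
each line; its values then stay in `Ω` everywhere on the line. -/
theorem comp (h : HasRadialDeriv u v) (hu : ContinuousOn u openPi) {g : 𝕜 → 𝕜} {Ω : Set 𝕜}
    (hΩ : IsOpen Ω) (hg : ContDiffOn ℝ 1 g Ω) (hm : MapsTo u openPi Ω) :
    HasRadialDeriv (fun x => g (u x)) (fun x => fderiv ℝ g (u x) (v x)) := by
  filter_upwards [h.isPrimitiveOn hu] with θ h1
  have h2 := h1.comp hΩ hg (fun ψ hψ => hm (show (ψ, θ) ∈ openPi from ⟨hψ, mem_univ _⟩))
  exact ⟨_, EventuallyEq.rfl, by simpa only [map_smul] using h2⟩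

end HasRadialDeriv

namespace HasAngularDeriv

variable {u v u' v' : ℝ × Circ → 𝕜}

theorem congr (h : HasAngularDeriv u v) (hu : u =ᵐ[muPi] u') (hv : v =ᵐ[muPi] v') :
    HasAngularDeriv u' v' := by
  filter_upwards [h, ae_radial_of_ae_muPi hu, ae_radial_of_ae_muPi hv] with ψ h1 h2 h3
  refine h1.congr ?_ ?_ <;> rw [Measure.restrict_univ]
  exacts [ae_coe_circ h2, ae_coe_circ h3]

theorem add (h : HasAngularDeriv u v) (h' : HasAngularDeriv u' v') :
    HasAngularDeriv (fun x => u x + u' x) (fun x => v x + v' x) := by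
  filter_upwards [h, h'] with ψ h1 h2
  exact h1.add h2

theorem clm_comp (L : 𝕜 →L[ℝ] 𝕜) (h : HasAngularDeriv u v) :
    HasAngularDeriv (fun x => L (u x)) (fun x => L (v x)) := by
  filter_upwards [h] with ψ h1
  exact h1.clm_comp L

theorem mul (h : HasAngularDeriv u v) (h' : HasAngularDeriv u' v') :
    HasAngularDeriv (fun x => u x * u' x) (fun x => v x * u' x + u x * v' x) := by
  filter_upwards [h, h'] with ψ h1 h2
  exact h1.mul h2

theorem isPrimitiveOn (h : HasAngularDeriv u v) (hu : ContinuousOn u openPi) :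
    ∀ᵐ ψ ∂(volume.restrict (Ioo (0 : ℝ) 1)), IsPrimitiveOn univ
      (fun s : ℝ => u (ψ, (s : Circ))) (fun s => v (ψ, (s : Circ))) := by
  filter_upwards [h, ae_restrict_mem measurableSet_Ioo] with ψ h1 h2
  refine h1.isPrimitiveOn isOpen_univ ?_
  refine hu.comp (Continuous.continuousOn ?_) fun s _ => ⟨h2, mem_univ _⟩
  exact continuous_const.prodMk (AddCircle.continuous_mk' _)

theorem comp (h : HasAngularDeriv u v) (hu : ContinuousOn u openPi) {g : 𝕜 → 𝕜} {Ω : Set 𝕜}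
    (hΩ : IsOpen Ω) (hg : ContDiffOn ℝ 1 g Ω) (hm : MapsTo u openPi Ω) :
    HasAngularDeriv (fun x => g (u x)) (fun x => fderiv ℝ g (u x) (v x)) := by
  filter_upwards [h.isPrimitiveOn hu, ae_restrict_mem measurableSet_Ioo] with ψ h1 hψ
  have h2 := h1.comp hΩ hg (fun s _ => hm (show (ψ, (s : Circ)) ∈ openPi from ⟨hψ, mem_univ _⟩))
  exact ⟨_, EventuallyEq.rfl, h2⟩

theorem const (c : 𝕜) : HasAngularDeriv (fun _ => c) 0 :=
  Eventually.of_forall fun _ => ⟨fun _ => c, EventuallyEq.rfl,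
    fun _ _ _ _ => intervalIntegrable_const, fun _ _ _ _ => by simp⟩

end HasAngularDeriv

/-! ### Sobolev bounds -/

open scoped NNReal ENNReal

/-- The weight exponent: `γ` for the Kondratev class, `0` for functions of `θ` alone. -/
noncomputable def wexp (γ : ℝ) (c : Bool) : ℝ := if c then γ else 0

/-- `a` has weighted `L²` norm at most `R`; for `c = false`, it depends on `θ` only. -/
structure L2Bound (γ : ℝ) (c : Bool) (a : ℝ × Circ → 𝕜) (R : ℝ≥0) : Prop where
  meas : AEStronglyMeasurable a muPi
  radial : c = false → ∃ α : Circ → 𝕜, a =ᵐ[muPi] fun x => α x.2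
  norm : eLpNorm (fun x => x.1 ^ (-wexp γ c) • a x) 2 muPi ≤ R

/-- All iterated derivatives of `a` of order at most `k` along `ψ ∂_ψ` and `∂_θ` have weighted
`L²` norm at most `R`. -/
def SobBound (γ : ℝ) (c : Bool) : ℕ → (ℝ × Circ → 𝕜) → ℝ≥0 → Prop
  | 0, a, R => L2Bound γ c a R
  | k + 1, a, R => L2Bound γ c a R ∧ ∃ a₁ a₂, HasRadialDeriv a a₁ ∧ HasAngularDeriv a a₂ ∧
      SobBound γ c k a₁ R ∧ SobBound γ c k a₂ R

variable {γ : ℝ} {c : Bool}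

theorem measurable_rpow_fst (s : ℝ) : Measurable fun x : ℝ × Circ => x.1 ^ s :=
  measurable_fst.pow_const s

namespace L2Bound

variable {a b : ℝ × Circ → 𝕜} {R S : ℝ≥0}

theorem mono (h : L2Bound γ c a R) (hRS : R ≤ S) : L2Bound γ c a S :=
  ⟨h.meas, h.radial, h.norm.trans (by exact_mod_cast hRS)⟩

theorem congr (h : L2Bound γ c a R) (hab : a =ᵐ[muPi] b) : L2Bound γ c b R := by
  refine ⟨h.meas.congr hab, fun hc => ?_, ?_⟩
  · obtain ⟨α, hα⟩ := h.radial hc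
    exact ⟨α, hab.symm.trans hα⟩
  · refine (eLpNorm_congr_ae ?_).le.trans h.norm
    filter_upwards [hab] with x hx
    rw [hx]

theorem meas_weight (h : L2Bound γ c a R) (s : ℝ) :
    AEStronglyMeasurable (fun x => x.1 ^ s • a x) muPi :=
  (measurable_rpow_fst s).aestronglyMeasurable.smul h.meas

theorem add (h : L2Bound γ c a R) (h' : L2Bound γ c b S) :
    L2Bound γ c (fun x => a x + b x) (R + S) := by
  refine ⟨h.meas.add h'.meas, fun hc => ?_, ?_⟩
  · obtain ⟨α, hα⟩ := h.radial hc
    obtain ⟨β, hβ⟩ := h'.radial hc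
    refine ⟨fun θ => α θ + β θ, ?_⟩
    filter_upwards [hα, hβ] with x h1 h2
    rw [h1, h2]
  · simp only [smul_add]
    refine (eLpNorm_add_le (h.meas_weight _) (h'.meas_weight _) (by norm_num)).trans ?_
    push_cast
    exact add_le_add h.norm h'.norm

theorem clm_comp (L : 𝕜 →L[ℝ] 𝕜) (h : L2Bound γ c a R) :
    L2Bound γ c (fun x => L (a x)) (‖L‖₊ * R) := by
  refine ⟨L.continuous.comp_aestronglyMeasurable h.meas, fun hc => ?_, ?_⟩
  · obtain ⟨α, hα⟩ := h.radial hc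
    refine ⟨fun θ => L (α θ), ?_⟩
    filter_upwards [hα] with x h1
    rw [h1]
  · have h1 : eLpNorm (fun x => x.1 ^ (-wexp γ c) • L (a x)) 2 muPi ≤
        ‖L‖₊ • eLpNorm (fun x => x.1 ^ (-wexp γ c) • a x) 2 muPi := by
      refine eLpNorm_le_nnreal_smul_eLpNorm_of_ae_le_mul (Eventually.of_forall fun x => ?_) 2
      rw [← map_smul]
      exact L.le_opNNNorm _
    refine h1.trans ?_
    rw [ENNReal.smul_def, smul_eq_mul, ENNReal.coe_mul]
    exact mul_le_mul_right h.norm _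

theorem zero : L2Bound γ c (0 : ℝ × Circ → 𝕜) R :=
  ⟨aestronglyMeasurable_zero, fun _ => ⟨0, EventuallyEq.rfl⟩, by simp⟩

end L2Bound

namespace SobBound

variable {a b : ℝ × Circ → 𝕜} {R S : ℝ≥0} {k l : ℕ}

theorem l2Bound (h : SobBound γ c k a R) : L2Bound γ c a R := by
  cases k
  exacts [h, h.1]

theorem mono (h : SobBound γ c k a R) (hRS : R ≤ S) : SobBound γ c k a S := by
  induction k generalizing a with
  | zero => exact L2Bound.mono h hRS
  | succ k ih =>
    obtain ⟨h0, a₁, a₂, h1, h2, h3, h4⟩ := h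
    exact ⟨h0.mono hRS, a₁, a₂, h1, h2, ih h3, ih h4⟩

theorem of_succ (h : SobBound γ c (k + 1) a R) : SobBound γ c k a R := by
  induction k generalizing a with
  | zero => exact h.1
  | succ k ih =>
    obtain ⟨h0, a₁, a₂, h1, h2, h3, h4⟩ := h
    exact ⟨h0, a₁, a₂, h1, h2, ih h3, ih h4⟩

theorem of_le (h : SobBound γ c k a R) (hlk : l ≤ k) : SobBound γ c l a R := by
  induction hlk with
  | refl => exact h
  | step _ ih => exact ih h.of_succ

theorem add (h : SobBound γ c k a R) (h' : SobBound γ c k b S) :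
    SobBound γ c k (fun x => a x + b x) (R + S) := by
  induction k generalizing a b with
  | zero => exact L2Bound.add h h'
  | succ k ih =>
    obtain ⟨h0, a₁, a₂, h1, h2, h3, h4⟩ := h
    obtain ⟨g0, b₁, b₂, g1, g2, g3, g4⟩ := h'
    exact ⟨h0.add g0, _, _, h1.add g1, h2.add g2, ih h3 g3, ih h4 g4⟩

theorem clm_comp (L : 𝕜 →L[ℝ] 𝕜) (h : SobBound γ c k a R) :
    SobBound γ c k (fun x => L (a x)) (‖L‖₊ * R) := by
  induction k generalizing a with
  | zero => exact L2Bound.clm_comp L h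
  | succ k ih =>
    obtain ⟨h0, a₁, a₂, h1, h2, h3, h4⟩ := h
    exact ⟨h0.clm_comp L, _, _, h1.clm_comp L, h2.clm_comp L, ih h3, ih h4⟩

theorem const_mul (r : 𝕜) (h : SobBound γ c k a R) :
    SobBound γ c k (fun x => r * a x) (‖r‖₊ * R) := by
  refine (h.clm_comp (ContinuousLinearMap.mul ℝ 𝕜 r)).mono ?_
  gcongr
  exact ContinuousLinearMap.opNorm_mul_apply_le ℝ 𝕜 r

theorem conj (h : SobBound γ c k a R) :
    SobBound γ c k (fun x => (starRingEnd 𝕜) (a x)) R := by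
  refine (h.clm_comp (RCLike.conjCLE (K := 𝕜) : 𝕜 →L[ℝ] 𝕜)).mono ?_
  refine mul_le_of_le_one_left' ?_
  refine ContinuousLinearMap.opNNNorm_le_bound _ _ fun x => ?_
  simp

theorem neg (h : SobBound γ c k a R) : SobBound γ c k (fun x => - a x) R := by
  simpa using h.const_mul (-1)

theorem sub (h : SobBound γ c k a R) (h' : SobBound γ c k b S) :
    SobBound γ c k (fun x => a x - b x) (R + S) := by
  simpa [sub_eq_add_neg] using h.add h'.neg

theorem zero : SobBound γ c k (0 : ℝ × Circ → 𝕜) R := by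
  induction k with
  | zero => exact L2Bound.zero
  | succ k ih =>
    exact ⟨L2Bound.zero, 0, 0, .of_radial (α := 0) EventuallyEq.rfl, .const 0, ih, ih⟩

end SobBound

end Kondratev

namespace Kondratev

variable {𝕜 : Type*} [RCLike 𝕜]

open scoped NNReal ENNReal

/-! ### One-dimensional estimates -/

theorem lintegral_mul_sq_le {α : Type*} {mα : MeasurableSpace α} {μ : Measure α} {f g : α → ℝ≥0∞}
    (hf : AEMeasurable f μ) (hg : AEMeasurable g μ) :
    (∫⁻ x, f x * g x ∂μ) ^ 2 ≤ (∫⁻ x, f x ^ 2 ∂μ) * ∫⁻ x, g x ^ 2 ∂μ := by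
  have h := ENNReal.lintegral_mul_le_Lp_mul_Lq μ Real.HolderConjugate.two_two hf hg
  have h2 := pow_le_pow_left' h 2
  refine h2.trans_eq ?_
  simp only [mul_pow, ← ENNReal.rpow_natCast, ← ENNReal.rpow_mul]
  norm_num

theorem lintegral_sq_le {α : Type*} {mα : MeasurableSpace α} {μ : Measure α} {f : α → ℝ≥0∞}
    (hf : AEMeasurable f μ) :
    (∫⁻ x, f x ∂μ) ^ 2 ≤ μ univ * ∫⁻ x, f x ^ 2 ∂μ := by
  simpa using lintegral_mul_sq_le (aemeasurable_const (b := (1 : ℝ≥0∞))) hf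

theorem ennreal_add_sq_le (x y : ℝ≥0∞) : (x + y) ^ 2 ≤ 2 * (x ^ 2 + y ^ 2) := by
  have h := ENNReal.rpow_add_le_mul_rpow_add_rpow x y (p := 2) (by norm_num)
  have e : (2 : ℝ≥0∞) ^ ((2 : ℝ) - 1) = 2 := by norm_num
  rw [e] at h
  exact_mod_cast h

/-- Squared form of `IsPrimitiveOn.norm_le`, by Cauchy-Schwarz on an interval of length b − a. -/
theorem IsPrimitiveOn.enorm_sq_le {E : Type*} [NormedAddCommGroup E] [NormedSpace ℝ E]
    {I : Set ℝ} [I.OrdConnected] {u v : ℝ → E} (h : IsPrimitiveOn I u v) {a b x : ℝ}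
    (hab : a < b) (ha : a ∈ I) (hb : b ∈ I) (hx : x ∈ Icc a b) :
    ‖u x‖ₑ ^ 2 ≤ 2 * (ENNReal.ofReal (b - a)⁻¹ * (∫⁻ y in Ioc a b, ‖u y‖ₑ ^ 2) +
      ENNReal.ofReal (b - a) * ∫⁻ y in Ioc a b, ‖v y‖ₑ ^ 2) := by
  have hpos : 0 < b - a := sub_pos.2 hab
  have h1 := h.norm_le hab ha hb hx
  have hui : IntegrableOn u (Ioc a b) := (h.continuousOn_uIcc ha hb).intervalIntegrable.1
  have hvi : IntegrableOn v (Ioc a b) := (h.int a ha b hb).1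
  have h2 : ‖u x‖ₑ ≤ ENNReal.ofReal (b - a)⁻¹ * (∫⁻ y in Ioc a b, ‖u y‖ₑ) +
      ∫⁻ y in Ioc a b, ‖v y‖ₑ := by
    rw [intervalIntegral.integral_of_le hab.le, intervalIntegral.integral_of_le hab.le] at h1
    rw [← ofReal_norm, ← ofReal_integral_norm_eq_lintegral_enorm hui,
      ← ofReal_integral_norm_eq_lintegral_enorm hvi, ← ENNReal.ofReal_mul (inv_nonneg.2 hpos.le),
      ← ENNReal.ofReal_add (by positivity) (by positivity)]
    exact ENNReal.ofReal_le_ofReal h1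
  have h3 := lintegral_sq_le hui.aestronglyMeasurable.enorm
  have h4 := lintegral_sq_le hvi.aestronglyMeasurable.enorm
  rw [Measure.restrict_apply_univ, Real.volume_Ioc] at h3 h4
  refine (pow_le_pow_left' h2 2).trans ((ennreal_add_sq_le _ _).trans ?_)
  refine mul_le_mul_right (add_le_add ?_ h4) _
  rw [mul_pow]
  refine (mul_le_mul_right h3 _).trans_eq ?_
  rw [← mul_assoc, sq, mul_assoc (ENNReal.ofReal _), ← ENNReal.ofReal_mul (inv_nonneg.2 hpos.le),
    inv_mul_cancel₀ hpos.ne', ENNReal.ofReal_one, mul_one]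

theorem ae_circ_of_ae_coe {P : Circ → Prop} (h : ∀ᵐ s : ℝ, P (s : Circ)) : ∀ᵐ θ : Circ, P θ := by
  have h1 : ∀ᵐ s : Ioc (0 : ℝ) (0 + 2 * Real.pi) ∂(Measure.comap Subtype.val volume),
      P ((s : ℝ) : Circ) := by
    rw [← ae_restrict_iff_subtype measurableSet_Ioc (p := fun s : ℝ => P (s : Circ))]
    exact ae_restrict_of_ae h
  have h2 := (AddCircle.measurePreserving_equivIoc (2 * Real.pi)
    (a := 0)).quasiMeasurePreserving.ae h1
  filter_upwards [h2] with θ hθ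
  have e : (((AddCircle.equivIoc (2 * Real.pi) 0 θ : Ioc (0 : ℝ) (0 + 2 * Real.pi)) : ℝ) : Circ)
      = θ := (AddCircle.equivIoc (2 * Real.pi) 0).symm_apply_apply θ
  rwa [e] at hθ

theorem lintegral_muPi {f : ℝ × Circ → ℝ≥0∞} (hf : AEMeasurable f muPi) :
    ∫⁻ x, f x ∂muPi = ∫⁻ ψ in Ioo (0 : ℝ) 1, ∫⁻ θ, f (ψ, θ) := by
  rw [muPi_eq] at hf ⊢
  exact lintegral_prod f hf

theorem lintegral_muPi_symm {f : ℝ × Circ → ℝ≥0∞} (hf : AEMeasurable f muPi) :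
    ∫⁻ x, f x ∂muPi = ∫⁻ θ, ∫⁻ ψ in Ioo (0 : ℝ) 1, f (ψ, θ) := by
  rw [muPi_eq] at hf ⊢
  exact lintegral_prod_symm f hf

theorem ae_muPi_of_radial {P : ℝ × Circ → Prop} (hP : MeasurableSet {x | P x})
    (h : ∀ᵐ ψ ∂(volume.restrict (Ioo (0 : ℝ) 1)), ∀ᵐ θ : Circ, P (ψ, θ)) : ∀ᵐ x ∂muPi, P x := by
  rw [muPi_eq]
  exact (Measure.ae_prod_iff_ae_ae hP).2 h

theorem ae_muPi_of_angular {P : ℝ × Circ → Prop} (hP : MeasurableSet {x | P x})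
    (h : ∀ᵐ θ : Circ, ∀ᵐ ψ ∂(volume.restrict (Ioo (0 : ℝ) 1)), P (ψ, θ)) : ∀ᵐ x ∂muPi, P x :=
  ae_muPi_of_radial hP ((Measure.ae_ae_comm (p := fun ψ θ => P (ψ, θ)) hP).2 h)

/-- A function with an angular derivative is bounded on almost every circle. -/
theorem HasAngularDeriv.exists_bound {a a₂ : ℝ × Circ → 𝕜} (h : HasAngularDeriv a a₂)
    (ha : AEStronglyMeasurable a muPi) (ha₂ : AEStronglyMeasurable a₂ muPi) :
    ∃ B : ℝ → ℝ≥0∞, Measurable B ∧ (∀ᵐ x ∂muPi, ‖a x‖ₑ ^ 2 ≤ B x.1) ∧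
      ∀ w : ℝ → ℝ≥0∞, Measurable w → ∫⁻ ψ in Ioo (0 : ℝ) 1, w ψ * B ψ =
        13 * (∫⁻ x, w x.1 * ‖a x‖ₑ ^ 2 ∂muPi + ∫⁻ x, w x.1 * ‖a₂ x‖ₑ ^ 2 ∂muPi) := by
  -- Strongly measurable representatives make the set where the bound holds measurable, which is
  -- what Fubini needs to pass from lines to the annulus.
  wlog hm : StronglyMeasurable a ∧ StronglyMeasurable a₂ generalizing a a₂
  · obtain ⟨B, h1, h2, h3⟩ := this (h.congr ha.ae_eq_mk ha₂.ae_eq_mk)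
      ha.stronglyMeasurable_mk.aestronglyMeasurable ha₂.stronglyMeasurable_mk.aestronglyMeasurable
      ⟨ha.stronglyMeasurable_mk, ha₂.stronglyMeasurable_mk⟩
    refine ⟨B, h1, ?_, fun w hw => ?_⟩
    · filter_upwards [h2, ha.ae_eq_mk] with x hx he
      rwa [he]
    · rw [h3 w hw]
      congr 2 <;> refine lintegral_congr_ae ?_
      · filter_upwards [ha.ae_eq_mk] with x he
        rw [he]
      · filter_upwards [ha₂.ae_eq_mk] with x he
        rw [he]
  have m1 : Measurable fun x : ℝ × Circ => ‖a x‖ₑ ^ 2 := hm.1.measurable.enorm.pow_const 2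
  have m2 : Measurable fun x : ℝ × Circ => ‖a₂ x‖ₑ ^ 2 := hm.2.measurable.enorm.pow_const 2
  have hB : Measurable fun ψ : ℝ => 13 * ∫⁻ θ : Circ, (‖a (ψ, θ)‖ₑ ^ 2 + ‖a₂ (ψ, θ)‖ₑ ^ 2) :=
    (Measurable.lintegral_prod_right' (m1.add m2)).const_mul 13
  refine ⟨_, hB, ?_, fun w hw => ?_⟩
  · refine ae_muPi_of_radial (measurableSet_le m1 (hB.comp measurable_fst)) ?_
    filter_upwards [h] with ψ hψ
    obtain ⟨U, hU, hp⟩ := hψ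
    rw [Measure.restrict_univ] at hU
    have m1' : Measurable fun θ : Circ => ‖a (ψ, θ)‖ₑ ^ 2 := m1.comp measurable_prodMk_left
    -- The one-dimensional bound is applied on a full period starting at s. The constant 13
    -- dominates both 2/(2π) and 2 · 2π.
    have key : ∀ s : ℝ, ‖U s‖ₑ ^ 2 ≤
        13 * ∫⁻ θ : Circ, (‖a (ψ, θ)‖ₑ ^ 2 + ‖a₂ (ψ, θ)‖ₑ ^ 2) := by
      intro s
      refine (hp.enorm_sq_le (lt_add_of_pos_right s Real.two_pi_pos) (mem_univ _) (mem_univ _)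
        (left_mem_Icc.2 (le_add_of_nonneg_right Real.two_pi_pos.le))).trans ?_
      have e1 : ∫⁻ y in Ioc s (s + 2 * Real.pi), ‖U y‖ₑ ^ 2 = ∫⁻ θ : Circ, ‖a (ψ, θ)‖ₑ ^ 2 := by
        rw [← AddCircle.lintegral_preimage (2 * Real.pi) s]
        refine lintegral_congr_ae (ae_restrict_of_ae ?_)
        filter_upwards [hU] with y hy
        rw [hy]
      have e2 : ∫⁻ y in Ioc s (s + 2 * Real.pi), ‖a₂ (ψ, (y : Circ))‖ₑ ^ 2 =
          ∫⁻ θ : Circ, ‖a₂ (ψ, θ)‖ₑ ^ 2 :=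
        AddCircle.lintegral_preimage (2 * Real.pi) s fun θ => ‖a₂ (ψ, θ)‖ₑ ^ 2
      rw [e1, e2, lintegral_add_left m1', mul_add, mul_add, ← mul_assoc, ← mul_assoc,
        add_sub_cancel_left]
      have hpi := Real.pi_gt_three
      have hpi' := Real.pi_lt_d2
      have two : (2 : ℝ≥0∞) = ENNReal.ofReal 2 := by simp
      have thirteen : (13 : ℝ≥0∞) = ENNReal.ofReal 13 := by simp
      rw [two, thirteen, ← ENNReal.ofReal_mul (by norm_num), ← ENNReal.ofReal_mul (by norm_num)]
      gcongr
      · have : (2 * Real.pi)⁻¹ ≤ 1 := inv_le_one_of_one_le₀ (by linarith)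
        linarith
      · linarith
    refine ae_circ_of_ae_coe (P := fun θ => ‖a (ψ, θ)‖ₑ ^ 2 ≤
      13 * ∫⁻ θ : Circ, (‖a (ψ, θ)‖ₑ ^ 2 + ‖a₂ (ψ, θ)‖ₑ ^ 2)) ?_
    filter_upwards [hU] with s hs
    rw [← hs]
    exact key s
  · have n1 : Measurable fun x : ℝ × Circ => w x.1 * ‖a x‖ₑ ^ 2 := (hw.comp measurable_fst).mul m1
    have n2 : Measurable fun x : ℝ × Circ => w x.1 * ‖a₂ x‖ₑ ^ 2 := (hw.comp measurable_fst).mul m2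
    have n12 : Measurable fun x : ℝ × Circ => w x.1 * ‖a x‖ₑ ^ 2 + w x.1 * ‖a₂ x‖ₑ ^ 2 := n1.add n2
    rw [← lintegral_add_left n1, lintegral_muPi n12.aemeasurable,
      ← lintegral_const_mul _ n12.lintegral_prod_right']
    refine lintegral_congr fun ψ => ?_
    have m12 : Measurable fun θ : Circ => ‖a (ψ, θ)‖ₑ ^ 2 + ‖a₂ (ψ, θ)‖ₑ ^ 2 :=
      (m1.add m2).comp measurable_prodMk_left
    rw [← mul_assoc, mul_comm (w ψ), mul_assoc, ← lintegral_const_mul _ m12]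
    simp only [mul_add]

/-- A function with a radial derivative is bounded on almost every radial line, with decay at
`ψ = 0`. -/
theorem HasRadialDeriv.exists_bound {γ : ℝ} (hγ : 0 ≤ γ) {a a₁ : ℝ × Circ → 𝕜}
    (h : HasRadialDeriv a a₁) (ha : AEStronglyMeasurable a muPi)
    (ha₁ : AEStronglyMeasurable a₁ muPi) :
    ∃ A : Circ → ℝ≥0∞, Measurable A ∧
      (∀ᵐ x ∂muPi, ‖a x‖ₑ ^ 2 ≤ ENNReal.ofReal (x.1 ^ (2 * γ - 1)) * A x.2) ∧
      ∫⁻ θ, A θ = 4 * (∫⁻ x, ENNReal.ofReal (x.1 ^ (-2 * γ)) * ‖a x‖ₑ ^ 2 ∂muPi +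
        ∫⁻ x, ENNReal.ofReal (x.1 ^ (-2 * γ)) * ‖a₁ x‖ₑ ^ 2 ∂muPi) := by
  wlog hm : StronglyMeasurable a ∧ StronglyMeasurable a₁ generalizing a a₁
  · obtain ⟨B, h1, h2, h3⟩ := this (h.congr ha.ae_eq_mk ha₁.ae_eq_mk)
      ha.stronglyMeasurable_mk.aestronglyMeasurable ha₁.stronglyMeasurable_mk.aestronglyMeasurable
      ⟨ha.stronglyMeasurable_mk, ha₁.stronglyMeasurable_mk⟩
    refine ⟨B, h1, ?_, ?_⟩
    · filter_upwards [h2, ha.ae_eq_mk] with x hx he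
      rwa [he]
    · rw [h3]
      congr 2 <;> refine lintegral_congr_ae ?_
      · filter_upwards [ha.ae_eq_mk] with x he
        rw [he]
      · filter_upwards [ha₁.ae_eq_mk] with x he
        rw [he]
  have mw : Measurable fun x : ℝ × Circ => ENNReal.ofReal (x.1 ^ (-2 * γ)) :=
    (measurable_rpow_fst _).ennreal_ofReal
  have m1 : Measurable fun x : ℝ × Circ => ENNReal.ofReal (x.1 ^ (-2 * γ)) * ‖a x‖ₑ ^ 2 :=
    mw.mul (hm.1.measurable.enorm.pow_const 2)
  have m2 : Measurable fun x : ℝ × Circ => ENNReal.ofReal (x.1 ^ (-2 * γ)) * ‖a₁ x‖ₑ ^ 2 :=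
    mw.mul (hm.2.measurable.enorm.pow_const 2)
  have hA : Measurable fun θ : Circ => 4 * ∫⁻ ψ in Ioo (0 : ℝ) 1,
      (ENNReal.ofReal (ψ ^ (-2 * γ)) * ‖a (ψ, θ)‖ₑ ^ 2 +
        ENNReal.ofReal (ψ ^ (-2 * γ)) * ‖a₁ (ψ, θ)‖ₑ ^ 2) :=
    (Measurable.lintegral_prod_left' (m1.add m2)).const_mul 4
  refine ⟨_, hA, ?_, ?_⟩
  · refine ae_muPi_of_angular (measurableSet_le (hm.1.measurable.enorm.pow_const 2)
      ((measurable_rpow_fst _).ennreal_ofReal.mul (hA.comp measurable_snd))) ?_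
    filter_upwards [h] with θ hθ
    obtain ⟨U, hU, hp⟩ := hθ
    filter_upwards [hU, ae_restrict_mem measurableSet_Ioo] with x hx hxm
    rw [← hx]
    have hx0 : 0 < x := hxm.1
    have hsub : Ioc (x / 2) x ⊆ Ioo (0 : ℝ) 1 := fun y hy =>
      ⟨(half_pos hx0).trans hy.1, hy.2.trans_lt hxm.2⟩
    -- The one-dimensional bound is used on the interval (x/2, x], whose length is comparable to its
    -- points. This makes the estimate scale invariant and adapted to ψ∂_ψ.
    refine (hp.enorm_sq_le (half_lt_self hx0) ⟨half_pos hx0, (half_lt_self hx0).trans hxm.2⟩ hxm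
      ⟨(half_lt_self hx0).le, le_rfl⟩).trans ?_
    have hh : x - x / 2 = x / 2 := by ring
    rw [hh]
    -- The factor 1/x is exchanged for the weight y^{-2γ}: for y ≤ x and γ ≥ 0 the weight at y is at
    -- least that at x, and what remains is x^{2γ-1}.
    have hw : ∀ y ∈ Ioc (x / 2) x, x⁻¹ ≤ x ^ (2 * γ - 1) * y ^ (-2 * γ) := by
      intro y hy
      have hy0 : 0 < y := (half_pos hx0).trans hy.1
      calc x⁻¹ = x ^ (2 * γ - 1) * x ^ (-2 * γ) := by
            rw [← Real.rpow_add hx0, ← Real.rpow_neg_one]; congr 1; ring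
        _ ≤ _ := by
            gcongr ?_ * ?_
            exact Real.rpow_le_rpow_of_nonpos hy0 hy.2 (by linarith)
    have hU' : U =ᵐ[volume.restrict (Ioc (x / 2) x)] fun y => a (y, θ) :=
      ae_mono (Measure.restrict_mono hsub le_rfl) hU
    have b1 : ENNReal.ofReal (x / 2)⁻¹ * ∫⁻ y in Ioc (x / 2) x, ‖U y‖ₑ ^ 2 ≤
        2 * (ENNReal.ofReal (x ^ (2 * γ - 1)) * ∫⁻ ψ in Ioo (0 : ℝ) 1,
          ENNReal.ofReal (ψ ^ (-2 * γ)) * ‖a (ψ, θ)‖ₑ ^ 2) := by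
      have e : ENNReal.ofReal (x / 2)⁻¹ = 2 * ENNReal.ofReal x⁻¹ := by
        rw [← ENNReal.ofReal_ofNat, ← ENNReal.ofReal_mul (by norm_num)]
        congr 1
        rw [inv_div, div_eq_mul_inv]
      rw [e, mul_assoc]
      refine mul_le_mul_right ?_ _
      rw [← lintegral_const_mul' _ _ ENNReal.ofReal_ne_top,
        ← lintegral_const_mul' _ _ ENNReal.ofReal_ne_top]
      refine le_trans ?_ (lintegral_mono_set hsub)
      refine lintegral_mono_ae ?_
      filter_upwards [hU', ae_restrict_mem measurableSet_Ioc] with y hy hym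
      rw [hy, ← mul_assoc, ← ENNReal.ofReal_mul (by positivity)]
      gcongr
      exact hw y hym
    have b2 : ENNReal.ofReal (x / 2) * ∫⁻ y in Ioc (x / 2) x, ‖y⁻¹ • a₁ (y, θ)‖ₑ ^ 2 ≤
        2 * (ENNReal.ofReal (x ^ (2 * γ - 1)) * ∫⁻ ψ in Ioo (0 : ℝ) 1,
          ENNReal.ofReal (ψ ^ (-2 * γ)) * ‖a₁ (ψ, θ)‖ₑ ^ 2) := by
      rw [← mul_assoc, ← ENNReal.ofReal_ofNat, ← ENNReal.ofReal_mul (by norm_num),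
        ← lintegral_const_mul' _ _ ENNReal.ofReal_ne_top,
        ← lintegral_const_mul' _ _ ENNReal.ofReal_ne_top]
      refine le_trans ?_ (lintegral_mono_set hsub)
      refine lintegral_mono_ae ?_
      filter_upwards [ae_restrict_mem measurableSet_Ioc] with y hym
      have hy0 : 0 < y := (half_pos hx0).trans hym.1
      rw [enorm_smul, mul_pow, ← mul_assoc, ← mul_assoc, ← ENNReal.ofReal_mul (by positivity),
        Real.enorm_eq_ofReal (by positivity), ← ENNReal.ofReal_pow (by positivity),
        ← ENNReal.ofReal_mul (by positivity)]
      gcongr ENNReal.ofReal ?_ * _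
      have h5 : y⁻¹ ≤ 2 * x⁻¹ := by
        rw [← div_eq_mul_inv, inv_le_comm₀ hy0 (by positivity), inv_div]
        exact hym.1.le
      calc x / 2 * y⁻¹ ^ 2 ≤ x / 2 * (2 * x⁻¹) ^ 2 := by gcongr
        _ = 2 * x⁻¹ := by field_simp
        _ ≤ 2 * (x ^ (2 * γ - 1) * y ^ (-2 * γ)) := by gcongr; exact hw y hym
        _ = _ := by ring
    refine (mul_le_mul_right (add_le_add b1 b2) _).trans_eq ?_
    have m1' : Measurable fun ψ : ℝ => ENNReal.ofReal (ψ ^ (-2 * γ)) * ‖a (ψ, θ)‖ₑ ^ 2 :=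
      m1.comp measurable_prodMk_right
    rw [lintegral_add_left m1']
    ring
  · have m12 : Measurable fun x : ℝ × Circ => ENNReal.ofReal (x.1 ^ (-2 * γ)) * ‖a x‖ₑ ^ 2 +
        ENNReal.ofReal (x.1 ^ (-2 * γ)) * ‖a₁ x‖ₑ ^ 2 := m1.add m2
    rw [← lintegral_add_left m1, lintegral_muPi_symm m12.aemeasurable,
      ← lintegral_const_mul _ m12.lintegral_prod_left']

end Kondratev

namespace Kondratev

variable {𝕜 : Type*} [RCLike 𝕜]

open scoped NNReal ENNReal

/-! ### Pointwise bounds and products -/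

section Products

variable {γ : ℝ} {c : Bool} {a b v : ℝ × Circ → 𝕜} {R S : ℝ≥0} {j k l : ℕ}

theorem eLpNorm_weight_sq (s : ℝ) (a : ℝ × Circ → 𝕜) :
    eLpNorm (fun x => x.1 ^ (-s) • a x) 2 muPi ^ 2 =
      ∫⁻ x, ENNReal.ofReal (x.1 ^ (-2 * s)) * ‖a x‖ₑ ^ 2 ∂muPi := by
  have h := eLpNorm_nnreal_pow_eq_lintegral (f := fun x : ℝ × Circ => x.1 ^ (-s) • a x)
    (μ := muPi) (p := 2) two_ne_zero
  simp only [NNReal.coe_ofNat, ENNReal.coe_ofNat, ENNReal.rpow_ofNat] at h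
  rw [h]
  refine lintegral_congr_ae ?_
  filter_upwards [ae_muPi_mem] with x hx
  have hx0 : 0 < x.1 := hx.1.1
  rw [enorm_smul, mul_pow, Real.enorm_eq_ofReal (by positivity), ← ENNReal.ofReal_pow (by positivity),
    ← Real.rpow_natCast, ← Real.rpow_mul hx0.le]
  rw [show -s * ((2 : ℕ) : ℝ) = -2 * s by push_cast; ring]

theorem ennreal_le_of_sq_le {x y : ℝ≥0∞} (h : x ^ 2 ≤ y ^ 2) : x ≤ y :=
  (ENNReal.pow_le_pow_left_iff two_ne_zero).1 h

theorem L2Bound.lintegral_le (h : L2Bound γ c a R) :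
    ∫⁻ x, ENNReal.ofReal (x.1 ^ (-2 * wexp γ c)) * ‖a x‖ₑ ^ 2 ∂muPi ≤ (R : ℝ≥0∞) ^ 2 := by
  rw [← eLpNorm_weight_sq]
  exact pow_le_pow_left' h.norm 2

theorem L2Bound.of_lintegral_le (hm : AEStronglyMeasurable a muPi)
    (hr : c = false → ∃ α : Circ → 𝕜, a =ᵐ[muPi] fun x => α x.2)
    (h : ∫⁻ x, ENNReal.ofReal (x.1 ^ (-2 * wexp γ c)) * ‖a x‖ₑ ^ 2 ∂muPi ≤ (R : ℝ≥0∞) ^ 2) :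
    L2Bound γ c a R := by
  refine ⟨hm, hr, ennreal_le_of_sq_le ?_⟩
  rwa [eLpNorm_weight_sq]

/-- Almost every slice of `a` at fixed ψ is measurable and agrees almost everywhere with `α`; a
single such slice suffices. -/
theorem ae_measurable_radial {α : Circ → 𝕜} (ha : AEStronglyMeasurable a muPi)
    (hα : a =ᵐ[muPi] fun x => α x.2) : AEStronglyMeasurable α volume := by
  have h1 := ae_radial_of_ae_muPi hα
  have h2 : ∀ᵐ ψ ∂(volume.restrict (Ioo (0 : ℝ) 1)),
      AEStronglyMeasurable (fun θ => a (ψ, θ)) (volume : Measure Circ) := by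
    rw [muPi_eq] at ha
    exact ha.prodMk_left
  have h3 : (volume.restrict (Ioo (0 : ℝ) 1)) ≠ 0 := by simp
  have : (ae (volume.restrict (Ioo (0 : ℝ) 1))).NeBot := ae_neBot.2 h3
  obtain ⟨ψ, h4, h5⟩ := (h1.and h2).exists
  exact h5.congr h4

theorem L2Bound.ae_measurable_of_radial {α : Circ → 𝕜} (h : L2Bound γ c a R)
    (hα : a =ᵐ[muPi] fun x => α x.2) : AEStronglyMeasurable α volume :=
  ae_measurable_radial h.meas hα

theorem lintegral_muPi_mul {f : ℝ → ℝ≥0∞} {g : Circ → ℝ≥0∞} (hf : AEMeasurable f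
    (volume.restrict (Ioo (0 : ℝ) 1))) (hg : AEMeasurable g volume) :
    ∫⁻ x, f x.1 * g x.2 ∂muPi = (∫⁻ ψ in Ioo (0 : ℝ) 1, f ψ) * ∫⁻ θ, g θ := by
  rw [muPi_eq]
  exact lintegral_prod_mul hf hg

theorem measurable_weight (s : ℝ) : Measurable fun ψ : ℝ => ENNReal.ofReal (ψ ^ s) :=
  (measurable_id.pow_const s).ennreal_ofReal

theorem HasAngularDeriv.exists_weighted_bound {a₂ : ℝ × Circ → 𝕜} (h : HasAngularDeriv a a₂)
    (h0 : L2Bound γ c a R) (h2 : L2Bound γ c a₂ R) :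
    ∃ B : ℝ → ℝ≥0∞, Measurable B ∧ (∀ᵐ x ∂muPi, ‖a x‖ₑ ^ 2 ≤ B x.1) ∧
      ∫⁻ ψ in Ioo (0 : ℝ) 1, ENNReal.ofReal (ψ ^ (-2 * wexp γ c)) * B ψ ≤ 26 * (R : ℝ≥0∞) ^ 2 := by
  obtain ⟨B, hB, h3, h4⟩ := h.exists_bound h0.meas h2.meas
  refine ⟨B, hB, h3, ?_⟩
  rw [h4 _ (measurable_weight _)]
  refine (mul_le_mul_right (add_le_add h0.lintegral_le h2.lintegral_le) _).trans_eq ?_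
  ring

theorem HasRadialDeriv.exists_weighted_bound (hγ : 0 ≤ γ) {a₁ : ℝ × Circ → 𝕜}
    (h : HasRadialDeriv a a₁) (h0 : L2Bound γ true a R) (h1 : L2Bound γ true a₁ R) :
    ∃ A : Circ → ℝ≥0∞, Measurable A ∧
      (∀ᵐ x ∂muPi, ‖a x‖ₑ ^ 2 ≤ ENNReal.ofReal (x.1 ^ (2 * γ - 1)) * A x.2) ∧
      ∫⁻ θ, A θ ≤ 8 * (R : ℝ≥0∞) ^ 2 := by
  obtain ⟨A, hA, h3, h4⟩ := h.exists_bound hγ h0.meas h1.meas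
  refine ⟨A, hA, h3, ?_⟩
  rw [h4]
  refine (mul_le_mul_right (add_le_add h0.lintegral_le h1.lintegral_le) _).trans_eq ?_
  ring

/-- The Sobolev embedding into bounded functions, with decay at `ψ = 0`. -/
theorem SobBound.ae_bound_decay (hγ : 1 / 2 < γ) (h : SobBound γ true 2 a R) :
    ∀ᵐ x ∂muPi, ‖a x‖ₑ ^ 2 ≤ ENNReal.ofReal (x.1 ^ (2 * γ - 1)) * (15 * R : ℝ≥0∞) ^ 2 := by
  obtain ⟨h0, a₁, a₂, hr, ha, h1, h2⟩ := h
  obtain ⟨h20, a₂₁, -, hr2, -, h21, -⟩ := h2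
  obtain ⟨A, hA, hA1, hA2⟩ := hr.exists_weighted_bound (by linarith) h0 h1.l2Bound
  obtain ⟨A', hA', hA1', hA2'⟩ := hr2.exists_weighted_bound (by linarith) h20 h21
  obtain ⟨B, hB, hB1, hB2⟩ := ha.exists_bound h0.meas h20.meas
  -- The angular bound holds with an arbitrary weight in ψ. Taking indicators as weights and
  -- inserting the radial bounds of `a` and of its angular derivative compares the integrals of both
  -- sides over every set, hence the functions.
  have key : B ≤ᵐ[volume.restrict (Ioo (0 : ℝ) 1)]
      fun ψ => ENNReal.ofReal (ψ ^ (2 * γ - 1)) * (15 * R : ℝ≥0∞) ^ 2 := by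
    refine ae_le_of_forall_setLIntegral_le_of_sigmaFinite hB fun s hs _ => ?_
    have hw : Measurable (s.indicator (fun _ : ℝ => (1 : ℝ≥0∞))) := measurable_one.indicator hs
    have e : ∀ f : ℝ → ℝ≥0∞, ∫⁻ ψ in s, f ψ ∂(volume.restrict (Ioo (0 : ℝ) 1)) =
        ∫⁻ ψ in Ioo (0 : ℝ) 1, s.indicator (fun _ => (1 : ℝ≥0∞)) ψ * f ψ := by
      intro f
      rw [← lintegral_indicator hs]
      refine lintegral_congr fun ψ => ?_
      by_cases hψ : ψ ∈ s <;> simp [hψ]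
    rw [e, e, hB2 _ hw]
    set w := s.indicator (fun _ : ℝ => (1 : ℝ≥0∞))
    have hAA : ∀ (f : ℝ × Circ → 𝕜) (A : Circ → ℝ≥0∞), Measurable A →
        (∀ᵐ x ∂muPi, ‖f x‖ₑ ^ 2 ≤ ENNReal.ofReal (x.1 ^ (2 * γ - 1)) * A x.2) →
        ∫⁻ θ, A θ ≤ 8 * (R : ℝ≥0∞) ^ 2 → ∫⁻ x, w x.1 * ‖f x‖ₑ ^ 2 ∂muPi ≤
        (∫⁻ ψ in Ioo (0 : ℝ) 1, w ψ * ENNReal.ofReal (ψ ^ (2 * γ - 1))) *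
          (8 * (R : ℝ≥0∞) ^ 2) := by
      intro f A hA h1 h2
      calc ∫⁻ x, w x.1 * ‖f x‖ₑ ^ 2 ∂muPi
          ≤ ∫⁻ x, (w x.1 * ENNReal.ofReal (x.1 ^ (2 * γ - 1))) * A x.2 ∂muPi := by
            refine lintegral_mono_ae ?_
            filter_upwards [h1] with x hx
            rw [mul_assoc]
            gcongr
        _ = _ := lintegral_muPi_mul (f := fun ψ => w ψ * ENNReal.ofReal (ψ ^ (2 * γ - 1)))
            (hw.mul (measurable_weight _)).aemeasurable hA.aemeasurable
        _ ≤ _ := by gcongr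
    refine (mul_le_mul_right (add_le_add (hAA a A hA hA1 hA2) (hAA a₂ A' hA' hA1' hA2')) _).trans ?_
    simp only [← mul_assoc]
    have hwm : Measurable fun ψ => w ψ * ENNReal.ofReal (ψ ^ (2 * γ - 1)) :=
      hw.mul (measurable_weight _)
    rw [lintegral_mul_const _ hwm]
    set J := ∫⁻ ψ in Ioo (0 : ℝ) 1, w ψ * ENNReal.ofReal (ψ ^ (2 * γ - 1))
    -- 13 · (8 + 8) = 208 is rounded up to 225 = 15², the source of the factor 15 in the pointwise
    -- and product estimates.
    calc 13 * (J * 8 * (R : ℝ≥0∞) ^ 2 + J * 8 * (R : ℝ≥0∞) ^ 2)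
        = 208 * (J * (R : ℝ≥0∞) ^ 2) := by ring
      _ ≤ 225 * (J * (R : ℝ≥0∞) ^ 2) := by gcongr; norm_num
      _ = _ := by ring
  filter_upwards [hB1, ae_muPi_fst key] with x h3 h4
  exact h3.trans h4

theorem SobBound.ae_bound_radial (h : SobBound γ false 1 a R) :
    ∀ᵐ x ∂muPi, ‖a x‖ₑ ≤ 15 * R := by
  obtain ⟨h0, a₁, a₂, hr, ha, h1, h2⟩ := h
  obtain ⟨B, hB, hB1, hB2⟩ := HasAngularDeriv.exists_weighted_bound ha h0 h2
  obtain ⟨α, hα⟩ := h0.radial rfl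
  -- The left side of |α(θ)|² ≤ B(ψ) is independent of ψ, so integrating over (0,1) replaces B by
  -- its integral.
  have h3 : ∀ᵐ θ : Circ, ‖α θ‖ₑ ^ 2 ≤ (15 * R : ℝ≥0∞) ^ 2 := by
    filter_upwards [ae_angular_of_ae_muPi (hα.and hB1)] with θ hθ
    have h5 : ∫⁻ _ in Ioo (0 : ℝ) 1, ‖α θ‖ₑ ^ 2 ≤
        ∫⁻ ψ in Ioo (0 : ℝ) 1, ENNReal.ofReal (ψ ^ (-2 * wexp γ false)) * B ψ := by
      refine lintegral_mono_ae ?_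
      filter_upwards [hθ] with ψ hψ
      have h6 := hψ.2
      rw [hψ.1] at h6
      simpa [wexp] using h6
    rw [setLIntegral_const, Real.volume_Ioo] at h5
    simp only [sub_zero, ENNReal.ofReal_one, mul_one] at h5
    refine h5.trans (hB2.trans ?_)
    rw [mul_pow]
    gcongr
    norm_num
  filter_upwards [hα, ae_muPi_snd h3] with x h4 h5
  rw [h4]
  exact ennreal_le_of_sq_le h5

/-- The order from which on a Sobolev bound implies boundedness. -/
theorem SobBound.ae_bound (hγ : 1 / 2 < γ) (h : SobBound γ c (if c then 2 else 1) a R) :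
    ∀ᵐ x ∂muPi, ‖a x‖ₑ ≤ 15 * R := by
  cases c
  · exact SobBound.ae_bound_radial h
  · filter_upwards [SobBound.ae_bound_decay hγ h, ae_muPi_mem] with x h1 h2
    refine ennreal_le_of_sq_le (h1.trans (mul_le_of_le_one_left' ?_))
    rw [ENNReal.ofReal_le_one]
    exact Real.rpow_le_one h2.1.1.le h2.1.2.le (by linarith)

theorem L2Bound.mul_of_ae_bound (h : L2Bound γ c v S) (ha : AEStronglyMeasurable a muPi)
    (hr : c = false → ∃ α : Circ → 𝕜, a =ᵐ[muPi] fun x => α x.2)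
    (hb : ∀ᵐ x ∂muPi, ‖a x‖ₑ ≤ R) : L2Bound γ c (fun x => a x * v x) (R * S) := by
  refine L2Bound.of_lintegral_le (ha.mul h.meas) (fun hc => ?_) ?_
  · obtain ⟨α, hα⟩ := hr hc
    obtain ⟨β, hβ⟩ := h.radial hc
    refine ⟨fun θ => α θ * β θ, ?_⟩
    filter_upwards [hα, hβ] with x h1 h2
    rw [h1, h2]
  · calc _ ≤ ∫⁻ x, (R : ℝ≥0∞) ^ 2 * (ENNReal.ofReal (x.1 ^ (-2 * wexp γ c)) * ‖v x‖ₑ ^ 2) ∂muPi := by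
          refine lintegral_mono_ae ?_
          filter_upwards [hb] with x hx
          rw [enorm_mul, mul_pow, mul_left_comm]
          gcongr
      _ = (R : ℝ≥0∞) ^ 2 * ∫⁻ x, ENNReal.ofReal (x.1 ^ (-2 * wexp γ c)) * ‖v x‖ₑ ^ 2 ∂muPi :=
          lintegral_const_mul' _ _ (by simp)
      _ ≤ (R : ℝ≥0∞) ^ 2 * (S : ℝ≥0∞) ^ 2 := by gcongr; exact h.lintegral_le
      _ = _ := by push_cast; ring

theorem L2Bound.mul_comm' (h : L2Bound γ c (fun x => a x * v x) R) :
    L2Bound γ c (fun x => v x * a x) R := by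
  simpa only [mul_comm] using h

/-- Product of a square integrable function of `θ` and a function with an angular derivative. -/
theorem L2Bound.mul_radial (h : L2Bound γ false a R) (hv : SobBound γ true 1 v S) :
    L2Bound γ true (fun x => a x * v x) (15 * R * S) := by
  obtain ⟨h0, v₁, v₂, -, ha, -, h2⟩ := hv
  obtain ⟨B, hB, hB1, hB2⟩ := HasAngularDeriv.exists_weighted_bound ha h0 h2
  obtain ⟨α, hα⟩ := h.radial rfl
  have hαm := h.ae_measurable_of_radial hα
  have hα2 : ∫⁻ θ, ‖α θ‖ₑ ^ 2 ≤ (R : ℝ≥0∞) ^ 2 := by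
    refine le_trans (le_of_eq ?_) h.lintegral_le
    have h3 := lintegral_muPi_mul (f := fun _ => 1) (g := fun θ => ‖α θ‖ₑ ^ 2)
      aemeasurable_const (hαm.enorm.pow_const 2)
    simp only [one_mul, setLIntegral_const, Real.volume_Ioo, sub_zero, ENNReal.ofReal_one] at h3
    rw [← h3]
    refine lintegral_congr_ae ?_
    filter_upwards [hα] with x hx
    simp [hx, wexp]
  refine L2Bound.of_lintegral_le (h.meas.mul h0.meas) (by simp) ?_
  calc _ ≤ ∫⁻ x, (ENNReal.ofReal (x.1 ^ (-2 * wexp γ true)) * B x.1) * ‖α x.2‖ₑ ^ 2 ∂muPi := by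
        refine lintegral_mono_ae ?_
        filter_upwards [hα, hB1] with x h3 h4
        rw [enorm_mul, mul_pow, h3, mul_assoc, mul_comm (‖α x.2‖ₑ ^ 2)]
        gcongr
    _ = (∫⁻ ψ in Ioo (0 : ℝ) 1, ENNReal.ofReal (ψ ^ (-2 * wexp γ true)) * B ψ) *
          ∫⁻ θ, ‖α θ‖ₑ ^ 2 := lintegral_muPi_mul
            (f := fun ψ => ENNReal.ofReal (ψ ^ (-2 * wexp γ true)) * B ψ)
            ((measurable_weight _).mul hB).aemeasurable (hαm.enorm.pow_const 2)
    _ ≤ (26 * (S : ℝ≥0∞) ^ 2) * (R : ℝ≥0∞) ^ 2 := by gcongr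
    _ ≤ (225 * (S : ℝ≥0∞) ^ 2) * (R : ℝ≥0∞) ^ 2 := by gcongr; norm_num
    _ = _ := by push_cast; ring

/-- Ladyzhenskaya's inequality. -/
theorem SobBound.mul_one_one (hγ : 1 / 2 < γ) (h : SobBound γ true 1 a R)
    (hv : SobBound γ true 1 v S) : L2Bound γ true (fun x => a x * v x) (15 * R * S) := by
  obtain ⟨h0, v₁, v₂, -, ha, -, h2⟩ := hv
  obtain ⟨B, hB, hB1, hB2⟩ := HasAngularDeriv.exists_weighted_bound ha h0 h2
  obtain ⟨g0, a₁, a₂, hr, -, g1, -⟩ := h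
  obtain ⟨A, hA, hA1, hA2⟩ := hr.exists_weighted_bound (by linarith) g0 g1
  refine L2Bound.of_lintegral_le (g0.meas.mul h0.meas) (by simp) ?_
  -- One factor is bounded along circles by a function of ψ and the other along radial lines by a
  -- function of θ, so the double integral of the product factors.
  calc _ ≤ ∫⁻ x, (ENNReal.ofReal (x.1 ^ (-2 * wexp γ true)) * B x.1) * A x.2 ∂muPi := by
        refine lintegral_mono_ae ?_
        filter_upwards [hA1, hB1, ae_muPi_mem] with x h3 h4 h5
        have h6 : ENNReal.ofReal (x.1 ^ (2 * γ - 1)) ≤ 1 := by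
          rw [ENNReal.ofReal_le_one]
          exact Real.rpow_le_one h5.1.1.le h5.1.2.le (by linarith)
        rw [enorm_mul, mul_pow, mul_assoc, mul_comm (‖a x‖ₑ ^ 2)]
        gcongr
        exact h3.trans (mul_le_of_le_one_left' h6)
    _ = (∫⁻ ψ in Ioo (0 : ℝ) 1, ENNReal.ofReal (ψ ^ (-2 * wexp γ true)) * B ψ) *
          ∫⁻ θ, A θ := lintegral_muPi_mul
            (f := fun ψ => ENNReal.ofReal (ψ ^ (-2 * wexp γ true)) * B ψ)
            ((measurable_weight _).mul hB).aemeasurable hA.aemeasurable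
    _ ≤ (26 * (S : ℝ≥0∞) ^ 2) * (8 * (R : ℝ≥0∞) ^ 2) := by gcongr
    _ = 208 * ((S : ℝ≥0∞) ^ 2 * (R : ℝ≥0∞) ^ 2) := by ring
    _ ≤ 225 * ((S : ℝ≥0∞) ^ 2 * (R : ℝ≥0∞) ^ 2) := by gcongr; norm_num
    _ = _ := by push_cast; ring

/-- Two derivatives in total suffice for a product in L². Either one factor is bounded and its class
can be absorbed into that of the other, or the derivatives are shared and one of the two product
estimates above applies. -/
theorem SobBound.l2Bound_mul (hγ : 1 / 2 < γ) {c₁ c₂ : Bool} (h : SobBound γ c₁ j a R)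
    (hv : SobBound γ c₂ k v S) (hjk : 2 ≤ j + k) :
    L2Bound γ (c₁ || c₂) (fun x => a x * v x) (15 * R * S) := by
  have hsupa : (if c₁ then 2 else 1) ≤ j → c₂ = (c₁ || c₂) →
      L2Bound γ (c₁ || c₂) (fun x => a x * v x) (15 * R * S) := by
    intro hj hc
    refine L2Bound.mul_of_ae_bound (hc ▸ hv.l2Bound) h.l2Bound.meas (fun h0 => ?_) ?_
    · exact h.l2Bound.radial (by revert h0; cases c₁ <;> simp)
    · simpa using (h.of_le hj).ae_bound hγ
  have hsupv : (if c₂ then 2 else 1) ≤ k → c₁ = (c₁ || c₂) →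
      L2Bound γ (c₁ || c₂) (fun x => a x * v x) (15 * R * S) := by
    intro hk hc
    have := L2Bound.mul_of_ae_bound (hc ▸ h.l2Bound) hv.l2Bound.meas (R := 15 * S) (fun h0 =>
      hv.l2Bound.radial (by revert h0; cases c₁ <;> simp))
      (by simpa using (hv.of_le hk).ae_bound hγ)
    exact this.mul_comm'.mono (le_of_eq (by ring))
  cases c₁ <;> cases c₂
  · rcases Nat.lt_or_ge j 1 with hj | hj
    · exact hsupv (by simp; omega) rfl
    · exact hsupa (by simpa using hj) rfl
  · rcases Nat.lt_or_ge k 1 with hk | hk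
    · exact hsupa (by simp; omega) rfl
    · exact L2Bound.mul_radial h.l2Bound (hv.of_le hk)
  · rcases Nat.lt_or_ge j 1 with hj | hj
    · exact hsupv (by simp; omega) rfl
    · exact ((L2Bound.mul_radial hv.l2Bound (h.of_le hj)).mul_comm').mono (le_of_eq (by ring))
  · rcases Nat.lt_or_ge j 2 with hj | hj
    · rcases Nat.lt_or_ge k 2 with hk | hk
      · exact SobBound.mul_one_one hγ (h.of_le (by omega)) (hv.of_le (by omega))
      · exact hsupv (by simpa using hk) rfl
    · exact hsupa (by simpa using hj) rfl

/-- Multiplication of Sobolev functions. -/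
theorem SobBound.mul (hγ : 1 / 2 < γ) {c₁ c₂ : Bool} (h : SobBound γ c₁ j a R)
    (hv : SobBound γ c₂ k v S) (hj : l ≤ j) (hk : l ≤ k) (hjk : l + 2 ≤ j + k) :
    SobBound γ (c₁ || c₂) l (fun x => a x * v x) (15 * 2 ^ l * R * S) := by
  induction l generalizing j k a v with
  | zero => simpa [SobBound] using SobBound.l2Bound_mul hγ h hv (by omega)
  | succ l ih =>
    obtain ⟨j, rfl⟩ : ∃ j', j = j' + 1 := ⟨j - 1, by omega⟩
    obtain ⟨k, rfl⟩ : ∃ k', k = k' + 1 := ⟨k - 1, by omega⟩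
    refine ⟨(SobBound.l2Bound_mul hγ h hv (by omega)).mono ?_, ?_⟩
    · have : (1 : ℝ≥0) ≤ 2 ^ (l + 1) := one_le_pow₀ (by norm_num)
      calc 15 * R * S = 15 * 1 * R * S := by ring
        _ ≤ _ := by gcongr
    -- Each of the two Leibniz terms has one factor of order lower by one. The target order drops by
    -- one as well, so the condition l + 2 ≤ j + k survives and the constant doubles.
    · have e : (15 * 2 ^ (l + 1) * R * S : ℝ≥0) = 15 * 2 ^ l * R * S + 15 * 2 ^ l * R * S := by ring
      have h' := h.of_succ
      have hv' := hv.of_succ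
      obtain ⟨h0, a₁, a₂, h1, h2, h3, h4⟩ := id h
      obtain ⟨g0, v₁, v₂, g1, g2, g3, g4⟩ := id hv
      rw [e]
      exact ⟨_, _, h1.mul g1, h2.mul g2,
        (ih h3 hv (by omega) (by omega) (by omega)).add (ih h g3 (by omega) (by omega) (by omega)),
        (ih h4 hv (by omega) (by omega) (by omega)).add (ih h g4 (by omega) (by omega) (by omega))⟩

end Products

end Kondratev

namespace Kondratev

variable {𝕜 : Type*} [RCLike 𝕜]

open scoped NNReal ENNReal

/-! ### Wirtinger coefficients of real derivatives -/

/-- The coefficients of the expansion `L h = a h + b (conj h)` of a real linear map: `a` for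
`s = -1` and `b` for `s = 1`. -/
noncomputable def wirtinger (s : ℝ) : (𝕜 →L[ℝ] 𝕜) →L[ℝ] 𝕜 :=
  (2⁻¹ : ℝ) • (ContinuousLinearMap.apply ℝ 𝕜 (1 : 𝕜) +
    s • (ContinuousLinearMap.mul ℝ 𝕜 RCLike.I).comp
      (ContinuousLinearMap.apply ℝ 𝕜 (RCLike.I : 𝕜)))

theorem wirtinger_apply (s : ℝ) (L : 𝕜 →L[ℝ] 𝕜) :
    wirtinger s L = (2⁻¹ : ℝ) • (L 1 + s • (RCLike.I * L RCLike.I)) := rfl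

/-- Write h as re h + im h · I and solve for re h and im h in terms of h and its conjugate. For real
scalars I = 0, both coefficients equal L(1)/2, and the formula still holds. -/
theorem wirtinger_expansion (L : 𝕜 →L[ℝ] 𝕜) (h : 𝕜) :
    L h = wirtinger (-1) L * h + wirtinger 1 L * (starRingEnd 𝕜) h := by
  have h1 : L h = (RCLike.re h : 𝕜) * L 1 + (RCLike.im h : 𝕜) * L RCLike.I := by
    conv_lhs => rw [← RCLike.re_add_im h]
    rw [map_add]
    congr 1
    · rw [show ((RCLike.re h : ℝ) : 𝕜) = RCLike.re h • (1 : 𝕜) by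
        rw [RCLike.real_smul_eq_coe_mul, mul_one], map_smul, smul_mul_assoc, one_mul]
    · rw [← RCLike.real_smul_eq_coe_mul, map_smul, RCLike.real_smul_eq_coe_mul]
  have h2 : wirtinger (-1) L * h + wirtinger 1 L * (starRingEnd 𝕜) h =
      L 1 * ((h + (starRingEnd 𝕜) h) / 2) - RCLike.I * L RCLike.I * ((h - (starRingEnd 𝕜) h) / 2) := by
    simp only [wirtinger_apply, RCLike.real_smul_eq_coe_mul]
    push_cast
    ring
  rw [h2, h1, ← RCLike.re_eq_add_conj]
  have h3 : (h - (starRingEnd 𝕜) h) / 2 = (RCLike.im h : 𝕜) * RCLike.I := by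
    rw [RCLike.sub_conj]
    ring
  rw [h3]
  rcases RCLike.I_mul_I_ax (K := 𝕜) with h0 | h0
  · simp [h0, mul_comm]
  · linear_combination (RCLike.im h : 𝕜) * L RCLike.I * h0

theorem norm_wirtinger_le {s : ℝ} (hs : |s| ≤ 1) : ‖(wirtinger s : (𝕜 →L[ℝ] 𝕜) →L[ℝ] 𝕜)‖ ≤ 1 := by
  refine ContinuousLinearMap.opNorm_le_bound _ zero_le_one fun L => ?_
  have hI : ‖(RCLike.I : 𝕜)‖ ≤ 1 := by
    rcases RCLike.I_mul_I_ax (K := 𝕜) with h0 | h0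
    · simp [h0]
    · exact (RCLike.norm_I_of_ne_zero (by rintro h; simp [h] at h0)).le
  have h1 : ‖L 1‖ ≤ ‖L‖ := by simpa using L.le_opNorm 1
  have h2 : ‖L RCLike.I‖ ≤ ‖L‖ :=
    (L.le_opNorm _).trans (mul_le_of_le_one_right (norm_nonneg _) hI)
  rw [wirtinger_apply, norm_smul, one_mul]
  have h3 : ‖L 1 + s • (RCLike.I * L RCLike.I)‖ ≤ ‖L‖ + ‖L‖ := by
    refine (norm_add_le _ _).trans (add_le_add h1 ?_)
    rw [norm_smul, norm_mul]
    calc ‖s‖ * (‖(RCLike.I : 𝕜)‖ * ‖L RCLike.I‖) ≤ 1 * (1 * ‖L‖) := by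
          gcongr
          exact hs
      _ = ‖L‖ := by ring
  rw [norm_inv, Real.norm_ofNat]
  linarith

/-- The derivatives of `g` up to order `k` are bounded by `M` on `Z`. -/
def DerivBound (k : ℕ) (g : 𝕜 → 𝕜) (Z : Set 𝕜) (M : ℝ≥0) : Prop :=
  ∀ j ≤ k, ∀ z ∈ Z, ‖iteratedFDeriv ℝ j g z‖ ≤ M

theorem contDiffOn_wirtinger {k : ℕ} {g : 𝕜 → 𝕜} {Ω : Set 𝕜} (hΩ : IsOpen Ω)
    (hg : ContDiffOn ℝ (k + 1 : ℕ) g Ω) (s : ℝ) :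
    ContDiffOn ℝ (k : ℕ) (fun z => wirtinger s (fderiv ℝ g z)) Ω :=
  (wirtinger s).contDiff.comp_contDiffOn (hg.fderiv_of_isOpen hΩ (by norm_cast))

theorem DerivBound.of_le {k l : ℕ} {g : 𝕜 → 𝕜} {Z : Set 𝕜} {M : ℝ≥0} (h : DerivBound k g Z M)
    (hl : l ≤ k) : DerivBound l g Z M := fun j hj => h j (hj.trans hl)

theorem DerivBound.norm_le {k : ℕ} {g : 𝕜 → 𝕜} {Z : Set 𝕜} {M : ℝ≥0} (h : DerivBound k g Z M)
    {z : 𝕜} (hz : z ∈ Z) : ‖g z‖ ≤ M := by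
  simpa using h 0 (Nat.zero_le _) z hz

theorem DerivBound.norm_fderiv_le {k : ℕ} {g : 𝕜 → 𝕜} {Z : Set 𝕜} {M : ℝ≥0}
    (h : DerivBound (k + 1) g Z M) {z : 𝕜} (hz : z ∈ Z) : ‖fderiv ℝ g z‖ ≤ M := by
  rw [← norm_iteratedFDeriv_one]
  exact h 1 (by omega) z hz

/-- The map from a real linear map to a Wirtinger coefficient is linear of norm at most one, so the
same `M` bounds the coefficients. This keeps the final estimate linear in `M`. -/
theorem DerivBound.wirtinger {k : ℕ} {g : 𝕜 → 𝕜} {Ω Z : Set 𝕜} {M : ℝ≥0} (hΩ : IsOpen Ω)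
    (hg : ContDiffOn ℝ (k + 1 : ℕ) g Ω) (hZ : Z ⊆ Ω) (h : DerivBound (k + 1) g Z M) {s : ℝ}
    (hs : |s| ≤ 1) : DerivBound k (fun z => Kondratev.wirtinger s (fderiv ℝ g z)) Z M := by
  intro j hj z hz
  have h1 : ContDiffAt ℝ (k : ℕ) (fderiv ℝ g) z :=
    (hg.fderiv_of_isOpen hΩ (by norm_cast)).contDiffAt (hΩ.mem_nhds (hZ hz))
  have h2 := (Kondratev.wirtinger s : (𝕜 →L[ℝ] 𝕜) →L[ℝ] 𝕜).norm_iteratedFDeriv_comp_left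
    (h1.of_le (m := (j : ℕ)) (by exact_mod_cast hj)) (le_refl _)
  refine h2.trans ?_
  rw [norm_iteratedFDeriv_fderiv]
  calc _ ≤ 1 * (M : ℝ) := by
        gcongr
        · exact norm_wirtinger_le hs
        · exact h (j + 1) (by omega) z hz
    _ = M := one_mul _

theorem exists_derivBound {k : ℕ} {g : 𝕜 → 𝕜} {Ω Z : Set 𝕜} (hΩ : IsOpen Ω)
    (hg : ContDiffOn ℝ (k : ℕ) g Ω) (hZ : Z ⊆ Ω) (hc : IsCompact Z) : ∃ M, DerivBound k g Z M := by
  have h1 : ∀ j ≤ k, ∃ M : ℝ≥0, ∀ z ∈ Z, ‖iteratedFDeriv ℝ j g z‖ ≤ M := by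
    intro j hj
    have h2 : ContinuousOn (iteratedFDeriv ℝ j g) Z :=
      ((hg.continuousOn_iteratedFDerivWithin (by exact_mod_cast hj) hΩ.uniqueDiffOn).congr
        fun z hz => (iteratedFDerivWithin_of_isOpen j hΩ hz).symm).mono hZ
    obtain ⟨C, hC⟩ := (hc.image_of_continuousOn h2).isBounded.exists_norm_le
    exact ⟨C.toNNReal, fun z hz => (hC _ (mem_image_of_mem _ hz)).trans (Real.le_coe_toNNReal _)⟩
  choose! M hM using h1
  refine ⟨∑ j ∈ Finset.range (k + 1), M j, fun j hj z hz => (hM j hj z hz).trans ?_⟩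
  exact_mod_cast Finset.single_le_sum (f := M) (fun _ _ => zero_le) (Finset.mem_range.2 (by omega))

/-! ### Multipliers -/

variable {γ : ℝ} {c c₀ c₁ c₂ : Bool} {k : ℕ}

/-- Multiplication by `G` maps the Sobolev class `c` into the class `c'`, at all orders up to `k`,
with norm at most `N`. -/
def IsMultiplier (γ : ℝ) (c c' : Bool) (k : ℕ) (G : ℝ × Circ → 𝕜) (N : ℝ≥0) : Prop :=
  ∀ l ≤ k, ∀ (v : ℝ × Circ → 𝕜) (S : ℝ≥0), SobBound γ c l v S →
    SobBound γ c' l (fun x => G x * v x) (N * S)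

/-- Multiplication by `G` maps the Sobolev class `c` into the class `c'` with the loss of one
derivative. -/
def IsLossyMultiplier (γ : ℝ) (c c' : Bool) (k : ℕ) (G : ℝ × Circ → 𝕜) (N : ℝ≥0) : Prop :=
  ∀ l ≤ k, ∀ (v : ℝ × Circ → 𝕜) (S : ℝ≥0), SobBound γ c (l + 1) v S →
    SobBound γ c' l (fun x => G x * v x) (N * S)

variable {G G' d : ℝ × Circ → 𝕜} {N N' R M : ℝ≥0}

theorem IsMultiplier.mono (h : IsMultiplier γ c₁ c₂ k G N) (hN : N ≤ N') :
    IsMultiplier γ c₁ c₂ k G N' :=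
  fun l hl v S hv => (h l hl v S hv).mono (by gcongr)

theorem IsMultiplier.add (h : IsMultiplier γ c₁ c₂ k G N) (h' : IsMultiplier γ c₁ c₂ k G' N') :
    IsMultiplier γ c₁ c₂ k (fun x => G x + G' x) (N + N') := by
  intro l hl v S hv
  have := (h l hl v S hv).add (h' l hl v S hv)
  simpa only [add_mul] using this

theorem IsLossyMultiplier.mono (h : IsLossyMultiplier γ c₁ c₂ k G N) (hN : N ≤ N') :
    IsLossyMultiplier γ c₁ c₂ k G N' :=
  fun l hl v S hv => (h l hl v S hv).mono (by gcongr)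

theorem IsLossyMultiplier.of_le {l : ℕ} (h : IsLossyMultiplier γ c₁ c₂ k G N) (hl : l ≤ k) :
    IsLossyMultiplier γ c₁ c₂ l G N := fun j hj => h j (hj.trans hl)

theorem IsLossyMultiplier.add (h : IsLossyMultiplier γ c₁ c₂ k G N)
    (h' : IsLossyMultiplier γ c₁ c₂ k G' N') :
    IsLossyMultiplier γ c₁ c₂ k (fun x => G x + G' x) (N + N') := by
  intro l hl v S hv
  have := (h l hl v S hv).add (h' l hl v S hv)
  simpa only [add_mul] using this

theorem IsMultiplier.comp_lossy (h : IsMultiplier γ c₁ c₂ k G N)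
    (hd : IsLossyMultiplier γ c₀ c₁ k d R) :
    IsLossyMultiplier γ c₀ c₂ k (fun x => G x * d x) (N * R) := by
  intro l hl v S hv
  have := h l hl _ _ (hd l hl v S hv)
  simpa only [mul_assoc] using this

/-- By Leibniz, X(Gv) = (XG)v + G(Xv). In the first term v is known to one order more than required,
so it is enough that XG is a multiplier losing one derivative. -/
theorem IsMultiplier.succ {G₁ G₂ : ℝ × Circ → 𝕜} (h : IsMultiplier γ c₁ c₂ k G N)
    (hr : HasRadialDeriv G G₁) (ha : HasAngularDeriv G G₂)
    (h₁ : IsLossyMultiplier γ c₁ c₂ k G₁ N) (h₂ : IsLossyMultiplier γ c₁ c₂ k G₂ N) :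
    IsMultiplier γ c₁ c₂ (k + 1) G (2 * N) := by
  intro l hl v S hv
  rcases Nat.lt_or_ge k l with hkl | hkl
  · obtain rfl : l = k + 1 := by omega
    have hv' := hv.of_succ
    obtain ⟨h0, v₁, v₂, g1, g2, g3, g4⟩ := id hv
    have e : 2 * N * S = N * S + N * S := by ring
    rw [e]
    refine ⟨((h k le_rfl v S hv').l2Bound).mono le_self_add, _, _, hr.mul g1, ha.mul g2,
      (h₁ k le_rfl v S hv).add (h k le_rfl _ _ g3), (h₂ k le_rfl v S hv).add (h k le_rfl _ _ g4)⟩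
  · exact (h l hkl v S hv).mono (by gcongr; exact le_mul_of_one_le_left' one_le_two)

theorem IsMultiplier.of_bound (hm : AEStronglyMeasurable G muPi)
    (hr : c = false → ∃ α : Circ → 𝕜, G =ᵐ[muPi] fun x => α x.2)
    (hb : ∀ᵐ x ∂muPi, ‖G x‖ ≤ N) : IsMultiplier γ c c 0 G N := by
  intro l hl v S hv
  obtain rfl : l = 0 := by omega
  refine L2Bound.mul_of_ae_bound hv hm hr ?_
  filter_upwards [hb] with x hx
  rw [← ofReal_norm, ENNReal.ofReal_le_iff_le_toReal (by simp)]
  exact hx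

/-- `d` and its conjugate are lossy multipliers with norm at most `R`. -/
def IsGradBound (γ : ℝ) (c c' : Bool) (k : ℕ) (d : ℝ × Circ → 𝕜) (R : ℝ≥0) : Prop :=
  IsLossyMultiplier γ c c' k d R ∧ IsLossyMultiplier γ c c' k (fun x => (starRingEnd 𝕜) (d x)) R

theorem IsGradBound.mono (h : IsGradBound γ c₁ c₂ k d R) (hR : R ≤ M) :
    IsGradBound γ c₁ c₂ k d M := ⟨h.1.mono hR, h.2.mono hR⟩

theorem IsGradBound.of_le {l : ℕ} (h : IsGradBound γ c₁ c₂ k d R) (hl : l ≤ k) :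
    IsGradBound γ c₁ c₂ l d R := ⟨h.1.of_le hl, h.2.of_le hl⟩

theorem IsGradBound.add {e : ℝ × Circ → 𝕜} (h : IsGradBound γ c₁ c₂ k d R)
    (h' : IsGradBound γ c₁ c₂ k e M) : IsGradBound γ c₁ c₂ k (fun x => d x + e x) (R + M) := by
  refine ⟨h.1.add h'.1, ?_⟩
  simpa only [map_add] using h.2.add h'.2

/-- In `SobBound.mul` the orders are n and l + 1 with target l, and the condition l + 2 ≤ n + l + 1
is exactly n ≥ 1. This is where m > 1 is used for multiplication by first derivatives. -/
theorem SobBound.isGradBound (hγ : 1 / 2 < γ) {n : ℕ} (hn : 1 ≤ n) (h : SobBound γ c₁ n d R)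
    (hc : c₂ = (c₁ || c)) : IsGradBound γ c c₂ n d (15 * 2 ^ n * R) := by
  have key : ∀ e : ℝ × Circ → 𝕜, SobBound γ c₁ n e R →
      IsLossyMultiplier γ c c₂ n e (15 * 2 ^ n * R) := by
    intro e he l hl v S hv
    rw [hc]
    refine (SobBound.mul hγ (l := l) he hv hl (by omega) (by omega)).mono ?_
    have : (2 : ℝ≥0) ^ l ≤ 2 ^ n := pow_le_pow_right₀ (by norm_num) hl
    gcongr
  exact ⟨key d h, key _ h.conj⟩

/-- If the Wirtinger coefficients of a field of real linear maps are multipliers, applying the field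
to `d` gives a lossy multiplier. -/
theorem IsGradBound.clm_apply {T : ℝ × Circ → 𝕜 →L[ℝ] 𝕜}
    (h₁ : IsMultiplier γ c₁ c₂ k (fun x => wirtinger (-1) (T x)) N)
    (h₂ : IsMultiplier γ c₁ c₂ k (fun x => wirtinger 1 (T x)) N)
    (hd : IsGradBound γ c₀ c₁ k d R) :
    IsLossyMultiplier γ c₀ c₂ k (fun x => T x (d x)) (2 * N * R) := by
  have h := (h₁.comp_lossy hd.1).add (h₂.comp_lossy hd.2)
  simp only [← wirtinger_expansion] at h
  exact h.mono (le_of_eq (by ring))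

/-- Superposition operators preserve Sobolev classes. -/
theorem IsMultiplier.comp {U d₁ d₂ : ℝ × Circ → 𝕜} {Ω Z : Set 𝕜} {n : ℕ} (hΩ : IsOpen Ω)
    (hZ : Z ⊆ Ω) (hU : ContinuousOn U openPi) (hUZ : MapsTo U openPi Z)
    (hrad : c = false → ∃ α : Circ → 𝕜, U = fun x => α x.2)
    (hr : HasRadialDeriv U d₁) (ha : HasAngularDeriv U d₂)
    (h₁ : IsGradBound γ c c n d₁ R) (h₂ : IsGradBound γ c c n d₂ R) (hk : k ≤ n + 1)
    {g : 𝕜 → 𝕜} (hg : ContDiffOn ℝ (k : ℕ) g Ω) (hM : DerivBound k g Z M) :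
    IsMultiplier γ c c k (fun x => g (U x)) (4 ^ k * M * (1 + R) ^ k) := by
  have hUΩ : MapsTo U openPi Ω := fun x hx => hZ (hUZ hx)
  induction k generalizing g with
  | zero =>
    simp only [pow_zero, one_mul, mul_one]
    refine IsMultiplier.of_bound ?_ (fun hc => ?_) ?_
    · exact (hg.continuousOn.comp hU hUΩ).aestronglyMeasurable isOpen_openPi.measurableSet
    · obtain ⟨α, rfl⟩ := hrad hc
      exact ⟨fun θ => g (α θ), EventuallyEq.rfl⟩
    · filter_upwards [ae_muPi_mem] with x hx
      exact hM.norm_le (hUZ hx)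
  | succ k ih =>
    have h0 := ih (by omega) (hg.of_le (by norm_cast; omega)) (hM.of_le (by omega))
    -- The induction is over all functions `g`, so it applies to the Wirtinger coefficients of the
    -- derivative, which have one derivative fewer.
    have hw : ∀ s : ℝ, |s| ≤ 1 → IsMultiplier γ c c k (fun x => wirtinger s (fderiv ℝ g (U x)))
        (4 ^ k * M * (1 + R) ^ k) := fun s hs =>
      ih (by omega) (contDiffOn_wirtinger hΩ hg s) (hM.wirtinger hΩ hg hZ hs)
    have hg1 : ContDiffOn ℝ 1 g Ω := hg.of_le (by norm_cast; omega)
    -- Each order contributes a factor 2 from the two Wirtinger terms, a factor 2 from Leibniz and a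
    -- factor 1 + R from the gradient.
    have e : 4 ^ (k + 1) * M * (1 + R) ^ (k + 1) = 2 * (2 * (4 ^ k * M * (1 + R) ^ k) * (1 + R)) := by
      ring
    rw [e]
    have hle : 2 * (4 ^ k * M * (1 + R) ^ k) * R ≤ 2 * (4 ^ k * M * (1 + R) ^ k) * (1 + R) := by
      gcongr
      exact le_add_self
    refine IsMultiplier.succ (h0.mono ?_) (hr.comp hU hΩ hg1 hUΩ) (ha.comp hU hΩ hg1 hUΩ)
      ((IsGradBound.clm_apply (hw _ (by simp)) (hw _ (by simp)) (h₁.of_le (by omega))).mono hle)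
      ((IsGradBound.clm_apply (hw _ (by simp)) (hw _ (by simp)) (h₂.of_le (by omega))).mono hle)
    calc 4 ^ k * M * (1 + R) ^ k = 1 * (4 ^ k * M * (1 + R) ^ k) * 1 := by ring
      _ ≤ _ := by
        gcongr
        · exact one_le_two
        · exact le_self_add

/-- Near a compact subset of `Ω`, continuity is uniform even when the second point leaves the
compact set, and a small enough neighbourhood remains in `Ω`. -/
theorem exists_uniform_radius {F : Type*} [NormedAddCommGroup F] {g : 𝕜 → F} {Ω Z : Set 𝕜} (hΩ : IsOpen Ω) (hZ : Z ⊆ Ω)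
    (hc : IsCompact Z) (hg : ContinuousOn g Ω) {ε : ℝ} (hε : 0 < ε) :
    ∃ δ : ℝ≥0, 0 < δ ∧ ∀ z ∈ Z, ∀ y, ‖y‖ ≤ δ → z + y ∈ Ω ∧ ‖g (z + y) - g z‖ ≤ ε := by
  have h1 := hc.uniformContinuousAt_of_continuousAt g
    (fun x hx => hg.continuousAt (hΩ.mem_nhds (hZ hx))) (Metric.dist_mem_uniformity hε)
  obtain ⟨δ₁, hδ₁, h2⟩ := Metric.mem_uniformity_dist.1 h1
  obtain ⟨δ₂, hδ₂, h3⟩ := hc.exists_thickening_subset_open hΩ hZ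
  have hδ : 0 < min δ₁ δ₂ / 2 := by positivity
  refine ⟨(min δ₁ δ₂ / 2).toNNReal, Real.toNNReal_pos.2 hδ, fun z hz y hy => ?_⟩
  rw [Real.coe_toNNReal _ hδ.le] at hy
  have hy' : ‖y‖ < min δ₁ δ₂ := lt_of_le_of_lt hy (half_lt_self (by positivity))
  refine ⟨h3 (Metric.mem_thickening_iff.2 ⟨z, hz, ?_⟩), ?_⟩
  · simpa [dist_eq_norm] using hy'.trans_le (min_le_right _ _)
  · have h4 : dist z (z + y) < δ₁ := by simpa [dist_eq_norm] using hy'.trans_le (min_le_left _ _)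
    have h5 := h2 h4 hz
    rw [← norm_neg, neg_sub, ← dist_eq_norm]
    exact h5.le

end Kondratev

/-! ### Continuous dependence of superposition multipliers, and Hardy's inequality. -/

namespace Kondratev

variable {𝕜 : Type*} [RCLike 𝕜]

open scoped NNReal ENNReal

theorem HasRadialDeriv.sub {u v u' v' : ℝ × Circ → 𝕜} (h : HasRadialDeriv u v)
    (h' : HasRadialDeriv u' v') : HasRadialDeriv (fun x => u x - u' x) (fun x => v x - v' x) := by
  simpa [sub_eq_add_neg] using h.add (h'.clm_comp (-ContinuousLinearMap.id ℝ 𝕜))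

theorem HasAngularDeriv.sub {u v u' v' : ℝ × Circ → 𝕜} (h : HasAngularDeriv u v)
    (h' : HasAngularDeriv u' v') : HasAngularDeriv (fun x => u x - u' x) (fun x => v x - v' x) := by
  simpa [sub_eq_add_neg] using h.add (h'.clm_comp (-ContinuousLinearMap.id ℝ 𝕜))

variable {γ : ℝ} {c : Bool} {k n : ℕ} {R M : ℝ≥0}

/-- Used to choose small parameters; the summand 1 in the denominator covers the case X = 0. -/
theorem nnreal_small_mul (ε X : ℝ≥0) : ε / (1 + X) * X ≤ ε := by
  rw [div_mul_eq_mul_div, mul_div_assoc]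
  refine mul_le_of_le_one_right' (div_le_one_of_le₀ le_add_self zero_le)

/-- Continuity of superposition operators as multipliers. -/
theorem IsMultiplier.comp_sub_small {U d₁ d₂ : ℝ × Circ → 𝕜} {Ω Z : Set 𝕜} (hΩ : IsOpen Ω)
    (hZ : Z ⊆ Ω) (hc : IsCompact Z) (hU : ContinuousOn U openPi) (hUZ : MapsTo U openPi Z)
    (hrad : c = false → ∃ α : Circ → 𝕜, U = fun x => α x.2)
    (hr : HasRadialDeriv U d₁) (ha : HasAngularDeriv U d₂)
    (h₁ : IsGradBound γ c c n d₁ R) (h₂ : IsGradBound γ c c n d₂ R) (hk : k ≤ n + 1)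
    {g : 𝕜 → 𝕜} (hg : ContDiffOn ℝ (k : ℕ) g Ω) {ε : ℝ≥0} (hε : 0 < ε) :
    ∃ δ : ℝ≥0, 0 < δ ∧ ∀ H e₁ e₂ : ℝ × Circ → 𝕜, ContinuousOn H openPi →
      (c = false → ∃ β : Circ → 𝕜, H = fun x => β x.2) → HasRadialDeriv H e₁ →
      HasAngularDeriv H e₂ → IsGradBound γ c c n e₁ δ → IsGradBound γ c c n e₂ δ →
      (∀ x ∈ openPi, ‖H x‖ ≤ δ) →
      IsMultiplier γ c c k (fun x => g (U x + H x) - g (U x)) ε := by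
  have hUΩ : MapsTo U openPi Ω := fun x hx => hZ (hUZ hx)
  induction k generalizing g ε with
  | zero =>
    obtain ⟨δ, hδ, h⟩ := exists_uniform_radius hΩ hZ hc hg.continuousOn (ε := ε) hε
    refine ⟨δ, hδ, fun H e₁ e₂ hH hrH _ _ _ _ hs => ?_⟩
    refine IsMultiplier.of_bound ?_ (fun hc => ?_) ?_
    · refine ContinuousOn.aestronglyMeasurable ?_ isOpen_openPi.measurableSet
      exact (hg.continuousOn.comp (hU.add hH) fun x hx => (h _ (hUZ hx) _ (hs x hx)).1).sub
        (hg.continuousOn.comp hU hUΩ)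
    · obtain ⟨α, rfl⟩ := hrad hc
      obtain ⟨β, rfl⟩ := hrH hc
      exact ⟨fun θ => g (α θ + β θ) - g (α θ), EventuallyEq.rfl⟩
    · filter_upwards [ae_muPi_mem] with x hx
      exact (h _ (hUZ hx) _ (hs x hx)).2
  | succ k ih =>
    obtain ⟨M, hM⟩ := exists_derivBound hΩ hg hZ hc
    have hg1 : ContDiffOn ℝ 1 g Ω := hg.of_le (by norm_cast; omega)
    set ε₁ : ℝ≥0 := ε / 8 / (1 + R) with hε₁d
    have hε₁ : 0 < ε₁ := by positivity
    set M' : ℝ≥0 := 4 ^ k * M * (1 + R) ^ k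
    obtain ⟨δ₀, hδ₀, h0⟩ := ih (by omega) (hg.of_le (by norm_cast; omega)) (half_pos hε)
    obtain ⟨δ₁, hδ₁, hw₁⟩ := ih (by omega) (contDiffOn_wirtinger hΩ hg (-1)) hε₁
    obtain ⟨δ₂, hδ₂, hw₂⟩ := ih (by omega) (contDiffOn_wirtinger hΩ hg 1) hε₁
    obtain ⟨δ₃, hδ₃, h3⟩ := exists_uniform_radius hΩ hZ hc hg.continuousOn (ε := 1) one_pos
    set δ₄ : ℝ≥0 := ε / 8 / (1 + (M' + ε₁))
    have hδ₄ : 0 < δ₄ := by positivity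
    refine ⟨min (min δ₀ δ₁) (min δ₂ (min δ₃ δ₄)), by positivity,
      fun H e₁ e₂ hH hrH hr' ha' g1 g2 hs => ?_⟩
    have l0 : min (min δ₀ δ₁) (min δ₂ (min δ₃ δ₄)) ≤ δ₀ := by simp
    have l1 : min (min δ₀ δ₁) (min δ₂ (min δ₃ δ₄)) ≤ δ₁ := by simp
    have l2 : min (min δ₀ δ₁) (min δ₂ (min δ₃ δ₄)) ≤ δ₂ := by simp
    have l3 : min (min δ₀ δ₁) (min δ₂ (min δ₃ δ₄)) ≤ δ₃ := by simp
    have l4 : min (min δ₀ δ₁) (min δ₂ (min δ₃ δ₄)) ≤ δ₄ := by simp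
    set δ := min (min δ₀ δ₁) (min δ₂ (min δ₃ δ₄))
    have hmaps : MapsTo (fun x => U x + H x) openPi Ω := fun x hx =>
      (h3 _ (hUZ hx) _ ((hs x hx).trans (by exact_mod_cast l3))).1
    have k0 := h0 H e₁ e₂ hH hrH hr' ha' (g1.mono l0) (g2.mono l0)
      fun x hx => (hs x hx).trans (by exact_mod_cast l0)
    have k1 := hw₁ H e₁ e₂ hH hrH hr' ha' (g1.mono l1) (g2.mono l1)
      fun x hx => (hs x hx).trans (by exact_mod_cast l1)
    have k2 := hw₂ H e₁ e₂ hH hrH hr' ha' (g1.mono l2) (g2.mono l2)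
      fun x hx => (hs x hx).trans (by exact_mod_cast l2)
    have hb : ∀ s : ℝ, |s| ≤ 1 → IsMultiplier γ c c k (fun x => wirtinger s (fderiv ℝ g (U x))) M' :=
      fun s hs' => IsMultiplier.comp hΩ hZ hU hUZ hrad hr ha h₁ h₂ (by omega)
        (contDiffOn_wirtinger hΩ hg s) (hM.wirtinger hΩ hg hZ hs')
    have t1 := (hb (-1) (by simp)).add k1
    have t2 := (hb 1 (by simp)).add k2
    simp only [add_sub_cancel] at t1 t2
    simp only [← map_sub] at k1 k2
    -- The difference of derivatives is written as (Dg(U + H) − Dg(U))d + Dg(U + H)e: the first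
    -- coefficient is small by induction, in the second the vector e is small. No further derivative
    -- of g is needed.
    have key : ∀ d e : ℝ × Circ → 𝕜, IsGradBound γ c c n d R → IsGradBound γ c c n e δ →
        IsLossyMultiplier γ c c k (fun x => fderiv ℝ g (U x + H x) (d x + e x) -
          fderiv ℝ g (U x) (d x)) (ε / 2) := by
      intro d e hd he
      have a1 := IsGradBound.clm_apply k1 k2 (hd.of_le (l := k) (by omega))
      have a2 := IsGradBound.clm_apply t1 t2 (he.of_le (l := k) (by omega))
      have a3 := (a1.add a2).mono (N' := ε / 2) ?_
      · convert! a3 using 2 with x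
        simp only [sub_apply, map_add]
        ring
      · have b1 : ε₁ * R ≤ ε / 8 := nnreal_small_mul _ _
        have b2 : δ * (M' + ε₁) ≤ ε / 8 := (mul_le_mul_left l4 _).trans (nnreal_small_mul _ _)
        calc 2 * ε₁ * R + 2 * (M' + ε₁) * δ = 2 * (ε₁ * R) + 2 * (δ * (M' + ε₁)) := by ring
          _ ≤ 2 * (ε / 8) + 2 * (ε / 8) := by gcongr
          _ = ε / 2 := by rw [← NNReal.coe_inj]; push_cast; ring
    have e : ε = 2 * (ε / 2) := by rw [← NNReal.coe_inj]; push_cast; ring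
    rw [e]
    exact IsMultiplier.succ k0
      (((hr.add hr').comp (hU.add hH) hΩ hg1 hmaps).sub (hr.comp hU hΩ hg1 hUΩ))
      (((ha.add ha').comp (hU.add hH) hΩ hg1 hmaps).sub (ha.comp hU hΩ hg1 hUΩ))
      (key _ _ h₁ g1) (key _ _ h₂ g2)

/-! ### Hardy's inequality -/

/-- With δ = γ − 1/2, split 1/s into the powers (δ−1)/2 and (−1−δ)/2 of s and apply Cauchy-Schwarz.
The first power squared integrates over (0,ψ) to ψ^δ/δ, and the remaining double integral is
evaluated by Tonelli, giving another factor 1/δ. Convergence at both ends requires γ > 1/2. -/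
theorem lintegral_hardy (hγ : 1 / 2 < γ) {b : ℝ → ℝ≥0∞} (hb : Measurable b) :
    ∫⁻ ψ in Ioo (0 : ℝ) 1, ENNReal.ofReal (ψ ^ (-2 * γ)) *
      (∫⁻ s in Ioo (0 : ℝ) ψ, ENNReal.ofReal s⁻¹ * b s) ^ 2 ≤
      ENNReal.ofReal ((γ - 1 / 2)⁻¹ ^ 2) *
        ∫⁻ s in Ioo (0 : ℝ) 1, ENNReal.ofReal (s ^ (-2 * γ)) * b s ^ 2 := by
  set δ := γ - 1 / 2 with hδd
  have hδ : 0 < δ := by simp only [hδd]; linarith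
  have hk : Measurable fun s : ℝ => ENNReal.ofReal (s ^ (-1 - δ)) * b s ^ 2 :=
    (measurable_weight _).mul (hb.pow_const 2)
  have step1 : ∀ ψ ∈ Ioo (0 : ℝ) 1, ENNReal.ofReal (ψ ^ (-2 * γ)) *
      (∫⁻ s in Ioo (0 : ℝ) ψ, ENNReal.ofReal s⁻¹ * b s) ^ 2 ≤
      ENNReal.ofReal (δ⁻¹ * ψ ^ (-1 - δ)) *
        ∫⁻ s in Ioo (0 : ℝ) ψ, ENNReal.ofReal (s ^ (-1 - δ)) * b s ^ 2 := by
    intro ψ hψ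
    have h1 := lintegral_mul_sq_le (μ := volume.restrict (Ioo (0 : ℝ) ψ))
      (f := fun s => ENNReal.ofReal (s ^ ((δ - 1) / 2)))
      (g := fun s => ENNReal.ofReal (s ^ ((-1 - δ) / 2)) * b s)
      (measurable_weight _).aemeasurable ((measurable_weight _).mul hb).aemeasurable
    have e1 : ∫⁻ s in Ioo (0 : ℝ) ψ, ENNReal.ofReal (s ^ ((δ - 1) / 2)) *
        (ENNReal.ofReal (s ^ ((-1 - δ) / 2)) * b s) =
        ∫⁻ s in Ioo (0 : ℝ) ψ, ENNReal.ofReal s⁻¹ * b s := by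
      refine setLIntegral_congr_fun measurableSet_Ioo fun s hs => ?_
      have hs0 : 0 < s := hs.1
      rw [← mul_assoc, ← ENNReal.ofReal_mul (by positivity), ← Real.rpow_add hs0,
        ← Real.rpow_neg_one]
      congr 3
      ring
    have e2 : ∫⁻ s in Ioo (0 : ℝ) ψ, ENNReal.ofReal (s ^ ((δ - 1) / 2)) ^ 2 =
        ENNReal.ofReal (δ⁻¹ * ψ ^ δ) := by
      have h2 : ∫⁻ s in Ioo (0 : ℝ) ψ, ENNReal.ofReal (s ^ ((δ - 1) / 2)) ^ 2 =
          ∫⁻ s in Ioc (0 : ℝ) ψ, ENNReal.ofReal (s ^ (δ - 1)) := by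
        rw [Measure.restrict_congr_set Ioo_ae_eq_Ioc]
        refine setLIntegral_congr_fun measurableSet_Ioc fun s hs => ?_
        have hs0 : 0 < s := hs.1
        rw [← ENNReal.ofReal_pow (by positivity), ← Real.rpow_natCast, ← Real.rpow_mul hs0.le]
        congr 2
        push_cast
        ring
      have h3 : IntervalIntegrable (fun s : ℝ => s ^ (δ - 1)) volume 0 ψ :=
        intervalIntegral.intervalIntegrable_rpow' (by linarith)
      rw [h2, ← ofReal_integral_eq_lintegral_ofReal h3.1 ?_, ← intervalIntegral.integral_of_le hψ.1.le,
        integral_rpow (Or.inl (by linarith))]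
      · congr 1
        rw [sub_add_cancel, Real.zero_rpow hδ.ne']
        field_simp
        ring
      · filter_upwards [ae_restrict_mem measurableSet_Ioc] with s hs
        exact Real.rpow_nonneg hs.1.le _
    have e3 : ∫⁻ s in Ioo (0 : ℝ) ψ, (ENNReal.ofReal (s ^ ((-1 - δ) / 2)) * b s) ^ 2 =
        ∫⁻ s in Ioo (0 : ℝ) ψ, ENNReal.ofReal (s ^ (-1 - δ)) * b s ^ 2 := by
      refine setLIntegral_congr_fun measurableSet_Ioo fun s hs => ?_
      have hs0 : 0 < s := hs.1
      rw [mul_pow, ← ENNReal.ofReal_pow (by positivity), ← Real.rpow_natCast,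
        ← Real.rpow_mul hs0.le]
      congr 3
      push_cast
      ring
    rw [e1, e2, e3] at h1
    refine (mul_le_mul_right h1 _).trans_eq ?_
    have hψ0 : 0 < ψ := hψ.1
    rw [← mul_assoc, ← ENNReal.ofReal_mul (by positivity)]
    congr 2
    rw [mul_left_comm, ← Real.rpow_add hψ0]
    congr 2
    simp only [hδd]
    ring
  calc _ ≤ ∫⁻ ψ in Ioo (0 : ℝ) 1, ENNReal.ofReal (δ⁻¹ * ψ ^ (-1 - δ)) *
        ∫⁻ s in Ioo (0 : ℝ) ψ, ENNReal.ofReal (s ^ (-1 - δ)) * b s ^ 2 :=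
        setLIntegral_mono_ae' measurableSet_Ioo (Eventually.of_forall step1)
    _ = ∫⁻ ψ in Ioo (0 : ℝ) 1, ∫⁻ s in Ioo (0 : ℝ) 1, ENNReal.ofReal (δ⁻¹ * ψ ^ (-1 - δ)) *
        (Ioi s).indicator (fun _ => ENNReal.ofReal (s ^ (-1 - δ)) * b s ^ 2) ψ := by
        refine setLIntegral_congr_fun measurableSet_Ioo fun ψ hψ => ?_
        rw [lintegral_const_mul' _ _ ENNReal.ofReal_ne_top]
        congr 1
        have e : Ioo (0 : ℝ) ψ = Iio ψ ∩ Ioo (0 : ℝ) 1 := by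
          ext s
          simp only [mem_Ioo, mem_inter_iff, mem_Iio]
          exact ⟨fun h => ⟨h.2, h.1, h.2.trans hψ.2⟩, fun h => ⟨h.2.1, h.1⟩⟩
        rw [e, ← Measure.restrict_restrict measurableSet_Iio, ← lintegral_indicator measurableSet_Iio]
        rfl
    -- The constraint s < ψ has been moved into an indicator so that the domain of integration is a
    -- product.
    _ = ∫⁻ s in Ioo (0 : ℝ) 1, ∫⁻ ψ in Ioo (0 : ℝ) 1, ENNReal.ofReal (δ⁻¹ * ψ ^ (-1 - δ)) *
        (Ioi s).indicator (fun _ => ENNReal.ofReal (s ^ (-1 - δ)) * b s ^ 2) ψ := by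
        refine lintegral_lintegral_swap ?_
        refine Measurable.aemeasurable ?_
        have hS : MeasurableSet {p : ℝ × ℝ | p.2 < p.1} :=
          measurableSet_lt measurable_snd measurable_fst
        have h1 : Measurable ({p : ℝ × ℝ | p.2 < p.1}.indicator
          fun p => ENNReal.ofReal (p.2 ^ (-1 - δ)) * b p.2 ^ 2) :=
          (hk.comp measurable_snd).indicator hS
        have h2 : Measurable fun p : ℝ × ℝ => ENNReal.ofReal (δ⁻¹ * p.1 ^ (-1 - δ)) :=
          ((measurable_fst.pow_const _).const_mul _).ennreal_ofReal
        exact h2.mul h1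
    _ ≤ ∫⁻ s in Ioo (0 : ℝ) 1, ENNReal.ofReal (δ⁻¹ ^ 2) *
          (ENNReal.ofReal (s ^ (-2 * γ)) * b s ^ 2) := by
        refine setLIntegral_mono_ae' measurableSet_Ioo (Eventually.of_forall fun s hs => ?_)
        have hs0 : 0 < s := hs.1
        calc _ ≤ ∫⁻ ψ, ENNReal.ofReal (δ⁻¹ * ψ ^ (-1 - δ)) *
              (Ioi s).indicator (fun _ => ENNReal.ofReal (s ^ (-1 - δ)) * b s ^ 2) ψ :=
              setLIntegral_le_lintegral _ _
          _ = ∫⁻ ψ in Ioi s, ENNReal.ofReal (δ⁻¹ * ψ ^ (-1 - δ)) *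
              (ENNReal.ofReal (s ^ (-1 - δ)) * b s ^ 2) := by
              rw [← lintegral_indicator measurableSet_Ioi]
              refine lintegral_congr fun ψ => ?_
              by_cases h : ψ ∈ Ioi s <;> simp [h]
          _ = (∫⁻ ψ in Ioi s, ENNReal.ofReal (δ⁻¹ * ψ ^ (-1 - δ))) *
              (ENNReal.ofReal (s ^ (-1 - δ)) * b s ^ 2) :=
              lintegral_mul_const _ ((measurable_id.pow_const _).const_mul _).ennreal_ofReal
          _ = _ := by
              have h4 : IntegrableOn (fun ψ : ℝ => δ⁻¹ * ψ ^ (-1 - δ)) (Ioi s) :=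
                (integrableOn_Ioi_rpow_of_lt (by linarith) hs0).const_mul _
              rw [← ofReal_integral_eq_lintegral_ofReal h4 ?_, integral_const_mul,
                integral_Ioi_rpow_of_lt (by linarith) hs0, ← mul_assoc, ← mul_assoc,
                ← ENNReal.ofReal_mul (by
                  have : -1 - δ + 1 = -δ := by ring
                  rw [this, neg_div_neg_eq]; positivity), ← ENNReal.ofReal_mul (by positivity)]
              · congr 2
                have h5 : -1 - δ + 1 = -δ := by ring
                have h6 : s ^ (-2 * γ) = s ^ (-δ) * s ^ (-1 - δ) := by
                  rw [← Real.rpow_add hs0]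
                  congr 1
                  simp only [hδd]
                  ring
                rw [h5, neg_div_neg_eq, h6]
                field_simp
              · filter_upwards [ae_restrict_mem measurableSet_Ioi] with ψ hψ
                have : 0 < ψ := hs0.trans hψ
                simp only [Pi.zero_apply]
                positivity
    _ = _ := lintegral_const_mul' _ _ ENNReal.ofReal_ne_top

/-- The constant in Hardy's inequality. -/
noncomputable def hardyConst (γ : ℝ) : ℝ≥0 := (γ - 1 / 2)⁻¹.toNNReal

/-- A function vanishing at `ψ = 0` with controlled radial derivative is a multiplier from
functions of `θ` into the Kondratev class. -/
theorem IsMultiplier.of_hardy (hγ : 1 / 2 < γ) {G G₁ : ℝ × Circ → 𝕜} {K : ℝ≥0}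
    (hG : ContinuousOn G openPi) (hr : HasRadialDeriv G G₁)
    (hlim : ∀ θ, Tendsto (fun ψ => G (ψ, θ)) (𝓝[>] 0) (𝓝 0)) {b : ℝ → ℝ≥0∞} (hb : Measurable b)
    (hG₁ : ∀ᵐ x ∂muPi, ‖G₁ x‖ₑ ≤ b x.1)
    (hK : ∫⁻ ψ in Ioo (0 : ℝ) 1, ENNReal.ofReal (ψ ^ (-2 * γ)) * b ψ ^ 2 ≤ (K : ℝ≥0∞) ^ 2) :
    IsMultiplier γ false true 0 G (hardyConst γ * K) := by
  intro l hl v S hv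
  obtain rfl : l = 0 := by omega
  have hv : L2Bound γ false v S := hv
  -- H is the primitive of b(s)/s from 0. It dominates |G(ψ,θ)| uniformly in θ because G vanishes at
  -- ψ = 0, and the norm of G·v then splits into the Hardy integral and the norm of a function of θ.
  set H : ℝ → ℝ≥0∞ := fun ψ => ∫⁻ s in Ioo (0 : ℝ) ψ, ENNReal.ofReal s⁻¹ * b s
  have hH : Measurable H := by
    refine Monotone.measurable fun x y hxy => ?_
    exact lintegral_mono_set (Ioo_subset_Ioo le_rfl hxy)
  have hGm : AEStronglyMeasurable G muPi := hG.aestronglyMeasurable isOpen_openPi.measurableSet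
  have hGH : ∀ᵐ θ : Circ, ∀ ψ ∈ Ioo (0 : ℝ) 1, ‖G (ψ, θ)‖ₑ ≤ H ψ := by
    filter_upwards [hr.isPrimitiveOn hG, ae_angular_of_ae_muPi hG₁] with θ h1 h2 ψ hψ
    have h3 : Tendsto (fun ε => ‖G (ψ, θ) - G (ε, θ)‖ₑ) (𝓝[>] 0) (𝓝 ‖G (ψ, θ) - 0‖ₑ) :=
      (tendsto_const_nhds.sub (hlim θ)).enorm
    rw [sub_zero] at h3
    -- The fundamental theorem holds only inside (0,1), so the lower endpoint is ε > 0 and the limit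
    -- ε → 0 is taken in the resulting bound.
    refine le_of_tendsto h3 ?_
    filter_upwards [Ioo_mem_nhdsGT hψ.1] with ε hε
    have hε' : ε ∈ Ioo (0 : ℝ) 1 := ⟨hε.1, hε.2.trans hψ.2⟩
    rw [h1.eq ε hε' ψ hψ, intervalIntegral.integral_of_le hε.2.le]
    refine (enorm_integral_le_lintegral_enorm _).trans ?_
    rw [Measure.restrict_congr_set Ioo_ae_eq_Ioc.symm]
    refine le_trans ?_ (lintegral_mono_set (Ioo_subset_Ioo hε.1.le le_rfl))
    have h4 : ∀ᵐ s ∂(volume.restrict (Ioo ε ψ)), ‖G₁ (s, θ)‖ₑ ≤ b s :=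
      ae_mono (Measure.restrict_mono (Ioo_subset_Ioo hε.1.le hψ.2.le) le_rfl) h2
    refine lintegral_mono_ae ?_
    filter_upwards [h4, ae_restrict_mem measurableSet_Ioo] with s hs hsm
    have hs0 : 0 < s := hε.1.trans hsm.1
    rw [enorm_smul, Real.enorm_eq_ofReal (by positivity)]
    gcongr
  obtain ⟨α, hα⟩ := hv.radial rfl
  have hαm := hv.ae_measurable_of_radial hα
  have hα2 : ∫⁻ θ, ‖α θ‖ₑ ^ 2 ≤ (S : ℝ≥0∞) ^ 2 := by
    refine le_trans (le_of_eq ?_) hv.lintegral_le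
    have h3 := lintegral_muPi_mul (f := fun _ => 1) (g := fun θ => ‖α θ‖ₑ ^ 2)
      aemeasurable_const (hαm.enorm.pow_const 2)
    simp only [one_mul, setLIntegral_const, Real.volume_Ioo, sub_zero, ENNReal.ofReal_one] at h3
    rw [← h3]
    refine lintegral_congr_ae ?_
    filter_upwards [hα] with x hx
    simp [hx, wexp]
  refine L2Bound.of_lintegral_le (hGm.mul hv.meas) (by simp) ?_
  calc _ ≤ ∫⁻ x, (ENNReal.ofReal (x.1 ^ (-2 * γ)) * H x.1 ^ 2) * ‖α x.2‖ₑ ^ 2 ∂muPi := by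
        refine lintegral_mono_ae ?_
        filter_upwards [hα, ae_muPi_snd hGH, ae_muPi_mem] with x h3 h4 h5
        rw [enorm_mul, mul_pow, h3, mul_assoc, wexp, if_pos rfl]
        gcongr
        exact h4 _ h5.1
    _ = (∫⁻ ψ in Ioo (0 : ℝ) 1, ENNReal.ofReal (ψ ^ (-2 * γ)) * H ψ ^ 2) *
          ∫⁻ θ, ‖α θ‖ₑ ^ 2 := lintegral_muPi_mul
            (f := fun ψ => ENNReal.ofReal (ψ ^ (-2 * γ)) * H ψ ^ 2)
            ((measurable_weight _).mul (hH.pow_const 2)).aemeasurable (hαm.enorm.pow_const 2)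
    _ ≤ (ENNReal.ofReal ((γ - 1 / 2)⁻¹ ^ 2) * (K : ℝ≥0∞) ^ 2) * (S : ℝ≥0∞) ^ 2 := by
        gcongr
        exact (lintegral_hardy hγ hb).trans (mul_le_mul_right hK _)
    _ = _ := by
        rw [ENNReal.ofReal_pow (inv_nonneg.2 (by linarith))]
        simp only [hardyConst, ENNReal.ofReal]
        push_cast
        ring

/-- The square root of the angular bound dominates `a` uniformly in θ, as required of the majorant
in `IsMultiplier.of_hardy`; 26 ≤ 6² gives the constant. -/
theorem SobBound.exists_radial_majorant {a : ℝ × Circ → 𝕜} (h : SobBound γ true 1 a R) :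
    ∃ b : ℝ → ℝ≥0∞, Measurable b ∧ (∀ᵐ x ∂muPi, ‖a x‖ₑ ≤ b x.1) ∧
      ∫⁻ ψ in Ioo (0 : ℝ) 1, ENNReal.ofReal (ψ ^ (-2 * γ)) * b ψ ^ 2 ≤ (6 * R : ℝ≥0∞) ^ 2 := by
  obtain ⟨h0, v₁, v₂, -, ha, -, h2⟩ := h
  obtain ⟨B, hB, hB1, hB2⟩ := HasAngularDeriv.exists_weighted_bound ha h0 h2
  have e : ∀ ψ, (B ψ ^ (1 / 2 : ℝ)) ^ 2 = B ψ := fun ψ => by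
    rw [← ENNReal.rpow_natCast, ← ENNReal.rpow_mul]
    norm_num
  refine ⟨fun ψ => B ψ ^ (1 / 2 : ℝ), hB.pow_const _, ?_, ?_⟩
  · filter_upwards [hB1] with x hx
    exact ennreal_le_of_sq_le (by rwa [e])
  · simp only [e]
    simp only [wexp, if_true] at hB2
    refine hB2.trans ?_
    rw [mul_pow]
    gcongr
    norm_num

end Kondratev

/-! ### Multipliers produced by compositions with ξ(θ) + w(ψ,θ). -/

namespace Kondratev

variable {𝕜 : Type*} [RCLike 𝕜]

open scoped NNReal ENNReal

/-- A continuous function `α(θ) + W(ψ,θ)` with `W` vanishing at `ψ = 0`, whose first derivatives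
`w₁` and `ξ₂ + w₂` are controlled by `R`. -/
structure SplitData (γ : ℝ) (n : ℕ) (α : Circ → 𝕜) (W ξ₂ w₁ w₂ : ℝ × Circ → 𝕜) (R : ℝ≥0) :
    Prop where
  cont_fst : Continuous α
  cont_snd : ContinuousOn W openPi
  lim : ∀ θ, Tendsto (fun ψ => W (ψ, θ)) (𝓝[>] 0) (𝓝 0)
  angular_fst : HasAngularDeriv (fun x => α x.2) ξ₂
  radial_snd : HasRadialDeriv W w₁
  angular_snd : HasAngularDeriv W w₂
  bound_fst : SobBound γ false n ξ₂ R
  bound_radial : SobBound γ true n w₁ R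
  bound_angular : SobBound γ true n w₂ R

/-- The constant relating Sobolev bounds to multiplier bounds of gradients. -/
noncomputable def gradConst (n : ℕ) : ℝ≥0 := 30 * 2 ^ n

namespace SplitData

variable {γ : ℝ} {c : Bool} {k n : ℕ} {α β : Circ → 𝕜} {W ξ₂ w₁ w₂ H β₂ h₁ h₂ : ℝ × Circ → 𝕜}
  {R S M : ℝ≥0}

theorem continuousOn_fst (h : SplitData γ n α W ξ₂ w₁ w₂ R) :
    ContinuousOn (fun x : ℝ × Circ => α x.2) openPi :=
  (h.cont_fst.comp continuous_snd).continuousOn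

theorem continuousOn (h : SplitData γ n α W ξ₂ w₁ w₂ R) :
    ContinuousOn (fun x : ℝ × Circ => α x.2 + W x) openPi :=
  h.continuousOn_fst.add h.cont_snd

theorem radial (h : SplitData γ n α W ξ₂ w₁ w₂ R) :
    HasRadialDeriv (fun x : ℝ × Circ => α x.2 + W x) w₁ := by
  have h1 : HasRadialDeriv (fun x : ℝ × Circ => α x.2) 0 := .of_radial (α := α) EventuallyEq.rfl
  simpa using h1.add h.radial_snd

theorem angular (h : SplitData γ n α W ξ₂ w₁ w₂ R) :
    HasAngularDeriv (fun x : ℝ × Circ => α x.2 + W x) (fun x => ξ₂ x + w₂ x) :=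
  h.angular_fst.add h.angular_snd

theorem gradBound_aux : 15 * 2 ^ n * R ≤ gradConst n * R := by
  unfold gradConst
  gcongr
  norm_num

theorem gradBound_fst (hγ : 1 / 2 < γ) (hn : 1 ≤ n) (h : SplitData γ n α W ξ₂ w₁ w₂ R) (c : Bool) :
    IsGradBound γ c c n ξ₂ (gradConst n * R) :=
  (h.bound_fst.isGradBound hγ hn (by simp)).mono gradBound_aux

theorem gradBound_radial (hγ : 1 / 2 < γ) (hn : 1 ≤ n) (h : SplitData γ n α W ξ₂ w₁ w₂ R)
    (c : Bool) : IsGradBound γ c true n w₁ (gradConst n * R) :=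
  (h.bound_radial.isGradBound hγ hn (by simp)).mono gradBound_aux

theorem gradBound_angular (hγ : 1 / 2 < γ) (hn : 1 ≤ n) (h : SplitData γ n α W ξ₂ w₁ w₂ R)
    (c : Bool) : IsGradBound γ c true n w₂ (gradConst n * R) :=
  (h.bound_angular.isGradBound hγ hn (by simp)).mono gradBound_aux

/-- The two summands each contribute 15 · 2^n R, which explains the factor 30 in `gradConst`. Only
the weighted class is considered, as w₂ carries functions of θ out of their class. -/
theorem gradBound_add (hγ : 1 / 2 < γ) (hn : 1 ≤ n) (h : SplitData γ n α W ξ₂ w₁ w₂ R) :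
    IsGradBound γ true true n (fun x => ξ₂ x + w₂ x) (gradConst n * R) := by
  refine ((h.bound_fst.isGradBound (c := true) hγ hn (by simp)).add
    (h.bound_angular.isGradBound hγ hn (by simp))).mono (le_of_eq ?_)
  unfold gradConst
  ring

theorem lim_comp {g : 𝕜 → 𝕜} {Ω Z : Set 𝕜} (hΩ : IsOpen Ω) (hZ : Z ⊆ Ω)
    (hg : ContinuousOn g Ω) (h : SplitData γ n α W ξ₂ w₁ w₂ R) (hα : ∀ θ, α θ ∈ Z) (θ : Circ) :
    Tendsto (fun ψ => g (α θ + W (ψ, θ)) - g (α θ)) (𝓝[>] 0) (𝓝 0) := by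
  have h1 : ContinuousAt g (α θ) := hg.continuousAt (hΩ.mem_nhds (hZ (hα θ)))
  have h2 : Tendsto (fun ψ => α θ + W (ψ, θ)) (𝓝[>] 0) (𝓝 (α θ)) := by
    simpa using tendsto_const_nhds.add (h.lim θ)
  simpa using (h1.tendsto.comp h2).sub_const (g (α θ))

/-- Superposition operators on the full class as multipliers of the weighted class. -/
theorem isMultiplier_comp (hγ : 1 / 2 < γ) (hn : 1 ≤ n) {Ω Z : Set 𝕜} (hΩ : IsOpen Ω) (hZ : Z ⊆ Ω)
    (h : SplitData γ n α W ξ₂ w₁ w₂ R)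
    (hU : MapsTo (fun x : ℝ × Circ => α x.2 + W x) openPi Z) (hk : k ≤ n + 1) {g : 𝕜 → 𝕜}
    (hg : ContDiffOn ℝ (k : ℕ) g Ω) (hM : DerivBound k g Z M) :
    IsMultiplier γ true true k (fun x => g (α x.2 + W x))
      (4 ^ k * M * (1 + gradConst n * R) ^ k) :=
  IsMultiplier.comp hΩ hZ h.continuousOn hU (by simp) h.radial h.angular
    (h.gradBound_radial hγ hn _) (h.gradBound_add hγ hn) hk hg hM

/-- The difference `g(α + W) - g(α)` maps functions of `θ` into the Kondratev class. -/
theorem isMultiplier_sub (hγ : 1 / 2 < γ) (hn : 1 ≤ n) {Ω Z : Set 𝕜} (hΩ : IsOpen Ω) (hZ : Z ⊆ Ω)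
    (h : SplitData γ n α W ξ₂ w₁ w₂ R) (hα : ∀ θ, α θ ∈ Z)
    (hU : MapsTo (fun x : ℝ × Circ => α x.2 + W x) openPi Z) (hk : k ≤ n + 1) {g : 𝕜 → 𝕜}
    (hg : ContDiffOn ℝ (k + 1 : ℕ) g Ω) (hM : DerivBound (k + 1) g Z M) :
    IsMultiplier γ false true k (fun x => g (α x.2 + W x) - g (α x.2))
      ((1 + hardyConst γ) * 4 ^ k * M * (gradConst n * R) * (1 + gradConst n * R) ^ k) := by
  have hUΩ : MapsTo (fun x : ℝ × Circ => α x.2 + W x) openPi Ω := fun x hx => hZ (hU hx)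
  have hαΩ : MapsTo (fun x : ℝ × Circ => α x.2) openPi Ω := fun x _ => hZ (hα x.2)
  induction k generalizing g with
  | zero =>
    -- Order zero is Hardy's inequality: g(α) has no radial derivative, so that of the bracket is
    -- Dg(α + W)w₁, bounded by M times a function of ψ.
    obtain ⟨b, hb, hb1, hb2⟩ := (h.bound_radial.of_le hn).exists_radial_majorant
    have hg1 : ContDiffOn ℝ 1 g Ω := hg
    have h1 := ((h.radial.comp h.continuousOn hΩ hg1 hUΩ).sub
      (HasRadialDeriv.of_radial (u := fun x => g (α x.2)) (α := fun θ => g (α θ)) EventuallyEq.rfl))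
    simp only [Pi.zero_apply, sub_zero] at h1
    refine (IsMultiplier.of_hardy (b := fun ψ => M * b ψ) (K := M * (6 * R)) hγ ?_ h1
      (fun θ => h.lim_comp hΩ hZ hg.continuousOn hα θ) (hb.const_mul _) ?_ ?_).mono ?_
    · exact (hg.continuousOn.comp h.continuousOn hUΩ).sub
        (hg.continuousOn.comp h.continuousOn_fst hαΩ)
    · filter_upwards [hb1, ae_muPi_mem] with x h2 h3
      calc _ ≤ ‖fderiv ℝ g (α x.2 + W x)‖ₑ * ‖w₁ x‖ₑ := ContinuousLinearMap.le_opENorm _ _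
        _ ≤ _ := by
          gcongr
          rw [← ofReal_norm, ENNReal.ofReal_le_iff_le_toReal (by simp)]
          exact hM.norm_fderiv_le (hU h3)
    · simp only [mul_pow, mul_left_comm _ ((M : ℝ≥0∞) ^ 2)]
      rw [lintegral_const_mul' _ _ (by simp)]
      push_cast
      rw [mul_pow]
      gcongr
    · have e : 6 * R ≤ gradConst n * R := by
        have : (1 : ℝ≥0) ≤ 2 ^ n := one_le_pow₀ (by norm_num)
        unfold gradConst
        gcongr
        calc (6 : ℝ≥0) ≤ 30 * 1 := by norm_num
          _ ≤ _ := by gcongr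
      calc hardyConst γ * (M * (6 * R)) = hardyConst γ * 1 * M * (6 * R) * 1 := by ring
        _ ≤ (1 + hardyConst γ) * 4 ^ 0 * M * (gradConst n * R) * (1 + gradConst n * R) ^ 0 := by
          simp only [pow_zero]
          gcongr
          exact le_add_self
  | succ k ih =>
    set P := gradConst n * R
    have h0 := ih (by omega) (hg.of_le (by norm_cast; omega)) (hM.of_le (by omega))
    have hg1 : ContDiffOn ℝ 1 g Ω := hg.of_le (by norm_cast; omega)
    set B := (1 + hardyConst γ) * 4 ^ k * M * P * (1 + P) ^ k
    set N := 4 ^ k * M * (1 + P) ^ k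
    -- The induction hypothesis for the Wirtinger coefficients: their differences between α + W and
    -- α again carry functions of θ into the weighted class.
    have hw : ∀ s : ℝ, |s| ≤ 1 → IsMultiplier γ false true k
        (fun x => wirtinger s (fderiv ℝ g (α x.2 + W x) - fderiv ℝ g (α x.2))) B := by
      intro s hs
      simpa only [map_sub] using
        ih (by omega) (contDiffOn_wirtinger hΩ hg s) (hM.wirtinger hΩ hg hZ hs)
    have hv : ∀ s : ℝ, |s| ≤ 1 → IsMultiplier γ true true k
        (fun x => wirtinger s (fderiv ℝ g (α x.2 + W x))) N := fun s hs =>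
      h.isMultiplier_comp hγ hn hΩ hZ hU (by omega)
        ((contDiffOn_wirtinger hΩ hg s).of_le (by norm_cast; omega))
        ((hM.wirtinger hΩ hg hZ hs).of_le (by omega))
    have t1 := IsGradBound.clm_apply (hv (-1) (by simp)) (hv 1 (by simp))
      ((h.gradBound_radial hγ hn false).of_le (by omega))
    have t2 := IsGradBound.clm_apply (hv (-1) (by simp)) (hv 1 (by simp))
      ((h.gradBound_angular hγ hn false).of_le (by omega))
    have t3 := IsGradBound.clm_apply (hw (-1) (by simp)) (hw 1 (by simp))
      ((h.gradBound_fst hγ hn false).of_le (by omega))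
    have hN : N * P ≤ B := by
      calc N * P = 1 * (4 ^ k * M * P * (1 + P) ^ k) := by ring
        _ ≤ (1 + hardyConst γ) * (4 ^ k * M * P * (1 + P) ^ k) := by
          gcongr
          exact le_self_add
        _ = B := by ring
    have e1 : (1 + hardyConst γ) * 4 ^ (k + 1) * M * P * (1 + P) ^ (k + 1) =
        2 * (2 * (B * (1 + P))) := by ring
    have hr := (h.radial.comp h.continuousOn hΩ hg1 hUΩ).sub
      (HasRadialDeriv.of_radial (u := fun x => g (α x.2)) (α := fun θ => g (α θ)) EventuallyEq.rfl)
    simp only [Pi.zero_apply, sub_zero] at hr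
    rw [e1]
    refine IsMultiplier.succ (h0.mono ?_) hr ((h.angular.comp h.continuousOn hΩ hg1 hUΩ).sub
      (h.angular_fst.comp h.continuousOn_fst hΩ hg1 hαΩ)) (t1.mono ?_) ?_
    · calc B = 1 * (B * 1) := by ring
        _ ≤ _ := by
          gcongr
          · exact one_le_two
          · exact le_self_add
    · calc 2 * N * P = 2 * (N * P) := by ring
        _ ≤ 2 * (B * 1) := by rw [mul_one]; gcongr
        _ ≤ 2 * (B * (1 + P)) := by
          gcongr
          exact le_self_add
    -- Dg(α + W)(ξ₂ + w₂) − Dg(α)ξ₂ = (Dg(α + W) − Dg(α))ξ₂ + Dg(α + W)w₂. In the first term the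
    -- coefficient moves into the weighted class, in the second w₂ does so and the coefficient then
    -- acts within it.
    · convert! (t3.add t2).mono (N' := 2 * (B * (1 + P))) ?_ using 2 with x
      · simp only [sub_apply, map_add]
        ring
      · calc 2 * B * P + 2 * N * P = 2 * (B * P + N * P) := by ring
          _ ≤ 2 * (B * P + B) := by gcongr
          _ = _ := by ring


/-- Continuity of the difference `g(α + W) - g(α)`, as a multiplier, with respect to `α`, `W`. -/
theorem isMultiplier_sub_small (hγ : 1 / 2 < γ) (hn : 1 ≤ n) {Ω Z : Set 𝕜} (hΩ : IsOpen Ω)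
    (hZ : Z ⊆ Ω) (hc : IsCompact Z) (h : SplitData γ n α W ξ₂ w₁ w₂ R) (hα : ∀ θ, α θ ∈ Z)
    (hU : MapsTo (fun x : ℝ × Circ => α x.2 + W x) openPi Z) (hk : k ≤ n + 1) {g : 𝕜 → 𝕜}
    (hg : ContDiffOn ℝ (k + 1 : ℕ) g Ω) {ε : ℝ≥0} (hε : 0 < ε) :
    ∃ δ : ℝ≥0, 0 < δ ∧ ∀ (β : Circ → 𝕜) (H β₂ h₁ h₂ : ℝ × Circ → 𝕜),
      SplitData γ n β H β₂ h₁ h₂ δ → (∀ θ, ‖β θ‖ ≤ δ) → (∀ x ∈ openPi, ‖β x.2 + H x‖ ≤ δ) →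
      IsMultiplier γ false true k (fun x => (g (α x.2 + W x + (β x.2 + H x)) - g (α x.2 + β x.2)) -
        (g (α x.2 + W x) - g (α x.2))) ε := by
  have hUΩ : MapsTo (fun x : ℝ × Circ => α x.2 + W x) openPi Ω := fun x hx => hZ (hU hx)
  have hαΩ : MapsTo (fun x : ℝ × Circ => α x.2) openPi Ω := fun x _ => hZ (hα x.2)
  induction k generalizing g ε with
  | zero =>
    obtain ⟨b, hb, hb1, hb2⟩ := (h.bound_radial.of_le hn).exists_radial_majorant
    have hg1 : ContDiffOn ℝ 1 g Ω := hg
    obtain ⟨M, hM⟩ := exists_derivBound hΩ hg hZ hc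
    set κ := hardyConst γ
    -- η bounds the oscillation of Dg and is matched to R; `δ₀` bounds the perturbation and is
    -- matched to M + η, a bound for the perturbed derivative. The denominator 24 is 2 · 12, with 12
    -- = 2 · 6 from the factor 2 in the majorant and the constant 6 of `exists_radial_majorant`.
    set η : ℝ≥0 := ε / 24 / (1 + κ) / (1 + R) with hηd
    have hη : 0 < η := by positivity
    set δ₀ : ℝ≥0 := ε / 24 / (1 + κ) / (1 + (M + η))
    have hδ₀ : 0 < δ₀ := by positivity
    obtain ⟨δ₁, hδ₁, hr⟩ := exists_uniform_radius hΩ hZ hc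
      (hg1.continuousOn_fderiv_of_isOpen hΩ le_rfl) (ε := η) hη
    refine ⟨min δ₀ δ₁, by positivity, fun β H β₂ h₁ h₂ hp hβs hHs => ?_⟩
    have hVΩ : MapsTo (fun x : ℝ × Circ => α x.2 + W x + (β x.2 + H x)) openPi Ω := fun x hx =>
      (hr _ (hU hx) _ ((hHs x hx).trans (by exact_mod_cast min_le_right _ _))).1
    have hβΩ : ∀ θ, α θ + β θ ∈ Ω := fun θ =>
      (hr _ (hα θ) _ ((hβs θ).trans (by exact_mod_cast min_le_right _ _))).1
    obtain ⟨b', hb', hb1', hb2'⟩ := (hp.bound_radial.of_le hn).exists_radial_majorant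
    have h1 := (((h.radial.add hp.radial).comp (h.continuousOn.add hp.continuousOn) hΩ hg1 hVΩ).sub
      (HasRadialDeriv.of_radial (u := fun x => g (α x.2 + β x.2)) (α := fun θ => g (α θ + β θ))
        EventuallyEq.rfl)).sub ((h.radial.comp h.continuousOn hΩ hg1 hUΩ).sub
      (HasRadialDeriv.of_radial (u := fun x => g (α x.2)) (α := fun θ => g (α θ)) EventuallyEq.rfl))
    simp only [Pi.zero_apply, sub_zero] at h1
    refine (IsMultiplier.of_hardy (b := fun ψ => η * b ψ + (M + η) * b' ψ)
      (K := 2 * (η * (6 * R) + (M + η) * (6 * min δ₀ δ₁))) hγ ?_ h1 (fun θ => ?_)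
      ((hb.const_mul _).add (hb'.const_mul _)) ?_ ?_).mono ?_
    · exact ((hg.continuousOn.comp (h.continuousOn.add hp.continuousOn) hVΩ).sub
        (hg.continuousOn.comp (h.continuousOn_fst.add hp.continuousOn_fst) fun x _ => hβΩ x.2)).sub
        ((hg.continuousOn.comp h.continuousOn hUΩ).sub
        (hg.continuousOn.comp h.continuousOn_fst hαΩ))
    · have h2 : ContinuousAt g (α θ + β θ) := hg.continuousOn.continuousAt (hΩ.mem_nhds (hβΩ θ))
      have h3 : Tendsto (fun ψ => α θ + W (ψ, θ) + (β θ + H (ψ, θ))) (𝓝[>] 0) (𝓝 (α θ + β θ)) := by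
        simpa using (tendsto_const_nhds.add (h.lim θ)).add (tendsto_const_nhds.add (hp.lim θ))
      simpa using ((h2.tendsto.comp h3).sub_const (g (α θ + β θ))).sub
        (h.lim_comp hΩ hZ hg.continuousOn hα θ)
    · filter_upwards [hb1, hb1', ae_muPi_mem] with x h2 h2' h3
      have e1 : ‖fderiv ℝ g (α x.2 + W x + (β x.2 + H x)) - fderiv ℝ g (α x.2 + W x)‖ ≤ η :=
        (hr _ (hU h3) _ ((hHs x h3).trans (by exact_mod_cast min_le_right _ _))).2
      have e2 : ‖fderiv ℝ g (α x.2 + W x + (β x.2 + H x))‖ ≤ M + η := by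
        have := hM.norm_fderiv_le (hU h3)
        calc _ = ‖fderiv ℝ g (α x.2 + W x) + (fderiv ℝ g (α x.2 + W x + (β x.2 + H x)) -
              fderiv ℝ g (α x.2 + W x))‖ := by rw [add_sub_cancel]
          _ ≤ _ := (norm_add_le _ _).trans (add_le_add this e1)
      have e1' : ‖fderiv ℝ g (α x.2 + W x + (β x.2 + H x)) - fderiv ℝ g (α x.2 + W x)‖ₑ ≤ η := by
        rw [← ofReal_norm, ENNReal.ofReal_le_iff_le_toReal (by simp)]
        exact e1
      have e2' : ‖fderiv ℝ g (α x.2 + W x + (β x.2 + H x))‖ₑ ≤ (M + η : ℝ≥0∞) := by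
        rw [← ofReal_norm, ENNReal.ofReal_le_iff_le_toReal (by simp)]
        simpa [ENNReal.toReal_add] using e2
      -- The radial derivative of the double difference is (Dg(U') − Dg(U))w₁ + Dg(U')h₁, where U =
      -- α + W and U' is its perturbation; the terms depending only on θ drop out.
      calc _ = ‖(fderiv ℝ g (α x.2 + W x + (β x.2 + H x)) - fderiv ℝ g (α x.2 + W x)) (w₁ x) +
            fderiv ℝ g (α x.2 + W x + (β x.2 + H x)) (h₁ x)‖ₑ := by
            congr 1
            simp only [sub_apply, map_add]
            ring
        _ ≤ _ := (enorm_add_le _ _).trans (add_le_add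
            ((ContinuousLinearMap.le_opENorm _ _).trans (mul_le_mul' e1' h2))
            ((ContinuousLinearMap.le_opENorm _ _).trans (mul_le_mul' e2' h2')))
    · calc _ ≤ ∫⁻ ψ in Ioo (0 : ℝ) 1, ((2 * (η : ℝ≥0∞) ^ 2) * (ENNReal.ofReal (ψ ^ (-2 * γ)) * b ψ ^ 2)
            + (2 * (M + η : ℝ≥0∞) ^ 2) * (ENNReal.ofReal (ψ ^ (-2 * γ)) * b' ψ ^ 2)) := by
            refine lintegral_mono fun ψ => ?_
            calc _ ≤ ENNReal.ofReal (ψ ^ (-2 * γ)) *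
                  (2 * ((η : ℝ≥0∞) * b ψ) ^ 2 + 2 * ((M + η : ℝ≥0∞) * b' ψ) ^ 2) := by
                  gcongr
                  exact (ennreal_add_sq_le _ _).trans_eq (mul_add _ _ _)
              _ = _ := by ring
        _ = (2 * (η : ℝ≥0∞) ^ 2) * (∫⁻ ψ in Ioo (0 : ℝ) 1, ENNReal.ofReal (ψ ^ (-2 * γ)) * b ψ ^ 2)
            + (2 * (M + η : ℝ≥0∞) ^ 2) *
              ∫⁻ ψ in Ioo (0 : ℝ) 1, ENNReal.ofReal (ψ ^ (-2 * γ)) * b' ψ ^ 2 := by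
            have hm : Measurable fun ψ => (2 * (η : ℝ≥0∞) ^ 2) *
                (ENNReal.ofReal (ψ ^ (-2 * γ)) * b ψ ^ 2) :=
              ((measurable_weight _).mul (hb.pow_const 2)).const_mul _
            rw [lintegral_add_left hm,
              lintegral_const_mul' _ _ (by finiteness), lintegral_const_mul' _ _ (by finiteness)]
        _ ≤ (2 * (η : ℝ≥0∞) ^ 2) * (6 * R : ℝ≥0) ^ 2 +
            (2 * (M + η : ℝ≥0∞) ^ 2) * (6 * min δ₀ δ₁ : ℝ≥0) ^ 2 := by
            gcongr
            · simpa using hb2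
            · simpa using hb2'
        _ ≤ _ := by
            norm_cast
            calc _ ≤ 2 * (η ^ 2 * (6 * R) ^ 2) + 2 * ((M + η) ^ 2 * (6 * min δ₀ δ₁) ^ 2) +
                  (2 * (η ^ 2 * (6 * R) ^ 2) + 2 * ((M + η) ^ 2 * (6 * min δ₀ δ₁) ^ 2) +
                    8 * ((η * (6 * R)) * ((M + η) * (6 * min δ₀ δ₁)))) := by
                  refine le_trans (le_of_eq ?_) le_self_add
                  ring
              _ = _ := by ring
    · have b1 : η * R ≤ ε / 24 / (1 + κ) := nnreal_small_mul _ _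
      have b2 : min δ₀ δ₁ * (M + η) ≤ ε / 24 / (1 + κ) :=
        (mul_le_mul_left (min_le_left _ _) _).trans (nnreal_small_mul _ _)
      calc κ * (2 * (η * (6 * R) + (M + η) * (6 * min δ₀ δ₁))) =
          12 * κ * (η * R + min δ₀ δ₁ * (M + η)) := by ring
        _ ≤ 12 * κ * (ε / 24 / (1 + κ) + ε / 24 / (1 + κ)) := by gcongr
        _ = 24 * (ε / 24 / (1 + κ) * κ) := by ring
        _ ≤ 24 * (ε / 24) := by
          gcongr
          exact nnreal_small_mul _ _
        _ = ε := mul_div_cancel₀ _ (by norm_num)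
  | succ k ih =>
    obtain ⟨M, hM⟩ := exists_derivBound hΩ hg hZ hc
    have hg1 : ContDiffOn ℝ 1 g Ω := hg.of_le (by norm_cast; omega)
    set P := gradConst n * R
    set ε₁ : ℝ≥0 := ε / 16 / (1 + P) with hε₁d
    have hε₁ : 0 < ε₁ := by positivity
    set B := (1 + hardyConst γ) * 4 ^ k * M * P * (1 + P) ^ k
    set N := 4 ^ k * M * (1 + P) ^ k
    have hw1 : ∀ s : ℝ, ContDiffOn ℝ (k + 1 : ℕ) (fun z => wirtinger s (fderiv ℝ g z)) Ω :=
      fun s => contDiffOn_wirtinger hΩ hg s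
    have hw0 : ∀ s : ℝ, ContDiffOn ℝ (k : ℕ) (fun z => wirtinger s (fderiv ℝ g z)) Ω :=
      fun s => (hw1 s).of_le (by norm_cast; omega)
    obtain ⟨δ₀, hδ₀, q0⟩ := ih (by omega) (hg.of_le (by norm_cast; omega)) (half_pos hε)
    -- Smallness is required of both kinds of multiplier for each Wirtinger coefficient: the double
    -- difference, by induction, and the plain difference on the weighted class, from
    -- `IsMultiplier.comp_sub_small`.
    obtain ⟨δ₁, hδ₁, q1⟩ := ih (by omega) (hw1 (-1)) hε₁
    obtain ⟨δ₂, hδ₂, q2⟩ := ih (by omega) (hw1 1) hε₁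
    obtain ⟨δ₃, hδ₃, q3⟩ := IsMultiplier.comp_sub_small (c := true) hΩ hZ hc h.continuousOn hU
      (by simp) h.radial h.angular (h.gradBound_radial hγ hn _) (h.gradBound_add hγ hn)
      (by omega : k ≤ n + 1) (hw0 (-1)) hε₁
    obtain ⟨δ₄, hδ₄, q4⟩ := IsMultiplier.comp_sub_small (c := true) hΩ hZ hc h.continuousOn hU
      (by simp) h.radial h.angular (h.gradBound_radial hγ hn _) (h.gradBound_add hγ hn)
      (by omega : k ≤ n + 1) (hw0 1) hε₁
    obtain ⟨δ₅, hδ₅, q5⟩ := exists_uniform_radius hΩ hZ hc hg.continuousOn (ε := 1) one_pos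
    have hcpos : 1 ≤ gradConst n := by
      have : (1 : ℝ≥0) ≤ 2 ^ n := one_le_pow₀ (by norm_num)
      unfold gradConst
      calc (1 : ℝ≥0) ≤ 30 * 1 := by norm_num
        _ ≤ _ := by gcongr
    have hcpos' : 0 < gradConst n := one_pos.trans_le hcpos
    set δ₆ : ℝ≥0 := ε / 16 / (1 + (N + B + ε₁))
    have hδ₆ : 0 < δ₆ := by positivity
    set δ := min (min δ₀ (min δ₁ δ₂)) (min (min δ₃ δ₄) (min δ₅ δ₆)) with hδd
    have hδ : 0 < δ := by positivity
    have l0 : δ ≤ δ₀ := by simp [hδd]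
    have l1 : δ ≤ δ₁ := by simp [hδd]
    have l2 : δ ≤ δ₂ := by simp [hδd]
    have l3 : δ ≤ δ₃ := by simp [hδd]
    have l4 : δ ≤ δ₄ := by simp [hδd]
    have l5 : δ ≤ δ₅ := by simp [hδd]
    have l6 : δ ≤ δ₆ := by simp [hδd]
    -- Division by `gradConst n` turns a bound on the perturbation data into the bound δ on the
    -- multiplier norms of its gradients.
    refine ⟨δ / gradConst n, by positivity, fun β H β₂ h₁ h₂ hp hβs hHs => ?_⟩
    have hδ' : δ / gradConst n ≤ δ := div_le_self zero_le hcpos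
    have hδ'' : gradConst n * (δ / gradConst n) = δ := mul_div_cancel₀ _ hcpos'.ne'
    have hp' : ∀ {S : ℝ≥0}, δ ≤ S → SplitData γ n β H β₂ h₁ h₂ S := fun {S} hS =>
      { hp with
        bound_fst := hp.bound_fst.mono (hδ'.trans hS)
        bound_radial := hp.bound_radial.mono (hδ'.trans hS)
        bound_angular := hp.bound_angular.mono (hδ'.trans hS) }
    have hβs' : ∀ {S : ℝ≥0}, δ ≤ S → ∀ θ, ‖β θ‖ ≤ S := fun hS θ =>
      (hβs θ).trans (by exact_mod_cast hδ'.trans hS)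
    have hHs' : ∀ {S : ℝ≥0}, δ ≤ S → ∀ x ∈ openPi, ‖β x.2 + H x‖ ≤ S := fun hS x hx =>
      (hHs x hx).trans (by exact_mod_cast hδ'.trans hS)
    have p1 := fun c => hp.gradBound_radial hγ hn c
    have p2 := fun c => hp.gradBound_angular hγ hn c
    have p3 := fun c => hp.gradBound_fst hγ hn c
    have p4 := hp.gradBound_add hγ hn
    rw [hδ''] at p1 p2 p3 p4
    have hVΩ : MapsTo (fun x : ℝ × Circ => α x.2 + W x + (β x.2 + H x)) openPi Ω := fun x hx =>
      (q5 _ (hU hx) _ (hHs' l5 x hx)).1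
    have hβΩ : ∀ θ, α θ + β θ ∈ Ω := fun θ => (q5 _ (hα θ) _ (hβs' l5 θ)).1
    have k0 := q0 β H β₂ h₁ h₂ (hp' l0) (hβs' l0) (hHs' l0)
    have k1 := q1 β H β₂ h₁ h₂ (hp' l1) (hβs' l1) (hHs' l1)
    have k2 := q2 β H β₂ h₁ h₂ (hp' l2) (hβs' l2) (hHs' l2)
    have k3 := q3 (fun x => β x.2 + H x) h₁ (fun x => β₂ x + h₂ x) hp.continuousOn (by simp)
      hp.radial hp.angular ((p1 true).mono l3) (p4.mono l3) (hHs' l3)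
    have k4 := q4 (fun x => β x.2 + H x) h₁ (fun x => β₂ x + h₂ x) hp.continuousOn (by simp)
      hp.radial hp.angular ((p1 true).mono l4) (p4.mono l4) (hHs' l4)
    have hB : ∀ s : ℝ, |s| ≤ 1 → IsMultiplier γ false true k (fun x =>
        wirtinger s (fderiv ℝ g (α x.2 + W x)) - wirtinger s (fderiv ℝ g (α x.2))) B := fun s hs =>
      h.isMultiplier_sub hγ hn hΩ hZ hα hU (by omega) (hw1 s) (hM.wirtinger hΩ hg hZ hs)
    have hN : ∀ s : ℝ, |s| ≤ 1 → IsMultiplier γ true true k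
        (fun x => wirtinger s (fderiv ℝ g (α x.2 + W x))) N := fun s hs =>
      h.isMultiplier_comp hγ hn hΩ hZ hU (by omega) (hw0 s)
        ((hM.wirtinger hΩ hg hZ hs).of_le (by omega))
    have s1 := (hB (-1) (by simp)).add k1
    have s2 := (hB 1 (by simp)).add k2
    have s3 := (hN (-1) (by simp)).add k3
    have s4 := (hN 1 (by simp)).add k4
    simp only [add_sub_cancel] at s1 s2 s3 s4
    simp only [← map_sub] at k1 k2 k3 k4 s1 s2
    have hkn : k ≤ n := by omega
    have t1 := IsGradBound.clm_apply k3 k4 ((h.gradBound_radial hγ hn false).of_le hkn)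
    have t2 := IsGradBound.clm_apply s3 s4 ((p1 false).of_le hkn)
    have t3 := IsGradBound.clm_apply k1 k2 ((h.gradBound_fst hγ hn false).of_le hkn)
    have t4 := IsGradBound.clm_apply s1 s2 ((p3 false).of_le hkn)
    have t5 := IsGradBound.clm_apply k3 k4 ((h.gradBound_angular hγ hn false).of_le hkn)
    have t6 := IsGradBound.clm_apply s3 s4 ((p2 false).of_le hkn)
    have b1 : ε₁ * P ≤ ε / 16 := nnreal_small_mul _ _
    have b2 : δ * (N + B + ε₁) ≤ ε / 16 := (mul_le_mul_left l6 _).trans (nnreal_small_mul _ _)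
    have b3 : (N + ε₁) * δ ≤ ε / 16 := by
      rw [mul_comm]
      refine le_trans ?_ b2
      gcongr
      exact le_self_add
    have b4 : (B + ε₁) * δ ≤ ε / 16 := by
      rw [mul_comm]
      refine le_trans ?_ b2
      gcongr
      exact le_add_self
    have hr := (((h.radial.add hp.radial).comp (h.continuousOn.add hp.continuousOn) hΩ hg1 hVΩ).sub
      (HasRadialDeriv.of_radial (u := fun x => g (α x.2 + β x.2)) (α := fun θ => g (α θ + β θ))
        EventuallyEq.rfl)).sub ((h.radial.comp h.continuousOn hΩ hg1 hUΩ).sub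
      (HasRadialDeriv.of_radial (u := fun x => g (α x.2)) (α := fun θ => g (α θ)) EventuallyEq.rfl))
    simp only [Pi.zero_apply, sub_zero] at hr
    have ha := (((h.angular.add hp.angular).comp (h.continuousOn.add hp.continuousOn) hΩ hg1 hVΩ).sub
      ((h.angular_fst.add hp.angular_fst).comp (h.continuousOn_fst.add hp.continuousOn_fst) hΩ hg1
        fun x _ => hβΩ x.2)).sub ((h.angular.comp h.continuousOn hΩ hg1 hUΩ).sub
      (h.angular_fst.comp h.continuousOn_fst hΩ hg1 hαΩ))
    have e : ε = 2 * (ε / 2) := (mul_div_cancel₀ _ two_ne_zero).symm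
    rw [e]
    refine IsMultiplier.succ k0 hr ha ?_ ?_
    · convert! (t1.add t2).mono (N' := ε / 2) ?_ using 2 with x
      · simp only [sub_apply, map_add]
        ring
      · calc _ = 2 * (ε₁ * P) + 2 * ((N + ε₁) * δ) := by ring
          _ ≤ 2 * (ε / 16) + 2 * (ε / 16) := by gcongr
          _ ≤ 2 * (ε / 16) + 2 * (ε / 16) + ε / 4 := le_self_add
          _ = ε / 2 := by rw [← NNReal.coe_inj]; push_cast; ring
    -- The four terms are: the double difference of Dg applied to ξ₂; the bracket of Dg at the
    -- perturbed functions applied to β₂; Dg(U') − Dg(U) applied to w₂; Dg(U') applied to h₂. Each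
    -- is at most ε/8.
    · convert! (((t3.add t4).add t5).add t6).mono (N' := ε / 2) ?_ using 2 with x
      · simp only [sub_apply, map_add]
        ring
      · calc _ = 2 * (ε₁ * P) + 2 * ((B + ε₁) * δ) + 2 * (ε₁ * P) + 2 * ((N + ε₁) * δ) := by ring
          _ ≤ 2 * (ε / 16) + 2 * (ε / 16) + 2 * (ε / 16) + 2 * (ε / 16) := by gcongr
          _ = ε / 2 := by rw [← NNReal.coe_inj]; push_cast; ring

end SplitData

end Kondratev

namespace Kondratev

variable {𝕜 : Type*} [RCLike 𝕜]

open scoped NNReal ENNReal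

/-! ### Fourier uniqueness for integrable functions on the circle -/

theorem norm_smul_re_le (z : ℂ) (a : 𝕜) : ‖z.re • a‖ ≤ ‖z‖ * ‖a‖ := by
  rw [norm_smul]
  exact mul_le_mul_of_nonneg_right (Complex.abs_re_le_norm z) (norm_nonneg _)

theorem integrable_re_smul {f : Circ → 𝕜} (hf : Integrable f) (b : C(Circ, ℂ)) :
    Integrable fun x => (b x).re • f x :=
  integrable_circ_smul (Complex.continuous_re.comp b.continuous) hf

theorem integrable_im_smul {f : Circ → 𝕜} (hf : Integrable f) (b : C(Circ, ℂ)) :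
    Integrable fun x => (b x).im • f x :=
  integrable_circ_smul (Complex.continuous_im.comp b.continuous) hf

theorem continuous_integral_re_smul {f : Circ → 𝕜} (hf : Integrable f) :
    Continuous fun b : C(Circ, ℂ) => ∫ x, (b x).re • f x := by
  rw [continuous_iff_continuousAt]
  intro b₀
  refine continuousAt_of_dominated (bound := fun x => (‖b₀‖ + 1) * ‖f x‖)
    (Eventually.of_forall fun b => (integrable_re_smul hf b).aestronglyMeasurable) ?_
    (hf.norm.const_mul _) (Eventually.of_forall fun x => ?_)
  · filter_upwards [Metric.ball_mem_nhds b₀ one_pos] with b hb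
    refine Eventually.of_forall fun x => (norm_smul_re_le _ _).trans ?_
    gcongr
    calc ‖b x‖ ≤ ‖b‖ := b.norm_coe_le_norm x
      _ ≤ ‖b₀‖ + ‖b - b₀‖ := norm_le_norm_add_norm_sub' _ _
      _ ≤ _ := by
        gcongr
        rw [← dist_eq_norm]
        exact (Metric.mem_ball.1 hb).le
  · exact (by fun_prop : Continuous fun b : C(Circ, ℂ) => (b x).re • f x).continuousAt

theorem integral_mul_I_re_smul (f : Circ → 𝕜) (b : C(Circ, ℂ)) :
    ∫ x, (((Complex.I • b : C(Circ, ℂ)) x).re) • f x = - ∫ x, (b x).im • f x := by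
  rw [← integral_neg]
  refine integral_congr_ae (Eventually.of_forall fun x => ?_)
  simp

/-- An integrable function on the circle whose real Fourier coefficients vanish is zero. -/
theorem ae_eq_zero_of_fourier {f : Circ → 𝕜} (hf : Integrable f)
    (hc : ∀ n : ℤ, ∫ x : Circ, (fourier n x : ℂ).re • f x = 0)
    (hs : ∀ n : ℤ, ∫ x : Circ, (fourier n x : ℂ).im • f x = 0) : f =ᵐ[volume] 0 := by
  have him : ∀ b : C(Circ, ℂ), ∫ x, (b x).im • f x =
      - ∫ x, (((Complex.I • b : C(Circ, ℂ)) x).re) • f x := fun b => by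
    rw [integral_mul_I_re_smul, neg_neg]
  -- The values of `f` are in `𝕜` while the Fourier modes are complex, so the pairing uses real and
  -- imaginary parts as real scalars. Requiring both pairings to vanish makes the set a complex
  -- subspace. It is closed and contains the modes, hence is everything.
  let P : Submodule ℂ C(Circ, ℂ) :=
    { carrier := {b | ∫ x, (b x).re • f x = 0 ∧ ∫ x, (b x).im • f x = 0}
      zero_mem' := by simp
      add_mem' := by
        rintro a b ⟨h1, h2⟩ ⟨h3, h4⟩
        refine ⟨?_, ?_⟩
        · simp only [ContinuousMap.add_apply, Complex.add_re, add_smul]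
          rw [integral_add (integrable_re_smul hf a) (integrable_re_smul hf b), h1, h3, add_zero]
        · simp only [ContinuousMap.add_apply, Complex.add_im, add_smul]
          rw [integral_add (integrable_im_smul hf a) (integrable_im_smul hf b), h2, h4, add_zero]
      smul_mem' := by
        rintro c b ⟨h1, h2⟩
        refine ⟨?_, ?_⟩
        · simp only [ContinuousMap.smul_apply, smul_eq_mul, Complex.mul_re, sub_smul, mul_smul]
          have g1 : Integrable fun x => c.re • (b x).re • f x :=
            integrable_circ_smul continuous_const (integrable_re_smul hf b)
          have g2 : Integrable fun x => c.im • (b x).im • f x :=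
            integrable_circ_smul continuous_const (integrable_im_smul hf b)
          rw [integral_sub g1 g2, integral_smul, integral_smul, h1, h2]
          simp
        · simp only [ContinuousMap.smul_apply, smul_eq_mul, Complex.mul_im, add_smul, mul_smul]
          have g1 : Integrable fun x => c.re • (b x).im • f x :=
            integrable_circ_smul continuous_const (integrable_im_smul hf b)
          have g2 : Integrable fun x => c.im • (b x).re • f x :=
            integrable_circ_smul continuous_const (integrable_re_smul hf b)
          rw [integral_add g1 g2, integral_smul, integral_smul, h1, h2]
          simp }
  have hP : IsClosed (P : Set C(Circ, ℂ)) := by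
    refine (isClosed_eq (continuous_integral_re_smul hf) continuous_const).inter
      (isClosed_eq ?_ continuous_const)
    simp only [him]
    exact ((continuous_integral_re_smul hf).comp (continuous_const_smul Complex.I)).neg
  have htop : (⊤ : Submodule ℂ C(Circ, ℂ)) ≤ P := by
    rw [← span_fourier_closure_eq_top]
    refine Submodule.topologicalClosure_minimal _ (Submodule.span_le.2 ?_) hP
    rintro _ ⟨n, rfl⟩
    exact ⟨hc n, hs n⟩
  have hreal : ∀ b : Circ → ℝ, Continuous b → ∫ x, b x • f x = 0 := fun b hb => by
    have := (htop (x := ⟨fun x => (b x : ℂ), Complex.continuous_ofReal.comp hb⟩) trivial).1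
    simpa using this
  -- Indicators of closed sets are dominated limits of continuous functions.
  refine ae_eq_zero_of_forall_setIntegral_isClosed_eq_zero hf fun F hF => ?_
  have hpos : ∀ n : ℕ, 0 < (1 : ℝ) / (n + 1) := fun n => Nat.one_div_pos_of_nat
  have h1 : Tendsto (fun n : ℕ => ∫ x, (thickenedIndicator (hpos n) F x : ℝ) • f x) atTop
      (𝓝 (∫ x, F.indicator f x)) := by
    refine tendsto_integral_of_dominated_convergence (fun x => ‖f x‖) (fun n => ?_) hf.norm
      (fun n => Eventually.of_forall fun x => ?_) (Eventually.of_forall fun x => ?_)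
    · exact (integrable_circ_smul (NNReal.continuous_coe.comp
        (thickenedIndicator (hpos n) F).continuous) hf).aestronglyMeasurable
    · rw [norm_smul]
      refine mul_le_of_le_one_left (norm_nonneg _) ?_
      simpa using thickenedIndicator_le_one (hpos n) F x
    · have h2 := tendsto_pi_nhds.1 (thickenedIndicator_tendsto_indicator_closure hpos
        tendsto_one_div_add_atTop_nhds_zero_nat F) x
      rw [hF.closure_eq] at h2
      have h3 := (NNReal.tendsto_coe.2 h2).smul_const (f x)
      convert! h3 using 2
      by_cases hx : x ∈ F <;> simp [hx]
  rw [integral_indicator hF.measurableSet] at h1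
  refine tendsto_nhds_unique h1 ?_
  exact (tendsto_congr fun n => hreal _ (NNReal.continuous_coe.comp
    (thickenedIndicator (hpos n) F).continuous)).2 tendsto_const_nhds

/-! ### Weak and absolutely continuous derivatives on the circle -/

theorem circ_integral_eq (f : Circ → 𝕜) : ∫ x, f x = ∫ s in (0 : ℝ)..(2 * Real.pi), f (s : Circ) := by
  have := AddCircle.intervalIntegral_preimage (2 * Real.pi) 0 f
  rw [zero_add] at this
  exact this.symm

theorem circDeriv_one_coe {b : Circ → ℝ} (s : ℝ) :
    circDeriv 1 b (s : Circ) = deriv (fun t : ℝ => b (t : Circ)) s := by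
  have := deriv_comp_const_add (fun t : ℝ => b (t : Circ)) s 0
  simp only [add_zero] at this
  rw [← this]
  simp [circDeriv, iteratedDeriv_one]

theorem IsCircTest.hasDerivAt {b : Circ → ℝ} (hb : IsCircTest b) (s : ℝ) :
    HasDerivAt (fun t : ℝ => b (t : Circ)) (circDeriv 1 b (s : Circ)) s := by
  rw [circDeriv_one_coe]
  exact (ContDiff.differentiable hb (by simp) s).hasDerivAt

theorem continuous_coe_circ : Continuous ((↑) : ℝ → Circ) := AddCircle.continuous_mk' _

theorem IsPrimitiveOn.real_smul {I : Set ℝ} [I.OrdConnected] {u v : ℝ → 𝕜} {a a' : ℝ → ℝ}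
    (h : IsPrimitiveOn I u v) (ha : ∀ x ∈ I, HasDerivAt a (a' x) x) (hc : ContinuousOn a' I) :
    IsPrimitiveOn I (fun x => a x • u x) (fun x => a' x • u x + a x • v x) := by
  have h1 : IsPrimitiveOn I (fun x => (algebraMap ℝ 𝕜) (a x)) (fun x => (algebraMap ℝ 𝕜) (a' x)) :=
    (IsPrimitiveOn.of_hasDerivAt ha hc).clm_comp (RCLike.ofRealCLM : ℝ →L[ℝ] 𝕜)
  simpa only [Algebra.smul_def] using h1.mul h

/-- Integration by parts on the circle. -/
theorem integral_circDeriv_smul {u v : Circ → 𝕜} {b : Circ → ℝ} (hb : IsCircTest b)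
    (h : HasACDeriv univ (fun s : ℝ => u (s : Circ)) (fun s => v (s : Circ))) :
    ∫ x, circDeriv 1 b x • u x = - ∫ x, b x • v x := by
  obtain ⟨U, hU, hp⟩ := h
  rw [Measure.restrict_univ] at hU
  have h1 := hp.real_smul (a := fun t : ℝ => b (t : Circ)) (fun s _ => hb.hasDerivAt s)
    ((continuous_circDeriv hb 1).comp continuous_coe_circ).continuousOn
  have hv := hp.int 0 (mem_univ _) (2 * Real.pi) (mem_univ _)
  have hUc : Continuous U := by
    rw [← continuousOn_univ]
    exact hp.continuousOn isOpen_univ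
  have hbc : Continuous fun t : ℝ => b (t : Circ) := ContDiff.continuous hb
  have hb'c : Continuous fun t : ℝ => circDeriv 1 b (t : Circ) :=
    (continuous_circDeriv hb 1).comp continuous_coe_circ
  have h2 := h1.eq 0 (mem_univ _) (2 * Real.pi) (mem_univ _)
  have i1 : IntervalIntegrable (fun s : ℝ => circDeriv 1 b (s : Circ) • U s) volume 0 (2 * Real.pi) :=
    (hb'c.smul hUc).intervalIntegrable _ _
  have i2 : IntervalIntegrable (fun s : ℝ => b (s : Circ) • v (s : Circ)) volume 0 (2 * Real.pi) :=
    hv.continuousOn_smul hbc.continuousOn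
  rw [intervalIntegral.integral_add i1 i2] at h2
  -- The boundary terms cancel because the continuous primitive coincides almost everywhere with a
  -- periodic function and is therefore periodic.
  have hper : U (2 * Real.pi) = U 0 := by
    have e : (fun s => U (s + 2 * Real.pi)) = U := by
      refine Continuous.ae_eq_iff_eq volume (by fun_prop) hUc |>.1 ?_
      have hU' : ∀ᵐ s : ℝ, U (s + 2 * Real.pi) = u ((s + 2 * Real.pi : ℝ) : Circ) :=
        (measurePreserving_add_right volume (2 * Real.pi)).quasiMeasurePreserving.ae hU
      filter_upwards [hU, hU'] with s h3 h4
      rw [h3, h4]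
      congr 1
      exact AddCircle.coe_add_period (2 * Real.pi) s
    simpa using congrFun e 0
  have hb0 : b ((2 * Real.pi : ℝ) : Circ) = b ((0 : ℝ) : Circ) := by
    rw [AddCircle.coe_period]
    rfl
  rw [hper, hb0, sub_self] at h2
  rw [circ_integral_eq, circ_integral_eq, eq_neg_iff_add_eq_zero, h2]
  congr 1
  refine intervalIntegral.integral_congr_ae ?_
  filter_upwards [hU] with s hs _
  rw [hs]

theorem isCircTest_fourier_re (n : ℤ) : IsCircTest fun x => (fourier n x : ℂ).re := by
  unfold IsCircTest
  simp only [fourier_coe_apply]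
  refine Complex.reCLM.contDiff.comp ?_
  refine Complex.contDiff_exp.comp ?_
  exact ((contDiff_const.mul Complex.ofRealCLM.contDiff)).div_const _

theorem isCircTest_fourier_im (n : ℤ) : IsCircTest fun x => (fourier n x : ℂ).im := by
  unfold IsCircTest
  simp only [fourier_coe_apply]
  refine Complex.imCLM.contDiff.comp ?_
  refine Complex.contDiff_exp.comp ?_
  exact ((contDiff_const.mul Complex.ofRealCLM.contDiff)).div_const _

theorem circDeriv_fourier (n : ℤ) (x : Circ) :
    circDeriv 1 (fun x => (fourier n x : ℂ).re) x = -n * (fourier n x : ℂ).im ∧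
    circDeriv 1 (fun x => (fourier n x : ℂ).im) x = n * (fourier n x : ℂ).re := by
  obtain ⟨s, rfl⟩ := QuotientAddGroup.mk_surjective x
  have e : (2 * Real.pi * Complex.I * n / (2 * Real.pi : ℝ) : ℂ) = Complex.I * n := by
    have : (Real.pi : ℂ) ≠ 0 := by exact_mod_cast Real.pi_ne_zero
    push_cast
    field_simp
  have h1 : HasDerivAt (fun t : ℝ => (fourier n (t : Circ) : ℂ))
      (Complex.I * n * fourier n (s : Circ)) s := by
    have := hasDerivAt_fourier (2 * Real.pi) n s
    rw [← e]
    convert! this using 1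
  constructor
  · refine (circDeriv_one_coe s).trans ?_
    refine ((Complex.reCLM.hasFDerivAt.comp_hasDerivAt s h1).deriv).trans ?_
    simp [mul_assoc]
  · refine (circDeriv_one_coe s).trans ?_
    refine ((Complex.imCLM.hasFDerivAt.comp_hasDerivAt s h1).deriv).trans ?_
    simp [mul_assoc]

theorem intervalIntegrable_coe {g : Circ → 𝕜} (hg : Integrable g) (a b : ℝ) :
    IntervalIntegrable (fun s : ℝ => g (s : Circ)) volume a b := by
  have hper : Function.Periodic (fun s : ℝ => g (s : Circ)) (2 * Real.pi) := fun s => by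
    simp only [AddCircle.coe_add_period]
  refine hper.intervalIntegrable Real.two_pi_pos.ne' (t := 0) ?_ a b
  rw [intervalIntegrable_iff_integrableOn_Ioc_of_le (by simpa using Real.two_pi_pos.le)]
  exact (AddCircle.measurePreserving_mk (2 * Real.pi) 0).integrable_comp_of_integrable hg

theorem isPrimitiveOn_integral {g : ℝ → 𝕜} (hg : ∀ a b, IntervalIntegrable g volume a b) (c : ℝ) :
    IsPrimitiveOn univ (fun s => ∫ t in c..s, g t) g :=
  ⟨fun a _ b _ => hg a b, fun a _ b _ =>
    intervalIntegral.integral_interval_sub_left (hg c b) (hg c a)⟩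

theorem hasACDeriv_const {I : Set ℝ} (c : 𝕜) : HasACDeriv I (fun _ => c) (fun _ => 0) :=
  ⟨fun _ => c, EventuallyEq.rfl, fun _ _ _ _ => intervalIntegrable_const, fun _ _ _ _ => by simp⟩

/-- A weak derivative on the circle is a derivative in the sense of absolute continuity. -/
theorem hasACDeriv_of_fourier {f g : Circ → 𝕜} (hf : Integrable f) (hg : Integrable g)
    (h : ∀ b : Circ → ℝ, (∃ n : ℤ, (b = fun x => (fourier n x : ℂ).re) ∨
      b = fun x => (fourier n x : ℂ).im) → ∫ x, circDeriv 1 b x • f x = - ∫ x, b x • g x) :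
    HasACDeriv univ (fun s : ℝ => f (s : Circ)) (fun s => g (s : Circ)) := by
  -- The mode n = 0 is the constant test function. It gives `g` mean zero, so the primitive of `g`
  -- descends to the circle.
  have hg0 : ∫ x, g x = 0 := by
    have := h _ ⟨0, Or.inl rfl⟩
    simp only [circDeriv_fourier] at this
    simpa using this.symm
  have hgi := intervalIntegrable_coe hg
  set V : ℝ → 𝕜 := fun s => ∫ t in (0 : ℝ)..s, g (t : Circ) with hVd
  have hp : IsPrimitiveOn univ V (fun s => g (s : Circ)) := isPrimitiveOn_integral hgi 0
  have hVc : Continuous V := by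
    rw [← continuousOn_univ]
    exact hp.continuousOn isOpen_univ
  have hper : Function.Periodic V (2 * Real.pi) := fun s => by
    have h1 := hp.eq s (mem_univ _) (s + 2 * Real.pi) (mem_univ _)
    rw [AddCircle.intervalIntegral_preimage, hg0] at h1
    exact sub_eq_zero.1 h1
  have hlc : Continuous hper.lift := by
    have hq : IsOpenQuotientMap ((↑) : ℝ → Circ) := QuotientAddGroup.isOpenQuotientMap_mk
    rw [hq.isQuotientMap.continuous_iff]
    exact hVc
  have hl : HasACDeriv univ (fun s : ℝ => hper.lift (s : Circ)) (fun s => g (s : Circ)) :=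
    ⟨V, EventuallyEq.rfl, hp⟩
  have hli : Integrable hper.lift := hlc.integrable_of_hasCompactSupport (HasCompactSupport.of_compactSpace _)
  -- The constant is the mean of the difference; it takes care of the mode n = 0, which derivatives
  -- of modes do not detect.
  set c : 𝕜 := (2 * Real.pi)⁻¹ • ∫ x, (f x - hper.lift x)
  have hci : Integrable (fun _ : Circ => c) := integrable_const c
  have hD : Integrable fun x => f x - hper.lift x - c := (hf.sub hli).sub hci
  have hzero : ∀ b : Circ → ℝ, IsCircTest b → (∃ n : ℤ, (b = fun x => (fourier n x : ℂ).re) ∨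
      b = fun x => (fourier n x : ℂ).im) →
      ∫ x, circDeriv 1 b x • (f x - hper.lift x - c) = 0 := by
    intro b hb hb'
    have hbc := continuous_circDeriv hb 1
    have e1 := integral_circDeriv_smul hb hl
    have e2 := integral_circDeriv_smul hb (u := fun _ => c) (v := fun _ => 0) (hasACDeriv_const c)
    simp only [smul_sub]
    have hi : Integrable fun x => circDeriv 1 b x • f x - circDeriv 1 b x • hper.lift x :=
      (integrable_circ_smul hbc hf).sub (integrable_circ_smul hbc hli)
    rw [integral_sub hi (integrable_circ_smul hbc hci), integral_sub (integrable_circ_smul hbc hf)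
      (integrable_circ_smul hbc hli), h b hb', e1, e2]
    simp
  have hmean : ∫ x, (f x - hper.lift x - c) = 0 := by
    have hi : Integrable fun x => f x - hper.lift x := hf.sub hli
    rw [integral_sub hi hci, integral_const, measureReal_def, AddCircle.measure_univ,
      ENNReal.toReal_ofReal Real.two_pi_pos.le]
    simp only [c]
    rw [smul_inv_smul₀ Real.two_pi_pos.ne', sub_self]
  -- For n ≠ 0 each mode is, up to the factor n, a derivative of another mode. Only these test
  -- functions are needed, and they are countable, which is what permits slicing on the annulus.
  have hae : (fun x => f x - hper.lift x - c) =ᵐ[volume] 0 := by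
    refine ae_eq_zero_of_fourier hD (fun n => ?_) (fun n => ?_)
    · rcases eq_or_ne n 0 with rfl | hn
      · simpa using hmean
      · have h1 := hzero _ (isCircTest_fourier_im n) ⟨n, Or.inr rfl⟩
        simp only [circDeriv_fourier, mul_smul] at h1
        rw [integral_smul] at h1
        exact (smul_eq_zero.1 h1).resolve_left (by exact_mod_cast hn)
    · rcases eq_or_ne n 0 with rfl | hn
      · simp
      · have h1 := hzero _ (isCircTest_fourier_re n) ⟨n, Or.inl rfl⟩
        simp only [circDeriv_fourier, mul_smul] at h1
        rw [integral_smul] at h1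
        exact (smul_eq_zero.1 h1).resolve_left (by simpa using hn)
  refine ⟨fun s => V s + c, ?_, ?_⟩
  · rw [Measure.restrict_univ]
    filter_upwards [ae_coe_circ hae] with s hs
    have : f (s : Circ) - V s - c = 0 := hs
    rw [sub_sub, sub_eq_zero] at this
    exact this.symm
  · exact ⟨hp.int, fun a ha b hb => by rw [← hp.eq a ha b hb]; ring⟩

end Kondratev

namespace Kondratev

variable {𝕜 : Type*} [RCLike 𝕜]

open scoped NNReal ENNReal

/-! ### Weak derivatives on the interval -/

/-- Smooth functions supported in a compact subinterval of `(0,1)`. -/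
structure IsRadialTest (a : ℝ → ℝ) : Prop where
  smooth : ContDiff ℝ ∞ a
  support : ∃ α β, 0 < α ∧ α < β ∧ β < 1 ∧ ∀ x, x ∉ Icc α β → a x = 0

theorem exists_Icc_of_isCompact {K : Set ℝ} (hK : IsCompact K) (h : K ⊆ Ioo 0 1) :
    ∃ α β, 0 < α ∧ α < β ∧ β < 1 ∧ K ⊆ Icc α β := by
  have hc : IsCompact (insert (1 / 2) K) := hK.insert _
  obtain ⟨x, hx, hx'⟩ := hc.exists_isLeast (insert_nonempty _ _)
  obtain ⟨y, hy, hy'⟩ := hc.exists_isGreatest (insert_nonempty _ _)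
  have hsub : insert (1 / 2) K ⊆ Ioo (0 : ℝ) 1 := insert_subset (by norm_num) h
  have h1 := hsub hx
  have h2 := hsub hy
  have h3 : x ≤ y := hx' hy
  refine ⟨x / 2, (1 + y) / 2, by linarith [h1.1], by linarith [h1.1, h2.2], by linarith [h2.2],
    fun z hz => ?_⟩
  have h4 : x ≤ z := hx' (mem_insert_of_mem _ hz)
  have h5 : z ≤ y := hy' (mem_insert_of_mem _ hz)
  exact ⟨by linarith [h1.1], by linarith [h2.2]⟩

theorem IsRadialTest.of_tsupport {a : ℝ → ℝ} (ha : ContDiff ℝ ∞ a) (hc : HasCompactSupport a)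
    (hs : tsupport a ⊆ Ioo 0 1) : IsRadialTest a := by
  obtain ⟨α, β, h1, h2, h3, h4⟩ := exists_Icc_of_isCompact hc hs
  exact ⟨ha, α, β, h1, h2, h3, fun x hx => image_eq_zero_of_notMem_tsupport fun h => hx (h4 h)⟩

theorem IsRadialTest.deriv {a : ℝ → ℝ} (ha : IsRadialTest a) : IsRadialTest (deriv a) := by
  obtain ⟨hs, α, β, h1, h2, h3, h4⟩ := ha
  refine ⟨((contDiff_infty_iff_deriv).1 hs).2, α, β, h1, h2, h3, fun x hx => ?_⟩
  have : a =ᶠ[𝓝 x] fun _ => 0 := by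
    filter_upwards [isClosed_Icc.isOpen_compl.mem_nhds hx] with y hy using h4 y hy
  rw [this.deriv_eq]
  simp

theorem integrableOn_Icc_of_locallyIntegrableOn {f : ℝ → 𝕜}
    (hf : LocallyIntegrableOn f (Ioo 0 1)) {α β : ℝ} (hα : 0 < α) (hβ : β < 1) :
    IntegrableOn f (Icc α β) :=
  hf.integrableOn_compact_subset (Icc_subset_Ioo hα hβ) isCompact_Icc

theorem locallyIntegrableOn_of_Icc {f : ℝ → 𝕜}
    (hf : ∀ α β, 0 < α → β < 1 → IntegrableOn f (Icc α β)) : LocallyIntegrableOn f (Ioo 0 1) := by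
  intro x hx
  refine ⟨Icc (x / 2) ((1 + x) / 2), mem_nhdsWithin_of_mem_nhds
    (Icc_mem_nhds (by linarith [hx.1]) (by linarith [hx.2])), hf _ _ (by linarith [hx.1]) (by linarith [hx.2])⟩

theorem setIntegral_Ioo_eq_intervalIntegral {f : ℝ → 𝕜} {α β : ℝ} (hα : 0 < α) (hαβ : α < β)
    (hβ : β < 1) (h0 : ∀ x, x ∉ Icc α β → f x = 0) :
    ∫ x in Ioo (0 : ℝ) 1, f x = ∫ x in α..β, f x := by
  rw [intervalIntegral.integral_of_le hαβ.le, ← integral_Icc_eq_integral_Ioc]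
  exact (setIntegral_eq_of_subset_of_forall_sdiff_eq_zero measurableSet_Ioo
    (Icc_subset_Ioo hα hβ) fun x hx => h0 x hx.2)

theorem integrableOn_radialTest_smul {f : ℝ → 𝕜} (hf : LocallyIntegrableOn f (Ioo 0 1))
    {a : ℝ → ℝ} (ha : IsRadialTest a) : IntegrableOn (fun x => a x • f x) (Ioo 0 1) := by
  obtain ⟨hs, α, β, h1, h2, h3, h4⟩ := ha
  have h5 := (integrableOn_Icc_of_locallyIntegrableOn hf h1 h3).continuousOn_smul
    hs.continuous.continuousOn isCompact_Icc
  refine IntegrableOn.mono_set ?_ (subset_univ _)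
  rw [integrableOn_univ, ← integrableOn_iff_integrable_of_support_subset (s := Icc α β)]
  · exact h5
  · intro x hx
    by_contra hxK
    exact hx (by simp [h4 x hxK])

/-- Integration by parts on the interval. -/
theorem integral_deriv_smul {f g : ℝ → 𝕜} (h : HasACDeriv (Ioo (0 : ℝ) 1) f g) {a a' : ℝ → ℝ}
    (ha : ∀ x, HasDerivAt a (a' x) x) (hc : Continuous a') {α β : ℝ} (hα : 0 < α) (hαβ : α < β)
    (hβ : β < 1) (h0 : ∀ x, x ∉ Icc α β → a x = 0) :
    ∫ x in Ioo (0 : ℝ) 1, a' x • f x = - ∫ x in Ioo (0 : ℝ) 1, a x • g x := by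
  obtain ⟨U, hU, hp⟩ := h
  have hac : Continuous a := continuous_iff_continuousAt.2 fun x => (ha x).continuousAt
  have h0' : ∀ x, x ∉ Icc α β → a' x = 0 := fun x hx => by
    have : a =ᶠ[𝓝 x] fun _ => 0 := by
      filter_upwards [isClosed_Icc.isOpen_compl.mem_nhds hx] with y hy using h0 y hy
    rw [← (ha x).deriv, this.deriv_eq]
    simp
  have e1 : ∫ x in Ioo (0 : ℝ) 1, a' x • f x = ∫ x in Ioo (0 : ℝ) 1, a' x • U x := by
    refine integral_congr_ae ?_
    filter_upwards [hU] with x hx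
    rw [hx]
  -- The interval is enlarged slightly so that the test function vanishes at the new endpoints and
  -- no boundary term survives.
  obtain ⟨α', hα', hα''⟩ := exists_between hα
  obtain ⟨β', hβ', hβ''⟩ := exists_between hβ
  have hsub : Icc α β ⊆ Icc α' β' := Icc_subset_Icc hα''.le hβ'.le
  rw [e1, setIntegral_Ioo_eq_intervalIntegral hα' (hα''.trans (hαβ.trans hβ')) hβ''
      (fun x hx => by rw [h0' x fun h => hx (hsub h), zero_smul]),
    setIntegral_Ioo_eq_intervalIntegral hα' (hα''.trans (hαβ.trans hβ')) hβ''
      (fun x hx => by rw [h0 x fun h => hx (hsub h), zero_smul])]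
  have hm1 : α' ∈ Ioo (0 : ℝ) 1 := ⟨hα', by linarith⟩
  have hm2 : β' ∈ Ioo (0 : ℝ) 1 := ⟨by linarith, hβ''⟩
  have h1 := (hp.real_smul (fun x _ => ha x) hc.continuousOn).eq α' hm1 β' hm2
  have i1 : IntervalIntegrable (fun x => a' x • U x) volume α' β' :=
    (hc.continuousOn.smul (hp.continuousOn_uIcc hm1 hm2)).intervalIntegrable
  have i2 : IntervalIntegrable (fun x => a x • g x) volume α' β' :=
    (hp.int _ hm1 _ hm2).continuousOn_smul hac.continuousOn
  rw [intervalIntegral.integral_add i1 i2, h0 α' (fun h => absurd h.1 (by linarith)),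
    h0 β' (fun h => absurd h.2 (by linarith)), zero_smul, zero_smul, sub_self] at h1
  exact eq_neg_of_add_eq_zero_left h1.symm

theorem exists_unit_radialTest : ∃ a : ℝ → ℝ, IsRadialTest a ∧ ∫ x in Ioo (0 : ℝ) 1, a x = 1 := by
  let b : ContDiffBump (1 / 2 : ℝ) := ⟨1 / 8, 1 / 4, by norm_num, by norm_num⟩
  have hs : tsupport (b.normed volume) ⊆ Ioo 0 1 := by
    rw [b.tsupport_normed_eq, Real.closedBall_eq_Icc]
    exact Icc_subset_Ioo (by norm_num [b]) (by norm_num [b])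
  refine ⟨b.normed volume, IsRadialTest.of_tsupport b.contDiff_normed b.hasCompactSupport_normed hs,
    ?_⟩
  refine (setIntegral_eq_integral_of_forall_compl_eq_zero fun x hx => ?_).trans
    (b.integral_normed (μ := volume))
  exact image_eq_zero_of_notMem_tsupport fun h => hx (hs h)

/-- The primitive starting at the left end of the support vanishes again beyond the right end
exactly because the integral is zero. -/
theorem IsRadialTest.exists_primitive {a : ℝ → ℝ} (ha : IsRadialTest a)
    (h : ∫ x in Ioo (0 : ℝ) 1, a x = 0) : ∃ A, IsRadialTest A ∧ _root_.deriv A = a := by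
  obtain ⟨hs, α, β, h1, h2, h3, h4⟩ := ha
  have hd : _root_.deriv (fun x => ∫ t in α..x, a t) = a := by
    funext x
    exact hs.continuous.deriv_integral _ _ _
  have hz : ∀ x y, (∀ t ∈ uIoc x y, t ∉ Icc α β ∨ a t = 0) → ∫ t in x..y, a t = 0 := by
    intro x y hxy
    refine (intervalIntegral.integral_congr_ae (g := fun _ => 0)
      (Eventually.of_forall fun t ht => ?_)).trans (by simp)
    rcases hxy t ht with h5 | h5
    exacts [h4 t h5, h5]
  -- The endpoint α itself lies in the support interval, so its value is obtained as a limit from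
  -- the left.
  have hα0 : a α = 0 := by
    have h6 : Tendsto a (𝓝[<] α) (𝓝 (a α)) := hs.continuous.continuousWithinAt
    refine tendsto_nhds_unique h6 (tendsto_const_nhds.congr' ?_)
    filter_upwards [self_mem_nhdsWithin] with t ht
    exact (h4 t fun h => absurd h.1 (not_le.2 ht)).symm
  refine ⟨fun x => ∫ t in α..x, a t, ⟨?_, α, β, h1, h2, h3, fun x hx => ?_⟩, hd⟩
  · rw [contDiff_infty_iff_deriv, hd]
    exact ⟨fun x => (hs.continuous.integral_hasStrictDerivAt α x).hasDerivAt.differentiableAt, hs⟩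
  · rcases lt_or_ge x α with hxα | hxα
    · refine hz _ _ fun t ht => ?_
      rw [uIoc_of_ge hxα.le] at ht
      rcases eq_or_lt_of_le ht.2 with rfl | h5
      exacts [Or.inr hα0, Or.inl fun h => absurd h.1 (not_le.2 h5)]
    · have hxβ : β < x := by
        by_contra h5
        exact hx ⟨hxα, not_lt.1 h5⟩
      rw [setIntegral_Ioo_eq_intervalIntegral h1 h2 h3 h4] at h
      rw [← intervalIntegral.integral_add_adjacent_intervals
        (hs.continuous.intervalIntegrable α β) (hs.continuous.intervalIntegrable β x), h, zero_add]
      refine hz _ _ fun t ht => Or.inl fun h => ?_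
      rw [uIoc_of_le hxβ.le] at ht
      exact absurd h.2 (not_le.2 ht.1)

theorem ae_eq_zero_of_radialTest {h : ℝ → 𝕜} (hh : LocallyIntegrableOn h (Ioo 0 1))
    (h0 : ∀ a, IsRadialTest a → ∫ x in Ioo (0 : ℝ) 1, a x • h x = 0) :
    ∀ᵐ x ∂(volume.restrict (Ioo (0 : ℝ) 1)), h x = 0 := by
  rw [ae_restrict_iff' measurableSet_Ioo]
  refine isOpen_Ioo.ae_eq_zero_of_integral_contDiff_smul_eq_zero hh fun a ha hc hs => ?_
  have hat := IsRadialTest.of_tsupport ha hc hs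
  rw [← h0 a hat]
  refine (setIntegral_eq_integral_of_forall_compl_eq_zero fun x hx => ?_).symm
  rw [image_eq_zero_of_notMem_tsupport fun h => hx (hs h), zero_smul]

/-- A weak derivative on the interval is a derivative in the sense of absolute continuity. -/
theorem hasACDeriv_of_radialTest {f g : ℝ → 𝕜} (hf : LocallyIntegrableOn f (Ioo 0 1))
    (hg : LocallyIntegrableOn g (Ioo 0 1)) (h : ∀ a, IsRadialTest a →
      ∫ x in Ioo (0 : ℝ) 1, deriv a x • f x = - ∫ x in Ioo (0 : ℝ) 1, a x • g x) :
    HasACDeriv (Ioo (0 : ℝ) 1) f g := by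
  have hint : ∀ a ∈ Ioo (0 : ℝ) 1, ∀ b ∈ Ioo (0 : ℝ) 1, IntervalIntegrable g volume a b :=
    fun a ha b hb => (hg.integrableOn_compact_subset
      (Set.OrdConnected.uIcc_subset ordConnected_Ioo ha hb) isCompact_uIcc).intervalIntegrable
  have hm : (1 / 2 : ℝ) ∈ Ioo (0 : ℝ) 1 := by norm_num
  set G : ℝ → 𝕜 := fun x => ∫ t in (1 / 2 : ℝ)..x, g t
  have hp : IsPrimitiveOn (Ioo (0 : ℝ) 1) G g := ⟨hint, fun a ha b hb =>
    intervalIntegral.integral_interval_sub_left (hint _ hm _ hb) (hint _ hm _ ha)⟩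
  have hGl : LocallyIntegrableOn G (Ioo 0 1) :=
    (hp.continuousOn isOpen_Ioo).locallyIntegrableOn measurableSet_Ioo
  have hD : LocallyIntegrableOn (fun x => f x - G x) (Ioo 0 1) := hf.sub hGl
  have h1 : ∀ a, IsRadialTest a → ∫ x in Ioo (0 : ℝ) 1, deriv a x • (f x - G x) = 0 := by
    intro a ha
    obtain ⟨α, β, a1, a2, a3, a4⟩ := ha.support
    have h2 := integral_deriv_smul (f := G) (g := g) ⟨G, EventuallyEq.rfl, hp⟩
      (fun x => (ha.smooth.differentiable (by simp) x).hasDerivAt) ha.deriv.smooth.continuous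
      a1 a2 a3 a4
    simp only [smul_sub]
    rw [integral_sub (integrableOn_radialTest_smul hf ha.deriv)
      (integrableOn_radialTest_smul hGl ha.deriv), h a ha, h2, sub_self]
  obtain ⟨a₀, ha₀, ha₀'⟩ := exists_unit_radialTest
  set c := ∫ x in Ioo (0 : ℝ) 1, a₀ x • (f x - G x)
  have hcl : LocallyIntegrableOn (fun _ : ℝ => c) (Ioo 0 1) :=
    (continuous_const.locallyIntegrable).locallyIntegrableOn _
  have h3 := ae_eq_zero_of_radialTest (h := fun x => f x - G x - c) (hD.sub hcl) fun a ha => ?_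
  · refine ⟨fun x => G x + c, ?_, hint, fun a ha b hb => by rw [← hp.eq a ha b hb]; ring⟩
    filter_upwards [h3] with x hx
    rw [sub_sub, sub_eq_zero] at hx
    exact hx.symm
  · set M := ∫ x in Ioo (0 : ℝ) 1, a x
    have hai : IntegrableOn a (Ioo 0 1) := ha.smooth.continuous.integrableOn_Icc.mono_set Ioo_subset_Icc_self
    have ha₀i : IntegrableOn a₀ (Ioo 0 1) := ha₀.smooth.continuous.integrableOn_Icc.mono_set Ioo_subset_Icc_self
    -- The du Bois-Reymond device: subtracting a multiple of a fixed test function of integral one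
    -- leaves integral zero, so the result is the derivative of a test function.
    have hb : IsRadialTest fun x => a x - M * a₀ x := by
      obtain ⟨s1, α, β, a1, a2, a3, a4⟩ := ha
      obtain ⟨s2, α', β', b1, b2, b3, b4⟩ := ha₀
      refine ⟨s1.sub (contDiff_const.mul s2), min α α', max β β', lt_min a1 b1,
        (min_le_left _ _).trans_lt (a2.trans_le (le_max_left _ _)), max_lt a3 b3, fun x hx => ?_⟩
      rw [a4 x fun h => hx ⟨(min_le_left _ _).trans h.1, h.2.trans (le_max_left _ _)⟩,
        b4 x fun h => hx ⟨(min_le_right _ _).trans h.1, h.2.trans (le_max_right _ _)⟩]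
      simp
    have hb0 : ∫ x in Ioo (0 : ℝ) 1, (a x - M * a₀ x) = 0 := by
      rw [integral_sub hai (ha₀i.const_mul M), integral_const_mul, ha₀']
      simp [M]
    obtain ⟨A, hA, hA'⟩ := hb.exists_primitive hb0
    have h5 := h1 A hA
    rw [hA'] at h5
    simp only [sub_smul, mul_smul] at h5
    have i1 := integrableOn_radialTest_smul hD ha
    have i2 := integrableOn_radialTest_smul hD ha₀
    have i3 : IntegrableOn (fun x => M • a₀ x • (f x - G x)) (Ioo 0 1) := i2.smul M
    rw [integral_sub i1 i3, integral_smul] at h5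
    simp only [smul_sub _ _ c]
    rw [integral_sub i1 (hai.smul_const c), sub_eq_zero.1 h5, integral_smul_const]
    exact sub_self _

end Kondratev

namespace Kondratev

variable {𝕜 : Type*} [RCLike 𝕜]

open scoped NNReal ENNReal

/-! ### Product test functions -/

theorem IsRadialTest.mul_isPiTest {a : ℝ → ℝ} (ha : IsRadialTest a) {b : Circ → ℝ}
    (hb : IsCircTest b) : IsPiTest fun x => a x.1 * b x.2 := by
  obtain ⟨hs, α, β, h1, h2, h3, h4⟩ := ha
  have hK : IsCompact (Icc α β ×ˢ (univ : Set Circ)) := isCompact_Icc.prod isCompact_univ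
  have h0 : ∀ x : ℝ × Circ, x ∉ Icc α β ×ˢ (univ : Set Circ) → a x.1 * b x.2 = 0 := fun x hx => by
    rw [h4 x.1 fun h => hx ⟨h, mem_univ _⟩, zero_mul]
  refine ⟨(hs.comp contDiff_fst).mul (hb.comp contDiff_snd), HasCompactSupport.intro hK h0, ?_⟩
  refine (closure_minimal (fun x hx => ?_) hK.isClosed).trans
    (prod_mono (Icc_subset_Ioo h1 h3) subset_rfl)
  by_contra h
  exact hx (h0 x h)

theorem mixedDeriv_mul (p q : ℕ) (a : ℝ → ℝ) (b : Circ → ℝ) (x : ℝ × Circ) :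
    mixedDeriv p q (fun x => a x.1 * b x.2) x = iteratedDeriv p a x.1 * circDeriv q b x.2 := by
  simp only [mixedDeriv, iteratedDeriv_mul_const_field, iteratedDeriv_const_mul_field, circDeriv]

theorem isCircTest_circDeriv_one {b : Circ → ℝ} (hb : IsCircTest b) :
    IsCircTest (circDeriv 1 b) := by
  unfold IsCircTest
  simp only [circDeriv_one_coe]
  exact (contDiff_infty_iff_deriv.1 hb).2

theorem circDeriv_circDeriv_one (q : ℕ) (b : Circ → ℝ) :
    circDeriv q (circDeriv 1 b) = circDeriv (q + 1) b := by
  funext x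
  simp only [circDeriv, iteratedDeriv_succ', iteratedDeriv_zero]
  congr 1
  funext s
  have := deriv_comp_const_add (fun t : ℝ => b (x + (t : Circ))) s 0
  simp only [add_zero] at this
  rw [← this]
  congr 1
  funext t
  rw [AddCircle.coe_add, add_assoc]

section Products

variable {p q : ℕ} {u v v' : ℝ × Circ → 𝕜} {a : ℝ → ℝ} {b : Circ → ℝ}

/-- Both weak derivatives refer to the same `u`. Testing the lower one with the derivative of the
test function and comparing shows that consecutive members of the family are weak derivatives of
each other. -/
theorem IsPiWeakDeriv.integral_radial (h : IsPiWeakDeriv p q u v)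
    (h' : IsPiWeakDeriv (p + 1) q u v') (ha : IsRadialTest a) (hb : IsCircTest b) :
    ∫ x, (deriv a x.1 * b x.2) • v x ∂muPi = - ∫ x, (a x.1 * b x.2) • v' x ∂muPi := by
  have e1 := h.eq _ (ha.deriv.mul_isPiTest hb)
  have e2 := h'.eq _ (ha.mul_isPiTest hb)
  simp only [mixedDeriv_mul, iteratedDeriv_succ'] at e1 e2
  rw [e1, add_right_comm, pow_succ, mul_neg_one, neg_smul, ← smul_neg] at e2
  exact (smul_right_injective 𝕜 (by simp : ((-1 : ℝ) ^ (p + q)) ≠ 0)) e2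

theorem IsPiWeakDeriv.integral_angular (h : IsPiWeakDeriv p q u v)
    (h' : IsPiWeakDeriv p (q + 1) u v') (ha : IsRadialTest a) (hb : IsCircTest b) :
    ∫ x, (a x.1 * circDeriv 1 b x.2) • v x ∂muPi = - ∫ x, (a x.1 * b x.2) • v' x ∂muPi := by
  have e1 := h.eq _ (ha.mul_isPiTest (isCircTest_circDeriv_one hb))
  have e2 := h'.eq _ (ha.mul_isPiTest hb)
  simp only [mixedDeriv_mul, circDeriv_circDeriv_one] at e1 e2
  rw [e1, ← add_assoc, pow_succ, mul_neg_one, neg_smul, ← smul_neg] at e2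
  exact (smul_right_injective 𝕜 (by simp : ((-1 : ℝ) ^ (p + q)) ≠ 0)) e2

end Products

/-! ### Slices of locally integrable functions -/

section Slices

variable {u v : ℝ × Circ → 𝕜}

theorem integrable_slab (hu : LocallyIntegrableOn u openPi) {α β : ℝ} (hα : 0 < α) (hβ : β < 1) :
    Integrable u ((volume.restrict (Icc α β)).prod (volume : Measure Circ)) := by
  have h1 := hu.integrableOn_compact_subset (t := Icc α β ×ˢ (univ : Set Circ))
    (prod_mono (Icc_subset_Ioo hα hβ) subset_rfl) (isCompact_Icc.prod isCompact_univ)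
  rwa [IntegrableOn, Measure.volume_eq_prod, ← Measure.prod_restrict, Measure.restrict_univ] at h1

theorem ae_of_forall_slab {P : ℝ → Prop}
    (h : ∀ α β, 0 < α → β < 1 → ∀ᵐ ψ ∂(volume.restrict (Icc α β)), P ψ) :
    ∀ᵐ ψ ∂(volume.restrict (Ioo (0 : ℝ) 1)), P ψ := by
  have h1 : Ioo (0 : ℝ) 1 ⊆ ⋃ n : ℕ, Icc (1 / ((n : ℝ) + 1)) (1 - 1 / ((n : ℝ) + 1)) := by
    intro x hx
    obtain ⟨n, hn⟩ := exists_nat_one_div_lt (lt_min hx.1 (sub_pos.2 hx.2))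
    rw [lt_min_iff] at hn
    exact mem_iUnion.2 ⟨n, hn.1.le, by linarith⟩
  refine ae_restrict_of_ae_restrict_of_subset h1 ((ae_restrict_iUnion_iff _ _).2 fun n => h _ _ ?_ ?_)
  · positivity
  · have : (0 : ℝ) < 1 / ((n : ℝ) + 1) := by positivity
    linarith

theorem ae_integrable_circle (hu : LocallyIntegrableOn u openPi) :
    ∀ᵐ ψ ∂(volume.restrict (Ioo (0 : ℝ) 1)), Integrable fun θ => u (ψ, θ) :=
  ae_of_forall_slab fun _ _ hα hβ => (integrable_slab hu hα hβ).prod_right_ae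

theorem ae_locallyIntegrableOn_radial (hu : LocallyIntegrableOn u openPi) :
    ∀ᵐ θ : Circ, LocallyIntegrableOn (fun ψ => u (ψ, θ)) (Ioo 0 1) := by
  have h1 : ∀ n : ℕ, ∀ᵐ θ : Circ, IntegrableOn (fun ψ => u (ψ, θ))
      (Icc (1 / ((n : ℝ) + 1)) (1 - 1 / ((n : ℝ) + 1))) := fun n =>
    (integrable_slab hu (by positivity) (by
      have : (0 : ℝ) < 1 / ((n : ℝ) + 1) := by positivity
      linarith)).prod_left_ae
  filter_upwards [ae_all_iff.2 h1] with θ h2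
  refine locallyIntegrableOn_of_Icc fun α β hα hβ => ?_
  obtain ⟨n, hn⟩ := exists_nat_one_div_lt (lt_min hα (sub_pos.2 hβ))
  rw [lt_min_iff] at hn
  exact (h2 n).mono_set (Icc_subset_Icc hn.1.le (by linarith))

theorem locallyIntegrableOn_circ_smul (hu : LocallyIntegrableOn u openPi) {b : Circ → ℝ}
    (hb : Continuous b) : LocallyIntegrableOn (fun x => b x.2 • u x) openPi :=
  hu.continuousOn_smul isOpen_openPi.isLocallyClosed (hb.comp continuous_snd).continuousOn

theorem locallyIntegrableOn_integral (hu : LocallyIntegrableOn u openPi) :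
    LocallyIntegrableOn (fun ψ => ∫ θ, u (ψ, θ)) (Ioo 0 1) :=
  locallyIntegrableOn_of_Icc fun _ _ hα hβ => (integrable_slab hu hα hβ).integral_prod_left

theorem integrable_mul_smul (hu : LocallyIntegrableOn u openPi) {a : ℝ → ℝ} (ha : IsRadialTest a)
    {b : Circ → ℝ} (hb : Continuous b) : Integrable (fun x => (a x.1 * b x.2) • u x) muPi := by
  obtain ⟨hs, α, β, h1, h2, h3, h4⟩ := ha
  refine integrable_pi_smul (K := Icc α β ×ˢ (univ : Set Circ)) (isCompact_Icc.prod isCompact_univ)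
    (prod_mono (Icc_subset_Ioo h1 h3) subset_rfl)
    ((hs.continuous.comp continuous_fst).mul (hb.comp continuous_snd)) (fun x hx => ?_) hu
  change a x.1 * b x.2 = 0
  rw [h4 x.1 fun h => hx ⟨h, mem_univ _⟩, zero_mul]

theorem integral_mul_smul (hu : LocallyIntegrableOn u openPi) {a : ℝ → ℝ} (ha : IsRadialTest a)
    {b : Circ → ℝ} (hb : Continuous b) : ∫ x, (a x.1 * b x.2) • u x ∂muPi =
      ∫ ψ in Ioo (0 : ℝ) 1, a ψ • ∫ θ, b θ • u (ψ, θ) := by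
  have h1 := integrable_mul_smul hu ha hb
  rw [muPi_eq] at h1 ⊢
  rw [integral_prod _ h1]
  refine integral_congr_ae (Eventually.of_forall fun ψ => ?_)
  simp only [mul_smul]
  rw [integral_smul]

/-- Joint measurability of an integral with variable endpoint, written as a difference of integrals
of indicators. It supplies the measurable set needed to interchange "for almost all ψ" and "for
almost all θ". -/
theorem stronglyMeasurable_radial_integral (hv : StronglyMeasurable v) (ψ₀ : ℝ) :
    StronglyMeasurable fun x : ℝ × Circ => ∫ s in ψ₀..x.1, v (s, x.2) := by
  have key : ∀ S : Set ((ℝ × Circ) × ℝ), MeasurableSet S →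
      StronglyMeasurable fun x : ℝ × Circ => ∫ s, S.indicator (fun y => v (y.2, y.1.2)) (x, s) :=
    fun S hS => ((hv.comp_measurable (measurable_snd.prodMk
      (measurable_snd.comp measurable_fst))).indicator hS).integral_prod_right'
  have h1 := key {y | ψ₀ < y.2 ∧ y.2 ≤ y.1.1}
    ((measurableSet_lt measurable_const measurable_snd).inter
      (measurableSet_le measurable_snd (measurable_fst.comp measurable_fst)))
  have h2 := key {y | y.1.1 < y.2 ∧ y.2 ≤ ψ₀}
    ((measurableSet_lt (measurable_fst.comp measurable_fst) measurable_snd).inter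
      (measurableSet_le measurable_snd measurable_const))
  convert! h1.sub h2 using 2 with x
  rw [intervalIntegral, ← integral_indicator measurableSet_Ioc, ← integral_indicator measurableSet_Ioc]
  rfl

end Slices

/-! ### Weak derivatives on the annulus -/

section Weak

variable {u v : ℝ × Circ → 𝕜}

/-- For a fixed angular test function, varying the radial one gives the weak identity on almost
every circle. Since countably many modes suffice by `hasACDeriv_of_fourier`, one exceptional null
set serves for all of them. -/
theorem hasAngularDeriv_of_weak (hu : LocallyIntegrableOn u openPi)
    (hv : LocallyIntegrableOn v openPi) (h : ∀ a b, IsRadialTest a → IsCircTest b →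
      ∫ x, (a x.1 * circDeriv 1 b x.2) • u x ∂muPi = - ∫ x, (a x.1 * b x.2) • v x ∂muPi) :
    HasAngularDeriv u v := by
  have key : ∀ b, IsCircTest b → ∀ᵐ ψ ∂(volume.restrict (Ioo (0 : ℝ) 1)),
      ∫ θ, circDeriv 1 b θ • u (ψ, θ) = - ∫ θ, b θ • v (ψ, θ) := by
    intro b hb
    have hbc : Continuous b := by simpa [circDeriv_zero] using continuous_circDeriv hb 0
    have hb' := continuous_circDeriv hb 1
    have i1 := locallyIntegrableOn_integral (locallyIntegrableOn_circ_smul hu hb')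
    have i2 := locallyIntegrableOn_integral (locallyIntegrableOn_circ_smul hv hbc)
    have h1 := ae_eq_zero_of_radialTest (i1.add i2) fun a ha => ?_
    · filter_upwards [h1] with ψ hψ using eq_neg_of_add_eq_zero_left hψ
    · have h2 := h a b ha hb
      rw [integral_mul_smul hu ha hb', integral_mul_smul hv ha hbc] at h2
      simp only [Pi.add_apply, smul_add]
      rw [integral_add (integrableOn_radialTest_smul i1 ha) (integrableOn_radialTest_smul i2 ha), h2,
        neg_add_cancel]
  have k1 := ae_all_iff.2 fun n : ℤ => key _ (isCircTest_fourier_re n)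
  have k2 := ae_all_iff.2 fun n : ℤ => key _ (isCircTest_fourier_im n)
  filter_upwards [k1, k2, ae_integrable_circle hu, ae_integrable_circle hv] with ψ h1 h2 h3 h4
  refine hasACDeriv_of_fourier h3 h4 ?_
  rintro b ⟨n, rfl | rfl⟩
  exacts [h1 n, h2 n]

/-- Pairing with a Fourier mode in θ leaves functions of ψ, for which the one-dimensional result
applies. From a common good radius ψ₀, u(ψ,·) − u(ψ₀,·) − ∫v has vanishing Fourier coefficients for
almost every ψ, hence is zero; interchanging the null sets gives the statement on radial lines. -/
theorem hasACDeriv_radial_of_weak (hum : StronglyMeasurable u) (hvm : StronglyMeasurable v)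
    (hu : LocallyIntegrableOn u openPi) (hv : LocallyIntegrableOn v openPi)
    (h : ∀ a b, IsRadialTest a → IsCircTest b →
      ∫ x, (deriv a x.1 * b x.2) • u x ∂muPi = - ∫ x, (a x.1 * b x.2) • v x ∂muPi) :
    ∀ᵐ θ : Circ, HasACDeriv (Ioo (0 : ℝ) 1) (fun ψ => u (ψ, θ)) (fun ψ => v (ψ, θ)) := by
  have key : ∀ b, IsCircTest b → HasACDeriv (Ioo (0 : ℝ) 1)
      (fun ψ => ∫ θ, b θ • u (ψ, θ)) (fun ψ => ∫ θ, b θ • v (ψ, θ)) := by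
    intro b hb
    have hbc : Continuous b := by simpa [circDeriv_zero] using continuous_circDeriv hb 0
    refine hasACDeriv_of_radialTest
      (locallyIntegrableOn_integral (locallyIntegrableOn_circ_smul hu hbc))
      (locallyIntegrableOn_integral (locallyIntegrableOn_circ_smul hv hbc)) fun a ha => ?_
    rw [← integral_mul_smul hu ha.deriv hbc, ← integral_mul_smul hv ha hbc]
    exact h a b ha hb
  choose Ur hUr hUr' using fun n : ℤ => key _ (isCircTest_fourier_re n)
  choose Ui hUi hUi' using fun n : ℤ => key _ (isCircTest_fourier_im n)
  have k1 := ae_all_iff.2 hUr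
  have k2 := ae_all_iff.2 hUi
  have hgood := (((k1.and k2).and (ae_integrable_circle hu)).and
    (ae_restrict_mem (μ := volume) (measurableSet_Ioo (a := (0 : ℝ)) (b := 1))))
  have hne : (ae (volume.restrict (Ioo (0 : ℝ) 1))).NeBot := by
    rw [ae_neBot, Ne, Measure.restrict_eq_zero]
    simp
  obtain ⟨ψ₀, ⟨⟨⟨g1, g2⟩, g3⟩, g4⟩⟩ := hgood.exists
  beta_reduce at g1 g2
  have hslab : ∀ ψ ∈ Ioo (0 : ℝ) 1,
      Integrable v ((volume.restrict (uIoc ψ₀ ψ)).prod (volume : Measure Circ)) := fun ψ hψ => by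
    have h5 := integrable_slab hv (lt_min g4.1 hψ.1) (max_lt g4.2 hψ.2)
    rw [← Measure.restrict_univ (μ := (volume : Measure Circ)), Measure.prod_restrict] at h5 ⊢
    exact IntegrableOn.mono_set h5 (prod_mono uIoc_subset_uIcc subset_rfl)
  have hae : ∀ᵐ ψ ∂(volume.restrict (Ioo (0 : ℝ) 1)), ∀ᵐ θ : Circ,
      u (ψ, θ) = u (ψ₀, θ) + ∫ s in ψ₀..ψ, v (s, θ) := by
    filter_upwards [hgood] with ψ hψ
    obtain ⟨⟨⟨h1, h2⟩, h3⟩, h4⟩ := hψ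
    have hT : Integrable fun θ => ∫ s in ψ₀..ψ, v (s, θ) := by
      have h5 := (hslab ψ h4).integral_prod_right
      simp only [intervalIntegral.intervalIntegral_eq_integral_uIoc]
      exact h5.smul _
    have hD : ∀ b : Circ → ℝ, Continuous b → ∫ θ, b θ • (u (ψ, θ) - u (ψ₀, θ) -
        ∫ s in ψ₀..ψ, v (s, θ)) = (∫ θ, b θ • u (ψ, θ)) - (∫ θ, b θ • u (ψ₀, θ)) -
          ∫ s in ψ₀..ψ, ∫ θ, b θ • v (s, θ) := by
      intro b hb
      simp only [smul_sub]
      have i1 : Integrable fun θ => b θ • u (ψ, θ) - b θ • u (ψ₀, θ) :=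
        (integrable_circ_smul hb h3).sub (integrable_circ_smul hb g3)
      rw [integral_sub i1 (integrable_circ_smul hb hT),
        integral_sub (integrable_circ_smul hb h3) (integrable_circ_smul hb g3)]
      congr 1
      rw [intervalIntegral_integral_swap]
      · simp only [intervalIntegral.integral_smul]
      · obtain ⟨C, hC⟩ := (isCompact_range hb).isBounded.exists_norm_le
        refine ((hslab ψ h4).norm.const_mul C).mono'
          ((hb.comp continuous_snd).aestronglyMeasurable.smul (hslab ψ h4).aestronglyMeasurable)
          (Eventually.of_forall fun x => ?_)
        simp only [Function.uncurry, norm_smul]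
        exact mul_le_mul_of_nonneg_right (hC _ (mem_range_self _)) (norm_nonneg _)
    have hzero := ae_eq_zero_of_fourier ((h3.sub g3).sub hT) (fun n => ?_) (fun n => ?_)
    · filter_upwards [hzero] with θ hθ
      simp only [Pi.sub_apply, Pi.zero_apply, sub_sub, sub_eq_zero] at hθ
      exact hθ
    · refine (hD (fun θ => (fourier n θ : ℂ).re)
        (Complex.continuous_re.comp (fourier n).continuous)).trans ?_
      rw [← h1 n, ← g1 n, (hUr' n).eq ψ₀ g4 ψ h4, sub_self]
    · refine (hD (fun θ => (fourier n θ : ℂ).im)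
        (Complex.continuous_im.comp (fourier n).continuous)).trans ?_
      rw [← h2 n, ← g2 n, (hUi' n).eq ψ₀ g4 ψ h4, sub_self]
  rw [Measure.ae_ae_comm] at hae
  · filter_upwards [hae, ae_locallyIntegrableOn_radial hv] with θ h1 h2
    have hint : ∀ a ∈ Ioo (0 : ℝ) 1, ∀ b ∈ Ioo (0 : ℝ) 1,
        IntervalIntegrable (fun s => v (s, θ)) volume a b :=
      fun a ha b hb => (h2.integrableOn_compact_subset
        (Set.OrdConnected.uIcc_subset ordConnected_Ioo ha hb) isCompact_uIcc).intervalIntegrable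
    refine ⟨fun ψ => u (ψ₀, θ) + ∫ s in ψ₀..ψ, v (s, θ), EventuallyEq.symm h1, hint,
      fun a ha b hb => ?_⟩
    rw [← intervalIntegral.integral_interval_sub_left (hint _ g4 _ hb) (hint _ g4 _ ha)]
    ring
  · exact StronglyMeasurable.measurableSet_eq_fun hum
      ((hum.comp_measurable (measurable_const.prodMk measurable_snd)).add
        (stronglyMeasurable_radial_integral hvm ψ₀))

end Weak

end Kondratev

namespace Kondratev

variable {𝕜 : Type*} [RCLike 𝕜]

open scoped NNReal ENNReal

/-! ### From absolutely continuous to weak derivatives -/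

theorem mixedDeriv_zero_one (φ : ℝ × Circ → ℝ) (x : ℝ × Circ) :
    mixedDeriv 0 1 φ x = circDeriv 1 (fun θ => φ (x.1, θ)) x.2 := by
  simp [mixedDeriv, circDeriv]

theorem mixedDeriv_one_zero (φ : ℝ × Circ → ℝ) (x : ℝ × Circ) :
    mixedDeriv 1 0 φ x = deriv (fun r => φ (r, x.2)) x.1 := by
  simp [mixedDeriv]

theorem mixedDeriv_succ_left (p q : ℕ) (φ : ℝ × Circ → ℝ) :
    mixedDeriv (p + 1) q φ = mixedDeriv p q (mixedDeriv 1 0 φ) := by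
  funext x
  simp only [mixedDeriv, iteratedDeriv_succ', iteratedDeriv_zero, AddCircle.coe_zero, add_zero]

theorem mixedDeriv_zero_succ (q : ℕ) (φ : ℝ × Circ → ℝ) :
    mixedDeriv 0 (q + 1) φ = mixedDeriv 0 q (mixedDeriv 0 1 φ) := by
  funext x
  have h1 : ∀ (q : ℕ) (φ : ℝ × Circ → ℝ), mixedDeriv 0 q φ x =
      circDeriv q (fun θ => φ (x.1, θ)) x.2 := fun q φ => by simp [mixedDeriv, circDeriv]
  rw [h1, h1, ← circDeriv_circDeriv_one]
  simp only [mixedDeriv_zero_one]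

theorem IsPiTest.mixedDeriv_test {φ : ℝ × Circ → ℝ} (hφ : IsPiTest φ) {p q : ℕ}
    (hs : ContDiff ℝ ∞ fun y : ℝ × ℝ => mixedDeriv p q φ (y.1, (y.2 : Circ))) :
    IsPiTest (mixedDeriv p q φ) := by
  have h0 : tsupport (mixedDeriv p q φ) ⊆ tsupport φ := by
    refine closure_minimal (fun x hx => ?_) (isClosed_tsupport φ)
    by_contra h
    exact hx (mixedDeriv_eq_zero p q h)
  exact ⟨hs, hφ.compact.of_isClosed_subset (isClosed_tsupport _) h0, h0.trans hφ.support_subset⟩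

theorem IsPiTest.radial {φ : ℝ × Circ → ℝ} (hφ : IsPiTest φ) : IsPiTest (mixedDeriv 1 0 φ) := by
  refine hφ.mixedDeriv_test ?_
  have := contDiff_partial_fst hφ.smooth 1
  simpa only [iteratedDeriv_one, mixedDeriv_one_zero] using this

theorem IsPiTest.angular {φ : ℝ × Circ → ℝ} (hφ : IsPiTest φ) : IsPiTest (mixedDeriv 0 1 φ) := by
  refine hφ.mixedDeriv_test ?_
  have := contDiff_partial_snd hφ.smooth 1
  simpa only [iteratedDeriv_one, mixedDeriv_zero_one, circDeriv_one_coe] using this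

section

variable {u v : ℝ × Circ → 𝕜}

theorem HasAngularDeriv.integral_eq (h : HasAngularDeriv u v) (hu : LocallyIntegrableOn u openPi)
    (hv : LocallyIntegrableOn v openPi) {φ : ℝ × Circ → ℝ} (hφ : IsPiTest φ) :
    ∫ x, mixedDeriv 0 1 φ x • u x ∂muPi = - ∫ x, φ x • v x ∂muPi := by
  have h1 := hφ.integrable_mixedDeriv 0 1 hu
  have h2 := hφ.integrable hv
  rw [muPi_eq] at h1 h2 ⊢
  rw [integral_prod _ h1, integral_prod _ h2, ← integral_neg]
  refine integral_congr_ae ?_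
  filter_upwards [h] with ψ hψ
  simp only [mixedDeriv_zero_one]
  refine integral_circDeriv_smul (u := fun θ => u (ψ, θ)) (v := fun θ => v (ψ, θ))
    (b := fun θ => φ (ψ, θ)) ?_ hψ
  exact hφ.smooth.comp (contDiff_const.prodMk contDiff_id)

theorem integral_radial_eq (h : ∀ᵐ θ : Circ, HasACDeriv (Ioo (0 : ℝ) 1) (fun ψ => u (ψ, θ))
    (fun ψ => v (ψ, θ))) (hu : LocallyIntegrableOn u openPi)
    (hv : LocallyIntegrableOn v openPi) {φ : ℝ × Circ → ℝ} (hφ : IsPiTest φ) :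
    ∫ x, mixedDeriv 1 0 φ x • u x ∂muPi = - ∫ x, φ x • v x ∂muPi := by
  have h1 := hφ.integrable_mixedDeriv 1 0 hu
  have h2 := hφ.integrable hv
  rw [muPi_eq] at h1 h2 ⊢
  rw [integral_prod_symm _ h1, integral_prod_symm _ h2, ← integral_neg]
  obtain ⟨α, β, a1, a2, a3, a4⟩ := exists_Icc_of_isCompact (hφ.compact.isCompact.image continuous_fst)
    (by rintro _ ⟨x, hx, rfl⟩; exact (hφ.support_subset hx).1)
  refine integral_congr_ae ?_
  filter_upwards [h] with θ hθ
  obtain ⟨t, rfl⟩ := QuotientAddGroup.mk_surjective θ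
  have hs : ContDiff ℝ ∞ fun ψ : ℝ => φ (ψ, (t : Circ)) :=
    hφ.smooth.comp (contDiff_id.prodMk contDiff_const)
  simp only [mixedDeriv_one_zero]
  refine integral_deriv_smul hθ (fun ψ => (hs.differentiable (by simp) ψ).hasDerivAt)
    (hs.continuous_deriv (by simp)) a1 a2 a3 fun ψ hψ => ?_
  exact image_eq_zero_of_notMem_tsupport fun hm => hψ (a4 ⟨_, hm, rfl⟩)

/-- A family of functions related by angular and radial derivatives consists of weak derivatives. -/
theorem isPiWeakDeriv_of_family {m : ℕ} {w : ℕ → ℕ → ℝ × Circ → 𝕜}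
    (hw : ∀ p q, p + q ≤ m → LocallyIntegrableOn (w p q) openPi)
    (ha : ∀ q, q + 1 ≤ m → HasAngularDeriv (w 0 q) (w 0 (q + 1)))
    (hr : ∀ p q, p + 1 + q ≤ m → ∀ᵐ θ : Circ, HasACDeriv (Ioo (0 : ℝ) 1)
      (fun ψ => w p q (ψ, θ)) (fun ψ => w (p + 1) q (ψ, θ))) {p q : ℕ} (hpq : p + q ≤ m) :
    IsPiWeakDeriv p q (w 0 0) (w p q) := by
  refine ⟨hw 0 0 (by omega), hw p q hpq, ?_⟩
  -- Derivatives are moved off the test function one at a time. Angular derivatives are only needed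
  -- for p = 0, since the remaining steps are radial.
  induction p with
  | zero =>
    induction q with
    | zero => simp [mixedDeriv_zero_zero]
    | succ q ih =>
      intro φ hφ
      rw [mixedDeriv_zero_succ, ih (by omega) _ hφ.angular,
        (ha q (by omega)).integral_eq (hw 0 q (by omega)) (hw 0 (q + 1) (by omega)) hφ]
      simp [pow_succ]
  | succ p ih =>
    intro φ hφ
    rw [mixedDeriv_succ_left, ih (by omega) _ hφ.radial,
      integral_radial_eq (hr p q (by omega)) (hw p q (by omega)) (hw (p + 1) q (by omega)) hφ,
      add_right_comm, pow_succ]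
    simp

theorem isCircWeakDeriv_of_family {m : ℕ} {w : ℕ → Circ → 𝕜} (hw : ∀ q ≤ m, Integrable (w q))
    (ha : ∀ q, q + 1 ≤ m → HasACDeriv univ (fun s : ℝ => w q (s : Circ))
      (fun s => w (q + 1) (s : Circ))) {q : ℕ} (hq : q ≤ m) : IsCircWeakDeriv q (w 0) (w q) := by
  refine ⟨hw 0 (by omega), hw q hq, ?_⟩
  induction q with
  | zero => simp [circDeriv_zero]
  | succ q ih =>
    intro φ hφ
    rw [← circDeriv_circDeriv_one, ih (by omega) _ (isCircTest_circDeriv_one hφ),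
      integral_circDeriv_smul hφ (ha q hq), pow_succ]
    simp

theorem IsCircWeakDeriv.hasACDeriv {q : ℕ} {u v v' : Circ → 𝕜} (h : IsCircWeakDeriv q u v)
    (h' : IsCircWeakDeriv (q + 1) u v') :
    HasACDeriv univ (fun s : ℝ => v (s : Circ)) (fun s => v' (s : Circ)) := by
  refine hasACDeriv_of_fourier h.right_int h'.right_int fun b hb => ?_
  have hbt : IsCircTest b := by
    obtain ⟨n, rfl | rfl⟩ := hb
    exacts [isCircTest_fourier_re n, isCircTest_fourier_im n]
  have e1 := h.eq _ (isCircTest_circDeriv_one hbt)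
  have e2 := h'.eq _ hbt
  rw [circDeriv_circDeriv_one] at e1
  rw [e1, pow_succ, mul_neg_one, neg_smul, ← smul_neg] at e2
  exact (smul_right_injective 𝕜 (by simp : ((-1 : ℝ) ^ q) ≠ 0)) e2

end

end Kondratev

namespace Kondratev

variable {𝕜 : Type*} [RCLike 𝕜]

open scoped NNReal ENNReal

/-! ### Elements of the Sobolev and Kondratev spaces satisfy Sobolev bounds -/

theorem HasACDeriv.real_smul {I : Set ℝ} [I.OrdConnected] {u v : ℝ → 𝕜} {a a' : ℝ → ℝ}
    (h : HasACDeriv I u v) (ha : ∀ x ∈ I, HasDerivAt a (a' x) x)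
    (hc : ContinuousOn a' I) :
    HasACDeriv I (fun x => a x • u x) (fun x => a' x • u x + a x • v x) := by
  obtain ⟨U, hU, hp⟩ := h
  refine ⟨fun x => a x • U x, ?_, (hp.real_smul ha hc).congr ?_⟩
  · filter_upwards [hU] with x hx
    rw [hx]
  · filter_upwards [hU] with x hx
    rw [hx]

theorem HasAngularDeriv.radial_smul {u v : ℝ × Circ → 𝕜} (h : HasAngularDeriv u v) (a : ℝ → ℝ) :
    HasAngularDeriv (fun x => a x.1 • u x) (fun x => a x.1 • v x) := by
  filter_upwards [h] with ψ h1
  simpa using h1.clm_comp (a ψ • ContinuousLinearMap.id ℝ 𝕜)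

theorem measurePreserving_snd_muPi : MeasurePreserving Prod.snd muPi (volume : Measure Circ) := by
  rw [muPi_eq]
  have : IsProbabilityMeasure (volume.restrict (Ioo (0 : ℝ) 1)) := ⟨by simp⟩
  exact measurePreserving_snd

theorem eLpNorm_comp_snd {f : Circ → 𝕜} (hf : AEStronglyMeasurable f volume) (p : ℝ≥0∞) :
    eLpNorm (fun x => f x.2) p muPi = eLpNorm f p volume :=
  eLpNorm_comp_measurePreserving hf measurePreserving_snd_muPi

/-- The pair `(p, q)` as an index. -/
def derivIdxMk {m p q : ℕ} (h : p + q ≤ m) : derivIdx m :=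
  ⟨(p, q), by simp only [Finset.mem_filter, Finset.mem_product, Finset.mem_range]; omega⟩

variable {m : ℕ} {γ : ℝ}

/-- The derivative `∂_ψ^p ∂_θ^q w`. -/
noncomputable def KondratevPi.derivFn (w : KondratevPi 𝕜 m γ) (p q : ℕ) : ℝ × Circ → 𝕜 :=
  if h : p + q ≤ m then
    unweight γ p ((w : PiLp 2 (fun _ : derivIdx m => Lp 𝕜 2 muPi)) (derivIdxMk h) : ℝ × Circ → 𝕜)
  else 0

theorem KondratevPi.isPiWeakDeriv (w : KondratevPi 𝕜 m γ) {p q : ℕ} (h : p + q ≤ m) :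
    IsPiWeakDeriv p q (KondratevPi.fn w) (KondratevPi.derivFn w p q) := by
  rw [KondratevPi.derivFn, dif_pos h]
  exact w.2 (derivIdxMk h)

theorem KondratevPi.stronglyMeasurable_derivFn (w : KondratevPi 𝕜 m γ) (p q : ℕ) :
    StronglyMeasurable (KondratevPi.derivFn w p q) := by
  rw [KondratevPi.derivFn]
  split_ifs with h
  · exact (measurable_rpow_fst _).stronglyMeasurable.smul (Lp.stronglyMeasurable _)
  · exact stronglyMeasurable_zero

theorem KondratevPi.l2Bound (w : KondratevPi 𝕜 m γ) {p q : ℕ} (h : p + q ≤ m) :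
    L2Bound γ true (fun x => x.1 ^ p • KondratevPi.derivFn w p q x) ‖w‖₊ := by
  refine ⟨((measurable_fst.pow_const p).stronglyMeasurable.smul
    (KondratevPi.stronglyMeasurable_derivFn w p q)).aestronglyMeasurable, by simp, ?_⟩
  have e : (fun x : ℝ × Circ => x.1 ^ (-wexp γ true) • x.1 ^ p • KondratevPi.derivFn w p q x) =ᵐ[muPi]
      ((w : PiLp 2 (fun _ : derivIdx m => Lp 𝕜 2 muPi)) (derivIdxMk h) : ℝ × Circ → 𝕜) := by
    filter_upwards [ae_muPi_mem] with x hx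
    have hx0 : 0 < x.1 := hx.1.1
    rw [KondratevPi.derivFn, dif_pos h, unweight, smul_smul, smul_smul, ← Real.rpow_natCast,
      ← Real.rpow_add hx0, ← Real.rpow_add hx0]
    simp [wexp]
  rw [eLpNorm_congr_ae e, ← Lp.enorm_def, enorm_eq_nnnorm]
  exact_mod_cast PiLp.nnnorm_apply_le _ _

/-- ψ∂_ψ(ψ^p v) = ψ^{p+1}∂_ψ v + pψ^p v with v = ∂_ψ^p ∂_θ^q w. As p ≤ m, each order costs at most
the factor 1 + m. -/
theorem KondratevPi.sobBound_derivFn (w : KondratevPi 𝕜 m γ) {k p q : ℕ} (h : p + q + k ≤ m) :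
    SobBound γ true k (fun x => x.1 ^ p • KondratevPi.derivFn w p q x) ((1 + m) ^ k * ‖w‖₊) := by
  induction k generalizing p q with
  | zero => simpa using! KondratevPi.l2Bound w (p := p) (q := q) h
  | succ k ih =>
    have hC : (1 + m : ℝ≥0) ^ (k + 1) * ‖w‖₊ =
        (1 + m) ^ k * ‖w‖₊ + m * ((1 + m) ^ k * ‖w‖₊) := by ring
    have h1 := ih (p := p) (q := q) (by omega)
    have h2 := ih (p := p) (q := q + 1) (by omega)
    have h3 := ih (p := p + 1) (q := q) (by omega)
    rw [hC]
    refine ⟨(KondratevPi.l2Bound w (by omega)).mono ?_, fun x => x.1 ^ (p + 1) • KondratevPi.derivFn w (p + 1) q x +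
      (p : 𝕜) * (x.1 ^ p • KondratevPi.derivFn w p q x), fun x => x.1 ^ p • KondratevPi.derivFn w p (q + 1) x, ?_, ?_,
      (h3.add (h1.const_mul (p : 𝕜))).mono ?_, h2.mono le_self_add⟩
    · refine le_add_right (le_mul_of_one_le_left' (one_le_pow₀ le_self_add))
    · have d0 := KondratevPi.isPiWeakDeriv w (p := p) (q := q) (by omega)
      have d1 := KondratevPi.isPiWeakDeriv w (p := p + 1) (q := q) (by omega)
      filter_upwards [hasACDeriv_radial_of_weak (KondratevPi.stronglyMeasurable_derivFn w p q)
        (KondratevPi.stronglyMeasurable_derivFn w (p + 1) q) d0.right_int d1.right_int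
        fun a b ha hb => d0.integral_radial d1 ha hb] with θ hθ
      have h4 := hθ.real_smul (a := fun ψ => ψ ^ p)
        (fun ψ _ => hasDerivAt_pow p ψ) (by fun_prop)
      refine h4.congr EventuallyEq.rfl ?_
      filter_upwards [ae_restrict_mem measurableSet_Ioo] with ψ hψ
      have hψ0 : ψ ≠ 0 := hψ.1.ne'
      have e1 : ψ⁻¹ * ψ ^ (p + 1) = ψ ^ p := by rw [pow_succ', inv_mul_cancel_left₀ hψ0]
      have e2 : ψ⁻¹ * ((p : ℝ) * ψ ^ p) = p * ψ ^ (p - 1) := by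
        cases p with
        | zero => simp
        | succ p => rw [mul_left_comm, pow_succ', inv_mul_cancel_left₀ hψ0, Nat.add_sub_cancel]
      have e3 : ∀ y : 𝕜, (p : 𝕜) * (ψ ^ p • y) = (p : ℝ) • ψ ^ p • y := fun y => by
        simp [Algebra.smul_def]
      rw [e3, smul_add, smul_smul ψ⁻¹, e1, smul_smul (p : ℝ), smul_smul ψ⁻¹, e2, add_comm]
    · have d0 := KondratevPi.isPiWeakDeriv w (p := p) (q := q) (by omega)
      have d1 := KondratevPi.isPiWeakDeriv w (p := p) (q := q + 1) (by omega)
      exact (hasAngularDeriv_of_weak d0.right_int d1.right_int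
        fun a b ha hb => d0.integral_angular d1 ha hb).radial_smul fun ψ => ψ ^ p
    · gcongr
      rw [← NNReal.coe_le_coe, coe_nnnorm, RCLike.norm_natCast]
      exact_mod_cast (by omega : p ≤ m)

theorem KondratevPi.derivFn_zero (w : KondratevPi 𝕜 m γ) : KondratevPi.derivFn w 0 0 = (KondratevPi.fn w) := by
  rw [KondratevPi.derivFn, dif_pos (Nat.zero_le _)]
  rfl

/-- The constant in the Sobolev bounds of Kondratev functions. -/
noncomputable def sobConst (m : ℕ) : ℝ≥0 := (1 + m) ^ m

theorem one_le_sobConst (m : ℕ) : 1 ≤ sobConst m := one_le_pow₀ le_self_add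

theorem KondratevPi.sobBound (w : KondratevPi 𝕜 m γ) :
    SobBound γ true m (KondratevPi.fn w) (sobConst m * ‖w‖₊) := by
  have := KondratevPi.sobBound_derivFn w (k := m) (p := 0) (q := 0) (by omega)
  simpa [KondratevPi.derivFn_zero w] using! this

/-- The derivative `D^q ξ`. -/
noncomputable def SobolevCirc.derivFn (ξ : SobolevCirc 𝕜 m) (q : ℕ) : Circ → 𝕜 :=
  if h : q < m + 1 then
    (ξ : PiLp 2 (fun _ : Fin (m + 1) => Lp 𝕜 2 (volume : Measure Circ))) ⟨q, h⟩
  else 0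

theorem SobolevCirc.isCircWeakDeriv (ξ : SobolevCirc 𝕜 m) {q : ℕ} (h : q ≤ m) :
    IsCircWeakDeriv q (SobolevCirc.fn ξ) (SobolevCirc.derivFn ξ q) := by
  rw [derivFn, dif_pos (by omega)]
  exact ξ.2 ⟨q, by omega⟩

theorem SobolevCirc.sobBound_derivFn (ξ : SobolevCirc 𝕜 m) {k q : ℕ} (h : q + k ≤ m) :
    SobBound γ false k (fun x => SobolevCirc.derivFn ξ q x.2) ‖ξ‖₊ := by
  have h0 : ∀ q ≤ m, L2Bound γ false (fun x => SobolevCirc.derivFn ξ q x.2) ‖ξ‖₊ := by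
    intro q hq
    have hm : AEStronglyMeasurable (SobolevCirc.derivFn ξ q) volume := (SobolevCirc.isCircWeakDeriv ξ hq).right_int.1
    refine ⟨hm.comp_quasiMeasurePreserving measurePreserving_snd_muPi.quasiMeasurePreserving,
      fun _ => ⟨_, EventuallyEq.rfl⟩, ?_⟩
    simp only [wexp, Bool.false_eq_true, if_false, neg_zero, Real.rpow_zero, one_smul]
    rw [eLpNorm_comp_snd hm, derivFn, dif_pos (by omega), ← Lp.enorm_def, enorm_eq_nnnorm]
    exact_mod_cast PiLp.nnnorm_apply_le _ _
  induction k generalizing q with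
  | zero => exact h0 q h
  | succ k ih =>
    refine ⟨h0 q (by omega), 0, fun x => SobolevCirc.derivFn ξ (q + 1) x.2, .of_radial EventuallyEq.rfl, ?_,
      .zero, ih (by omega)⟩
    exact Eventually.of_forall fun ψ =>
      (SobolevCirc.isCircWeakDeriv ξ (by omega)).hasACDeriv (SobolevCirc.isCircWeakDeriv ξ (by omega))

theorem SobolevCirc.sobBound (ξ : SobolevCirc 𝕜 m) :
    SobBound γ false m (fun x => SobolevCirc.fn ξ x.2) ‖ξ‖₊ := by
  have := SobolevCirc.sobBound_derivFn ξ (γ := γ) (k := m) (q := 0) (by omega)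
  rwa [derivFn, dif_pos (by omega)] at this

end Kondratev

namespace Kondratev

variable {𝕜 : Type*} [RCLike 𝕜]

open scoped NNReal ENNReal

variable {m : ℕ} {γ : ℝ} {c : Bool} {z : ℝ × Circ → 𝕜} {R : ℝ≥0}

/-! ### Functions with Sobolev bounds are elements of the Sobolev and Kondratev spaces -/

/-- The iterated derivatives of a function in the Sobolev class, arranged so that the entry `(p, q)`
corresponds to `ψ^p ∂_ψ^p ∂_θ^q`. -/
theorem SobBound.exists_family (h : SobBound γ c m z R) : ∃ Z : ℕ → ℕ → ℝ × Circ → 𝕜, Z 0 0 = z ∧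
    (∀ p q, p + q ≤ m → SobBound γ c (m - (p + q)) (Z p q) ((1 + m) ^ p * R)) ∧
    (∀ q, q + 1 ≤ m → HasAngularDeriv (Z 0 q) (Z 0 (q + 1))) ∧
    (∀ p q, p + 1 + q ≤ m → HasRadialDeriv (Z p q) (fun x => Z (p + 1) q x + (p : 𝕜) * Z p q x)) := by
  have key : ∀ (k : ℕ) (a : ℝ × Circ → 𝕜) (S : ℝ≥0), SobBound γ c (k + 1) a S →
      ∃ a₁ a₂, HasRadialDeriv a a₁ ∧ HasAngularDeriv a a₂ ∧ SobBound γ c k a₁ S ∧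
        SobBound γ c k a₂ S := fun k a S h => h.2
  choose! D₁ D₂ h₁ h₂ h₃ h₄ using key
  let Y : ℕ → ℝ × Circ → 𝕜 := fun q => Nat.rec z (fun q a => D₂ (m - (q + 1)) a R) q
  -- ψ^{p+1}∂_ψ^{p+1} = (ψ∂_ψ − p)ψ^p∂_ψ^p recovers pure derivatives from iterates of ψ∂_ψ. Angular
  -- derivatives are taken first, then the radial recursion is run.
  let Z : ℕ → ℕ → ℝ × Circ → 𝕜 := fun p q => Nat.rec (Y q)
    (fun p a => fun x => D₁ (m - (p + 1 + q)) a ((1 + m) ^ p * R) x - (p : 𝕜) * a x) p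
  have hY : ∀ q ≤ m, SobBound γ c (m - q) (Y q) R := by
    intro q hq
    induction q with
    | zero => exact h
    | succ q ih =>
      have e : m - q = m - (q + 1) + 1 := by omega
      exact h₄ _ _ _ (e ▸ ih (by omega))
  have hZ : ∀ p q, p + q ≤ m → SobBound γ c (m - (p + q)) (Z p q) ((1 + m) ^ p * R) := by
    intro p q hpq
    induction p with
    | zero => simpa [Z] using hY q (by omega)
    | succ p ih =>
      have e : m - (p + q) = m - (p + 1 + q) + 1 := by omega
      have ih' := ih (by omega)
      have h5 := h₃ _ _ _ (e ▸ ih')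
      refine (h5.sub ((ih'.of_le (by omega)).const_mul (p : 𝕜))).mono ?_
      have e2 : (1 + m : ℝ≥0) ^ (p + 1) * R = (1 + m) ^ p * R + m * ((1 + m) ^ p * R) := by ring
      rw [e2]
      gcongr
      rw [← NNReal.coe_le_coe, coe_nnnorm, RCLike.norm_natCast]
      exact_mod_cast (by omega : p ≤ m)
  refine ⟨Z, rfl, hZ, fun q hq => ?_, fun p q hpq => ?_⟩
  · have e : m - q = m - (q + 1) + 1 := by omega
    exact h₂ _ _ _ (e ▸ hY q (by omega))
  · have e : m - (p + q) = m - (p + 1 + q) + 1 := by omega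
    have h5 := h₁ _ _ _ (e ▸ hZ p q (by omega))
    simpa [Z] using! h5

/-- The constant bounding the norm of an element of a Sobolev or Kondratev space by its Sobolev
bound. -/
noncomputable def liftConst (m : ℕ) : ℝ≥0 := Fintype.card (derivIdx m) * sobConst m

theorem norm_piLp_le {ι : Type*} [Fintype ι] {E : ι → Type*} [∀ i, NormedAddCommGroup (E i)]
    (x : PiLp 2 E) {B : ℝ} (h : ∀ i, ‖x i‖ ≤ B) : ‖x‖ ≤ Fintype.card ι * B := by
  classical
  rcases isEmpty_or_nonempty ι with he | ⟨⟨i₀⟩⟩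
  · rw [PiLp.norm_eq_of_L2]
    simp
  have hB : 0 ≤ B := (norm_nonneg _).trans (h i₀)
  rw [PiLp.norm_eq_of_L2]
  refine Real.sqrt_le_iff.2 ⟨by positivity, ?_⟩
  calc ∑ i, ‖x i‖ ^ 2 ≤ ∑ _i : ι, B ^ 2 := by
        gcongr with i
        exact h i
    _ = Fintype.card ι * B ^ 2 := by simp
    _ ≤ (Fintype.card ι * Fintype.card ι) * B ^ 2 := by
        gcongr
        exact_mod_cast Nat.le_mul_self _
    _ = _ := by ring

theorem L2Bound.memLp (h : L2Bound γ c z R) : MemLp (fun x => x.1 ^ (-wexp γ c) • z x) 2 muPi :=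
  ⟨h.meas_weight _, h.norm.trans_lt ENNReal.coe_lt_top⟩

theorem locallyIntegrableOn_unweight {f : ℝ × Circ → 𝕜} (hf : MemLp f 2 muPi) (p : ℕ) :
    LocallyIntegrableOn (unweight γ p f) openPi := by
  have h1 : IntegrableOn f openPi := hf.integrable (by norm_num)
  refine h1.locallyIntegrableOn.continuousOn_smul isOpen_openPi.isLocallyClosed ?_
  exact fun x hx => (continuousAt_fst.rpow_const (Or.inl hx.1.1.ne')).continuousWithinAt

/-- Dividing the entry (p, q) of the family by ψ^p gives the derivatives proper, and ψ^{-γ} times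
the entry is the stored L² component. Differentiating ψ^{-p} cancels the term p·Z in the radial
relation. -/
theorem SobBound.exists_kondratevPi (h : SobBound γ true m z R) :
    ∃ w : KondratevPi 𝕜 m γ, KondratevPi.fn w =ᵐ[muPi] z ∧ ‖w‖ ≤ liftConst m * R := by
  obtain ⟨Z, hZ0, hZ, hZa, hZr⟩ := h.exists_family
  have hmem : ∀ k : derivIdx m, MemLp (fun x : ℝ × Circ => x.1 ^ (-γ) • Z k.1.1 k.1.2 x) 2 muPi := by
    rintro ⟨⟨p, q⟩, hk⟩
    have hk' := (Finset.mem_filter.1 hk).2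
    simpa [wexp] using (hZ p q hk').l2Bound.memLp
  have hmem' : ∀ p q, p + q ≤ m → MemLp (fun x : ℝ × Circ => x.1 ^ (-γ) • Z p q x) 2 muPi :=
    fun p q hpq => hmem (derivIdxMk hpq)
  let W : ℕ → ℕ → ℝ × Circ → 𝕜 := fun p q => unweight γ p (fun x => x.1 ^ (-γ) • Z p q x)
  have hW : ∀ p q, W p q =ᵐ[muPi] fun x => x.1 ^ (-(p : ℝ)) • Z p q x := by
    intro p q
    filter_upwards [ae_muPi_mem] with x hx
    simp only [W, unweight]
    rw [smul_smul, ← Real.rpow_add hx.1.1]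
    congr 2
    ring
  have hweak : ∀ p q, p + q ≤ m → IsPiWeakDeriv p q (W 0 0) (W p q) := by
    intro p q hpq
    refine isPiWeakDeriv_of_family (m := m)
      (fun p q hpq => locallyIntegrableOn_unweight (hmem' p q hpq) p) (fun q hq => ?_)
      (fun p q hpq => ?_) hpq
    · exact ((hZa q hq).radial_smul fun ψ => ψ ^ (-γ)).radial_smul fun ψ => ψ ^ (γ - ((0 : ℕ) : ℝ))
    · filter_upwards [hZr p q hpq, ae_angular_of_ae_muPi (hW p q),
        ae_angular_of_ae_muPi (hW (p + 1) q)] with θ h1 h2 h3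
      have h4 := h1.real_smul (a := fun ψ => ψ ^ (-(p : ℝ)))
        (fun ψ hψ => Real.hasDerivAt_rpow_const (Or.inl hψ.1.ne'))
        (fun ψ hψ => (continuousWithinAt_const.mul
          ((Real.continuousAt_rpow_const _ _ (Or.inl hψ.1.ne')).continuousWithinAt)))
      refine h4.congr (EventuallyEq.symm h2) ?_
      filter_upwards [h3, ae_restrict_mem measurableSet_Ioo] with ψ h5 hψ
      have hψ0 : 0 < ψ := hψ.1
      refine Eq.trans ?_ h5.symm
      have e1 : ψ ^ (-(p : ℝ)) * ψ⁻¹ = ψ ^ (-((p + 1 : ℕ) : ℝ)) := by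
        rw [← Real.rpow_neg_one, ← Real.rpow_add hψ0]
        congr 1
        push_cast
        ring
      have e2 : ψ ^ (-(p : ℝ) - 1) = ψ ^ (-((p + 1 : ℕ) : ℝ)) := by
        congr 1
        push_cast
        ring
      rw [smul_smul, e1, e2, smul_add]
      simp only [Algebra.smul_def, map_mul, map_neg, map_natCast]
      ring
  let w₀ : PiLp 2 (fun _ : derivIdx m => Lp 𝕜 2 muPi) := WithLp.toLp 2 fun k => (hmem k).toLp _
  have hw₀ : ∀ k : derivIdx m, (w₀ k : ℝ × Circ → 𝕜) =ᵐ[muPi]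
      fun x : ℝ × Circ => x.1 ^ (-γ) • Z k.1.1 k.1.2 x := fun k => (hmem k).coeFn_toLp
  have hu : ∀ k : derivIdx m, unweight γ k.1.1 (w₀ k : ℝ × Circ → 𝕜) =ᵐ[muPi] W k.1.1 k.1.2 := by
    intro k
    filter_upwards [hw₀ k] with x hx
    simp only [unweight, W, hx]
  have hmemw : w₀ ∈ KondratevPi 𝕜 m γ := fun k =>
    (hweak k.1.1 k.1.2 (Finset.mem_filter.1 k.2).2).congr (hu (derivIdxZero m)).symm (hu k).symm
  refine ⟨⟨w₀, hmemw⟩, ?_, ?_⟩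
  · refine (hu (derivIdxZero m)).trans ((hW 0 0).trans (Eventually.of_forall fun x => ?_))
    simp [hZ0]
  · have h1 : ∀ k, ‖w₀ k‖ ≤ sobConst m * R := by
      rintro ⟨⟨p, q⟩, hk⟩
      have hk' : p + q ≤ m := (Finset.mem_filter.1 hk).2
      have h2 := (hZ p q hk').l2Bound.norm
      rw [← toReal_enorm]
      refine ENNReal.toReal_le_of_le_ofReal (by positivity) ?_
      rw [Lp.enorm_toLp]
      refine (le_of_eq (by simp [wexp])).trans (h2.trans ?_)
      rw [← NNReal.coe_mul, ENNReal.ofReal_coe_nnreal, ENNReal.coe_le_coe]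
      gcongr
      exact pow_le_pow_right₀ le_self_add (by omega)
    refine (norm_piLp_le w₀ h1).trans (le_of_eq ?_)
    simp only [liftConst]
    push_cast
    ring

theorem SobBound.exists_sobolevCirc (h : SobBound γ false m z R) :
    ∃ ξ : SobolevCirc 𝕜 m, (fun x : ℝ × Circ => SobolevCirc.fn ξ x.2) =ᵐ[muPi] z ∧
      ‖ξ‖ ≤ (m + 1) * R := by
  obtain ⟨Z, hZ0, hZ, hZa, -⟩ := h.exists_family
  have hrad : ∀ q ≤ m, ∃ α : Circ → 𝕜, Z 0 q =ᵐ[muPi] fun x => α x.2 := fun q hq =>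
    (hZ 0 q (by omega)).l2Bound.radial rfl
  choose! α hα using hrad
  have hnorm : ∀ q ≤ m, AEStronglyMeasurable (α q) volume ∧ eLpNorm (α q) 2 volume ≤ R := by
    intro q hq
    have h1 := (hZ 0 q (by omega)).l2Bound
    have h2 := h1.ae_measurable_of_radial (hα q hq)
    refine ⟨h2, ?_⟩
    rw [← eLpNorm_comp_snd h2]
    have h3 := h1.norm
    simp only [wexp, Bool.false_eq_true, if_false, neg_zero, Real.rpow_zero, one_smul, pow_zero,
      one_mul] at h3
    rwa [eLpNorm_congr_ae (hα q hq)] at h3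
  have hmem : ∀ q : Fin (m + 1), MemLp (α q) 2 volume := fun q =>
    ⟨(hnorm q (by omega)).1, (hnorm q (by omega)).2.trans_lt ENNReal.coe_lt_top⟩
  have hweak : ∀ q ≤ m, IsCircWeakDeriv q (α 0) (α q) := by
    intro q hq
    refine isCircWeakDeriv_of_family (m := m)
      (fun q hq => (hmem ⟨q, by omega⟩).integrable (by norm_num)) (fun q hq => ?_) hq
    have h1 := (hZa q hq).congr (hα q (by omega)) (hα (q + 1) hq)
    have hne : (ae (volume.restrict (Ioo (0 : ℝ) 1))).NeBot := by
      rw [ae_neBot, Ne, Measure.restrict_eq_zero]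
      simp
    -- The functions depend on θ only, so the relation on a single circle is the relation on 𝕋.
    exact h1.exists.choose_spec
  let ξ₀ : PiLp 2 (fun _ : Fin (m + 1) => Lp 𝕜 2 (volume : Measure Circ)) :=
    WithLp.toLp 2 fun q => (hmem q).toLp _
  have hξ₀ : ∀ q : Fin (m + 1), (ξ₀ q : Circ → 𝕜) =ᵐ[volume] α q := fun q => (hmem q).coeFn_toLp
  have hmemξ : ξ₀ ∈ SobolevCirc 𝕜 m := fun q =>
    (hweak q (by omega)).congr (hξ₀ 0).symm (hξ₀ q).symm
  refine ⟨⟨ξ₀, hmemξ⟩, ?_, ?_⟩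
  · rw [← hZ0]
    refine EventuallyEq.trans ?_ (hα 0 (by omega)).symm
    exact ae_muPi_snd (hξ₀ 0)
  · have h1 : ∀ q, ‖ξ₀ q‖ ≤ R := by
      intro q
      rw [← toReal_enorm]
      refine ENNReal.toReal_le_of_le_ofReal (by positivity) ?_
      rw [Lp.enorm_toLp, ENNReal.ofReal_coe_nnreal]
      exact (hnorm q (by omega)).2
    refine (norm_piLp_le ξ₀ h1).trans (le_of_eq ?_)
    simp

end Kondratev

namespace Kondratev

variable {𝕜 : Type*} [RCLike 𝕜]

open scoped NNReal ENNReal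

/-! ### Continuous representatives -/

/-- Integration of the derivative of (T − x + r)V(r) from x − T to x. With T a full period the right
side depends on V and v only up to null sets, so it defines a pointwise representative that is
jointly measurable when parameters are present. -/
theorem IsPrimitiveOn.smul_eq_integral {V v : ℝ → 𝕜} (h : IsPrimitiveOn univ V v) (T x : ℝ) :
    T • V x = ∫ t in (0 : ℝ)..T, (V (x - t) + (T - t) • v (x - t)) := by
  have h1 := (h.real_smul (a := fun r => T - x + r) (a' := fun _ => 1)
    (fun r _ => by simpa using (hasDerivAt_id r).const_add (T - x)) continuousOn_const).eq
    (x - T) (mem_univ _) x (mem_univ _)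
  have h2 := intervalIntegral.integral_comp_sub_left (a := 0) (b := T)
    (fun r => (1 : ℝ) • V r + (T - x + r) • v r) x
  simp only [sub_zero] at h2
  rw [← h2] at h1
  have h3 : T - x + (x - T) = 0 := by ring
  have h4 : T - x + x = T := by ring
  rw [h3, h4, zero_smul, sub_zero] at h1
  rw [h1]
  refine intervalIntegral.integral_congr fun t _ => ?_
  simp only [one_smul]
  congr 2
  ring

/-- The continuous representative of a function `u` on the circle with weak derivative `v`. -/
noncomputable def circRep (u v : Circ → 𝕜) (θ : Circ) : 𝕜 :=
  (2 * Real.pi)⁻¹ • ∫ t in (0 : ℝ)..(2 * Real.pi),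
    (u (θ - (t : Circ)) + (2 * Real.pi - t) • v (θ - (t : Circ)))

section Circle

variable {u v : Circ → 𝕜}

theorem circRep_coe {V : ℝ → 𝕜} (hV : V =ᵐ[volume] fun s : ℝ => u (s : Circ))
    (h : IsPrimitiveOn univ V fun s : ℝ => v (s : Circ)) (x : ℝ) : circRep u v (x : Circ) = V x := by
  have h1 := h.smul_eq_integral (2 * Real.pi) x
  rw [circRep, eq_comm, eq_inv_smul_iff₀ Real.two_pi_pos.ne', h1]
  refine intervalIntegral.integral_congr_ae ?_
  have h2 : ∀ᵐ t : ℝ, V (x - t) = u ((x - t : ℝ) : Circ) :=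
    (Measure.measurePreserving_sub_left volume x).quasiMeasurePreserving.ae hV
  filter_upwards [h2] with t ht _
  rw [ht, AddCircle.coe_sub]

theorem continuous_circRep (h : HasACDeriv univ (fun s : ℝ => u (s : Circ)) fun s => v (s : Circ)) :
    Continuous (circRep u v) := by
  obtain ⟨V, hV, hp⟩ := h
  rw [Measure.restrict_univ] at hV
  have hq : IsOpenQuotientMap ((↑) : ℝ → Circ) := QuotientAddGroup.isOpenQuotientMap_mk
  rw [hq.isQuotientMap.continuous_iff]
  have : circRep u v ∘ ((↑) : ℝ → Circ) = V := funext fun x => circRep_coe hV hp x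
  rw [this, ← continuousOn_univ]
  exact hp.continuousOn isOpen_univ

theorem circRep_ae_eq (h : HasACDeriv univ (fun s : ℝ => u (s : Circ)) fun s => v (s : Circ)) :
    u =ᵐ[volume] circRep u v := by
  obtain ⟨V, hV, hp⟩ := h
  rw [Measure.restrict_univ] at hV
  refine ae_circ_of_ae_coe ?_
  filter_upwards [hV] with s hs
  rw [circRep_coe hV hp, hs]

theorem hasACDeriv_circRep
    (h : HasACDeriv univ (fun s : ℝ => u (s : Circ)) fun s => v (s : Circ)) :
    HasACDeriv univ (fun s : ℝ => circRep u v (s : Circ)) fun s => v (s : Circ) := by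
  refine h.congr ?_ EventuallyEq.rfl
  rw [Measure.restrict_univ]
  exact ae_coe_circ (circRep_ae_eq h)

theorem norm_circRep_le (hu : Integrable u) (hv : Integrable v) (θ : Circ) :
    ‖circRep u v θ‖ ≤ ∫ t, (‖u t‖ + ‖v t‖) := by
  have hpi : 1 ≤ 2 * Real.pi := by linarith [Real.pi_gt_three]
  have e1 : ∫ t, (‖u t‖ + ‖v t‖) =
      ∫ t in (0 : ℝ)..(2 * Real.pi), (‖u (θ - (t : Circ))‖ + ‖v (θ - (t : Circ))‖) := by
    rw [← integral_sub_left_eq_self (fun t => ‖u t‖ + ‖v t‖) volume θ]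
    have := AddCircle.intervalIntegral_preimage (2 * Real.pi) 0
      (fun t => ‖u (θ - t)‖ + ‖v (θ - t)‖)
    rw [zero_add] at this
    exact this.symm
  have hi : IntervalIntegrable (fun t : ℝ => ‖u (θ - (t : Circ))‖ + ‖v (θ - (t : Circ))‖) volume 0
      (2 * Real.pi) := by
    have h1 : Integrable fun t : Circ => ‖u (θ - t)‖ + ‖v (θ - t)‖ :=
      (hu.comp_sub_left θ).norm.add (hv.comp_sub_left θ).norm
    have h2 := (AddCircle.measurePreserving_mk (2 * Real.pi) 0).integrable_comp_of_integrable h1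
    rw [zero_add] at h2
    exact (intervalIntegrable_iff_integrableOn_Ioc_of_le Real.two_pi_pos.le).2 h2
  rw [circRep, norm_smul, norm_inv, Real.norm_of_nonneg Real.two_pi_pos.le,
    inv_mul_le_iff₀ Real.two_pi_pos, e1, ← intervalIntegral.integral_const_mul]
  refine intervalIntegral.norm_integral_le_of_norm_le Real.two_pi_pos.le ?_ (hi.const_mul _)
  refine Eventually.of_forall fun t ht => (norm_add_le _ _).trans ?_
  rw [norm_smul, Real.norm_of_nonneg (sub_nonneg.2 ht.2), mul_add]
  refine add_le_add (le_mul_of_one_le_left (norm_nonneg _) hpi) ?_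
  exact mul_le_mul_of_nonneg_right (by linarith [ht.1]) (norm_nonneg _)

end Circle

theorem stronglyMeasurable_circRep {u v : ℝ × Circ → 𝕜} (hu : StronglyMeasurable u)
    (hv : StronglyMeasurable v) : StronglyMeasurable fun x : ℝ × Circ =>
      circRep (fun θ => u (x.1, θ)) (fun θ => v (x.1, θ)) x.2 := by
  simp only [circRep, intervalIntegral.integral_of_le Real.two_pi_pos.le]
  refine StronglyMeasurable.const_smul ?_ _
  have hm : Measurable fun y : (ℝ × Circ) × ℝ => (y.1.1, y.1.2 - (y.2 : Circ)) :=
    (measurable_fst.comp measurable_fst).prodMk ((measurable_snd.comp measurable_fst).sub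
      ((AddCircle.measurable_mk').comp measurable_snd))
  exact StronglyMeasurable.integral_prod_right' (f := fun y : (ℝ × Circ) × ℝ =>
    u (y.1.1, y.1.2 - (y.2 : Circ)) + (2 * Real.pi - y.2) • v (y.1.1, y.1.2 - (y.2 : Circ)))
    ((hu.comp_measurable hm).add
      ((measurable_const.sub measurable_snd).stronglyMeasurable.smul (hv.comp_measurable hm)))

/-- The primitive in the radial variable vanishing at `ψ = 0`. -/
noncomputable def radialPrim (V : ℝ × Circ → 𝕜) (x : ℝ × Circ) : 𝕜 :=
  ∫ s in (0 : ℝ)..x.1, (Ioo (0 : ℝ) 1).indicator (fun s => V (s, x.2)) s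

section RadialPrim

variable {V : ℝ × Circ → 𝕜} {g : ℝ → ℝ}

theorem radialPrim_zero (V : ℝ × Circ → 𝕜) (θ : Circ) : radialPrim V (0, θ) = 0 := by
  simp [radialPrim]

theorem ae_norm_indicator_le
    (hb : ∀ᵐ s ∂(volume.restrict (Ioo (0 : ℝ) 1)), ∀ θ, ‖V (s, θ)‖ ≤ g s) (θ : Circ) :
    ∀ᵐ s, ‖(Ioo (0 : ℝ) 1).indicator (fun s => V (s, θ)) s‖ ≤ (Ioo (0 : ℝ) 1).indicator g s := by
  rw [ae_restrict_iff' measurableSet_Ioo] at hb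
  filter_upwards [hb] with s hs
  by_cases hm : s ∈ Ioo (0 : ℝ) 1
  · rw [indicator_of_mem hm, indicator_of_mem hm]
    exact hs hm θ
  · rw [indicator_of_notMem hm, indicator_of_notMem hm, norm_zero]

theorem norm_radialPrim_le
    (hb : ∀ᵐ s ∂(volume.restrict (Ioo (0 : ℝ) 1)), ∀ θ, ‖V (s, θ)‖ ≤ g s)
    (hg : IntegrableOn g (Ioo 0 1)) (x : ℝ × Circ) :
    ‖radialPrim V x‖ ≤ ∫ s in Ioo (0 : ℝ) 1, g s := by
  have hi : Integrable ((Ioo (0 : ℝ) 1).indicator g) :=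
    (integrable_indicator_iff measurableSet_Ioo).2 hg
  have hae := ae_norm_indicator_le hb x.2
  rw [← integral_indicator measurableSet_Ioo]
  rw [radialPrim, intervalIntegral.norm_intervalIntegral_eq]
  exact (norm_integral_le_of_norm_le hi.integrableOn (ae_restrict_of_ae hae)).trans
    (setIntegral_le_integral hi (hae.mono fun s hs => (norm_nonneg _).trans hs))

/-- Dominated convergence for an integral with parameter θ and variable endpoint ψ; the majorant
g(s) is uniform in θ. -/
theorem continuous_radialPrim (hm : StronglyMeasurable V)
    (hb : ∀ᵐ s ∂(volume.restrict (Ioo (0 : ℝ) 1)), ∀ θ, ‖V (s, θ)‖ ≤ g s)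
    (hg : IntegrableOn g (Ioo 0 1))
    (hc : ∀ᵐ s ∂(volume.restrict (Ioo (0 : ℝ) 1)), Continuous fun θ => V (s, θ)) :
    Continuous (radialPrim V) := by
  have hi : Integrable ((Ioo (0 : ℝ) 1).indicator g) :=
    (integrable_indicator_iff measurableSet_Ioo).2 hg
  have hmθ : ∀ θ, StronglyMeasurable ((Ioo (0 : ℝ) 1).indicator fun s => V (s, θ)) := fun θ =>
    (hm.comp_measurable (measurable_id.prodMk measurable_const)).indicator measurableSet_Ioo
  rw [continuous_iff_continuousAt]
  rintro ⟨ψ, θ⟩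
  have h1 := intervalIntegral.continuousAt_parametric_primitive_of_dominated (μ := volume)
    (F := fun θ s => (Ioo (0 : ℝ) 1).indicator (fun s => V (s, θ)) s)
    ((Ioo (0 : ℝ) 1).indicator g) (-|ψ| - 1) (|ψ| + 1) (a₀ := 0) (b₀ := ψ) (x₀ := θ)
    (fun θ => (hmθ θ).aestronglyMeasurable)
    (Eventually.of_forall fun θ => ae_restrict_of_ae (ae_norm_indicator_le hb θ))
    hi.intervalIntegrable (ae_restrict_of_ae ?_)
    ⟨by linarith [abs_nonneg ψ], by linarith [abs_nonneg ψ]⟩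
    ⟨by linarith [neg_abs_le ψ], by linarith [le_abs_self ψ]⟩ (by simp)
  · exact ContinuousAt.comp (f := fun x : ℝ × Circ => (x.2, x.1))
      (g := fun p : Circ × ℝ => ∫ s in (0 : ℝ)..p.2, (Ioo (0 : ℝ) 1).indicator
        (fun s => V (s, p.1)) s) h1 (continuous_snd.prodMk continuous_fst).continuousAt
  · rw [ae_restrict_iff' measurableSet_Ioo] at hc
    filter_upwards [hc] with s hs
    by_cases hm : s ∈ Ioo (0 : ℝ) 1
    · simp only [indicator_of_mem hm]
      exact (hs hm).continuousAt
    · simp only [indicator_of_notMem hm]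
      exact continuousAt_const

end RadialPrim


variable {γ : ℝ} {a b : ℝ × Circ → 𝕜} {R : ℝ≥0}

theorem memLp_rpow_fst (hγ : 1 / 2 < γ) : MemLp (fun x : ℝ × Circ => x.1 ^ (γ - 1)) 2 muPi := by
  rw [memLp_two_iff_integrable_sq (measurable_rpow_fst _).aestronglyMeasurable, muPi_eq]
  have h1 : IntegrableOn (fun s : ℝ => (s ^ (γ - 1)) ^ 2) (Ioo 0 1) := by
    have h2 := (intervalIntegral.integrableOn_Ioo_rpow_iff (s := (γ - 1) * 2) one_pos).2
      (by linarith)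
    refine h2.congr_fun (fun s hs => ?_) measurableSet_Ioo
    dsimp only
    rw [Real.rpow_mul hs.1.le]
    norm_cast
  exact Integrable.comp_fst h1 _

/-- The norm of `ψ^{γ-1}` in `L²(Π)`. -/
noncomputable def radialConst (γ : ℝ) : ℝ≥0 :=
  (eLpNorm (fun x : ℝ × Circ => x.1 ^ (γ - 1)) 2 muPi).toNNReal

/-- ψ^{-1}b = ψ^{γ-1} · ψ^{-γ}b is a product of two L² functions, the first being in L² because γ >
1/2. -/
theorem L2Bound.integrable_inv_smul (hγ : 1 / 2 < γ) (h : L2Bound γ true b R) :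
    Integrable (fun x => x.1⁻¹ • b x) muPi ∧
      ∫ x, ‖x.1⁻¹ • b x‖ ∂muPi ≤ radialConst γ * R := by
  have hρ := memLp_rpow_fst hγ
  have hb := h.memLp
  have e : (fun x : ℝ × Circ => x.1 ^ (γ - 1) • x.1 ^ (-wexp γ true) • b x) =ᵐ[muPi]
      fun x => x.1⁻¹ • b x := by
    filter_upwards [ae_muPi_mem] with x hx
    rw [smul_smul, ← Real.rpow_add hx.1.1, ← Real.rpow_neg_one]
    congr 2
    simp only [wexp, if_true]
    ring
  have h1 : Integrable (fun x => x.1⁻¹ • b x) muPi :=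
    (memLp_one_iff_integrable.1 (MemLp.smul (r := 1) hb hρ)).congr e
  refine ⟨h1, ?_⟩
  rw [integral_norm_eq_lintegral_enorm h1.1, ← eLpNorm_one_eq_lintegral_enorm]
  refine ENNReal.toReal_le_of_le_ofReal (by positivity) ?_
  rw [← eLpNorm_congr_ae e]
  refine (eLpNorm_smul_le_mul_eLpNorm (p := 2) (q := 2) hb.1 hρ.1).trans ?_
  rw [ENNReal.ofReal_mul (by positivity), ENNReal.ofReal_coe_nnreal, ENNReal.ofReal_coe_nnreal,
    radialConst, ENNReal.coe_toNNReal hρ.2.ne]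
  exact mul_le_mul_right h.norm _

/-- Every interval (0,δ) has positive measure, so the bound holds at points arbitrarily close to
zero, where its right side tends to zero. -/
theorem tendsto_unique_of_ae_le {A : ℝ → 𝕜} {k : 𝕜} (hγ : 1 / 2 < γ)
    (hA : Tendsto A (𝓝[>] 0) (𝓝 k)) {C : ℝ≥0∞} (hC : C ≠ ⊤)
    (h : ∀ᵐ ψ ∂(volume.restrict (Ioo (0 : ℝ) 1)), ‖A ψ‖ₑ ^ 2 ≤ ENNReal.ofReal (ψ ^ (2 * γ - 1)) * C) :
    k = 0 := by
  have hr : Tendsto (fun ψ : ℝ => ENNReal.ofReal (ψ ^ (2 * γ - 1)) * C) (𝓝[>] 0) (𝓝 0) := by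
    have h1 : Tendsto (fun ψ : ℝ => ψ ^ (2 * γ - 1)) (𝓝[>] 0) (𝓝 0) := by
      have := (Real.continuousAt_rpow_const 0 (2 * γ - 1) (Or.inr (by linarith))).tendsto
      rw [Real.zero_rpow (by linarith)] at this
      exact this.mono_left nhdsWithin_le_nhds
    have h2 := ENNReal.Tendsto.mul_const (ENNReal.tendsto_ofReal h1) (Or.inr hC)
    simpa using h2
  have hl : Tendsto (fun ψ => ‖A ψ‖ₑ ^ 2) (𝓝[>] 0) (𝓝 (‖k‖ₑ ^ 2)) :=
    (ENNReal.continuous_pow 2).continuousAt.tendsto.comp (hA.enorm)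
  have hf : ∃ᶠ ψ in 𝓝[>] (0 : ℝ), ‖A ψ‖ₑ ^ 2 ≤ ENNReal.ofReal (ψ ^ (2 * γ - 1)) * C := by
    intro hn
    obtain ⟨δ, hδ, hsub⟩ := mem_nhdsGT_iff_exists_Ioo_subset.1 hn
    have hδ' : 0 < min δ 1 := lt_min hδ one_pos
    have h0 := ae_restrict_of_ae_restrict_of_subset
      (Ioo_subset_Ioo_right (min_le_right δ 1) : Ioo 0 (min δ 1) ⊆ Ioo (0 : ℝ) 1) h
    have h1 : ∀ᵐ ψ ∂(volume.restrict (Ioo (0 : ℝ) (min δ 1))), False := by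
      filter_upwards [h0, ae_restrict_mem measurableSet_Ioo] with ψ h2 h3
      exact hsub ⟨h3.1, h3.2.trans_le (min_le_left _ _)⟩ h2
    simp only [ae_iff, not_false_eq_true, ofPred_true, Measure.restrict_apply_univ,
      Real.volume_Ioo, sub_zero, ENNReal.ofReal_eq_zero] at h1
    linarith
  have := le_of_tendsto_of_tendsto_of_frequently hl hr hf
  simpa using this

/-- The representative is the integral from ψ = 0 of ∂_ψ a. This derivative is integrable and, on
almost every circle, has a continuous version controlled by itself and its angular derivative. The
possible constant on each radial line is zero by the decay estimate. -/
theorem SobBound.exists_continuous (hγ : 1 / 2 < γ) (h : SobBound γ true 2 a R) :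
    ∃ W : ℝ × Circ → 𝕜, Continuous W ∧ (∀ θ, W (0, θ) = 0) ∧ a =ᵐ[muPi] W ∧
      ∀ x, ‖W x‖ ≤ 2 * radialConst γ * R := by
  have hdecay := h.ae_bound_decay hγ
  obtain ⟨h0, a₁, -, hr, -, ⟨h10, -, a₁₂, -, hang, -, h12⟩, -⟩ := h
  have hbm := h10.meas.ae_eq_mk
  have hcm := (L2Bound.meas h12).ae_eq_mk
  set b := h10.meas.mk a₁
  set c := (L2Bound.meas h12).mk a₁₂
  have hb : StronglyMeasurable b := h10.meas.stronglyMeasurable_mk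
  have hc : StronglyMeasurable c := (L2Bound.meas h12).stronglyMeasurable_mk
  obtain ⟨hBi, hBn⟩ := (h10.congr hbm).integrable_inv_smul hγ
  obtain ⟨hCi, hCn⟩ := (L2Bound.congr h12 hcm).integrable_inv_smul hγ
  have hBC : HasAngularDeriv (fun x => x.1⁻¹ • b x) fun x => x.1⁻¹ • c x :=
    (hang.congr hbm hcm).radial_smul fun s => s⁻¹
  have hinv : StronglyMeasurable fun x : ℝ × Circ => x.1⁻¹ := (measurable_fst.inv).stronglyMeasurable
  have hBm : StronglyMeasurable fun x : ℝ × Circ => x.1⁻¹ • b x := hinv.smul hb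
  have hCm : StronglyMeasurable fun x : ℝ × Circ => x.1⁻¹ • c x := hinv.smul hc
  set B := fun x : ℝ × Circ => x.1⁻¹ • b x
  set C := fun x : ℝ × Circ => x.1⁻¹ • c x
  let V : ℝ × Circ → 𝕜 := fun x => circRep (fun θ => B (x.1, θ)) (fun θ => C (x.1, θ)) x.2
  have hV : StronglyMeasurable V := stronglyMeasurable_circRep hBm hCm
  let g : ℝ → ℝ := fun s => ∫ θ, (‖B (s, θ)‖ + ‖C (s, θ)‖)
  have hsum : Integrable (fun x => ‖B x‖ + ‖C x‖) muPi := hBi.norm.add hCi.norm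
  have hg : IntegrableOn g (Ioo 0 1) := by
    rw [muPi_eq] at hsum
    exact hsum.integral_prod_left
  have hgn : ∫ s in Ioo (0 : ℝ) 1, g s ≤ 2 * radialConst γ * R := by
    have e : ∫ s in Ioo (0 : ℝ) 1, g s = ∫ x, (‖B x‖ + ‖C x‖) ∂muPi := by
      rw [muPi_eq] at hsum ⊢
      exact (integral_prod _ hsum).symm
    rw [e, integral_add hBi.norm hCi.norm]
    linarith
  have hVb : ∀ᵐ s ∂(volume.restrict (Ioo (0 : ℝ) 1)), ∀ θ, ‖V (s, θ)‖ ≤ g s := by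
    rw [muPi_eq] at hBi hCi
    filter_upwards [hBi.prod_right_ae, hCi.prod_right_ae] with s h1 h2 θ
    exact norm_circRep_le h1 h2 θ
  have hVc : ∀ᵐ s ∂(volume.restrict (Ioo (0 : ℝ) 1)), Continuous fun θ => V (s, θ) := by
    filter_upwards [hBC] with s hs
    exact continuous_circRep (u := fun θ => B (s, θ)) (v := fun θ => C (s, θ)) hs
  have hVB : ∀ᵐ x ∂muPi, B x = V x := by
    refine ae_muPi_of_radial (measurableSet_eq_fun hBm.measurable hV.measurable) ?_
    filter_upwards [hBC] with s hs
    exact circRep_ae_eq (u := fun θ => B (s, θ)) (v := fun θ => C (s, θ)) hs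
  have hW := continuous_radialPrim hV hVb hg hVc
  refine ⟨radialPrim V, hW, radialPrim_zero V, ?_, fun x => (norm_radialPrim_le hVb hg x).trans hgn⟩
  have hVa : ∀ᵐ x ∂muPi, x.1⁻¹ • a₁ x = V x := by
    filter_upwards [hbm, hVB] with x h1 h2
    rw [h1, ← h2]
  have ham := h0.meas.ae_eq_mk
  have hsm : StronglyMeasurable (h0.meas.mk a) := h0.meas.stronglyMeasurable_mk
  refine ham.trans (ae_muPi_of_angular (P := fun x => h0.meas.mk a x = radialPrim V x)
    (measurableSet_eq_fun hsm.measurable hW.measurable) ?_)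
  filter_upwards [hr, ae_angular_of_ae_muPi hdecay, ae_angular_of_ae_muPi hVa,
    ae_angular_of_ae_muPi ham] with θ ⟨A, hA, hp⟩ h2 h3 h4
  have hI : Integrable ((Ioo (0 : ℝ) 1).indicator fun s => V (s, θ)) :=
    ((integrable_indicator_iff measurableSet_Ioo).2 hg).mono'
      ((hV.comp_measurable (measurable_id.prodMk measurable_const)).indicator
        measurableSet_Ioo).aestronglyMeasurable (ae_norm_indicator_le hVb θ)
  have hp' := hp.congr h3
  -- On a radial line two primitives of the same function differ by a constant, evaluated here at
  -- 1/2.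
  have key : ∀ ψ ∈ Ioo (0 : ℝ) 1, A ψ = radialPrim V (ψ, θ) +
      (A (1 / 2) - radialPrim V (1 / 2, θ)) := by
    intro ψ hψ
    have h12 : (1 / 2 : ℝ) ∈ Ioo (0 : ℝ) 1 := by norm_num
    have e1 := hp'.eq (1 / 2) h12 ψ hψ
    have e2 : ∫ s in (1 / 2)..ψ, V (s, θ) =
        ∫ s in (1 / 2)..ψ, (Ioo (0 : ℝ) 1).indicator (fun s => V (s, θ)) s := by
      refine intervalIntegral.integral_congr fun s hs => ?_
      have : s ∈ Ioo (0 : ℝ) 1 := Set.OrdConnected.uIcc_subset ordConnected_Ioo h12 hψ hs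
      simp only [indicator_of_mem this]
    have e3 := intervalIntegral.integral_interval_sub_left (a := 0) (b := ψ) (c := 1 / 2)
      hI.intervalIntegrable hI.intervalIntegrable
    rw [e2, ← e3] at e1
    change A ψ - A (1 / 2) = radialPrim V (ψ, θ) - radialPrim V (1 / 2, θ) at e1
    rw [← sub_add_cancel (A ψ) (A (1 / 2)), e1]
    ring
  have hlim : Tendsto A (𝓝[>] 0) (𝓝 (A (1 / 2) - radialPrim V (1 / 2, θ))) := by
    have h5 : Tendsto (fun ψ : ℝ => radialPrim V (ψ, θ)) (𝓝[>] 0) (𝓝 0) := by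
      have := (hW.comp (continuous_id.prodMk continuous_const : Continuous fun ψ : ℝ => (ψ, θ))).tendsto 0
      rw [Function.comp_apply, id, radialPrim_zero] at this
      exact this.mono_left nhdsWithin_le_nhds
    have h6 := h5.add_const (A (1 / 2) - radialPrim V (1 / 2, θ))
    rw [zero_add] at h6
    refine h6.congr' ?_
    filter_upwards [Ioo_mem_nhdsGT (one_pos : (0 : ℝ) < 1)] with ψ hψ
    exact (key ψ hψ).symm
  have hk := tendsto_unique_of_ae_le (C := (15 * R) ^ 2) hγ hlim (by finiteness) (by
    filter_upwards [hA, h2] with ψ h5 h6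
    rwa [h5])
  filter_upwards [hA, h4, ae_restrict_mem measurableSet_Ioo] with ψ h5 h6 hψ
  rw [← h6, ← h5, key ψ hψ, hk, add_zero]

end Kondratev

namespace Kondratev

variable {𝕜 : Type*} [RCLike 𝕜]

open scoped NNReal ENNReal

/-! ### The continuous representative of an element of `J_{0,γ}^m(Π)` -/

variable {m : ℕ} {γ : ℝ}

theorem SobolevCirc.eLpNorm_derivFn_le (ξ : SobolevCirc 𝕜 m) (q : ℕ) :
    eLpNorm (SobolevCirc.derivFn ξ q) 2 volume ≤ ‖ξ‖₊ := by
  rw [derivFn]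
  split_ifs with h
  · rw [← Lp.enorm_def, enorm_eq_nnnorm]
    exact_mod_cast PiLp.nnnorm_apply_le _ _
  · simp

/-- The norm of the embedding of `L²(𝕋)` into `L¹(𝕋)`. -/
noncomputable def circConst : ℝ≥0 :=
  ((volume (univ : Set Circ)) ^ (1 / (1 : ℝ≥0∞).toReal - 1 / (2 : ℝ≥0∞).toReal)).toNNReal

theorem SobolevCirc.integral_norm_le (ξ : SobolevCirc 𝕜 m) {q : ℕ} (h : q ≤ m) :
    ∫ θ, ‖SobolevCirc.derivFn ξ q θ‖ ≤ circConst * ‖ξ‖ := by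
  have hi := (SobolevCirc.isCircWeakDeriv ξ h).right_int
  rw [integral_norm_eq_lintegral_enorm hi.1, ← eLpNorm_one_eq_lintegral_enorm]
  refine ENNReal.toReal_le_of_le_ofReal (by positivity) ?_
  refine (eLpNorm_le_eLpNorm_mul_rpow_measure_univ (q := 2) (by norm_num) hi.1).trans ?_
  rw [ENNReal.ofReal_mul (by positivity), ENNReal.ofReal_coe_nnreal, circConst,
    ENNReal.coe_toNNReal (ENNReal.rpow_ne_top_of_nonneg (by norm_num) (measure_ne_top _ _)), mul_comm, ofReal_norm, enorm_eq_nnnorm]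
  exact mul_le_mul_right (SobolevCirc.eLpNorm_derivFn_le ξ q) _

theorem SobolevCirc.exists_continuous (hm : 1 ≤ m) (ξ : SobolevCirc 𝕜 m) :
    ∃ α : Circ → 𝕜, Continuous α ∧ SobolevCirc.fn ξ =ᵐ[volume] α ∧
      HasAngularDeriv (fun x => α x.2) (fun x => SobolevCirc.derivFn ξ 1 x.2) ∧
      ∀ θ, ‖α θ‖ ≤ 2 * circConst * ‖ξ‖ := by
  have h0 := SobolevCirc.isCircWeakDeriv ξ (q := 0) (by omega)
  have h1 := SobolevCirc.isCircWeakDeriv ξ (q := 1) hm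
  have hac : HasACDeriv univ (fun s : ℝ => SobolevCirc.derivFn ξ 0 (s : Circ))
    fun s => SobolevCirc.derivFn ξ 1 (s : Circ) := h0.hasACDeriv h1
  refine ⟨circRep (SobolevCirc.derivFn ξ 0) (SobolevCirc.derivFn ξ 1), continuous_circRep hac,
    circRep_ae_eq hac, Eventually.of_forall fun ψ => hasACDeriv_circRep hac, fun θ => ?_⟩
  refine (norm_circRep_le h0.right_int h1.right_int θ).trans ?_
  rw [integral_add h0.right_int.norm h1.right_int.norm]
  linarith [SobolevCirc.integral_norm_le ξ (q := 0) (by omega), SobolevCirc.integral_norm_le ξ hm]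

theorem closedPi_subset_closure : closedPi ⊆ closure openPi := by
  unfold closedPi openPi
  rw [closure_prod_eq, closure_Ioo zero_ne_one, closure_univ]

theorem isCompact_closedPi : IsCompact closedPi := isCompact_Icc.prod isCompact_univ

theorem openPi_subset_closedPi : openPi ⊆ closedPi := prod_mono Ioo_subset_Icc_self subset_rfl

theorem eqOn_closedPi {U V : ℝ × Circ → 𝕜} (hU : ContinuousOn U closedPi)
    (hV : ContinuousOn V closedPi) (h : U =ᵐ[muPi] V) : EqOn U V closedPi := by
  have h1 : EqOn U V openPi := Measure.eqOn_open_of_ae_eq h isOpen_openPi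
    (hU.mono openPi_subset_closedPi) (hV.mono openPi_subset_closedPi)
  exact h1.of_subset_closure hU hV openPi_subset_closedPi closedPi_subset_closure

/-- Continuous representatives `α` and `W` of the two components of `u`. -/
structure IsSplitRep (u : JSpace 𝕜 m γ) (α : Circ → 𝕜) (W : ℝ × Circ → 𝕜) : Prop where
  cont_fst : Continuous α
  cont_snd : Continuous W
  zero : ∀ θ, W (0, θ) = 0
  ae_fst : SobolevCirc.fn u.fst =ᵐ[volume] α
  ae_snd : KondratevPi.fn u.snd =ᵐ[muPi] W

theorem SobolevCirc.fn_add (ξ η : SobolevCirc 𝕜 m) :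
    SobolevCirc.fn (ξ + η) =ᵐ[volume] fun θ => SobolevCirc.fn ξ θ + SobolevCirc.fn η θ :=
  Lp.coeFn_add _ _

theorem SobolevCirc.fn_smul (c : 𝕜) (ξ : SobolevCirc 𝕜 m) :
    SobolevCirc.fn (c • ξ) =ᵐ[volume] fun θ => c * SobolevCirc.fn ξ θ :=
  Lp.coeFn_smul c _

theorem KondratevPi.fn_add (w z : KondratevPi 𝕜 m γ) :
    KondratevPi.fn (w + z) =ᵐ[muPi] fun x => KondratevPi.fn w x + KondratevPi.fn z x := by
  filter_upwards [Lp.coeFn_add (w.1 (derivIdxZero m)) (z.1 (derivIdxZero m))] with x hx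
  simp only [KondratevPi.fn, unweight, ← smul_add]
  congr 1

theorem KondratevPi.fn_smul (c : 𝕜) (w : KondratevPi 𝕜 m γ) :
    KondratevPi.fn (c • w) =ᵐ[muPi] fun x => c * KondratevPi.fn w x := by
  filter_upwards [Lp.coeFn_smul c (w.1 (derivIdxZero m))] with x hx
  exact (congrArg (x.1 ^ (γ - ((0 : ℕ) : ℝ)) • ·) hx).trans (mul_smul_comm _ _ _).symm

theorem JSpace.fn_add (u v : JSpace 𝕜 m γ) :
    JSpace.fn (u + v) =ᵐ[muPi] fun x => JSpace.fn u x + JSpace.fn v x := by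
  filter_upwards [ae_muPi_snd (SobolevCirc.fn_add u.fst v.fst), KondratevPi.fn_add u.snd v.snd]
    with x h1 h2
  simp only [JSpace.fn, WithLp.add_fst, WithLp.add_snd, h1, h2]
  ring

theorem JSpace.fn_smul (c : 𝕜) (u : JSpace 𝕜 m γ) :
    JSpace.fn (c • u) =ᵐ[muPi] fun x => c * JSpace.fn u x := by
  filter_upwards [ae_muPi_snd (SobolevCirc.fn_smul c u.fst), KondratevPi.fn_smul c u.snd]
    with x h1 h2
  simp only [JSpace.fn, WithLp.smul_fst, WithLp.smul_snd, h1, h2]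
  ring

theorem JSpace.norm_fst_le (u : JSpace 𝕜 m γ) : ‖u.fst‖ ≤ ‖u‖ := by
  rw [WithLp.prod_norm_eq_of_L2]
  exact Real.le_sqrt_of_sq_le (le_add_of_nonneg_right (sq_nonneg _))

theorem JSpace.norm_snd_le (u : JSpace 𝕜 m γ) : ‖u.snd‖ ≤ ‖u‖ := by
  rw [WithLp.prod_norm_eq_of_L2]
  exact Real.le_sqrt_of_sq_le (le_add_of_nonneg_left (sq_nonneg _))

namespace IsSplitRep

variable {u v : JSpace 𝕜 m γ} {α β : Circ → 𝕜} {W H : ℝ × Circ → 𝕜}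

theorem continuous (h : IsSplitRep u α W) : Continuous fun x : ℝ × Circ => α x.2 + W x :=
  (h.cont_fst.comp continuous_snd).add h.cont_snd

theorem ae_eq (h : IsSplitRep u α W) : JSpace.fn u =ᵐ[muPi] fun x => α x.2 + W x := by
  filter_upwards [ae_muPi_snd h.ae_fst, h.ae_snd] with x h1 h2
  rw [JSpace.fn, h1, h2]

theorem isContRep (h : IsSplitRep u α W) : IsContRep u fun x => α x.2 + W x :=
  ⟨h.continuous.continuousOn, h.ae_eq⟩

theorem add (h : IsSplitRep u α W) (h' : IsSplitRep v β H) :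
    IsSplitRep (u + v) (fun θ => α θ + β θ) (fun x => W x + H x) where
  cont_fst := h.cont_fst.add h'.cont_fst
  cont_snd := h.cont_snd.add h'.cont_snd
  zero θ := by rw [h.zero, h'.zero, add_zero]
  ae_fst := by
    filter_upwards [SobolevCirc.fn_add u.fst v.fst, h.ae_fst, h'.ae_fst] with θ h1 h2 h3
    rw [← h2, ← h3, ← h1]
    rfl
  ae_snd := by
    filter_upwards [KondratevPi.fn_add u.snd v.snd, h.ae_snd, h'.ae_snd] with θ h1 h2 h3
    rw [← h2, ← h3, ← h1]
    rfl

end IsSplitRep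

/-- The constant of the embedding of `J_{0,γ}^m(Π)` into the continuous functions. -/
noncomputable def supConst (m : ℕ) (γ : ℝ) : ℝ≥0 :=
  2 * circConst + 2 * radialConst γ * sobConst m

/-- With m = n + 1 the first derivatives have order n. All the data are bounded linearly by the norm
of u, so the same lemma serves for base points and for small increments. -/
theorem JSpace.exists_splitData {n : ℕ} (hn : 1 ≤ n) (hγ : 1 / 2 < γ) (u : JSpace 𝕜 (n + 1) γ) :
    ∃ α W ξ₂ w₁ w₂, IsSplitRep u α W ∧
      SplitData γ n α W ξ₂ w₁ w₂ (sobConst (n + 1) * ‖u‖₊) ∧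
      (∀ θ, ‖α θ‖ ≤ supConst (n + 1) γ * ‖u‖) ∧
      ∀ x, ‖α x.2 + W x‖ ≤ supConst (n + 1) γ * ‖u‖ := by
  obtain ⟨α, hα, hαe, hαd, hαn⟩ := SobolevCirc.exists_continuous (by omega) u.fst
  have hw := KondratevPi.sobBound u.snd
  obtain ⟨W, hW, hW0, hWe, hWn⟩ := (hw.of_le (l := 2) (by omega)).exists_continuous hγ
  obtain ⟨-, w₁, w₂, hr, ha, h1, h2⟩ := hw
  have hle : sobConst (n + 1) * ‖u.snd‖₊ ≤ sobConst (n + 1) * ‖u‖₊ := by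
    gcongr
    exact JSpace.norm_snd_le u
  have hle' : ‖u.fst‖₊ ≤ sobConst (n + 1) * ‖u‖₊ :=
    (show ‖u.fst‖₊ ≤ ‖u‖₊ from JSpace.norm_fst_le u).trans
      (le_mul_of_one_le_left' (one_le_sobConst _))
  have b1 : ∀ θ, ‖α θ‖ ≤ 2 * circConst * ‖u‖ := fun θ => (hαn θ).trans (by
    gcongr
    exact JSpace.norm_fst_le u)
  have b2 : ∀ x, ‖W x‖ ≤ 2 * radialConst γ * sobConst (n + 1) * ‖u‖ := fun x => (hWn x).trans (by
    have : ((sobConst (n + 1) * ‖u.snd‖₊ : ℝ≥0) : ℝ) ≤ (sobConst (n + 1) * ‖u‖₊ : ℝ≥0) := hle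
    push_cast at this
    push_cast
    rw [mul_assoc _ _ ‖u‖]
    gcongr)
  refine ⟨α, W, fun x => SobolevCirc.derivFn u.fst 1 x.2, w₁, w₂, ⟨hα, hW, hW0, hαe, hWe⟩,
    ⟨hα, hW.continuousOn, fun θ => ?_, hαd, hr.congr hWe EventuallyEq.rfl,
      ha.congr hWe EventuallyEq.rfl,
      (SobolevCirc.sobBound_derivFn u.fst (by omega)).mono hle', h1.mono hle, h2.mono hle⟩,
    fun θ => (b1 θ).trans ?_, fun x => ?_⟩
  · have := (hW.comp (continuous_id.prodMk continuous_const : Continuous fun ψ : ℝ => (ψ, θ))).tendsto 0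
    rw [Function.comp_apply, id, hW0] at this
    exact this.mono_left nhdsWithin_le_nhds
  · rw [supConst]
    push_cast
    gcongr
    exact le_add_of_nonneg_right (by positivity)
  · refine (norm_add_le _ _).trans ((add_le_add (b1 _) (b2 _)).trans (le_of_eq ?_))
    rw [supConst]
    push_cast
    ring

/-! ### Functions determine the elements of the spaces -/

theorem IsCircWeakDeriv.ae_eq_zero {q : ℕ} {u v : Circ → 𝕜} (h : IsCircWeakDeriv q u v)
    (hu : u =ᵐ[volume] 0) : v =ᵐ[volume] 0 := by
  have key : ∀ φ, IsCircTest φ → ∫ x, φ x • v x = 0 := fun φ hφ => by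
    have h1 := h.eq φ hφ
    have h2 : ∫ x, circDeriv q φ x • u x = 0 := by
      rw [integral_congr_ae (g := fun _ => (0 : 𝕜)) (by filter_upwards [hu] with x hx; simp [hx])]
      simp
    rw [h2] at h1
    exact (smul_eq_zero.1 h1.symm).resolve_left (by simp)
  exact ae_eq_zero_of_fourier h.right_int (fun n => key _ (isCircTest_fourier_re n))
    fun n => key _ (isCircTest_fourier_im n)

/-- Product tests a(ψ)b(θ) suffice: the radial factor localises to circles, and Fourier uniqueness
finishes on almost every circle. -/
theorem IsPiWeakDeriv.ae_eq_zero {p q : ℕ} {u v : ℝ × Circ → 𝕜} (h : IsPiWeakDeriv p q u v)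
    (hv : StronglyMeasurable v) (hu : u =ᵐ[muPi] 0) : v =ᵐ[muPi] 0 := by
  have key : ∀ b, IsCircTest b → ∀ᵐ ψ ∂(volume.restrict (Ioo (0 : ℝ) 1)),
      ∫ θ, b θ • v (ψ, θ) = 0 := by
    intro b hb
    have hbc : Continuous b := by simpa [circDeriv_zero] using continuous_circDeriv hb 0
    refine ae_eq_zero_of_radialTest
      (locallyIntegrableOn_integral (locallyIntegrableOn_circ_smul h.right_int hbc)) fun a ha => ?_
    rw [← integral_mul_smul h.right_int ha hbc]
    have h1 := h.eq _ (ha.mul_isPiTest hb)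
    have h2 : ∫ x, mixedDeriv p q (fun x => a x.1 * b x.2) x • u x ∂muPi = 0 := by
      rw [integral_congr_ae (g := fun _ => (0 : 𝕜)) (by filter_upwards [hu] with x hx; simp [hx])]
      simp
    rw [h2] at h1
    exact (smul_eq_zero.1 h1.symm).resolve_left (by simp)
  refine ae_muPi_of_radial (P := fun x => v x = 0) (measurableSet_eq_fun hv.measurable measurable_const) ?_
  filter_upwards [ae_integrable_circle h.right_int,
    ae_all_iff.2 fun n : ℤ => key _ (isCircTest_fourier_re n),
    ae_all_iff.2 fun n : ℤ => key _ (isCircTest_fourier_im n)] with ψ h1 h2 h3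
  exact ae_eq_zero_of_fourier h1 h2 h3

theorem SobolevCirc.eq_zero {ξ : SobolevCirc 𝕜 m} (h : SobolevCirc.fn ξ =ᵐ[volume] 0) : ξ = 0 := by
  refine Subtype.ext (PiLp.ext fun q => ?_)
  exact (Lp.eq_zero_iff_ae_eq_zero).2 ((ξ.2 q).ae_eq_zero h)

theorem KondratevPi.eq_zero {w : KondratevPi 𝕜 m γ} (h : KondratevPi.fn w =ᵐ[muPi] 0) : w = 0 := by
  refine Subtype.ext (PiLp.ext fun k => ?_)
  refine (Lp.eq_zero_iff_ae_eq_zero).2 ?_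
  have h1 := (w.2 k).ae_eq_zero
    ((measurable_rpow_fst _).stronglyMeasurable.smul (Lp.stronglyMeasurable _)) h
  filter_upwards [h1, ae_muPi_mem] with x hx hm
  exact (smul_eq_zero.1 hx).resolve_left (Real.rpow_pos_of_pos hm.1.1 _).ne'

/-- The sum is direct because the weighted part vanishes at ψ = 0: the trace there recovers ξ. Each
component is then zero together with its stored derivatives. -/
theorem JSpace.eq_zero (hm : 1 < m) (hγ : 1 / 2 < γ) {u : JSpace 𝕜 m γ}
    (h : JSpace.fn u =ᵐ[muPi] 0) : u = 0 := by
  obtain ⟨n, rfl⟩ : ∃ n, m = n + 1 := ⟨m - 1, by omega⟩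
  obtain ⟨α, W, -, -, -, hr, -⟩ := JSpace.exists_splitData (by omega) hγ u
  have h1 := eqOn_closedPi hr.continuous.continuousOn continuousOn_const (hr.ae_eq.symm.trans h)
  have h2 : ∀ θ, α θ = 0 := fun θ => by
    have : α θ + W (0, θ) = 0 := h1 (show ((0 : ℝ), θ) ∈ closedPi from ⟨by simp, mem_univ _⟩)
    rwa [hr.zero, add_zero] at this
  have h3 : u.fst = 0 := SobolevCirc.eq_zero (hr.ae_fst.trans (Eventually.of_forall h2))
  have h4 : u.snd = 0 := by
    refine KondratevPi.eq_zero (hr.ae_snd.trans ?_)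
    filter_upwards [ae_muPi_mem] with x hx
    have : α x.2 + W x = 0 := h1 (openPi_subset_closedPi hx)
    rwa [h2, zero_add] at this
  exact WithLp.ofLp_injective 2 (Prod.ext h3 h4)

theorem JSpace.ext_fn (hm : 1 < m) (hγ : 1 / 2 < γ) {u v : JSpace 𝕜 m γ}
    (h : JSpace.fn u =ᵐ[muPi] JSpace.fn v) : u = v := by
  rw [← sub_eq_zero]
  refine JSpace.eq_zero hm hγ ?_
  have e : u - v = u + (-1 : 𝕜) • v := by simp [sub_eq_add_neg]
  rw [e]
  filter_upwards [JSpace.fn_add u ((-1 : 𝕜) • v), JSpace.fn_smul (-1 : 𝕜) v, h] with x h1 h2 h3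
  rw [h1, h2, h3]
  simp

end Kondratev

namespace Kondratev

variable {𝕜 : Type*} [RCLike 𝕜]

open scoped NNReal ENNReal

/-! ### The superposition operator -/

variable {m n : ℕ} {γ : ℝ}

/-- `v = g(u)` as functions on the annulus. -/
def IsComposition (g : 𝕜 → 𝕜) (u v : JSpace 𝕜 m γ) : Prop :=
  JSpace.fn v =ᵐ[muPi] fun x => g (JSpace.fn u x)

/-- The norm of the constant function `1` in `L²(Π)`. -/
noncomputable def oneConst (𝕜 : Type*) [RCLike 𝕜] : ℝ≥0 :=
  (eLpNorm (fun _ : ℝ × Circ => (1 : 𝕜)) 2 muPi).toNNReal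

theorem SobBound.one (k : ℕ) :
    SobBound γ false k (fun _ : ℝ × Circ => (1 : 𝕜)) (oneConst 𝕜) := by
  have h0 : L2Bound γ false (fun _ : ℝ × Circ => (1 : 𝕜)) (oneConst 𝕜) := by
    refine ⟨aestronglyMeasurable_const, fun _ => ⟨fun _ => 1, EventuallyEq.rfl⟩, ?_⟩
    simp only [wexp, Bool.false_eq_true, if_false, neg_zero, Real.rpow_zero, one_smul]
    rw [oneConst, ENNReal.coe_toNNReal (memLp_const (1 : 𝕜)).2.ne]
  cases k with
  | zero => exact h0
  | succ k => exact ⟨h0, 0, 0, .of_radial (α := fun _ => 1) EventuallyEq.rfl, .const 1, .zero, .zero⟩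

/-- The constant in the norm bound of `exists_of_sobBound`. -/
noncomputable def sumConst (m : ℕ) : ℝ≥0 := (m + 1) + liftConst m

theorem JSpace.exists_of_sobBound {z₁ z₂ : ℝ × Circ → 𝕜} {R S : ℝ≥0}
    (h₁ : SobBound γ false m z₁ R) (h₂ : SobBound γ true m z₂ S) :
    ∃ v : JSpace 𝕜 m γ, JSpace.fn v =ᵐ[muPi] (fun x => z₁ x + z₂ x) ∧
      ‖v‖ ≤ sumConst m * (R + S) := by
  obtain ⟨ξ, hξ, hξn⟩ := h₁.exists_sobolevCirc
  obtain ⟨w, hw, hwn⟩ := h₂.exists_kondratevPi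
  refine ⟨WithLp.toLp 2 (ξ, w), ?_, ?_⟩
  · filter_upwards [hξ, hw] with x h1 h2
    rw [← h1, ← h2]
    rfl
  · have h3 : ‖(WithLp.toLp 2 (ξ, w) : JSpace 𝕜 m γ)‖ ≤ ‖ξ‖ + ‖w‖ := by
      rw [WithLp.prod_norm_eq_of_L2]
      refine Real.sqrt_le_iff.2 ⟨by positivity, ?_⟩
      change ‖ξ‖ ^ 2 + ‖w‖ ^ 2 ≤ _
      nlinarith [norm_nonneg ξ, norm_nonneg w]
    refine h3.trans ((add_le_add hξn hwn).trans ?_)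
    rw [sumConst]
    push_cast
    have := (liftConst m).2
    have := R.2
    have := S.2
    nlinarith [mul_nonneg (liftConst m).2 R.2, mul_nonneg (by positivity : (0 : ℝ) ≤ m + 1) S.2]

theorem mapsTo_of_mem_imageIn {Ω : Set 𝕜} {u : JSpace 𝕜 m γ} (hu : u ∈ imageIn m γ Ω)
    {U : ℝ × Circ → 𝕜} (hU : IsContRep u U) : MapsTo U closedPi Ω := by
  obtain ⟨V, hV, hVΩ⟩ := hu
  intro x hx
  rw [eqOn_closedPi hU.continuousOn hV.continuousOn (hU.ae_eq.symm.trans hV.ae_eq) hx]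
  exact hVΩ x hx

theorem IsSplitRep.fst_mem {u : JSpace 𝕜 m γ} {α : Circ → 𝕜} {W : ℝ × Circ → 𝕜}
    (h : IsSplitRep u α W) (θ : Circ) : α θ ∈ (fun x : ℝ × Circ => α x.2 + W x) '' closedPi :=
  ⟨(0, θ), ⟨by simp, mem_univ _⟩, by simp [h.zero]⟩

theorem SplitData.mono {α : Circ → 𝕜} {W ξ₂ w₁ w₂ : ℝ × Circ → 𝕜} {R S : ℝ≥0}
    (h : SplitData γ n α W ξ₂ w₁ w₂ R) (hRS : R ≤ S) : SplitData γ n α W ξ₂ w₁ w₂ S where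
  cont_fst := h.cont_fst
  cont_snd := h.cont_snd
  lim := h.lim
  angular_fst := h.angular_fst
  radial_snd := h.radial_snd
  angular_snd := h.angular_snd
  bound_fst := h.bound_fst.mono hRS
  bound_radial := h.bound_radial.mono hRS
  bound_angular := h.bound_angular.mono hRS

theorem isGradBound_zero (hγ : 1 / 2 < γ) (hn : 1 ≤ n) {R : ℝ≥0} :
    IsGradBound γ false false n (0 : ℝ × Circ → 𝕜) R :=
  ((SobBound.zero (c := false) (R := 0)).isGradBound hγ hn (by simp)).mono (by simp)

theorem SplitData.isMultiplier_comp_fst (hγ : 1 / 2 < γ) (hn : 1 ≤ n) {Ω Z : Set 𝕜}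
    (hΩ : IsOpen Ω) (hZ : Z ⊆ Ω) {α : Circ → 𝕜} {W ξ₂ w₁ w₂ : ℝ × Circ → 𝕜} {R M : ℝ≥0}
    (h : SplitData γ n α W ξ₂ w₁ w₂ R) (hα : ∀ θ, α θ ∈ Z) {g : 𝕜 → 𝕜}
    (hg : ContDiffOn ℝ (n + 1 : ℕ) g Ω) (hM : DerivBound (n + 1) g Z M) :
    IsMultiplier γ false false (n + 1) (fun x => g (α x.2))
      (4 ^ (n + 1) * M * (1 + gradConst n * R) ^ (n + 1)) :=
  IsMultiplier.comp hΩ hZ h.continuousOn_fst (fun x _ => hα x.2) (fun _ => ⟨α, rfl⟩)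
    (d₁ := 0) (.of_radial EventuallyEq.rfl) h.angular_fst
    (isGradBound_zero hγ hn)
    (h.gradBound_fst hγ hn _) le_rfl hg hM

/-- The constant of the Moser estimate. -/
noncomputable def moserConst (𝕜 : Type*) [RCLike 𝕜] (n : ℕ) (γ : ℝ) : ℝ≥0 :=
  sumConst (n + 1) * (4 ^ (n + 1) * (2 + hardyConst γ) * oneConst 𝕜) *
    ((1 + gradConst n * sobConst (n + 1)) ^ (n + 2) * 2 ^ (n + 1))

theorem moser_arith (κ x : ℝ≥0) (n : ℕ) :
    (1 + κ * x) ^ (n + 2) ≤ (1 + κ) ^ (n + 2) * 2 ^ (n + 1) * (1 + x ^ (n + 2)) := by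
  have h1 : 1 + κ * x ≤ (1 + κ) * (1 + x) := by
    calc 1 + κ * x ≤ 1 + κ * x + (κ + x) := le_self_add
      _ = _ := by ring
  -- Convexity of the power, for which 2^{n+1} is the usual constant.
  have h2 : (1 + x) ^ (n + 2) ≤ 2 ^ (n + 1) * (1 ^ (n + 2) + x ^ (n + 2)) := by
    exact_mod_cast add_pow_le (zero_le_one (α := ℝ)) x.2 (n + 2)
  rw [one_pow] at h2
  calc (1 + κ * x) ^ (n + 2) ≤ ((1 + κ) * (1 + x)) ^ (n + 2) := by gcongr
    _ = (1 + κ) ^ (n + 2) * (1 + x) ^ (n + 2) := mul_pow _ _ _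
    _ ≤ (1 + κ) ^ (n + 2) * (2 ^ (n + 1) * (1 + x ^ (n + 2))) := by gcongr
    _ = _ := by ring

/-- Both f(α) and f(α + W) − f(α) are applied, as multipliers, to the constant function 1, which
lies in the class of functions of θ; the results are the two components of f(u). -/
theorem exists_isComposition (hn : 1 ≤ n) (hγ : 1 / 2 < γ) {Ω : Set 𝕜} (hΩ : IsOpen Ω) {g : 𝕜 → 𝕜}
    (hg : ContDiffOn ℝ (n + 2 : ℕ) g Ω) {u : JSpace 𝕜 (n + 1) γ} (hu : u ∈ imageIn (n + 1) γ Ω)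
    {U : ℝ × Circ → 𝕜} (hU : IsContRep u U) {M : ℝ≥0} (hM : DerivBound (n + 2) g (U '' closedPi) M) :
    ∃ v, IsComposition g u v ∧ ‖v‖ ≤ moserConst 𝕜 n γ * M * (1 + ‖u‖ ^ (n + 2)) := by
  obtain ⟨α, W, ξ₂, w₁, w₂, hr, hd, -, -⟩ := JSpace.exists_splitData hn hγ u
  have hUe := eqOn_closedPi hU.continuousOn hr.continuous.continuousOn (hU.ae_eq.symm.trans hr.ae_eq)
  rw [hUe.image_eq] at hM
  set Z := (fun x : ℝ × Circ => α x.2 + W x) '' closedPi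
  have hZ : Z ⊆ Ω := (mapsTo_of_mem_imageIn hu hr.isContRep).image_subset
  have hUZ : MapsTo (fun x : ℝ × Circ => α x.2 + W x) openPi Z := fun x hx =>
    mem_image_of_mem _ (openPi_subset_closedPi hx)
  have h1 := (hd.isMultiplier_comp_fst hγ hn hΩ hZ hr.fst_mem (hg.of_le (by norm_cast; omega))
    (hM.of_le (by omega))) (n + 1) le_rfl _ _ (SobBound.one _)
  have h2 := (hd.isMultiplier_sub hγ hn hΩ hZ hr.fst_mem hUZ le_rfl hg hM)
    (n + 1) le_rfl _ _ (SobBound.one _)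
  obtain ⟨v, hv, hvn⟩ := JSpace.exists_of_sobBound h1 h2
  refine ⟨v, ?_, hvn.trans ?_⟩
  · filter_upwards [hv, hr.ae_eq] with x h3 h4
    rw [h3, h4]
    ring
  · have key := moser_arith (gradConst n * sobConst (n + 1)) ‖u‖₊ n
    set κ := gradConst n * sobConst (n + 1) with hκ
    have e : gradConst n * (sobConst (n + 1) * ‖u‖₊) = κ * ‖u‖₊ := by rw [hκ, mul_assoc]
    rw [e]
    have final : sumConst (n + 1) * (4 ^ (n + 1) * M * (1 + κ * ‖u‖₊) ^ (n + 1) * oneConst 𝕜 +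
        (1 + hardyConst γ) * 4 ^ (n + 1) * M * (κ * ‖u‖₊) * (1 + κ * ‖u‖₊) ^ (n + 1) * oneConst 𝕜) ≤
        moserConst 𝕜 n γ * M * (1 + ‖u‖₊ ^ (n + 2)) := by
      set y := κ * ‖u‖₊
      -- The added term completes 1 + (1 + h)y to (2 + h)(1 + y), h being the Hardy constant, so
      -- that everything collapses to one power (1 + y)^{n+2}.
      calc sumConst (n + 1) * (4 ^ (n + 1) * M * (1 + y) ^ (n + 1) * oneConst 𝕜 +
            (1 + hardyConst γ) * 4 ^ (n + 1) * M * y * (1 + y) ^ (n + 1) * oneConst 𝕜)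
          ≤ sumConst (n + 1) * (4 ^ (n + 1) * M * (1 + y) ^ (n + 1) * oneConst 𝕜 +
            (1 + hardyConst γ) * 4 ^ (n + 1) * M * y * (1 + y) ^ (n + 1) * oneConst 𝕜) +
            sumConst (n + 1) * (4 ^ (n + 1) * M * (1 + y) ^ (n + 1) * oneConst 𝕜) *
              ((1 + hardyConst γ) + y) := le_self_add
        _ = sumConst (n + 1) * (4 ^ (n + 1) * (2 + hardyConst γ) * oneConst 𝕜) * M *
            (1 + y) ^ (n + 2) := by ring
        _ ≤ sumConst (n + 1) * (4 ^ (n + 1) * (2 + hardyConst γ) * oneConst 𝕜) * M *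
            ((1 + κ) ^ (n + 2) * 2 ^ (n + 1) * (1 + ‖u‖₊ ^ (n + 2))) := by gcongr
        _ = _ := by rw [moserConst, ← hκ]; ring
    exact_mod_cast final

theorem IsComposition.unique (hm : 1 < m) (hγ : 1 / 2 < γ) {g : 𝕜 → 𝕜} {u v v' : JSpace 𝕜 m γ}
    (h : IsComposition g u v) (h' : IsComposition g u v') : v = v' :=
  JSpace.ext_fn hm hγ (EventuallyEq.trans h h'.symm)

theorem JSpace.fn_sub (u v : JSpace 𝕜 m γ) :
    JSpace.fn (u - v) =ᵐ[muPi] fun x => JSpace.fn u x - JSpace.fn v x := by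
  have e : u - v = u + (-1 : 𝕜) • v := by simp [sub_eq_add_neg]
  rw [e]
  filter_upwards [JSpace.fn_add u ((-1 : 𝕜) • v), JSpace.fn_smul (-1 : 𝕜) v] with x h1 h2
  rw [h1, h2]
  ring

/-- The increment f(u + h) − f(u) splits into f(α + β) − f(α) and the double difference. Both are
small multipliers, applied to 1. -/
theorem isComposition_sub_small (hn : 1 ≤ n) (hγ : 1 / 2 < γ) {Ω : Set 𝕜} (hΩ : IsOpen Ω)
    {g : 𝕜 → 𝕜} (hg : ContDiffOn ℝ (n + 2 : ℕ) g Ω) {u : JSpace 𝕜 (n + 1) γ}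
    (hu : u ∈ imageIn (n + 1) γ Ω) {ε : ℝ≥0} (hε : 0 < ε) :
    ∃ δ : ℝ≥0, 0 < δ ∧ ∀ h v v' : JSpace 𝕜 (n + 1) γ, ‖h‖ ≤ δ → IsComposition g u v →
      IsComposition g (u + h) v' → ‖v' - v‖ ≤ ε := by
  obtain ⟨α, W, ξ₂, w₁, w₂, hr, hd, -, -⟩ := JSpace.exists_splitData hn hγ u
  set Z := (fun x : ℝ × Circ => α x.2 + W x) '' closedPi
  have hZ : Z ⊆ Ω := (mapsTo_of_mem_imageIn hu hr.isContRep).image_subset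
  have hc : IsCompact Z := isCompact_closedPi.image hr.continuous
  have hUZ : MapsTo (fun x : ℝ × Circ => α x.2 + W x) openPi Z := fun x hx =>
    mem_image_of_mem _ (openPi_subset_closedPi hx)
  set K : ℝ≥0 := sumConst (n + 1) * (oneConst 𝕜 + oneConst 𝕜) with hK
  set ε' : ℝ≥0 := ε / (1 + K) with hε'
  have hε'0 : 0 < ε' := by positivity
  obtain ⟨δ₁, hδ₁, H1⟩ := IsMultiplier.comp_sub_small hΩ hZ hc hd.continuousOn_fst
    (fun x _ => hr.fst_mem x.2) (fun _ : false = false => ⟨α, rfl⟩)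
    (d₁ := 0) (.of_radial EventuallyEq.rfl) hd.angular_fst
    (isGradBound_zero hγ hn)
    (hd.gradBound_fst hγ hn _) le_rfl (hg.of_le (by norm_cast; omega)) hε'0
  obtain ⟨δ₂, hδ₂, H2⟩ := hd.isMultiplier_sub_small hγ hn hΩ hZ hc hr.fst_mem hUZ le_rfl hg hε'0
  -- L exceeds the three factors by which ‖h‖ controls the split data, the supremum and the gradient
  -- multipliers.
  set L : ℝ≥0 := sobConst (n + 1) + supConst (n + 1) γ + gradConst n * sobConst (n + 1) with hL
  have hLpos : 0 < L := by
    have := one_le_sobConst (n + 1)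
    exact lt_of_lt_of_le (zero_lt_one.trans_le this) (by rw [hL, add_assoc]; exact le_self_add)
  refine ⟨min δ₁ δ₂ / L, by positivity, fun h v v' hh hv hv' => ?_⟩
  obtain ⟨β, H, β₂, h₁, h₂, hr', hd', hs1, hs2⟩ := JSpace.exists_splitData hn hγ h
  have hLh : L * ‖h‖₊ ≤ min δ₁ δ₂ := by
    have : ‖h‖₊ ≤ min δ₁ δ₂ / L := hh
    rwa [le_div_iff₀ hLpos, mul_comm] at this
  have b1 : sobConst (n + 1) * ‖h‖₊ ≤ L * ‖h‖₊ := by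
    gcongr
    rw [hL, add_assoc]
    exact le_self_add
  have b2 : gradConst n * (sobConst (n + 1) * ‖h‖₊) ≤ L * ‖h‖₊ := by
    rw [← mul_assoc]
    gcongr
    rw [hL]
    exact le_add_self
  have b3 : supConst (n + 1) γ * ‖h‖ ≤ L * ‖h‖ := by
    gcongr
    rw [hL, add_assoc, add_left_comm]
    exact le_self_add
  have c1 : L * ‖h‖ ≤ δ₁ := by exact_mod_cast hLh.trans (min_le_left _ _)
  have c2 : L * ‖h‖ ≤ δ₂ := by exact_mod_cast hLh.trans (min_le_right _ _)
  have k1 := H1 (fun x => β x.2) 0 β₂ hd'.continuousOn_fst (fun _ => ⟨β, rfl⟩)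
    (.of_radial EventuallyEq.rfl) hd'.angular_fst
    (isGradBound_zero hγ hn)
    ((hd'.gradBound_fst hγ hn _).mono (b2.trans (hLh.trans (min_le_left _ _))))
    (fun x _ => (hs1 x.2).trans (b3.trans c1)) (n + 1) le_rfl _ _ (SobBound.one _)
  have k2 := H2 β H β₂ h₁ h₂ (hd'.mono (b1.trans (hLh.trans (min_le_right _ _))))
    (fun θ => (hs1 θ).trans (b3.trans c2)) (fun x _ => (hs2 x).trans (b3.trans c2))
    (n + 1) le_rfl _ _ (SobBound.one _)
  obtain ⟨d, hd, hdn⟩ := JSpace.exists_of_sobBound k1 k2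
  have e : v' - v = d := by
    refine JSpace.ext_fn (by omega) hγ ?_
    filter_upwards [JSpace.fn_sub v' v, hv, hv', hd, hr.ae_eq, (hr.add hr').ae_eq]
      with x e1 e2 e3 e4 e5 e6
    rw [e1, e2, e3, e4, e5, e6]
    have e7 : α x.2 + β x.2 + (W x + H x) = α x.2 + W x + (β x.2 + H x) := by ring
    rw [e7]
    ring
  rw [e]
  refine hdn.trans ?_
  have : sumConst (n + 1) * (ε' * oneConst 𝕜 + ε' * oneConst 𝕜) ≤ ε := by
    calc sumConst (n + 1) * (ε' * oneConst 𝕜 + ε' * oneConst 𝕜) = ε' * K := by rw [hK]; ring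
      _ ≤ ε' * (1 + K) := by gcongr; exact le_add_self
      _ = ε := by rw [hε']; field_simp
  exact_mod_cast this

/-- The image of u is compact in the open set `Ω`, and the embedding into continuous functions
bounds the displacement of the image. -/
theorem isOpen_imageIn (hn : 1 ≤ n) (hγ : 1 / 2 < γ) {Ω : Set 𝕜} (hΩ : IsOpen Ω) :
    IsOpen (imageIn (n + 1) γ Ω) := by
  rw [Metric.isOpen_iff]
  intro u hu
  obtain ⟨α, W, -, -, -, hr, -⟩ := JSpace.exists_splitData hn hγ u
  have hZ := (mapsTo_of_mem_imageIn hu hr.isContRep).image_subset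
  obtain ⟨δ, hδ, hsub⟩ := (isCompact_closedPi.image hr.continuous).exists_thickening_subset_open hΩ hZ
  have hC : (0 : ℝ) < 1 + supConst (n + 1) γ := by positivity
  refine ⟨δ / (1 + supConst (n + 1) γ), by positivity, fun v hv => ?_⟩
  obtain ⟨β, H, -, -, -, hr', -, -, hs⟩ := JSpace.exists_splitData hn hγ (v - u)
  have hv' := (hr.add hr').isContRep
  rw [add_sub_cancel] at hv'
  refine ⟨_, hv', fun x hx => hsub (Metric.mem_thickening_iff.2 ⟨_, mem_image_of_mem _ hx, ?_⟩)⟩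
  rw [mem_ball_iff_norm, lt_div_iff₀ hC] at hv
  have e : α x.2 + β x.2 + (W x + H x) - (α x.2 + W x) = β x.2 + H x := by ring
  rw [dist_eq_norm, e]
  refine (hs x).trans_lt (lt_of_le_of_lt ?_ hv)
  nlinarith [norm_nonneg (v - u)]

open scoped Classical in
/-- The superposition operator `u ↦ g(u)`. -/
noncomputable def compFn (g : 𝕜 → 𝕜) (u : JSpace 𝕜 m γ) : JSpace 𝕜 m γ :=
  if h : ∃ v, IsComposition g u v then h.choose else 0

theorem isComposition_compFn {g : 𝕜 → 𝕜} {u : JSpace 𝕜 m γ} (h : ∃ v, IsComposition g u v) :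
    IsComposition g u (compFn g u) := by
  rw [compFn, dif_pos h]
  exact h.choose_spec

section Superposition

variable {Ω : Set 𝕜} {g : 𝕜 → 𝕜} {u : JSpace 𝕜 (n + 1) γ}

theorem JSpace.exists_isContRep (hn : 1 ≤ n) (hγ : 1 / 2 < γ) (u : JSpace 𝕜 (n + 1) γ) :
    ∃ U, IsContRep u U :=
  let ⟨_, _, _, _, _, hr, _⟩ := JSpace.exists_splitData hn hγ u
  ⟨_, hr.isContRep⟩

theorem compFn_spec (hn : 1 ≤ n) (hγ : 1 / 2 < γ) (hΩ : IsOpen Ω)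
    (hg : ContDiffOn ℝ (n + 2 : ℕ) g Ω) (hu : u ∈ imageIn (n + 1) γ Ω) :
    IsComposition g u (compFn g u) := by
  obtain ⟨U, hU⟩ := JSpace.exists_isContRep hn hγ u
  obtain ⟨M, hM⟩ := exists_derivBound hΩ hg (mapsTo_of_mem_imageIn hu hU).image_subset
    (isCompact_closedPi.image_of_continuousOn hU.continuousOn)
  obtain ⟨v, hv, -⟩ := exists_isComposition hn hγ hΩ hg hu hU hM
  exact isComposition_compFn ⟨v, hv⟩

theorem norm_compFn_le (hn : 1 ≤ n) (hγ : 1 / 2 < γ) (hΩ : IsOpen Ω)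
    (hg : ContDiffOn ℝ (n + 2 : ℕ) g Ω) (hu : u ∈ imageIn (n + 1) γ Ω) {U : ℝ × Circ → 𝕜}
    (hU : IsContRep u U) {M : ℝ≥0} (hM : DerivBound (n + 2) g (U '' closedPi) M) :
    ‖compFn g u‖ ≤ moserConst 𝕜 n γ * M * (1 + ‖u‖ ^ (n + 2)) := by
  obtain ⟨v, hv, hvn⟩ := exists_isComposition hn hγ hΩ hg hu hU hM
  rwa [(compFn_spec hn hγ hΩ hg hu).unique (by omega) hγ hv]

theorem continuousOn_compFn (hn : 1 ≤ n) (hγ : 1 / 2 < γ) (hΩ : IsOpen Ω)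
    (hg : ContDiffOn ℝ (n + 2 : ℕ) g Ω) :
    ContinuousOn (compFn g) (imageIn (n + 1) γ Ω) := by
  intro u hu
  refine ContinuousAt.continuousWithinAt (Metric.continuousAt_iff.2 fun ε hε => ?_)
  obtain ⟨δ, hδ, h⟩ := isComposition_sub_small hn hγ hΩ hg hu (ε := (ε / 2).toNNReal)
    (Real.toNNReal_pos.2 (by positivity))
  obtain ⟨δ', hδ', h'⟩ := Metric.isOpen_iff.1 (isOpen_imageIn hn hγ hΩ) u hu
  refine ⟨min δ δ', lt_min hδ hδ', fun v hv => ?_⟩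
  have h1 := compFn_spec hn hγ hΩ hg (h' (hv.trans_le (min_le_right _ _)))
  rw [dist_eq_norm] at hv ⊢
  have h2 := h (v - u) _ _ (hv.trans_le (min_le_left _ _)).le (compFn_spec hn hγ hΩ hg hu)
    (by rwa [add_sub_cancel])
  rw [Real.coe_toNNReal _ (by positivity)] at h2
  linarith

end Superposition

end Kondratev

namespace Kondratev

variable {𝕜 : Type*} [RCLike 𝕜]

open scoped NNReal ENNReal

/-! ### Completeness -/

variable {m n : ℕ} {γ : ℝ}

/-- The functional is the inner product with the L² function b. -/
theorem continuous_integral_smul {X : Type*} [MeasurableSpace X] {μ : Measure X} {b : X → ℝ}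
    (hb : MemLp b 2 μ) : Continuous fun f : Lp 𝕜 2 μ => ∫ x, b x • f x ∂μ := by
  have hb' : MemLp (fun x => (b x : 𝕜)) 2 μ := hb.ofReal
  have e : (fun f : Lp 𝕜 2 μ => ∫ x, b x • f x ∂μ) = fun f => inner 𝕜 (hb'.toLp _) f := by
    funext f
    rw [L2.inner_def]
    refine integral_congr_ae ?_
    filter_upwards [hb'.coeFn_toLp] with x hx
    rw [hx, RCLike.inner_apply, RCLike.conj_ofReal, RCLike.real_smul_eq_coe_mul, mul_comm]
  rw [e]
  exact continuous_const.inner continuous_id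

theorem continuous_integral_smul' {X : Type*} [MeasurableSpace X] {μ : Measure X} {a b : X → ℝ}
    (hb : MemLp (fun x => a x * b x) 2 μ) :
    Continuous fun f : Lp 𝕜 2 μ => ∫ x, a x • (b x • f x) ∂μ := by
  simpa only [mul_smul] using continuous_integral_smul (𝕜 := 𝕜) hb

theorem memLp_continuous_circ {b : Circ → ℝ} (hb : Continuous b) (p : ℝ≥0∞) :
    MemLp b p volume := by
  obtain ⟨C, hC⟩ := (isCompact_range hb).isBounded.exists_norm_le
  exact MemLp.of_bound hb.aestronglyMeasurable C
    (Eventually.of_forall fun x => hC _ (mem_range_self x))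

/-- Each weak derivative identity, for a fixed test function, is an equation between continuous
functionals of the stored components. The resulting completeness is needed to integrate along
segments. -/
theorem isClosed_sobolevCirc : IsClosed (SobolevCirc 𝕜 m :
    Set (PiLp 2 (fun _ : Fin (m + 1) => Lp 𝕜 2 (volume : Measure Circ)))) := by
  have hi : ∀ f : Lp 𝕜 2 (volume : Measure Circ), Integrable f := fun f =>
    (Lp.memLp f).integrable (by norm_num)
  have e : (SobolevCirc 𝕜 m : Set (PiLp 2 (fun _ : Fin (m + 1) => Lp 𝕜 2 (volume : Measure Circ)))) =
      ⋂ q : Fin (m + 1), ⋂ φ : {φ : Circ → ℝ // IsCircTest φ},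
        {g | ∫ x, circDeriv q φ.1 x • (g 0 : Circ → 𝕜) x =
          (-1 : ℝ) ^ (q : ℕ) • ∫ x, φ.1 x • (g q : Circ → 𝕜) x} := by
    ext g
    simp only [mem_iInter, mem_ofPred_eq]
    exact ⟨fun h q φ => (h q).eq φ.1 φ.2, fun h q => ⟨hi _, hi _, fun φ hφ => h q ⟨φ, hφ⟩⟩⟩
  rw [e]
  refine isClosed_iInter fun q => isClosed_iInter fun φ => isClosed_eq ?_ ?_
  · exact (continuous_integral_smul (memLp_continuous_circ (continuous_circDeriv φ.2 q) 2)).comp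
      (PiLp.continuous_apply 2 _ 0)
  · have hφ : Continuous φ.1 := by simpa [circDeriv_zero] using continuous_circDeriv φ.2 0
    exact ((continuous_integral_smul (memLp_continuous_circ hφ 2)).comp
      (PiLp.continuous_apply 2 _ q)).const_smul _

theorem IsPiTest.memLp_mixedDeriv {φ : ℝ × Circ → ℝ} (hφ : IsPiTest φ) (p q : ℕ) (s : ℝ) :
    MemLp (fun x => mixedDeriv p q φ x * x.1 ^ s) 2 muPi := by
  have hc := continuous_mixedDeriv hφ.smooth p q
  obtain ⟨C, hC⟩ := hφ.compact.exists_bound_of_continuousOn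
    (f := fun x => mixedDeriv p q φ x * x.1 ^ s) (hc.continuousOn.mul fun x hx =>
      (continuousAt_fst.rpow_const (Or.inl (hφ.support_subset hx).1.1.ne')).continuousWithinAt)
  refine MemLp.of_bound (hc.measurable.mul (measurable_rpow_fst s)).aestronglyMeasurable (max C 0)
    (Eventually.of_forall fun x => ?_)
  by_cases hx : x ∈ tsupport φ
  · exact (hC x hx).trans (le_max_left _ _)
  · simp [mixedDeriv_eq_zero p q hx]

/-- As on the circle; the unweighting powers of ψ are bounded on the support of the test function,
which stays away from ψ = 0. -/
theorem isClosed_kondratevPi : IsClosed (KondratevPi 𝕜 m γ :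
    Set (PiLp 2 (fun _ : derivIdx m => Lp 𝕜 2 muPi))) := by
  have hi : ∀ (f : Lp 𝕜 2 muPi) (p : ℕ), LocallyIntegrableOn (unweight γ p f) openPi := fun f p =>
    locallyIntegrableOn_unweight (Lp.memLp f) p
  have e : (KondratevPi 𝕜 m γ : Set (PiLp 2 (fun _ : derivIdx m => Lp 𝕜 2 muPi))) =
      ⋂ k : derivIdx m, ⋂ φ : {φ : ℝ × Circ → ℝ // IsPiTest φ},
        {g | ∫ x, mixedDeriv k.1.1 k.1.2 φ.1 x •
            (x.1 ^ (γ - ((0 : ℕ) : ℝ)) • (g (derivIdxZero m) : ℝ × Circ → 𝕜) x) ∂muPi =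
          (-1 : ℝ) ^ (k.1.1 + k.1.2) • ∫ x, φ.1 x •
            (x.1 ^ (γ - (k.1.1 : ℝ)) • (g k : ℝ × Circ → 𝕜) x) ∂muPi} := by
    ext g
    simp only [mem_iInter, mem_ofPred_eq]
    exact ⟨fun h k φ => (h k).eq φ.1 φ.2, fun h k => ⟨hi _ _, hi _ _, fun φ hφ => h k ⟨φ, hφ⟩⟩⟩
  rw [e]
  refine isClosed_iInter fun k => isClosed_iInter fun φ => isClosed_eq ?_ ?_
  · exact (continuous_integral_smul' (φ.2.memLp_mixedDeriv k.1.1 k.1.2 _)).comp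
      (PiLp.continuous_apply 2 _ (derivIdxZero m))
  · have h0 : MemLp (fun x => φ.1 x * x.1 ^ (γ - (k.1.1 : ℝ))) 2 muPi := by
      simpa only [mixedDeriv_zero_zero] using φ.2.memLp_mixedDeriv 0 0 (γ - (k.1.1 : ℝ))
    exact ((continuous_integral_smul' h0).comp (PiLp.continuous_apply 2 _ k)).const_smul _

instance : CompleteSpace (SobolevCirc 𝕜 m) := isClosed_sobolevCirc.completeSpace_coe

instance : CompleteSpace (KondratevPi 𝕜 m γ) := isClosed_kondratevPi.completeSpace_coe

/-! ### The algebra structure and evaluation functionals -/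

/-- The constant in the product estimate. -/
noncomputable def mulConst (m : ℕ) : ℝ≥0 := sumConst m * (4 * (15 * 2 ^ m * sobConst m * sobConst m))

/-- In (ξ + w)(η + z), the product ξη stays in the class of θ and the three other products fall into
the weighted class. -/
theorem JSpace.exists_mul (hm : 1 < m) (hγ : 1 / 2 < γ) (u v : JSpace 𝕜 m γ) :
    ∃ w : JSpace 𝕜 m γ, JSpace.fn w =ᵐ[muPi] (fun x => JSpace.fn u x * JSpace.fn v x) ∧
      ‖w‖ ≤ mulConst m * ‖u‖ * ‖v‖ := by
  have hf : ∀ u : JSpace 𝕜 m γ, SobBound γ false m (fun x => SobolevCirc.fn u.fst x.2)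
      (sobConst m * ‖u‖₊) := fun u =>
    (SobolevCirc.sobBound u.fst).mono ((show ‖u.fst‖₊ ≤ ‖u‖₊ from JSpace.norm_fst_le u).trans
      (le_mul_of_one_le_left' (one_le_sobConst _)))
  have hs : ∀ u : JSpace 𝕜 m γ, SobBound γ true m (KondratevPi.fn u.snd)
      (sobConst m * ‖u‖₊) := fun u =>
    (KondratevPi.sobBound u.snd).mono (by gcongr; exact JSpace.norm_snd_le u)
  have hmul : ∀ {c₁ c₂ : Bool} {a b : ℝ × Circ → 𝕜} {R S : ℝ≥0}, SobBound γ c₁ m a R →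
      SobBound γ c₂ m b S → SobBound γ (c₁ || c₂) m (fun x => a x * b x) (15 * 2 ^ m * R * S) :=
    fun h h' => h.mul hγ h' le_rfl le_rfl (by omega)
  have h1 := hmul (hf u) (hf v)
  have h2 := (SobBound.add (c := true) (hmul (c₁ := false) (c₂ := true) (hf u) (hs v))
    (hmul (c₁ := true) (c₂ := false) (hs u) (hf v))).add (hmul (c₁ := true) (c₂ := true) (hs u) (hs v))
  obtain ⟨w, hw, hwn⟩ := JSpace.exists_of_sobBound h1 h2
  refine ⟨w, ?_, hwn.trans (le_of_eq ?_)⟩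
  · filter_upwards [hw] with x hx
    rw [hx, JSpace.fn, JSpace.fn]
    ring
  · rw [mulConst]
    push_cast
    ring

theorem JSpace.exists_mulL (hm : 1 < m) (hγ : 1 / 2 < γ) :
    ∃ B : JSpace 𝕜 m γ →L[𝕜] JSpace 𝕜 m γ →L[𝕜] JSpace 𝕜 m γ,
      ∀ u v, JSpace.fn (B u v) =ᵐ[muPi] fun x => JSpace.fn u x * JSpace.fn v x := by
  choose p hp hpn using fun u v : JSpace 𝕜 m γ => JSpace.exists_mul hm hγ u v
  refine ⟨LinearMap.mkContinuous₂ (LinearMap.mk₂ 𝕜 p ?_ ?_ ?_ ?_) (mulConst m) hpn, hp⟩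
  · intro u u' v
    refine JSpace.ext_fn hm hγ ?_
    filter_upwards [hp (u + u') v, JSpace.fn_add u u', JSpace.fn_add (p u v) (p u' v), hp u v,
      hp u' v] with x h1 h2 h3 h4 h5
    rw [h1, h2, h3, h4, h5]
    ring
  · intro c u v
    refine JSpace.ext_fn hm hγ ?_
    filter_upwards [hp (c • u) v, JSpace.fn_smul c u, JSpace.fn_smul c (p u v), hp u v]
      with x h1 h2 h3 h4
    rw [h1, h2, h3, h4]
    ring
  · intro u v v'
    refine JSpace.ext_fn hm hγ ?_
    filter_upwards [hp u (v + v'), JSpace.fn_add v v', JSpace.fn_add (p u v) (p u v'), hp u v,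
      hp u v'] with x h1 h2 h3 h4 h5
    rw [h1, h2, h3, h4, h5]
    ring
  · intro c u v
    refine JSpace.ext_fn hm hγ ?_
    filter_upwards [hp u (c • v), JSpace.fn_smul c v, JSpace.fn_smul c (p u v), hp u v]
      with x h1 h2 h3 h4
    rw [h1, h2, h3, h4]
    ring

theorem JSpace.fn_real_smul (c : ℝ) (u : JSpace 𝕜 m γ) :
    JSpace.fn (c • u) =ᵐ[muPi] fun x => c * JSpace.fn u x := by
  have e : c • u = (c : 𝕜) • u := by
    rw [← algebraMap_smul 𝕜 c u]
  rw [e]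
  exact JSpace.fn_smul _ _

theorem JSpace.exists_conjL (hm : 1 < m) (hγ : 1 / 2 < γ) :
    ∃ B : JSpace 𝕜 m γ →L[ℝ] JSpace 𝕜 m γ,
      ∀ u, JSpace.fn (B u) =ᵐ[muPi] fun x => (starRingEnd 𝕜) (JSpace.fn u x) := by
  have hex : ∀ u : JSpace 𝕜 m γ, ∃ w : JSpace 𝕜 m γ,
      JSpace.fn w =ᵐ[muPi] (fun x => (starRingEnd 𝕜) (JSpace.fn u x)) ∧
        ‖w‖ ≤ (sumConst m * (1 + sobConst m) : ℝ≥0) * ‖u‖ := by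
    intro u
    obtain ⟨w, hw, hwn⟩ := JSpace.exists_of_sobBound (SobolevCirc.sobBound u.fst).conj
      (KondratevPi.sobBound u.snd).conj
    refine ⟨w, ?_, hwn.trans ?_⟩
    · filter_upwards [hw] with x hx
      rw [hx, JSpace.fn, map_add]
    · have h1 : ‖u.fst‖₊ ≤ ‖u‖₊ := JSpace.norm_fst_le u
      have h2 : ‖u.snd‖₊ ≤ ‖u‖₊ := JSpace.norm_snd_le u
      have : sumConst m * (‖u.fst‖₊ + sobConst m * ‖u.snd‖₊) ≤
          sumConst m * (1 + sobConst m) * ‖u‖₊ := by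
        calc sumConst m * (‖u.fst‖₊ + sobConst m * ‖u.snd‖₊)
            ≤ sumConst m * (‖u‖₊ + sobConst m * ‖u‖₊) := by gcongr
          _ = _ := by ring
      exact_mod_cast this
  choose p hp hpn using hex
  refine ⟨LinearMap.mkContinuous ⟨⟨p, fun u v => ?_⟩, fun c u => ?_⟩ _ hpn, hp⟩
  · refine JSpace.ext_fn hm hγ ?_
    filter_upwards [hp (u + v), JSpace.fn_add u v, JSpace.fn_add (p u) (p v), hp u, hp v]
      with x h1 h2 h3 h4 h5
    rw [h1, h2, h3, h4, h5, map_add]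
  · refine JSpace.ext_fn hm hγ ?_
    filter_upwards [hp (c • u), JSpace.fn_real_smul c u, JSpace.fn_real_smul c (p u), hp u]
      with x h1 h2 h3 h4
    rw [RingHom.id_apply, h1, h2, h3, h4, map_mul, RCLike.conj_ofReal]

namespace IsContRep

variable {u v : JSpace 𝕜 m γ} {U V : ℝ × Circ → 𝕜}

theorem add (h : IsContRep u U) (h' : IsContRep v V) : IsContRep (u + v) fun x => U x + V x :=
  ⟨h.continuousOn.add h'.continuousOn, by
    filter_upwards [JSpace.fn_add u v, h.ae_eq, h'.ae_eq] with x h1 h2 h3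
    rw [h1, h2, h3]⟩

theorem real_smul (c : ℝ) (h : IsContRep u U) : IsContRep (c • u) fun x => c * U x :=
  ⟨continuousOn_const.mul h.continuousOn, by
    filter_upwards [JSpace.fn_real_smul c u, h.ae_eq] with x h1 h2
    rw [h1, h2]⟩

theorem eqOn (h : IsContRep u U) (h' : IsContRep u V) : EqOn U V closedPi :=
  eqOn_closedPi h.continuousOn h'.continuousOn (h.ae_eq.symm.trans h'.ae_eq)

theorem comp (h : IsContRep u U) {Ω : Set 𝕜} (hu : u ∈ imageIn m γ Ω) {g : 𝕜 → 𝕜}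
    (hg : ContinuousOn g Ω) (hv : IsComposition g u v) : IsContRep v fun x => g (U x) :=
  ⟨hg.comp h.continuousOn (mapsTo_of_mem_imageIn hu h), by
    filter_upwards [hv, h.ae_eq] with x h1 h2
    rw [h1, h2]⟩

end IsContRep

/-- Uniqueness of continuous representatives makes evaluation at a point linear, and the sup bound
makes it continuous. -/
theorem JSpace.exists_evalL (hn : 1 ≤ n) (hγ : 1 / 2 < γ) {x : ℝ × Circ} (hx : x ∈ closedPi) :
    ∃ L : JSpace 𝕜 (n + 1) γ →L[ℝ] 𝕜, ∀ u U, IsContRep u U → L u = U x := by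
  choose α W _ _ _ hr _ _ hn' using
    fun u : JSpace 𝕜 (n + 1) γ => JSpace.exists_splitData hn hγ u
  refine ⟨LinearMap.mkContinuous ⟨⟨fun u => α u x.2 + W u x, fun u v => ?_⟩, fun c u => ?_⟩
    (supConst (n + 1) γ) fun u => hn' u x, fun u U hU => (hr u).isContRep.eqOn hU hx⟩
  · exact (hr (u + v)).isContRep.eqOn ((hr u).isContRep.add (hr v).isContRep) hx
  · rw [RingHom.id_apply, RCLike.real_smul_eq_coe_mul]
    exact (hr (c • u)).isContRep.eqOn ((hr u).isContRep.real_smul c) hx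

end Kondratev

namespace Kondratev

variable {𝕜 : Type*} [RCLike 𝕜]

open scoped NNReal ENNReal

/-! ### Differentiability of the superposition operator -/

/-- The remainder is the integral of (D(u + th) − D(u))h, small compared with ‖h‖ by continuity of
D. It thus suffices to prove the integral identity, with no direct estimate of a Taylor remainder in
the function space. -/
theorem hasFDerivAt_of_integral {E F : Type*} [NormedAddCommGroup E] [NormedSpace ℝ E]
    [NormedAddCommGroup F] [NormedSpace ℝ F] [CompleteSpace F] {S : Set E} (hS : IsOpen S)
    {Φ : E → F} {D : E → E →L[ℝ] F} (hD : ContinuousOn D S)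
    (h : ∀ u h : E, (∀ t ∈ Icc (0 : ℝ) 1, u + t • h ∈ S) →
      Φ (u + h) - Φ u = ∫ t in (0 : ℝ)..1, D (u + t • h) h) {u : E} (hu : u ∈ S) :
    HasFDerivAt Φ (D u) u := by
  rw [hasFDerivAt_iff_isLittleO_nhds_zero, Asymptotics.isLittleO_iff]
  intro ε hε
  obtain ⟨δ, hδ, hb⟩ := Metric.continuousAt_iff.1 (hD.continuousAt (hS.mem_nhds hu)) ε hε
  obtain ⟨δ', hδ', hb'⟩ := Metric.isOpen_iff.1 hS u hu
  filter_upwards [Metric.ball_mem_nhds (0 : E) (lt_min hδ hδ')] with k hk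
  rw [mem_ball_zero_iff, lt_min_iff] at hk
  have hn : ∀ t ∈ Icc (0 : ℝ) 1, dist (u + t • k) u ≤ ‖k‖ := fun t ht => by
    rw [dist_eq_norm, add_sub_cancel_left, norm_smul, Real.norm_of_nonneg ht.1]
    exact mul_le_of_le_one_left (norm_nonneg _) ht.2
  have hmem : ∀ t ∈ Icc (0 : ℝ) 1, u + t • k ∈ S := fun t ht => hb' ((hn t ht).trans_lt hk.2)
  have hint : IntervalIntegrable (fun t : ℝ => D (u + t • k) k) volume 0 1 := by
    refine ContinuousOn.intervalIntegrable ?_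
    rw [uIcc_of_le zero_le_one]
    refine ContinuousOn.clm_apply (hD.comp (by fun_prop) hmem) continuousOn_const
  have e : Φ (u + k) - Φ u - D u k = ∫ t in (0 : ℝ)..1, (D (u + t • k) k - D u k) := by
    rw [intervalIntegral.integral_sub hint intervalIntegrable_const, ← h u k hmem]
    simp
  rw [e]
  have := intervalIntegral.norm_integral_le_of_norm_le_const (a := 0) (b := 1) (C := ε * ‖k‖)
    (f := fun t : ℝ => D (u + t • k) k - D u k) fun t ht => by
      rw [uIoc_of_le zero_le_one] at ht
      have ht' : t ∈ Icc (0 : ℝ) 1 := ⟨ht.1.le, ht.2⟩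
      rw [← sub_apply]
      refine (ContinuousLinearMap.le_opNorm _ _).trans ?_
      gcongr
      rw [← dist_eq_norm]
      exact (hb ((hn t ht').trans_lt hk.1)).le
  simpa using this

theorem contDiffOn_one_of_hasFDerivAt {K E F : Type*} [NontriviallyNormedField K]
    [NormedAddCommGroup E] [NormedSpace K E] [NormedAddCommGroup F] [NormedSpace K F] {S : Set E}
    (hS : IsOpen S) {Φ : E → F} {D : E → E →L[K] F} (hD : ContinuousOn D S)
    (h : ∀ u ∈ S, HasFDerivAt Φ (D u) u) : ContDiffOn K 1 Φ S := by
  rw [← zero_add (1 : WithTop ℕ∞), contDiffOn_succ_iff_fderiv_of_isOpen hS]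
  refine ⟨fun u hu => (h u hu).differentiableAt.differentiableWithinAt, by simp, ?_⟩
  rw [contDiffOn_zero]
  exact hD.congr fun u hu => (h u hu).fderiv

/-- A continuous functional commutes with the integral, so a separating family reduces the vector
identity to the scalar fundamental theorem of calculus. -/
theorem sub_eq_integral_of_functionals {E F : Type*} [NormedAddCommGroup E] [NormedSpace ℝ E]
    [NormedAddCommGroup F] [NormedSpace ℝ F] [CompleteSpace F] {ι : Type*} {L : ι → F →L[ℝ] 𝕜}
    (hL : ∀ v, (∀ i, L i v = 0) → v = 0) {S : Set E} {Φ : E → F} {D : E → E →L[ℝ] F}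
    (hD : ContinuousOn D S)
    (hφ : ∀ i u h, (∀ t ∈ Icc (0 : ℝ) 1, u + t • h ∈ S) → ∃ φ : ℝ → 𝕜, ∀ t ∈ Icc (0 : ℝ) 1,
      L i (Φ (u + t • h)) = φ t ∧ HasDerivAt φ (L i (D (u + t • h) h)) t) (u h : E)
    (hmem : ∀ t ∈ Icc (0 : ℝ) 1, u + t • h ∈ S) :
    Φ (u + h) - Φ u = ∫ t in (0 : ℝ)..1, D (u + t • h) h := by
  have hDc : ContinuousOn (fun t : ℝ => D (u + t • h) h) (Icc 0 1) :=
    ContinuousOn.clm_apply (hD.comp (by fun_prop) hmem) continuousOn_const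
  rw [← uIcc_of_le zero_le_one] at hDc
  rw [← sub_eq_zero]
  refine hL _ fun i => ?_
  obtain ⟨φ, h1⟩ := hφ i u h hmem
  have h2 : ∫ t in (0 : ℝ)..1, L i (D (u + t • h) h) = φ 1 - φ 0 := by
    refine intervalIntegral.integral_eq_sub_of_hasDerivAt (fun t ht => ?_)
      ((L i).continuous.comp_continuousOn hDc).intervalIntegrable
    rw [uIcc_of_le zero_le_one] at ht
    exact (h1 t ht).2
  have e0 := (h1 0 (by simp)).1
  have e1 := (h1 1 (by simp)).1
  rw [zero_smul, add_zero] at e0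
  rw [one_smul] at e1
  rw [map_sub, map_sub, ← (L i).intervalIntegral_comp_comm hDc.intervalIntegrable, h2, e0, e1,
    sub_self]

section Algebra

variable {E : Type*} [NormedAddCommGroup E] [NormedSpace 𝕜 E] [NormedSpace ℝ E]
  [IsScalarTower ℝ 𝕜 E] {S : Set E}

theorem exists_continuousOn_mul_add (B : E →L[𝕜] E →L[𝕜] E) (J : E →L[ℝ] E) {A₁ A₂ : E → E}
    (h₁ : ContinuousOn A₁ S) (h₂ : ContinuousOn A₂ S) :
    ∃ D : E → E →L[ℝ] E, ContinuousOn D S ∧ ∀ u h, D u h = B (A₁ u) h + B (A₂ u) (J h) := by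
  let R := ContinuousLinearMap.restrictScalarsL 𝕜 E E ℝ ℝ
  refine ⟨fun u => R (B (A₁ u)) + (R (B (A₂ u))).comp J, ?_, fun u h => rfl⟩
  exact (R.continuous.comp_continuousOn (B.continuous.comp_continuousOn h₁)).add
    ((R.continuous.comp_continuousOn (B.continuous.comp_continuousOn h₂)).clm_comp
      continuousOn_const)

theorem contDiffOn_one_of_mul (hS : IsOpen S) (B : E →L[𝕜] E →L[𝕜] E) {A : E → E}
    (hA : ContinuousOn A S) {Φ : E → E} {D : E → E →L[ℝ] E}
    (hD : ∀ u ∈ S, HasFDerivAt Φ (D u) u) (h : ∀ u ∈ S, ∀ k, B (A u) k = D u k) :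
    ContDiffOn 𝕜 1 Φ S :=
  contDiffOn_one_of_hasFDerivAt (D := fun u => B (A u)) hS (B.continuous.comp_continuousOn hA)
    fun u hu => hasFDerivAt_of_restrictScalars ℝ (hD u hu) (ContinuousLinearMap.ext (h u hu))

end Algebra

variable {n : ℕ} {γ : ℝ} {Ω : Set 𝕜} {f : 𝕜 → 𝕜}

/-- Evaluations of the superposition operator along segments. -/
theorem eval_compFn_segment (hn : 1 ≤ n) (hγ : 1 / 2 < γ) (hΩ : IsOpen Ω)
    (hf : ContDiffOn ℝ (n + 3 : ℕ) f Ω)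
    {D : JSpace 𝕜 (n + 1) γ → JSpace 𝕜 (n + 1) γ →L[ℝ] JSpace 𝕜 (n + 1) γ}
    (hDf : ∀ u ∈ imageIn (n + 1) γ Ω, ∀ h, JSpace.fn (D u h) =ᵐ[muPi]
      fun x => fderiv ℝ f (JSpace.fn u x) (JSpace.fn h x)) {x : ℝ × Circ} (hx : x ∈ closedPi)
    {L : JSpace 𝕜 (n + 1) γ →L[ℝ] 𝕜} (hL : ∀ u U, IsContRep u U → L u = U x)
    (u h : JSpace 𝕜 (n + 1) γ)
    (hmem : ∀ t ∈ Icc (0 : ℝ) 1, u + t • h ∈ imageIn (n + 1) γ Ω) :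
    ∃ φ : ℝ → 𝕜, ∀ t ∈ Icc (0 : ℝ) 1, L (compFn f (u + t • h)) = φ t ∧
      HasDerivAt φ (L (D (u + t • h) h)) t := by
  have hf2 : ContDiffOn ℝ (n + 2 : ℕ) f Ω := hf.of_le (by norm_cast; omega)
  have hf1 : ContDiffOn ℝ 1 f Ω := hf.of_le (by norm_cast; omega)
  have hd : ContinuousOn (fderiv ℝ f) Ω := hf1.continuousOn_fderiv_of_isOpen hΩ le_rfl
  obtain ⟨U, hU⟩ := JSpace.exists_isContRep hn hγ u
  obtain ⟨H, hH⟩ := JSpace.exists_isContRep hn hγ h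
  have hseg : ∀ t : ℝ, IsContRep (u + t • h) fun x => U x + t * H x := fun t =>
    hU.add (hH.real_smul t)
  -- The curve is given by f of the pointwise representatives, hence is defined for all t, and its
  -- two-sided derivative makes sense also at the endpoints t = 0 and t = 1.
  refine ⟨fun t => f (U x + t * H x), fun t ht => ?_⟩
  have hm := mapsTo_of_mem_imageIn (hmem t ht) (hseg t)
  refine ⟨hL _ _ ((hseg t).comp (hmem t ht) hf.continuousOn
    (compFn_spec hn hγ hΩ hf2 (hmem t ht))), ?_⟩
  have e3 : L (D (u + t • h) h) = fderiv ℝ f (U x + t * H x) (H x) := by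
    refine hL _ (fun x => fderiv ℝ f (U x + t * H x) (H x)) ⟨?_, ?_⟩
    · exact (hd.comp (hseg t).continuousOn hm).clm_apply hH.continuousOn
    · filter_upwards [hDf _ (hmem t ht) h, (hseg t).ae_eq, hH.ae_eq] with x h1 h2 h3
      rw [h1, h2, h3]
  rw [e3]
  have h2 : HasFDerivAt f (fderiv ℝ f (U x + t * H x)) (U x + t * H x) :=
    ((hf1.differentiableOn one_ne_zero).differentiableAt (hΩ.mem_nhds (hm hx))).hasFDerivAt
  have h3 : HasDerivAt (fun t : ℝ => U x + (t : 𝕜) * H x) (H x) t := by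
    have h4 := ((RCLike.ofRealCLM (K := 𝕜)).hasDerivAt (x := t)).mul_const (H x)
    simpa using h4.const_add (U x)
  exact h2.comp_hasDerivAt t h3

-- The derivative D(u)h = a(u)h + b(u) conj h uses the Wirtinger coefficients of Df. They are
-- C^{m+1}, so the continuity of superposition already proved applies to them and yields continuity
-- of D.
set_option maxHeartbeats 1000000 in
theorem exists_hasFDerivAt_compFn (hn : 1 ≤ n) (hγ : 1 / 2 < γ) (hΩ : IsOpen Ω)
    (hf : ContDiffOn ℝ (n + 3 : ℕ) f Ω) :
    ∃ D : JSpace 𝕜 (n + 1) γ → JSpace 𝕜 (n + 1) γ →L[ℝ] JSpace 𝕜 (n + 1) γ,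
      ContinuousOn D (imageIn (n + 1) γ Ω) ∧
      (∀ u ∈ imageIn (n + 1) γ Ω, ∀ h, JSpace.fn (D u h) =ᵐ[muPi]
        fun x => fderiv ℝ f (JSpace.fn u x) (JSpace.fn h x)) ∧
      ∀ u ∈ imageIn (n + 1) γ Ω, HasFDerivAt (compFn f) (D u) u := by
  obtain ⟨B, hB⟩ := JSpace.exists_mulL (𝕜 := 𝕜) (m := n + 1) (by omega) hγ
  obtain ⟨J, hJ⟩ := JSpace.exists_conjL (𝕜 := 𝕜) (m := n + 1) (by omega) hγ
  have ha := fun s => contDiffOn_wirtinger (k := n + 2) hΩ hf s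
  choose L hL using fun x : closedPi => JSpace.exists_evalL (𝕜 := 𝕜) (γ := γ) hn hγ x.2
  have hLz : ∀ v, (∀ x, L x v = 0) → v = 0 := fun v hv => by
    obtain ⟨V, hV⟩ := JSpace.exists_isContRep hn hγ v
    refine JSpace.eq_zero (by omega) hγ (hV.ae_eq.trans ?_)
    filter_upwards [ae_muPi_mem] with x hx
    rw [← hL ⟨x, openPi_subset_closedPi hx⟩ _ _ hV, hv]
    rfl
  obtain ⟨D, hD, hDB⟩ := exists_continuousOn_mul_add B J
    (continuousOn_compFn hn hγ hΩ (ha (-1))) (continuousOn_compFn hn hγ hΩ (ha 1))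
  have hDf : ∀ u ∈ imageIn (n + 1) γ Ω, ∀ h, JSpace.fn (D u h) =ᵐ[muPi]
      fun x => fderiv ℝ f (JSpace.fn u x) (JSpace.fn h x) := by
    intro u hu h
    rw [hDB]
    filter_upwards [JSpace.fn_add (B (compFn (fun z => wirtinger (-1) (fderiv ℝ f z)) u) h)
      (B (compFn (fun z => wirtinger 1 (fderiv ℝ f z)) u) (J h)),
      hB (compFn (fun z => wirtinger (-1) (fderiv ℝ f z)) u) h,
      hB (compFn (fun z => wirtinger 1 (fderiv ℝ f z)) u) (J h), hJ h,
      compFn_spec hn hγ hΩ (ha (-1)) hu, compFn_spec hn hγ hΩ (ha 1) hu]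
      with x h1 h2 h3 h4 h5 h6
    rw [h1, h2, h3, h4, h5, h6, ← wirtinger_expansion]
  have hseg : ∀ (x : closedPi) (u h : JSpace 𝕜 (n + 1) γ),
      (∀ t ∈ Icc (0 : ℝ) 1, u + t • h ∈ imageIn (n + 1) γ Ω) → ∃ φ : ℝ → 𝕜, ∀ t ∈ Icc (0 : ℝ) 1,
      L x (compFn f (u + t • h)) = φ t ∧ HasDerivAt φ (L x (D (u + t • h) h)) t :=
    fun x => eval_compFn_segment hn hγ hΩ hf hDf x.2 (hL x)
  have hint := sub_eq_integral_of_functionals hLz hD hseg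
  have hder : ∀ u ∈ imageIn (n + 1) γ Ω, HasFDerivAt (compFn f) (D u) u := fun u hu =>
    hasFDerivAt_of_integral (isOpen_imageIn hn hγ hΩ) hD hint hu
  exact ⟨D, hD, hDf, hder⟩

theorem contDiffOn_compFn (hn : 1 ≤ n) (hγ : 1 / 2 < γ) (hΩ : IsOpen Ω)
    (hf : ContDiffOn ℝ (n + 3 : ℕ) f Ω) :
    ContDiffOn ℝ 1 (compFn f) (imageIn (n + 1) γ Ω) := by
  obtain ⟨D, hD, -, h⟩ := exists_hasFDerivAt_compFn hn hγ hΩ hf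
  exact contDiffOn_one_of_hasFDerivAt (isOpen_imageIn hn hγ hΩ) hD h

-- When f is differentiable over the scalar field, the real derivative is multiplication by f'(u),
-- hence linear over that field; continuity of u ↦ f'(u) gives C¹.
set_option maxHeartbeats 1000000 in
theorem contDiffOn_compFn_field (hn : 1 ≤ n) (hγ : 1 / 2 < γ) (hΩ : IsOpen Ω)
    (hf : ContDiffOn 𝕜 (n + 3 : ℕ) f Ω) :
    ContDiffOn 𝕜 1 (compFn f) (imageIn (n + 1) γ Ω) := by
  obtain ⟨D, hD, hDf, h⟩ := exists_hasFDerivAt_compFn hn hγ hΩ (hf.restrict_scalars ℝ)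
  obtain ⟨B, hB⟩ := JSpace.exists_mulL (𝕜 := 𝕜) (m := n + 1) (by omega) hγ
  have hd : ContDiffOn ℝ (n + 2 : ℕ) (deriv f) Ω :=
    (hf.deriv_of_isOpen hΩ (by norm_cast)).restrict_scalars ℝ
  refine contDiffOn_one_of_mul (isOpen_imageIn hn hγ hΩ) B (continuousOn_compFn hn hγ hΩ hd) h
    fun u hu k => ?_
  refine JSpace.ext_fn (by omega) hγ ?_
  obtain ⟨U, hU⟩ := JSpace.exists_isContRep hn hγ u
  filter_upwards [hB (compFn (deriv f) u) k, compFn_spec hn hγ hΩ hd hu, hDf u hu k, hU.ae_eq,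
    ae_muPi_mem] with x h1 h2 h3 h4 hx
  have hxΩ : JSpace.fn u x ∈ Ω := by
    rw [h4]
    exact mapsTo_of_mem_imageIn hu hU (openPi_subset_closedPi hx)
  have h5 : HasDerivAt f (deriv f (JSpace.fn u x)) (JSpace.fn u x) :=
    ((hf.differentiableOn (by simp)).differentiableAt (hΩ.mem_nhds hxΩ)).hasDerivAt
  rw [h3, (h5.hasFDerivAt.restrictScalars ℝ).fderiv]
  refine h1.trans ?_
  rw [h2]
  simp [mul_comm]

end Kondratev

/-! ### The theorem. -/

theorem mainTheorem5 {𝕜 : Type*} [RCLike 𝕜] (m : ℕ) (hm : 1 < m) (γ : ℝ) (hγ : 1 / 2 < γ) :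
    (∀ u : Kondratev.JSpace 𝕜 m γ, ∃ U : ℝ × Kondratev.Circ → 𝕜, Kondratev.IsContRep u U) ∧
    ∃ C : ℝ, ∀ (Ω : Set 𝕜) (f : 𝕜 → 𝕜), IsOpen Ω → ContDiffOn ℝ ((m + 1 : ℕ) : ℕ∞) f Ω →
      IsOpen (Kondratev.imageIn m γ Ω) ∧
      ∃ F : Kondratev.JSpace 𝕜 m γ → Kondratev.JSpace 𝕜 m γ,
        (∀ u ∈ Kondratev.imageIn m γ Ω, ∀ w : Kondratev.JSpace 𝕜 m γ,
          w = F u ↔ Kondratev.JSpace.fn w =ᵐ[Kondratev.muPi]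
            fun x => f (Kondratev.JSpace.fn u x)) ∧
        ContinuousOn F (Kondratev.imageIn m γ Ω) ∧
        (∀ u ∈ Kondratev.imageIn m γ Ω, ∀ U : ℝ × Kondratev.Circ → 𝕜, Kondratev.IsContRep u U →
          ∀ M : ℝ,
            (∀ j ≤ m + 1, ∀ x ∈ Kondratev.closedPi, ‖iteratedFDeriv ℝ j f (U x)‖ ≤ M) →
            ‖F u‖ ≤ C * M * (1 + ‖u‖ ^ (m + 1))) ∧
        (ContDiffOn ℝ ((m + 2 : ℕ) : ℕ∞) f Ω →
          ContDiffOn ℝ 1 F (Kondratev.imageIn m γ Ω)) ∧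
        (ContDiffOn 𝕜 ((m + 2 : ℕ) : ℕ∞) f Ω →
          ContDiffOn 𝕜 1 F (Kondratev.imageIn m γ Ω)) := by
  obtain ⟨n, rfl⟩ : ∃ n, m = n + 1 := ⟨m - 1, by omega⟩
  have hn : 1 ≤ n := by omega
  refine ⟨Kondratev.JSpace.exists_isContRep hn hγ, Kondratev.moserConst 𝕜 n γ, fun Ω f hΩ hf =>
    ⟨Kondratev.isOpen_imageIn hn hγ hΩ, Kondratev.compFn f, fun u hu w => ⟨?_, fun h => ?_⟩,
      Kondratev.continuousOn_compFn hn hγ hΩ hf, fun u hu U hU M hM => ?_,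
      Kondratev.contDiffOn_compFn hn hγ hΩ, Kondratev.contDiffOn_compFn_field hn hγ hΩ⟩⟩
  · rintro rfl
    exact Kondratev.compFn_spec hn hγ hΩ hf hu
  · exact Kondratev.IsComposition.unique hm hγ h (Kondratev.compFn_spec hn hγ hΩ hf hu)
  -- Nonnegativity of M follows from its being a bound at one point, as the closed annulus is
  -- nonempty.
  · have hM0 : 0 ≤ M := (norm_nonneg _).trans (hM 0 (Nat.zero_le _) (0, 0) ⟨by simp, mem_univ _⟩)
    lift M to NNReal using hM0
    refine Kondratev.norm_compFn_le hn hγ hΩ hf hu hU ?_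
    rintro j hj _ ⟨x, hx, rfl⟩
    exact hM j hj x hx
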